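/- Let $n\ge m\ge 0$ be integers, let $A\in M_n(\mathbb{R})$ be a positive definite symmetric matrix, let $k\ge 1$ be an integer, and let $$C_m(A)=A^{1/2}\bigl(\mathbb{R}_{\ge 0}^m\times\mathbb{R}^{n-m}\bigr)\subset\mathbb{R}^n .$$ For a metric measure space $(X,d,\nu)$ the Cheeger energy of $f\in L^2(X,\nu;\mathbb{R})$ is $\mathrm{Ch}(f)=\inf\{\liminf_i \frac12\int_X(\mathrm{Lip}\,u_i)^2d\nu\}$, where the infimum is over all sequences of $d$-Lipschitz functions $u_i\to f$ in $L^2$ and $\mathrm{Lip}\,u$ is the local Lipschitz constant of $u$. Let $H^{1,2}(X)=\{f\in L^2(X,\nu;\mathbb{R}) : \mathrm{Ch}(f)<\infty\}$. If $\mathrm{Ch}$ is a quadratic form (i.e. $X$ is infinitesimally Hilbertian), let $\mathcal{E}(f,\varphi)=\int_X\langle df,d\varphi\rangle d\nu=\frac12(\mathrm{Ch}(f+\varphi)-\mathrm{Ch}(f-\varphi))$ be the bilinear form on $H^{1,2}(X)$ with $\mathcal{E}(f,f)=2\,\mathrm{Ch}(f)$. The Laplacian $\Delta$ of $X$ is the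 operator on $L^2(X,\nu;\mathbb{R})$ such that $f\in\mathcal{D}(\Delta)$ and $\Delta f=h$ if and only if $f\in H^{1,2}(X)$ and $\mathcal{E}(f,\varphi)=\int_X h\varphi\,d\nu$ for all $\varphi\in H^{1,2}(X)$. A self-adjoint operator has compact resolvent if its resolvent set is non-empty and all its resolvents are compact. (1) The metric measure space $(C_m(A),\ |\xi-\xi'|,\ e^{-k\|\xi\|^2}d\xi)$ is infinitesimally Hilbertian. Its Laplacian $\Delta^k_{C_m(A)}$ (the Neumann Laplacian of the Gaussian cone) is self-adjoint and has compact resolvent, and its $0$-eigenspace is one-dimensional, spanned by the constant functions. (2) Suppose $k=jl$ with integers $j,l\ge 1$. Let $S^1=\mathbb{R}/2\pi\mathbb{Z}$ with coordinate $t$, and let $X_{l,m,A}$ be $C_m(A)\times S^1$ with the measure $d\xi\,dt$ and the Riemannian distance of $$g_{l,\infty}=\frac{1}{l^2(1+\|\xi\|^2)}(dt)^2+{}^t\!d\xi\cdot d\xi$$ (the infimum of the lengths of $C^1$ curves in $C_m(A)\times S^1$). Let $S^1$ act by $e^{\sqrt{-1}\tau}\cdot(\xi,e^{\sqrt{-1}t})=(\xi,e^{\sqrt{-1}(t+l\tau)})$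 and set $$H^{\rho_k}=\{f\in L^2(C_m(A)\times S^1,d\xi\,dt;\mathbb{C}) : \sigma^k f(\sigma\cdot p)=f(p)\ \text{for a.e. } p,\ \text{for every } \sigma\in S^1\}.$$ Then $X_{l,m,A}$ is infinitesimally Hilbertian and its Laplacian $\Delta_{l,m,A}$ is self-adjoint. Let $\Delta^{\rho_k}_{l,m,A}$ be the operator on $H^{\rho_k}$ whose domain consists of those $f\in H^{\rho_k}$ with $\mathrm{Re} f,\mathrm{Im} f\in\mathcal{D}(\Delta_{l,m,A})$, with $\Delta^{\rho_k}_{l,m,A}f=\Delta_{l,m,A}\mathrm{Re} f+\sqrt{-1}\,\Delta_{l,m,A}\mathrm{Im} f\in H^{\rho_k}$. It is self-adjoint and has compact resolvent, its lowest eigenvalue is $k^2+kn$, and the corresponding eigenspace is one-dimensional, spanned by $e^{-k\|\xi\|^2/2-\sqrt{-1}jt}$. -/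

import Mathlib

open MeasureTheory Filter Topology
open scoped ENNReal

noncomputable section

namespace GaussianCone

/-! ### Analysis on a metric measure space `(X, d, ν)`

The distance is passed explicitly as a function `d : X → X → ℝ`. -/

section MetricMeasure

variable {X : Type*}

/-- `u` is (globally) Lipschitz with respect to the distance `d`. -/
def IsLip (d : X → X → ℝ) (u : X → ℝ) : Prop :=
  ∃ K : ℝ, ∀ x y, |u y - u x| ≤ K * d x y

/-- The local Lipschitz constant `limsup_{y → x} |u y - u x| / d x y` with respect to `d`, where
`y → x` means that `d x y` tends to `0` through positive values. It is `0` at isolated points. -/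
def localLip (d : X → X → ℝ) (u : X → ℝ) (x : X) : ℝ≥0∞ :=
  limsup (fun y => ENNReal.ofReal (|u y - u x| / d x y)) (comap (d x) (𝓝[>] 0))

variable [MeasurableSpace X]

/-- The Cheeger energy `Ch f`: the infimum of `liminf (1/2) ∫ (Lip u_i)² dν` over all sequences of
Lipschitz functions `u_i` which converge to `f` in `L²`. -/
def cheeger (d : X → X → ℝ) (ν : Measure X) (f : Lp ℝ 2 ν) : ℝ≥0∞ :=
  ⨅ (u : ℕ → X → ℝ) (_ : ∀ i, IsLip d (u i))
    (_ : Tendsto (fun i => eLpNorm (fun x => u i x - f x) 2 ν) atTop (𝓝 0)),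
    liminf (fun i => (∫⁻ x, localLip d (u i) x ^ 2 ∂ν) / 2) atTop

/-- The Sobolev space `H^{1,2}(X, d, ν)`. -/
def sobolev (d : X → X → ℝ) (ν : Measure X) : Set (Lp ℝ 2 ν) :=
  {f | cheeger d ν f < ∞}

/-- `Ch` is a quadratic form (the parallelogram law holds). -/
def InfinitesimallyHilbertian (d : X → X → ℝ) (ν : Measure X) : Prop :=
  ∀ f g : Lp ℝ 2 ν,
    cheeger d ν (f + g) + cheeger d ν (f - g) = 2 * cheeger d ν f + 2 * cheeger d ν g

/-- The energy form `∫ ⟨df, dφ⟩ dν` on `H^{1,2}`, i.e. the polarization of the quadratic form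
`2 Ch(f) = ∫ |df|² dν`. -/
def energy (d : X → X → ℝ) (ν : Measure X) (f φ : Lp ℝ 2 ν) : ℝ :=
  ((cheeger d ν (f + φ)).toReal - (cheeger d ν (f - φ)).toReal) / 2

/-- `Δ` is the (nonnegative) Laplacian of `(X, d, ν)`: `f` is in the domain with `Δ f = h` if and
only if `f ∈ H^{1,2}` and `∫ ⟨df, dφ⟩ dν = ∫ h φ dν` for all `φ ∈ H^{1,2}`. There is at most one
such `Δ`, since its graph is prescribed. -/
def IsLaplacian (d : X → X → ℝ) (ν : Measure X) (Δ : Lp ℝ 2 ν →ₗ.[ℝ] Lp ℝ 2 ν) : Prop :=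
  ∀ f h : Lp ℝ 2 ν, (f, h) ∈ Δ.graph ↔
    f ∈ sobolev d ν ∧ ∀ φ ∈ sobolev d ν, energy d ν f φ = ∫ x, h x * φ x ∂ν

end MetricMeasure

/-! ### Unbounded operators -/

section Operators

variable {𝕜 H : Type*} [RCLike 𝕜] [NormedAddCommGroup H] [InnerProductSpace 𝕜 H]

/-- `R` is a bounded everywhere defined inverse of `T - z`. -/
def IsResolventAt (T : H →ₗ.[𝕜] H) (z : 𝕜) (R : H →L[𝕜] H) : Prop :=
  (∀ y, (R y, y + z • R y) ∈ T.graph) ∧ ∀ f h, (f, h) ∈ T.graph → R (h - z • f) = f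

/-- The resolvent set of `T` is non-empty and all resolvents are compact operators. -/
def HasCompactResolvent (T : H →ₗ.[𝕜] H) : Prop :=
  (∃ z R, IsResolventAt T z R) ∧ ∀ z R, IsResolventAt T z R → IsCompactOperator R

/-- The `μ`-eigenspace `{f ∈ D(T) | T f = μ f}`. -/
def eigenspace (T : H →ₗ.[𝕜] H) (μ : 𝕜) : Submodule 𝕜 H where
  carrier := {f | (f, μ • f) ∈ T.graph}
  zero_mem' := by
    change ((0 : H), μ • (0 : H)) ∈ T.graph
    rw [smul_zero]
    exact T.graph.zero_mem
  add_mem' := by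
    intro f g hf hg
    simpa [smul_add] using T.graph.add_mem hf hg
  smul_mem' := by
    intro c f hf
    simpa [smul_comm μ c f] using T.graph.smul_mem c hf

end Operators

/-! ### The cone `C_m(A)` and the Gaussian measure -/

section Cone

open scoped MatrixOrder in
/-- `C_m(A) = A^{1/2} (ℝ_{≥0}^m × ℝ^{n-m})`. -/
def cone {n : ℕ} (m : ℕ) (A : Matrix (Fin n) (Fin n) ℝ) : Set (EuclideanSpace ℝ (Fin n)) :=
  (fun x : Fin n → ℝ => WithLp.toLp 2 ((CFC.sqrt A).mulVec x)) ''
    {x | ∀ i : Fin n, (i : ℕ) < m → 0 ≤ x i}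

variable {n : ℕ} (m : ℕ) (A : Matrix (Fin n) (Fin n) ℝ)

/-- Lebesgue measure `dξ` on the cone. -/
def coneMeasure : Measure (cone m A) :=
  (volume : Measure (EuclideanSpace ℝ (Fin n))).comap Subtype.val

/-- The measure `e^{-k|ξ|²} dξ` on the cone. -/
def gaussianMeasure (k : ℕ) : Measure (cone m A) :=
  (coneMeasure m A).withDensity
    fun ξ => ENNReal.ofReal (Real.exp (-(k : ℝ) * ‖(ξ : EuclideanSpace ℝ (Fin n))‖ ^ 2))

open scoped MatrixOrder in
theorem measurableSet_cone : MeasurableSet (cone m A) := by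
  have hc : IsClosed {x : Fin n → ℝ | ∀ i : Fin n, (i : ℕ) < m → 0 ≤ x i} := by
    simp only [Set.ofPred_forall]
    exact isClosed_iInter fun i => isClosed_iInter fun _ =>
      isClosed_le continuous_const (continuous_apply i)
  obtain ⟨K, hK, hU⟩ := ((isSigmaCompact_univ (X := Fin n → ℝ)).of_isClosed_subset hc
    (Set.subset_univ _)).image
    (f := fun x : Fin n → ℝ => (WithLp.toLp 2 ((CFC.sqrt A).mulVec x) :
      EuclideanSpace ℝ (Fin n))) (by fun_prop)
  rw [cone, ← hU]
  exact MeasurableSet.iUnion fun i => (hK i).measurableSet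

instance : SigmaFinite (coneMeasure m A) := by
  apply SigmaFinite.of_map (coneMeasure m A) (f := Subtype.val) measurable_subtype_coe.aemeasurable
  rw [coneMeasure, (MeasurableEmbedding.subtype_coe (measurableSet_cone m A)).map_comap]
  infer_instance

end Cone

/-! ### The limit space `X_{l,m,A} = (C_m(A) × S¹, g_{l,∞}, dξ dt)` -/

section LimitSpace

instance factTwoPiPos : Fact (0 < 2 * Real.pi) := ⟨Real.two_pi_pos⟩

/-- `S¹ = ℝ / 2πℤ`, with coordinate `t`; its total length is `2π`. -/
abbrev S1 : Type := AddCircle (2 * Real.pi)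

variable {n : ℕ} (l m : ℕ) (A : Matrix (Fin n) (Fin n) ℝ)

/-- The Riemannian length, for `g_{l,∞} = dt² / (l² (1 + |ξ|²)) + |dξ|²`, of the curve
`τ ↦ (x τ, θ τ)`, `0 ≤ τ ≤ 1`. -/
def curveLength (x : ℝ → EuclideanSpace ℝ (Fin n)) (θ : ℝ → ℝ) : ℝ :=
  ∫ τ in (0 : ℝ)..1,
    √(deriv θ τ ^ 2 / ((l : ℝ) ^ 2 * (1 + ‖x τ‖ ^ 2)) + ‖deriv x τ‖ ^ 2)

/-- The Riemannian distance of `g_{l,∞}` on `C_m(A) × S¹`: the infimum of the lengths of the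
`C¹` curves in `C_m(A) × S¹` that join `p` to `q` (the circle component is lifted to `ℝ`). -/
def limitDist (p q : cone m A × S1) : ℝ :=
  sInf {L | ∃ (x : ℝ → EuclideanSpace ℝ (Fin n)) (θ : ℝ → ℝ),
    ContDiff ℝ 1 x ∧ ContDiff ℝ 1 θ ∧ (∀ τ ∈ Set.Icc (0 : ℝ) 1, x τ ∈ cone m A) ∧
    x 0 = p.1 ∧ (θ 0 : S1) = p.2 ∧ x 1 = q.1 ∧ (θ 1 : S1) = q.2 ∧ L = curveLength l x θ}

/-- The measure `dξ dt` on `C_m(A) × S¹`. -/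
def limitMeasure : Measure (cone m A × S1) := (coneMeasure m A).prod volume

/-- The action `e^{iτ} · (ξ, e^{it}) = (ξ, e^{i(t + lτ)})` of `S¹` on `C_m(A) × S¹`. -/
def circleAct (τ : S1) (p : cone m A × S1) : cone m A × S1 := (p.1, p.2 + l • τ)

theorem measurePreserving_circleAct (τ : S1) :
    MeasurePreserving (circleAct l m A τ) (limitMeasure m A) (limitMeasure m A) :=
  (MeasurePreserving.id (coneMeasure m A)).prod (measurePreserving_add_right volume (l • τ))

/-- `(L²(C_m(A) × S¹, dξ dt) ⊗ ℂ)^{ρ_k}`, where `S¹` acts on `ℂ` by `ρ_k(σ) = σ^k`: the closed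
subspace of all `f` such that `σ^k f(σ · p) = f(p)` for all `σ = e^{iτ} ∈ S¹`. -/
def rhoPart (k : ℕ) : Submodule ℂ (Lp ℂ 2 (limitMeasure m A)) :=
  ⨅ τ : S1, LinearMap.ker
    ((fourier (k : ℤ) τ • (Lp.compMeasurePreservingₗᵢ ℂ (circleAct l m A τ)
        (measurePreserving_circleAct l m A τ)).toContinuousLinearMap -
      ContinuousLinearMap.id ℂ _ :
        Lp ℂ 2 (limitMeasure m A) →L[ℂ] Lp ℂ 2 (limitMeasure m A)) :
        Lp ℂ 2 (limitMeasure m A) →ₗ[ℂ] Lp ℂ 2 (limitMeasure m A))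

theorem isClosed_rhoPart (k : ℕ) :
    IsClosed (rhoPart l m A k : Set (Lp ℂ 2 (limitMeasure m A))) := by
  rw [rhoPart, Submodule.coe_iInf]
  exact isClosed_iInter fun τ => ContinuousLinearMap.isClosed_ker _

instance (k : ℕ) : CompleteSpace (rhoPart l m A k) :=
  (isClosed_rhoPart l m A k).completeSpace_coe

/-- Real part of a complex `L²` function. -/
def rePart {X : Type*} [MeasurableSpace X] {ν : Measure X} (f : Lp ℂ 2 ν) : Lp ℝ 2 ν :=
  Complex.reCLM.compLp f

/-- Imaginary part of a complex `L²` function. -/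
def imPart {X : Type*} [MeasurableSpace X] {ν : Measure X} (f : Lp ℂ 2 ν) : Lp ℝ 2 ν :=
  Complex.imCLM.compLp f

/-- `T` is the `ρ_k`-part `(Δ ⊗ id_ℂ)|_{(D(Δ) ⊗ ℂ)^{ρ_k}}` of the operator `Δ`: its domain consists
of the `f ∈ (L² ⊗ ℂ)^{ρ_k}` whose real and imaginary parts are in `D(Δ)`, and
`T f = Δ (Re f) + i Δ (Im f)`. -/
def IsRhoPart (k : ℕ) (Δ : Lp ℝ 2 (limitMeasure m A) →ₗ.[ℝ] Lp ℝ 2 (limitMeasure m A))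
    (T : rhoPart l m A k →ₗ.[ℂ] rhoPart l m A k) : Prop :=
  (∀ f : rhoPart l m A k, f ∈ T.domain ↔
    rePart (f : Lp ℂ 2 (limitMeasure m A)) ∈ Δ.domain ∧
    imPart (f : Lp ℂ 2 (limitMeasure m A)) ∈ Δ.domain) ∧
  ∀ f h : rhoPart l m A k, (f, h) ∈ T.graph →
    (rePart (f : Lp ℂ 2 (limitMeasure m A)), rePart (h : Lp ℂ 2 (limitMeasure m A))) ∈ Δ.graph ∧
    (imPart (f : Lp ℂ 2 (limitMeasure m A)), imPart (h : Lp ℂ 2 (limitMeasure m A))) ∈ Δ.graph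

end LimitSpace

end GaussianCone

end

/-!
Both Laplacians are handled through their resolvents `(1 + Δ)⁻¹`. On a metric measure space on which
the local Lipschitz constant of a Lipschitz function is almost everywhere the norm of a linear
gradient obeying the product rule (`LipGradient`), let `V` be the closure of the graph `{(u, ∇u)}`
in a Hilbert space `L² × L²`, and let `π : V → L²` be the first projection. The Cheeger energy is the
relaxation of the norm of `V`: `2 Ch(f) + ‖f‖²` is the minimum of `‖w‖²` over the lifts `w` of `f`
(`LipGradient.isRelaxation`). Hence `Ch` is quadratic, and the weak equation `Δ f = h` says precisely
that `π π* (f + h) = f` (`IsRelaxation.resolvent_iff`). So `Δ` is the operator with the bounded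
symmetric injective resolvent `π π*`, and such an operator is self-adjoint, with compact resolvent as
soon as `π π*` is compact. Functions with bounded support form a core (`mem_closure_core`). By
`localLip_cone` and `localLip_limit` both spaces have such gradients: Lipschitz functions on the
cone extend to `ℝⁿ`, where the theorem of Rademacher applies, and at interior points of the convex
cone the local Lipschitz constant is the norm of the derivative. For the limit space the distance is
compared infinitesimally with the product distance whose circle factor is frozen at the base point
(`eventually_flatDist_le`, `exists_limitDist_le`); the upper bound uses segments in the cone, the
lower bound the Cauchy-Schwarz inequality along curves.

For the Gaussian cone, the cone is invariant under scaling, so `∫ ⟨∇u, ξ⟩ dξ = -n ∫ u dξ` without a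
boundary term (`integral_inner_coneGrad`). Applied to `φ² exp (-k |ξ|²)` this gives the oscillator
identity: with respect to the Gaussian measure,
`∫ |∇φ - k φ ξ|² + k² |ξ|² φ² = ∫ |∇φ|² + k n φ²` (`oscillator_identity`). It bounds the mass of `φ`
far from the origin, and the Poincaré inequality on the convex cells of a fine grid
(`poincare_convex`) controls `φ` near the origin, so `π` is compact (`isCompactOperator_proj_gauss`).
A function in the kernel of `Δ` has no energy, so by the Poincaré inequality it is constant on all
balls (`exists_const_of_snd_eq_zero`).

For the limit space, an element of the isotypic part has the form `exp (-i j t) G(ξ)`, with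
`j = k / l`, so its real and imaginary parts are combinations of the two modes `cos (j t)` and
`sin (j t)` with coefficients on the cone. For a function `u` on the limit space let `v` be one of its
two mode coefficients and write `v = φ exp (-k |ξ|² / 2)`. The inverse metric and the derivative in
`t` together give the potential `l² j² (1 + |ξ|²) = k² + k² |ξ|²`, and the oscillator identity turns
`∫ |∇v|² + (k² + k² |ξ|²) v² dξ` into `∫ |∇φ|² + (k² + k n) φ²` for the Gaussian measure
(`ground_energy`). By Bessel's inequality the energy of `u` is therefore at least the sum over both
modes of the Gaussian energy of `φ` plus `(k² + k n) ‖φ‖²` (`modeEnergy_le`). This has three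
consequences. Eigenvalues of the isotypic part are at least `k² + k n`. The two modes of the ground
state, for which `φ = 1`, attain the bound, so the first variation vanishes and they are
eigenfunctions (`resolvent_ground`); conversely, an eigenfunction for `k² + k n` has components `φ`
without energy, which are constant (`adjoint_modeOp_of_resolvent_eq`). Finally, taking components
maps bounded sets of the form domain into bounded sets of the form domain of the Gaussian cone, so
compactness is inherited from there (`isCompactOperator_rhoResolvent`). The resolvent preserves the
isotypic part because the Cheeger energy is invariant under isometries (`LipGradient.resolvent_comp`).
-/

noncomputable section

namespace GaussianCone

/-! ### Relaxation of a Hilbert norm along a bounded operator -/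

section Relaxation

variable {V H : Type*} [NormedAddCommGroup V] [InnerProductSpace ℝ V]
  [NormedAddCommGroup H] [InnerProductSpace ℝ H]

/-- The image of a closed ball of a Hilbert space under a bounded operator is closed. The proof
takes the elements of least norm in a decreasing sequence of closed convex sets; they form a Cauchy
sequence by the parallelogram law. -/
theorem exists_lift_of_mem_closure [CompleteSpace V] (π : V →L[ℝ] H) {r : ℝ} {f : H}
    (hf : f ∈ closure (π '' Metric.closedBall 0 r)) : ∃ w, ‖w‖ ≤ r ∧ π w = f := by
  let C : ℕ → Set V := fun N => {w | ‖w‖ ≤ r ∧ ‖π w - f‖ ≤ 1 / ((N : ℝ) + 1)}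
  have hne : ∀ N, (C N).Nonempty := by
    intro N
    obtain ⟨_, ⟨w, hw, rfl⟩, hd⟩ := Metric.mem_closure_iff.1 hf (1 / ((N : ℝ) + 1)) (by positivity)
    refine ⟨w, by simpa using hw, ?_⟩
    rw [← dist_eq_norm, dist_comm]
    exact hd.le
  have hcl : ∀ N, IsClosed (C N) := by
    intro N
    have h1 : IsClosed {w : V | ‖w‖ ≤ r} := isClosed_le (by fun_prop) (by fun_prop)
    have h2 : IsClosed {w : V | ‖π w - f‖ ≤ 1 / ((N : ℝ) + 1)} :=
      isClosed_le (by fun_prop) (by fun_prop)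
    exact h1.inter h2
  have hconv : ∀ N, Convex ℝ (C N) := by
    intro N x hx y hy a b ha hb hab
    constructor
    · calc ‖a • x + b • y‖ ≤ ‖a • x‖ + ‖b • y‖ := norm_add_le _ _
        _ = a * ‖x‖ + b * ‖y‖ := by
          rw [norm_smul, norm_smul, Real.norm_of_nonneg ha, Real.norm_of_nonneg hb]
        _ ≤ a * r + b * r := by gcongr; exacts [hx.1, hy.1]
        _ = r := by rw [← add_mul, hab, one_mul]
    · have : π (a • x + b • y) - f = a • (π x - f) + b • (π y - f) := by
        rw [map_add, map_smul, map_smul]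
        nth_rewrite 1 [← one_smul ℝ f]
        rw [← hab]
        module
      rw [this]
      calc _ ≤ ‖a • (π x - f)‖ + ‖b • (π y - f)‖ := norm_add_le _ _
        _ = a * ‖π x - f‖ + b * ‖π y - f‖ := by
          rw [norm_smul, norm_smul, Real.norm_of_nonneg ha, Real.norm_of_nonneg hb]
        _ ≤ a * (1 / ((N : ℝ) + 1)) + b * (1 / ((N : ℝ) + 1)) := by gcongr; exacts [hx.2, hy.2]
        _ = _ := by rw [← add_mul, hab, one_mul]
  -- the element of least norm of each of the decreasing closed convex sets `C N`
  have hmin : ∀ N, ∃ x ∈ C N, ∀ w ∈ C N, ‖x‖ ≤ ‖w‖ := by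
    intro N
    obtain ⟨x, hx, hxe⟩ := exists_norm_eq_iInf_of_complete_convex (hne N) (hcl N).isComplete
      (hconv N) 0
    refine ⟨x, hx, fun w hw => ?_⟩
    have h1 : ‖(0 : V) - x‖ ≤ ‖(0 : V) - w‖ := by
      rw [hxe]
      exact ciInf_le ⟨0, by rintro _ ⟨z, rfl⟩; exact norm_nonneg _⟩ (⟨w, hw⟩ : C N)
    simpa using h1
  choose x hxC hxm using hmin
  have hanti : ∀ {N M}, N ≤ M → C M ⊆ C N := by
    intro N M h w hw
    refine ⟨hw.1, hw.2.trans ?_⟩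
    gcongr
  -- `(x N + x M) / 2` lies in `C N`, so it is at least as long as `x N`; with the parallelogram
  -- law this bounds the distance by the increase of the norms
  have hdist : ∀ {N M}, N ≤ M → ‖x M - x N‖ ^ 2 ≤ 2 * (‖x M‖ ^ 2 - ‖x N‖ ^ 2) := by
    intro N M h
    have h1 := hxm N _ (hconv N (hxC N) (hanti h (hxC M)) (by norm_num : (0 : ℝ) ≤ 1 / 2)
      (by norm_num : (0 : ℝ) ≤ 1 / 2) (by norm_num))
    rw [← smul_add, norm_smul] at h1
    have h2 : 2 * ‖x N‖ ≤ ‖x M + x N‖ := by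
      rw [add_comm (x M)]
      norm_num at h1
      linarith
    have h3 := parallelogram_law_with_norm ℝ (x M) (x N)
    nlinarith [norm_nonneg (x N), mul_self_le_mul_self (by positivity) h2]
  have hmono : Monotone fun N => ‖x N‖ ^ 2 := by
    intro N M h
    have := hxm N _ (hanti h (hxC M))
    dsimp only
    gcongr
  have hbdd : BddAbove (Set.range fun N => ‖x N‖ ^ 2) := by
    refine ⟨r ^ 2, ?_⟩
    rintro _ ⟨N, rfl⟩
    have := (hxC N).1
    dsimp only
    gcongr
  have hcs : CauchySeq x := by
    have h0 := (tendsto_atTop_ciSup hmono hbdd).cauchySeq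
    rw [Metric.cauchySeq_iff'] at h0 ⊢
    intro ε hε
    obtain ⟨N, hN⟩ := h0 (ε ^ 2 / 2) (by positivity)
    refine ⟨N, fun n hn => ?_⟩
    have h1 := hN n hn
    rw [Real.dist_eq, abs_lt] at h1
    rw [dist_eq_norm]
    have h2 := hdist hn
    exact lt_of_pow_lt_pow_left₀ 2 hε.le (by linarith)
  obtain ⟨w, hw⟩ := cauchySeq_tendsto_of_complete hcs
  have hwC : ∀ N, w ∈ C N := fun N =>
    (hcl N).mem_of_tendsto hw (eventually_atTop.2 ⟨N, fun M h => hanti h (hxC M)⟩)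
  refine ⟨w, (hwC 0).1, ?_⟩
  have : ‖π w - f‖ ≤ 0 :=
    ge_of_tendsto tendsto_one_div_add_atTop_nhds_zero_nat (Eventually.of_forall fun N => (hwC N).2)
  simpa [sub_eq_zero] using this

/-- The squared norm of `V` pushed forward along `π`: the infimum of `‖w‖²` over all lifts `w` of
`f`. -/
def liftNormSq (π : V →L[ℝ] H) (f : H) : ℝ≥0∞ := ⨅ (w : V) (_ : π w = f), ‖w‖ₑ ^ 2

theorem liftNormSq_le (π : V →L[ℝ] H) (w : V) : liftNormSq π (π w) ≤ ‖w‖ₑ ^ 2 :=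
  iInf₂_le (f := fun (p : V) (_ : π p = π w) => ‖p‖ₑ ^ 2) w rfl

theorem enorm_sq_eq_ofReal {E : Type*} [SeminormedAddCommGroup E] (w : E) :
    ‖w‖ₑ ^ 2 = ENNReal.ofReal (‖w‖ ^ 2) := by
  rw [ENNReal.ofReal_pow (norm_nonneg _), ofReal_norm]

theorem lowerSemicontinuous_liftNormSq [CompleteSpace V] (π : V →L[ℝ] H) :
    LowerSemicontinuous (liftNormSq π) := by
  rw [lowerSemicontinuous_iff_isClosed_preimage]
  intro y
  refine isClosed_of_closure_subset fun f hf => ?_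
  change liftNormSq π f ≤ y
  refine le_of_forall_gt_imp_ge_of_dense fun z hz => ?_
  rcases eq_or_ne z ⊤ with rfl | hz'
  · exact le_top
  have hz2 : ENNReal.ofReal (√z.toReal ^ 2) = z := by
    rw [Real.sq_sqrt ENNReal.toReal_nonneg, ENNReal.ofReal_toReal hz']
  obtain ⟨w, hw, rfl⟩ := exists_lift_of_mem_closure π (r := √z.toReal) (f := f) (by
    refine closure_mono (fun g hg => ?_) hf
    have hg' : liftNormSq π g < z := lt_of_le_of_lt hg hz
    simp only [liftNormSq, iInf_lt_iff] at hg'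
    obtain ⟨w, rfl, hw⟩ := hg'
    refine ⟨w, ?_, rfl⟩
    rw [enorm_sq_eq_ofReal, ← hz2] at hw
    have h2 := (ENNReal.ofReal_lt_ofReal_iff_of_nonneg (by positivity)).1 hw
    rw [mem_closedBall_zero_iff]
    exact (lt_of_pow_lt_pow_left₀ 2 (Real.sqrt_nonneg _) h2).le)
  refine (liftNormSq_le π w).trans ?_
  rw [enorm_sq_eq_ofReal, ← hz2]
  gcongr

/-- Lifts orthogonal to the kernel have least norm. -/
theorem liftNormSq_of_mem_orthogonal (π : V →L[ℝ] H) {w : V} (hw : w ∈ (π.ker)ᗮ) :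
    liftNormSq π (π w) = ‖w‖ₑ ^ 2 := by
  refine le_antisymm (liftNormSq_le π w) (le_iInf₂ fun p hp => ?_)
  rw [enorm_sq_eq_ofReal, enorm_sq_eq_ofReal]
  refine ENNReal.ofReal_le_ofReal ?_
  have h0 : inner ℝ (p - w) w = 0 :=
    hw _ (by rw [LinearMap.mem_ker]; simp [hp])
  have h1 := norm_add_sq_real (p - w) w
  rw [sub_add_cancel, h0] at h1
  nlinarith [sq_nonneg ‖p - w‖]

theorem exists_orthogonal_lift [CompleteSpace V] (π : V →L[ℝ] H) (w : V) :
    ∃ p ∈ (π.ker)ᗮ, π p = π w := by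
  have : CompleteSpace π.ker := π.isClosed_ker.completeSpace_coe
  refine ⟨w - π.ker.starProjection w, Submodule.sub_starProjection_mem_orthogonal _, ?_⟩
  have h := (π.ker.starProjection_apply_mem w)
  rw [LinearMap.mem_ker] at h
  rw [map_sub]
  simpa using h

/-- `c` is the functional with `2 c f + ‖f‖² = inf {‖w‖² | π w = f}`. -/
def IsRelaxation (π : V →L[ℝ] H) (c : H → ℝ≥0∞) : Prop :=
  ∀ f, 2 * c f + ‖f‖ₑ ^ 2 = liftNormSq π f

namespace IsRelaxation

variable {π : V →L[ℝ] H} {c : H → ℝ≥0∞}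

theorem norm_map_le (hc : IsRelaxation π c) (w : V) : ‖π w‖ ≤ ‖w‖ := by
  have h : ‖π w‖ₑ ^ 2 ≤ ‖w‖ₑ ^ 2 :=
    (le_add_self.trans (hc (π w)).le).trans (liftNormSq_le π w)
  rw [enorm_sq_eq_ofReal, enorm_sq_eq_ofReal, ENNReal.ofReal_le_ofReal_iff (by positivity)] at h
  exact le_of_sq_le_sq h (norm_nonneg _)

theorem apply_orthogonal (hc : IsRelaxation π c) {w : V} (hw : w ∈ (π.ker)ᗮ) :
    c (π w) = ENNReal.ofReal ((‖w‖ ^ 2 - ‖π w‖ ^ 2) / 2) := by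
  have h := hc (π w)
  have hle : ‖π w‖ ^ 2 ≤ ‖w‖ ^ 2 := by
    have := hc.norm_map_le w
    gcongr
  rw [liftNormSq_of_mem_orthogonal π hw, enorm_sq_eq_ofReal, enorm_sq_eq_ofReal] at h
  have h2 : 2 * c (π w) = 2 * ENNReal.ofReal ((‖w‖ ^ 2 - ‖π w‖ ^ 2) / 2) := by
    rw [← ENNReal.add_left_inj (ENNReal.ofReal_ne_top (r := ‖π w‖ ^ 2)), h,
      show (2 : ℝ≥0∞) = ENNReal.ofReal 2 by simp, ← ENNReal.ofReal_mul (by norm_num),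
      ← ENNReal.ofReal_add (by linarith) (by positivity)]
    congr 1
    ring
  exact (ENNReal.mul_right_inj (by norm_num) (by norm_num)).1 h2

/-- The domain of finite energy is parametrised by the orthogonal complement of `ker π`. -/
theorem lt_top_iff [CompleteSpace V] (hc : IsRelaxation π c) (f : H) :
    c f < ⊤ ↔ ∃ w ∈ (π.ker)ᗮ, π w = f := by
  constructor
  · intro h
    have h1 : liftNormSq π f < ⊤ := by
      rw [← hc f]
      exact ENNReal.add_lt_top.2 ⟨ENNReal.mul_lt_top (by norm_num) h,
        ENNReal.pow_lt_top enorm_lt_top⟩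
    simp only [liftNormSq, iInf_lt_iff] at h1
    obtain ⟨w, rfl, -⟩ := h1
    exact exists_orthogonal_lift π w
  · rintro ⟨w, hw, rfl⟩
    rw [hc.apply_orthogonal hw]
    exact ENNReal.ofReal_lt_top

theorem toReal_orthogonal (hc : IsRelaxation π c) {w : V} (hw : w ∈ (π.ker)ᗮ) :
    (c (π w)).toReal = (‖w‖ ^ 2 - ‖π w‖ ^ 2) / 2 := by
  rw [hc.apply_orthogonal hw, ENNReal.toReal_ofReal]
  have := pow_le_pow_left₀ (norm_nonneg _) (hc.norm_map_le w) 2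
  linarith

/-- The energy inherits the parallelogram law from the two Hilbert norms. -/
theorem parallelogram [CompleteSpace V] (hc : IsRelaxation π c) (f g : H) :
    c (f + g) + c (f - g) = 2 * c f + 2 * c g := by
  by_cases hfg : c f < ⊤ ∧ c g < ⊤
  · obtain ⟨w, hw, rfl⟩ := (hc.lt_top_iff f).1 hfg.1
    obtain ⟨p, hp, rfl⟩ := (hc.lt_top_iff g).1 hfg.2
    have e1 := pow_le_pow_left₀ (norm_nonneg _) (hc.norm_map_le w) 2
    have e2 := pow_le_pow_left₀ (norm_nonneg _) (hc.norm_map_le p) 2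
    have e3 := pow_le_pow_left₀ (norm_nonneg _) (hc.norm_map_le (w + p)) 2
    have e4 := pow_le_pow_left₀ (norm_nonneg _) (hc.norm_map_le (w - p)) 2
    rw [← map_add, ← map_sub, hc.apply_orthogonal hw, hc.apply_orthogonal hp,
      hc.apply_orthogonal (Submodule.add_mem _ hw hp),
      hc.apply_orthogonal (Submodule.sub_mem _ hw hp),
      ← ENNReal.ofReal_add (by linarith) (by linarith),
      show (2 : ℝ≥0∞) = ENNReal.ofReal 2 by simp, ← ENNReal.ofReal_mul (by norm_num),
      ← ENNReal.ofReal_mul (by norm_num), ← ENNReal.ofReal_add (by linarith) (by linarith)]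
    congr 1
    have h1 := parallelogram_law_with_norm ℝ w p
    have h2 := parallelogram_law_with_norm ℝ (π w) (π p)
    rw [map_add, map_sub]
    linarith
  · have hR : 2 * c f + 2 * c g = ⊤ := by
      rw [not_and_or, not_lt_top_iff, not_lt_top_iff] at hfg
      rcases hfg with h | h <;> simp [h, ENNReal.mul_top]
    -- `f` and `g` are half the sum and half the difference of `f + g` and `f - g`, so the left
    -- side cannot be finite either
    have hL : ¬ (c (f + g) < ⊤ ∧ c (f - g) < ⊤) := by
      rintro ⟨h1, h2⟩
      obtain ⟨w, hw, hwe⟩ := (hc.lt_top_iff _).1 h1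
      obtain ⟨p, hp, hpe⟩ := (hc.lt_top_iff _).1 h2
      refine hfg ⟨(hc.lt_top_iff _).2 ⟨(1 / 2 : ℝ) • (w + p),
        Submodule.smul_mem _ _ (Submodule.add_mem _ hw hp), ?_⟩,
        (hc.lt_top_iff _).2 ⟨(1 / 2 : ℝ) • (w - p),
        Submodule.smul_mem _ _ (Submodule.sub_mem _ hw hp), ?_⟩⟩
      · rw [map_smul, map_add, hwe, hpe]; module
      · rw [map_smul, map_sub, hwe, hpe]; module
    rw [hR]
    rw [not_and_or, not_lt_top_iff, not_lt_top_iff] at hL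
    rcases hL with h | h <;> simp [h]

/-- The polarisation of the energy, on lifts orthogonal to `ker π`. -/
theorem energy_orthogonal (hc : IsRelaxation π c) {w p : V} (hw : w ∈ (π.ker)ᗮ)
    (hp : p ∈ (π.ker)ᗮ) :
    ((c (π w + π p)).toReal - (c (π w - π p)).toReal) / 2 =
      inner ℝ w p - inner ℝ (π w) (π p) := by
  rw [← map_add, ← map_sub, hc.toReal_orthogonal (Submodule.add_mem _ hw hp),
    hc.toReal_orthogonal (Submodule.sub_mem _ hw hp), map_add, map_sub, norm_add_sq_real,
    norm_sub_sq_real, norm_add_sq_real, norm_sub_sq_real]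
  ring

/-- The weak formulation of `(1 + Δ)⁻¹ = π π*`. -/
theorem resolvent_iff [CompleteSpace V] [CompleteSpace H] (hc : IsRelaxation π c) (f h : H) :
    π (π.adjoint (f + h)) = f ↔ c f < ⊤ ∧ ∀ φ, c φ < ⊤ →
      ((c (f + φ)).toReal - (c (f - φ)).toReal) / 2 = inner ℝ h φ := by
  have hadj : ∀ g, π.adjoint g ∈ (π.ker)ᗮ := by
    intro g u hu
    rw [ContinuousLinearMap.adjoint_inner_right]
    rw [LinearMap.mem_ker] at hu
    simp only [ContinuousLinearMap.coe_coe] at hu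
    rw [hu, inner_zero_left]
  constructor
  · intro hf
    have hw := hadj (f + h)
    refine ⟨(hc.lt_top_iff f).2 ⟨_, hw, hf⟩, fun φ hφ => ?_⟩
    obtain ⟨p, hp, rfl⟩ := (hc.lt_top_iff φ).1 hφ
    have := hc.energy_orthogonal hw hp
    rw [hf, ContinuousLinearMap.adjoint_inner_left, inner_add_left] at this
    rw [this]
    ring
  · rintro ⟨hf, hE⟩
    obtain ⟨w, hw, rfl⟩ := (hc.lt_top_iff f).1 hf
    -- the difference `w - π* (π w + h)` is orthogonal to `ker π`; testing the weak equation with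
    -- its image shows that its norm vanishes
    have hz := Submodule.sub_mem _ hw (hadj (π w + h))
    have h1 := hE _ ((hc.lt_top_iff _).2 ⟨_, hz, rfl⟩)
    rw [hc.energy_orthogonal hw hz] at h1
    have h2 : inner ℝ (w - π.adjoint (π w + h)) (w - π.adjoint (π w + h)) = 0 := by
      rw [inner_sub_left, ContinuousLinearMap.adjoint_inner_left, inner_add_left, ← h1]
      ring
    rw [inner_self_eq_zero, sub_eq_zero] at h2
    rw [← h2]

end IsRelaxation

end Relaxation

/-! ### Self-adjoint operators given by a resolvent -/

section OfResolvent

variable {𝕜 H : Type*} [RCLike 𝕜] [NormedAddCommGroup H] [InnerProductSpace 𝕜 H]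

/-- The operator `R⁻¹ - 1`, with graph `{(f, h) | R (f + h) = f}`. -/
def ofResolvent (R : H →L[𝕜] H) : H →ₗ.[𝕜] H :=
  Submodule.toLinearPMap
    { carrier := {p : H × H | R (p.1 + p.2) = p.1}
      zero_mem' := by simp
      add_mem' := by
        intro p q hp hq
        change R (p.1 + q.1 + (p.2 + q.2)) = p.1 + q.1
        rw [add_add_add_comm, map_add]
        exact congrArg₂ _ hp hq
      smul_mem' := by
        intro a p hp
        change R (a • p.1 + a • p.2) = a • p.1
        rw [← smul_add, map_smul]
        exact congrArg _ hp }

variable {R : H →L[𝕜] H}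

theorem mem_graph_ofResolvent (hinj : ∀ x, R x = 0 → x = 0) {p : H × H} :
    p ∈ (ofResolvent R).graph ↔ R (p.1 + p.2) = p.1 := by
  rw [ofResolvent, Submodule.toLinearPMap_graph_eq]
  · exact Iff.rfl
  · intro x hx h0
    change R (x.1 + x.2) = x.1 at hx
    rw [h0, zero_add] at hx
    exact hinj _ hx

theorem mem_domain_ofResolvent {f : H} :
    f ∈ (ofResolvent R).domain ↔ ∃ g, R g = f := by
  rw [ofResolvent, Submodule.toLinearPMap_domain]
  constructor
  · rintro ⟨⟨a, b⟩, h, rfl⟩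
    exact ⟨_, h⟩
  · rintro ⟨g, rfl⟩
    refine ⟨(R g, g - R g), ?_, rfl⟩
    change R (R g + (g - R g)) = R g
    rw [add_sub_cancel]

theorem isSelfAdjoint_ofResolvent [CompleteSpace H] (hinj : ∀ x, R x = 0 → x = 0)
    (hsym : ∀ x y, inner 𝕜 (R x) y = inner 𝕜 x (R y)) : IsSelfAdjoint (ofResolvent R) := by
  have hdense : Dense ((ofResolvent R).domain : Set H) := by
    have h1 : (ofResolvent R).domain = R.range := by
      ext f
      rw [mem_domain_ofResolvent]
      exact Iff.rfl
    rw [h1, Submodule.dense_iff_topologicalClosure_eq_top, Submodule.topologicalClosure_eq_top_iff,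
      Submodule.eq_bot_iff]
    intro x hx
    refine hinj x (ext_inner_left 𝕜 fun y => ?_)
    rw [← hsym, inner_zero_right]
    exact hx _ ⟨y, rfl⟩
  rw [LinearPMap.isSelfAdjoint_def]
  refine LinearPMap.eq_of_eq_graph ?_
  rw [LinearPMap.adjoint_graph_eq_graph_adjoint hdense]
  ext ⟨f, h⟩
  rw [Submodule.mem_adjoint_iff, mem_graph_ofResolvent hinj]
  dsimp only
  constructor
  · intro H1
    refine ext_inner_left 𝕜 fun z => ?_
    have h1 := H1 (R z) (z - R z) (by rw [mem_graph_ofResolvent hinj]; simp)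
    rw [inner_sub_left, hsym, hsym] at h1
    rw [map_add, inner_add_right]
    linear_combination -h1
  · intro hf a b hab
    rw [mem_graph_ofResolvent hinj] at hab
    dsimp only at hab
    have h1 : inner 𝕜 (a + b) f = inner 𝕜 a (f + h) := by
      nth_rewrite 1 [← hf]
      rw [← hsym, hab]
    rw [inner_add_left, inner_add_right] at h1
    linear_combination h1

theorem hasCompactResolvent_ofResolvent (hinj : ∀ x, R x = 0 → x = 0)
    (hR : IsCompactOperator R) : HasCompactResolvent (ofResolvent R) := by
  refine ⟨⟨-1, R, fun y => ?_, fun f h hfh => ?_⟩, fun z R' hR' => ?_⟩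
  · rw [mem_graph_ofResolvent hinj]
    simp
  · rw [mem_graph_ofResolvent hinj] at hfh
    rw [neg_smul, one_smul, sub_neg_eq_add, add_comm]
    exact hfh
  · have h : (R' : H → H) = R ∘ (R' + ContinuousLinearMap.id 𝕜 H + z • R' : H →L[𝕜] H) := by
      ext y
      have h1 := hR'.1 y
      rw [mem_graph_ofResolvent hinj] at h1
      dsimp only at h1
      rw [← add_assoc] at h1
      exact h1.symm
    rw [h]
    exact hR.comp_clm _

theorem mem_eigenspace_ofResolvent (hinj : ∀ x, R x = 0 → x = 0) {μ : 𝕜} {f : H} :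
    f ∈ eigenspace (ofResolvent R) μ ↔ R (f + μ • f) = f :=
  mem_graph_ofResolvent hinj

end OfResolvent

/-! ### Lipschitz functions and their gradients on a metric measure space -/

section Lipschitz

variable {X : Type*} {d : X → X → ℝ} {u v : X → ℝ}

theorem IsLip.add (hu : IsLip d u) (hv : IsLip d v) : IsLip d (u + v) := by
  obtain ⟨K, hK⟩ := hu
  obtain ⟨L, hL⟩ := hv
  refine ⟨K + L, fun x y => ?_⟩
  have e : (u + v) y - (u + v) x = (u y - u x) + (v y - v x) := by
    simp only [Pi.add_apply]; ring
  rw [e, add_mul]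
  exact (abs_add_le _ _).trans (add_le_add (hK x y) (hL x y))

theorem IsLip.smul (c : ℝ) (hu : IsLip d u) : IsLip d (c • u) := by
  obtain ⟨K, hK⟩ := hu
  refine ⟨|c| * K, fun x y => ?_⟩
  have e : (c • u) y - (c • u) x = c * (u y - u x) := by
    simp only [Pi.smul_apply, smul_eq_mul]; ring
  rw [e, abs_mul, mul_assoc]
  exact mul_le_mul_of_nonneg_left (hK x y) (abs_nonneg c)

theorem isLip_const (hd : ∀ x y, 0 ≤ d x y) (c : ℝ) : IsLip d fun _ => c :=
  ⟨1, fun x y => by simpa using hd x y⟩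

theorem IsLip.exists_nonneg (hd : ∀ x y, 0 ≤ d x y) (hu : IsLip d u) :
    ∃ K : ℝ, 0 ≤ K ∧ ∀ x y, |u y - u x| ≤ K * d x y := by
  obtain ⟨K, hK⟩ := hu
  exact ⟨|K|, abs_nonneg K, fun x y =>
    (hK x y).trans (mul_le_mul_of_nonneg_right (le_abs_self K) (hd x y))⟩

/-- The product of Lipschitz functions is Lipschitz if one factor is bounded and vanishes wherever
the other one is not bounded by `N`. -/
theorem IsLip.mul (hd : ∀ x y, 0 ≤ d x y) (hu : IsLip d u) (hv : IsLip d v) {M N : ℝ}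
    (hM : ∀ x, |u x| ≤ M) (hN : ∀ x, u x ≠ 0 → |v x| ≤ N) : IsLip d (u * v) := by
  obtain ⟨K, hK0, hK⟩ := hu.exists_nonneg hd
  obtain ⟨L, hL0, hL⟩ := hv.exists_nonneg hd
  refine ⟨M * L + |N| * K, fun x y => ?_⟩
  have hM0 : 0 ≤ M := (abs_nonneg _).trans (hM x)
  have key : ∀ a b : X, u a ≠ 0 →
      |(u * v) b - (u * v) a| ≤ M * |v b - v a| + |N| * |u b - u a| := by
    intro a b ha
    have e : (u * v) b - (u * v) a = u b * (v b - v a) + v a * (u b - u a) := by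
      simp only [Pi.mul_apply]; ring
    rw [e]
    refine (abs_add_le _ _).trans ?_
    rw [abs_mul, abs_mul]
    exact add_le_add (mul_le_mul_of_nonneg_right (hM b) (abs_nonneg _))
      (mul_le_mul_of_nonneg_right ((hN a ha).trans (le_abs_self N)) (abs_nonneg _))
  have hfin : M * |v y - v x| + |N| * |u y - u x| ≤ (M * L + |N| * K) * d x y := by
    have h1 := mul_le_mul_of_nonneg_left (hL x y) hM0
    have h2 := mul_le_mul_of_nonneg_left (hK x y) (abs_nonneg N)
    linarith
  by_cases hx : u x = 0
  · by_cases hy : u y = 0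
    · have h0 : (u * v) y - (u * v) x = 0 := by simp [hx, hy]
      rw [h0, abs_zero]
      exact le_trans (by positivity) hfin
    · rw [abs_sub_comm]
      refine le_trans (key y x hy) ?_
      rwa [abs_sub_comm (v x), abs_sub_comm (u x)]
  · exact (key x y hx).trans hfin

theorem localLip_le {K : ℝ} (hK : ∀ x y, |u y - u x| ≤ K * d x y) (x : X) :
    localLip d u x ≤ ENNReal.ofReal K := by
  refine limsup_le_of_le (by isBoundedDefault) ?_
  have h : ∀ᶠ y in comap (d x) (𝓝[>] 0), 0 < d x y :=
    tendsto_comap.eventually (eventually_mem_nhdsWithin (a := (0 : ℝ)) (s := Set.Ioi 0))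
  filter_upwards [h] with y hy
  refine ENNReal.ofReal_le_ofReal ?_
  rw [div_le_iff₀ hy]
  exact hK x y

end Lipschitz

section LpTwo

variable {X E : Type*} [MeasurableSpace X] [NormedAddCommGroup E] {ν : Measure X}

theorem eLpNorm_two_sq (f : X → E) : eLpNorm f 2 ν ^ 2 = ∫⁻ x, ‖f x‖ₑ ^ 2 ∂ν := by
  have h := eLpNorm_nnreal_pow_eq_lintegral (f := f) (μ := ν) (p := 2) (by norm_num)
  simpa using h

theorem Lp_enorm_sq (f : Lp E 2 ν) : ‖f‖ₑ ^ 2 = ∫⁻ x, ‖f x‖ₑ ^ 2 ∂ν := by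
  rw [Lp.enorm_def, eLpNorm_two_sq]

theorem memLp_two_iff {f : X → E} (hf : AEStronglyMeasurable f ν) :
    MemLp f 2 ν ↔ ∫⁻ x, ‖f x‖ₑ ^ 2 ∂ν < ⊤ := by
  rw [← eLpNorm_two_sq, ENNReal.pow_lt_top_iff]
  simp [MemLp, hf]

theorem tendsto_eLpNorm_two_of_sq {ι : Type*} {l : Filter ι} {f : ι → X → E}
    (h : Tendsto (fun i => ∫⁻ x, ‖f i x‖ₑ ^ 2 ∂ν) l (𝓝 0)) :
    Tendsto (fun i => eLpNorm (f i) 2 ν) l (𝓝 0) := by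
  have h2 := ((ENNReal.continuous_rpow_const (y := 1 / 2)).tendsto 0).comp h
  rw [ENNReal.zero_rpow_of_pos (by norm_num)] at h2
  refine h2.congr fun i => ?_
  rw [Function.comp_apply, ← eLpNorm_two_sq, ← ENNReal.rpow_natCast, ← ENNReal.rpow_mul]
  norm_num

/-- Cutoffs that increase to `1` converge strongly to the identity on `L²`. -/
theorem tendsto_eLpNorm_cutoff [NormedSpace ℝ E] {f : X → E} (hf : MemLp f 2 ν)
    {χ : ℕ → X → ℝ} (hχm : ∀ n, AEStronglyMeasurable (χ n) ν) (hχ : ∀ n x, |χ n x - 1| ≤ 1)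
    (hlim : ∀ x, Tendsto (fun n => χ n x) atTop (𝓝 1)) :
    Tendsto (fun n => eLpNorm (fun x => (χ n x - 1) • f x) 2 ν) atTop (𝓝 0) := by
  refine tendsto_eLpNorm_two_of_sq ?_
  have h0 : (0 : ℝ≥0∞) = ∫⁻ _, 0 ∂ν := by simp
  rw [h0]
  refine tendsto_lintegral_of_dominated_convergence' (fun x => ‖f x‖ₑ ^ 2) (fun n => ?_)
    (fun n => ?_) ((memLp_two_iff hf.1).1 hf).ne ?_
  · exact ((((hχm n).sub aestronglyMeasurable_const).smul hf.1).enorm).pow_const 2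
  · refine Eventually.of_forall fun x => ?_
    dsimp only
    gcongr
    rw [enorm_smul]
    refine mul_le_of_le_one_left' ?_
    rw [Real.enorm_eq_ofReal_abs]
    simpa using ENNReal.ofReal_le_ofReal (hχ n x)
  · refine Eventually.of_forall fun x => ?_
    have h1 : Tendsto (fun n => (χ n x - 1) • f x) atTop (𝓝 0) := by
      simpa using ((hlim x).sub_const 1).smul_const (f x)
    simpa using ENNReal.Tendsto.pow (n := 2) h1.enorm

end LpTwo

/-- A gradient for the Lipschitz functions of `(X, d, ν)`: a linear first order operator with
values in an inner product space whose norm is almost everywhere the local Lipschitz constant. -/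
structure LipGradient {X : Type*} [MeasurableSpace X] (d : X → X → ℝ) (ν : Measure X)
    (F : Type*) [NormedAddCommGroup F] [InnerProductSpace ℝ F] where
  /-- The gradient of a function; its values on functions which are not Lipschitz are irrelevant. -/
  grad : (X → ℝ) → X → F
  dist_nonneg : ∀ x y, 0 ≤ d x y
  measurable_fun : ∀ {u}, IsLip d u → AEStronglyMeasurable u ν
  measurable_grad : ∀ {u}, IsLip d u → AEStronglyMeasurable (grad u) ν
  localLip_eq : ∀ {u}, IsLip d u → ∀ᵐ x ∂ν, localLip d u x = ‖grad u x‖ₑ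
  grad_add : ∀ {u v}, IsLip d u → IsLip d v → ∀ᵐ x ∂ν, grad (u + v) x = grad u x + grad v x
  grad_smul : ∀ (c : ℝ) {u}, IsLip d u → ∀ᵐ x ∂ν, grad (c • u) x = c • grad u x
  grad_mul : ∀ {u v}, IsLip d u → IsLip d v → IsLip d (u * v) →
    ∀ᵐ x ∂ν, grad (u * v) x = u x • grad v x + v x • grad u x

namespace LipGradient

variable {X : Type*} [MeasurableSpace X] {d : X → X → ℝ} {ν : Measure X}
  {F : Type*} [NormedAddCommGroup F] [InnerProductSpace ℝ F] (D : LipGradient d ν F)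

/-- `w = (u, ∇u)` for the Lipschitz function `u`. -/
def IsGradOf (w : WithLp 2 (Lp ℝ 2 ν × Lp F 2 ν)) (u : X → ℝ) : Prop :=
  IsLip d u ∧ (∀ᵐ x ∂ν, w.fst x = u x) ∧ ∀ᵐ x ∂ν, w.snd x = D.grad u x

/-- The graph `{(u, ∇u)}` of the gradient on Lipschitz functions, inside `L² × L²`. -/
def graph : Submodule ℝ (WithLp 2 (Lp ℝ 2 ν × Lp F 2 ν)) where
  carrier := {w | ∃ u, D.IsGradOf w u}
  zero_mem' := by
    have h0 := isLip_const D.dist_nonneg 0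
    refine ⟨_, h0, ?_, ?_⟩
    · filter_upwards [Lp.coeFn_zero ℝ 2 ν] with x hx
      simpa using hx
    · filter_upwards [Lp.coeFn_zero F 2 ν, D.grad_smul 0 h0] with x hx h1
      have e : (0 : ℝ) • (fun _ : X => (0 : ℝ)) = fun _ => 0 := by ext; simp
      rw [e, zero_smul] at h1
      rw [WithLp.zero_snd, hx, h1, Pi.zero_apply]
  add_mem' := by
    rintro w w' ⟨u, hu, h1, h2⟩ ⟨v, hv, h3, h4⟩
    refine ⟨u + v, hu.add hv, ?_, ?_⟩
    · filter_upwards [h1, h3, Lp.coeFn_add w.fst w'.fst] with x a1 a2 a3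
      rw [WithLp.add_fst, a3, Pi.add_apply, Pi.add_apply, a1, a2]
    · filter_upwards [h2, h4, Lp.coeFn_add w.snd w'.snd, D.grad_add hu hv] with x a1 a2 a3 a4
      rw [WithLp.add_snd, a3, Pi.add_apply, a1, a2, a4]
  smul_mem' := by
    rintro c w ⟨u, hu, h1, h2⟩
    refine ⟨c • u, hu.smul c, ?_, ?_⟩
    · filter_upwards [h1, Lp.coeFn_smul c w.fst] with x a1 a3
      rw [WithLp.smul_fst, a3, Pi.smul_apply, Pi.smul_apply, a1]
    · filter_upwards [h2, Lp.coeFn_smul c w.snd, D.grad_smul c hu] with x a1 a3 a4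
      rw [WithLp.smul_snd, a3, Pi.smul_apply, a1, a4]

/-- The closure of the graph of the gradient. It is the form domain if the gradient is closable,
but closability is not needed. -/
abbrev closedGraph : Submodule ℝ (WithLp 2 (Lp ℝ 2 ν × Lp F 2 ν)) := D.graph.topologicalClosure

/-- The projection of the closed graph to `L²`. -/
def proj : D.closedGraph →L[ℝ] Lp ℝ 2 ν :=
  (WithLp.fstL 2 ℝ (Lp ℝ 2 ν) (Lp F 2 ν)).comp D.closedGraph.subtypeL

theorem proj_apply (w : D.closedGraph) : D.proj w = (w : WithLp 2 (Lp ℝ 2 ν × Lp F 2 ν)).fst := rfl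

theorem exists_isGradOf {u : X → ℝ} (hu : IsLip d u) (h2 : MemLp u 2 ν)
    (h3 : MemLp (D.grad u) 2 ν) :
    ∃ w, D.IsGradOf w u ∧ w.fst = h2.toLp u ∧ w.snd = h3.toLp (D.grad u) :=
  ⟨WithLp.toLp 2 (h2.toLp u, h3.toLp (D.grad u)), ⟨hu, h2.coeFn_toLp, h3.coeFn_toLp⟩, rfl, rfl⟩

theorem IsGradOf.lintegral_localLip {w : WithLp 2 (Lp ℝ 2 ν × Lp F 2 ν)} {u : X → ℝ}
    (h : D.IsGradOf w u) : ∫⁻ x, localLip d u x ^ 2 ∂ν = ‖w.snd‖ₑ ^ 2 := by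
  rw [Lp_enorm_sq]
  refine lintegral_congr_ae ?_
  filter_upwards [D.localLip_eq h.1, h.2.2] with x h1 h2
  rw [h1, h2]

theorem enorm_sq_closedGraph (w : D.closedGraph) : ‖w‖ₑ ^ 2 =
    ‖(w : WithLp 2 (Lp ℝ 2 ν × Lp F 2 ν)).fst‖ₑ ^ 2 +
      ‖(w : WithLp 2 (Lp ℝ 2 ν × Lp F 2 ν)).snd‖ₑ ^ 2 := by
  change ‖(w : WithLp 2 (Lp ℝ 2 ν × Lp F 2 ν))‖ₑ ^ 2 = _
  rw [enorm_sq_eq_ofReal, enorm_sq_eq_ofReal, enorm_sq_eq_ofReal, WithLp.prod_norm_sq_eq_of_L2,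
    ENNReal.ofReal_add (by positivity) (by positivity)]

/-- An element of the closed graph is a limit of Lipschitz functions with convergent gradients,
which is a competitor in the definition of the Cheeger energy. -/
theorem cheeger_le (w : WithLp 2 (Lp ℝ 2 ν × Lp F 2 ν)) (hw : w ∈ D.closedGraph) :
    2 * cheeger d ν w.fst ≤ ‖w.snd‖ₑ ^ 2 := by
  obtain ⟨p, hp, hlim⟩ := mem_closure_iff_seq_limit.1 hw
  choose u hu using hp
  have hfst : Tendsto (fun i => (p i).fst) atTop (𝓝 w.fst) :=
    ((WithLp.fstL 2 ℝ (Lp ℝ 2 ν) (Lp F 2 ν)).continuous.tendsto w).comp hlim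
  have hsnd : Tendsto (fun i => (p i).snd) atTop (𝓝 w.snd) :=
    ((WithLp.sndL 2 ℝ (Lp ℝ 2 ν) (Lp F 2 ν)).continuous.tendsto w).comp hlim
  have hu1 : Tendsto (fun i => eLpNorm (fun x => u i x - w.fst x) 2 ν) atTop (𝓝 0) := by
    have h1 := (tendsto_iff_edist_tendsto_0).1 hfst
    refine h1.congr fun i => ?_
    rw [Lp.edist_def]
    refine eLpNorm_congr_ae ?_
    filter_upwards [(hu i).2.1] with x hx
    rw [Pi.sub_apply, hx]
  have h2 : cheeger d ν w.fst ≤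
      liminf (fun i => (∫⁻ x, localLip d (u i) x ^ 2 ∂ν) / 2) atTop :=
    iInf_le_of_le u (iInf_le_of_le (fun i => (hu i).1) (iInf_le_of_le hu1 le_rfl))
  have h3 : Tendsto (fun i => (∫⁻ x, localLip d (u i) x ^ 2 ∂ν) / 2) atTop
      (𝓝 (‖w.snd‖ₑ ^ 2 / 2)) := by
    simp_rw [fun i => (hu i).lintegral_localLip]
    exact ENNReal.Tendsto.div_const (ENNReal.Tendsto.pow hsnd.enorm) (Or.inr (by norm_num))
  rw [h3.liminf_eq] at h2
  calc 2 * cheeger d ν w.fst ≤ 2 * (‖w.snd‖ₑ ^ 2 / 2) := by gcongr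
    _ = _ := ENNReal.mul_div_cancel (by norm_num) (by norm_num)

variable [CompleteSpace F]

/-- The Cheeger energy is the relaxation of the Dirichlet energy of Lipschitz functions. -/
theorem isRelaxation : IsRelaxation D.proj (cheeger d ν) := by
  have : CompleteSpace D.closedGraph :=
    (Submodule.isClosed_topologicalClosure _).completeSpace_coe
  intro f
  refine le_antisymm (le_iInf₂ fun w hw => ?_) ?_
  · subst hw
    have h := D.cheeger_le w w.2
    rw [enorm_sq_closedGraph, add_comm, proj_apply]
    gcongr
  · rcases eq_or_ne (cheeger d ν f) ⊤ with htop | htop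
    · simp [htop, ENNReal.mul_top]
    -- lower bound for the Cheeger energy: every finite value above it bounds the lifted norm
    suffices H : ∀ z : ℝ≥0∞, cheeger d ν f < z → z < ⊤ →
        liftNormSq D.proj f ≤ 2 * z + ‖f‖ₑ ^ 2 by
      have hlim : Tendsto (fun z : ℝ≥0∞ => 2 * z + ‖f‖ₑ ^ 2) (𝓝[>] (cheeger d ν f))
          (𝓝 (2 * cheeger d ν f + ‖f‖ₑ ^ 2)) := by
        refine Tendsto.mono_left ?_ nhdsWithin_le_nhds
        exact (ENNReal.Tendsto.const_mul tendsto_id (Or.inr (by norm_num))).add_const _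
      have : (𝓝[>] (cheeger d ν f)).NeBot := nhdsGT_neBot_of_exists_gt ⟨⊤, htop.lt_top⟩
      refine ge_of_tendsto hlim ?_
      have h2 : Set.Iio (⊤ : ℝ≥0∞) ∈ 𝓝[>] (cheeger d ν f) :=
        mem_nhdsWithin_of_mem_nhds (Iio_mem_nhds htop.lt_top)
      filter_upwards [self_mem_nhdsWithin, h2] with z hz hz'
      exact H z hz hz'
    intro z hz hztop
    -- otherwise, by lower semicontinuity, the strict inequality persists near `f`, and it fails at
    -- a Lipschitz function of small energy that is close to `f`
    by_contra! hcon
    obtain ⟨y, hy1, hy2⟩ := exists_between hcon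
    have hlow : ∀ᶠ g in 𝓝 f, y < liftNormSq D.proj g :=
      lowerSemicontinuous_liftNormSq D.proj f y hy2
    have hup : ∀ᶠ g : Lp ℝ 2 ν in 𝓝 f, 2 * z + ‖g‖ₑ ^ 2 < y := by
      have hct : Tendsto (fun g : Lp ℝ 2 ν => 2 * z + ‖g‖ₑ ^ 2) (𝓝 f)
          (𝓝 (2 * z + ‖f‖ₑ ^ 2)) :=
        tendsto_const_nhds.add (ENNReal.Tendsto.pow (continuous_enorm.tendsto f))
      exact hct.eventually (gt_mem_nhds hy1)
    obtain ⟨ε, hε, hball⟩ := Metric.nhds_basis_eball.eventually_iff.1 (hlow.and hup)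
    simp only [cheeger, iInf_lt_iff] at hz
    obtain ⟨u, hu, hlim, hlt⟩ := hz
    have hfr := frequently_lt_of_liminf_lt (by isBoundedDefault) hlt
    have hclose : ∀ᶠ i in atTop, eLpNorm (fun x => u i x - f x) 2 ν < min ε 1 :=
      hlim.eventually (gt_mem_nhds (by simpa using hε))
    obtain ⟨i, hi1, hi2⟩ := (hfr.and_eventually hclose).exists
    have hmem0 : MemLp (fun x => u i x - f x) 2 ν :=
      ⟨(D.measurable_fun (hu i)).sub (Lp.aestronglyMeasurable f),
        (hi2.trans_le (min_le_right _ _)).trans_le le_top⟩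
    have hmem : MemLp (u i) 2 ν := by
      have := hmem0.add (Lp.memLp f)
      refine this.ae_eq (Eventually.of_forall fun x => ?_)
      simp
    have hI : ∫⁻ x, ‖D.grad (u i) x‖ₑ ^ 2 ∂ν = ∫⁻ x, localLip d (u i) x ^ 2 ∂ν := by
      refine lintegral_congr_ae ?_
      filter_upwards [D.localLip_eq (hu i)] with x h1
      rw [h1]
    have hI2 : ∫⁻ x, localLip d (u i) x ^ 2 ∂ν < 2 * z := by
      rw [mul_comm]
      exact (ENNReal.div_lt_iff (by norm_num) (by norm_num)).1 hi1
    have hgr : MemLp (D.grad (u i)) 2 ν := by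
      rw [memLp_two_iff (D.measurable_grad (hu i)), hI]
      exact hI2.trans (ENNReal.mul_lt_top (by norm_num) hztop)
    obtain ⟨w, hw, hw1, hw2⟩ := D.exists_isGradOf (hu i) hmem hgr
    have hwc : w ∈ D.closedGraph := Submodule.le_topologicalClosure _ ⟨_, hw⟩
    have hb : w.fst ∈ Metric.eball f ε := by
      rw [Metric.mem_eball, Lp.edist_def]
      refine lt_of_eq_of_lt (eLpNorm_congr_ae ?_) (hi2.trans_le (min_le_left _ _))
      filter_upwards [hw.2.1] with x hx
      rw [Pi.sub_apply, hx]
    obtain ⟨hA, hB⟩ := hball hb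
    have hC := liftNormSq_le D.proj ⟨w, hwc⟩
    rw [enorm_sq_closedGraph, proj_apply] at hC
    dsimp only at hC
    rw [← hw.lintegral_localLip] at hC
    refine absurd (hA.trans_le hC) (not_lt.2 ?_)
    rw [add_comm]
    exact (add_le_add_left hI2.le _).trans hB.le

end LipGradient

/-! ### Cutoffs, density of Lipschitz functions, and the Laplacian -/

theorem isLip_clamp {X : Type*} {d : X → X → ℝ} {u : X → ℝ} (hu : IsLip d u) :
    IsLip d fun x => max 0 (min 1 (u x)) := by
  obtain ⟨K, hK⟩ := hu
  refine ⟨K, fun x y => le_trans ?_ (hK x y)⟩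
  refine (abs_max_sub_max_le_max _ _ _ _).trans (max_le (by simp) ?_)
  exact (abs_min_sub_min_le_max _ _ _ _).trans (max_le (by simp) le_rfl)

namespace LipGradient

variable {X : Type*} [MeasurableSpace X] {d : X → X → ℝ} {ν : Measure X}
  {F : Type*} [NormedAddCommGroup F] [InnerProductSpace ℝ F] (D : LipGradient d ν F)

/-- Lipschitz functions which vanish where the exhaustion function `ρ` is large are a core for the
closed gradient. -/
theorem mem_closure_core {ρ : X → ℝ} (hρ : IsLip d ρ)
    (hb : ∀ u, IsLip d u → ∀ R : ℝ, ∃ M, ∀ x, ρ x ≤ R → |u x| ≤ M)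
    {w : WithLp 2 (Lp ℝ 2 ν × Lp F 2 ν)} (hw : w ∈ D.closedGraph) :
    w ∈ closure {w | ∃ u, D.IsGradOf w u ∧ ∃ R : ℝ, ∀ x, R ≤ ρ x → u x = 0} := by
  suffices H : (D.graph : Set (WithLp 2 (Lp ℝ 2 ν × Lp F 2 ν))) ⊆
      closure {w | ∃ u, D.IsGradOf w u ∧ ∃ R : ℝ, ∀ x, R ≤ ρ x → u x = 0} from
    closure_minimal H isClosed_closure hw
  rintro w ⟨u, hu, hu1, hu2⟩
  obtain ⟨K, hK0, hK⟩ := hρ.exists_nonneg D.dist_nonneg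
  have hlin : ∀ n : ℕ, IsLip d fun x => 2 - ρ x / ((n : ℝ) + 1) := by
    intro n
    have := (isLip_const D.dist_nonneg 2).add (hρ.smul (-(1 / ((n : ℝ) + 1))))
    convert this using 1
    ext x
    simp only [Pi.add_apply, Pi.smul_apply, smul_eq_mul]
    ring
  -- the cutoff is `1` where `ρ ≤ n + 1` and `0` where `ρ ≥ 2 (n + 1)`
  let χ : ℕ → X → ℝ := fun n x => max 0 (min 1 (2 - ρ x / ((n : ℝ) + 1)))
  have hχ : ∀ n, IsLip d (χ n) := fun n => isLip_clamp (hlin n)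
  have hχ0 : ∀ n x, 0 ≤ χ n x := fun n x => le_max_left _ _
  have hχ1 : ∀ n x, χ n x ≤ 1 := fun n x => max_le zero_le_one (min_le_left _ _)
  have hχK : ∀ n x y, |χ n y - χ n x| ≤ K / ((n : ℝ) + 1) * d x y := by
    intro n x y
    refine (abs_max_sub_max_le_max _ _ _ _).trans (max_le ?_ ?_)
    · rw [sub_self, abs_zero]
      have := D.dist_nonneg x y
      positivity
    refine (abs_min_sub_min_le_max _ _ _ _).trans (max_le ?_ ?_)
    · rw [sub_self, abs_zero]
      have := D.dist_nonneg x y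
      positivity
    have e : 2 - ρ y / ((n : ℝ) + 1) - (2 - ρ x / ((n : ℝ) + 1)) =
        -((ρ y - ρ x) / ((n : ℝ) + 1)) := by ring
    rw [e, abs_neg, abs_div, abs_of_pos (by positivity : (0 : ℝ) < (n : ℝ) + 1), div_mul_eq_mul_div]
    gcongr
    exact hK x y
  have hsupp : ∀ (n : ℕ) x, 2 * ((n : ℝ) + 1) ≤ ρ x → χ n x = 0 := by
    intro n x hx
    have h2 : 2 - ρ x / ((n : ℝ) + 1) ≤ 0 := by
      rw [sub_nonpos, le_div_iff₀ (by positivity)]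
      exact hx
    exact max_eq_left ((min_le_right _ _).trans h2)
  have hlim : ∀ x, Tendsto (fun n => χ n x) atTop (𝓝 1) := by
    intro x
    refine tendsto_const_nhds.congr' ?_
    obtain ⟨N, hN⟩ := exists_nat_ge (ρ x)
    filter_upwards [eventually_ge_atTop N] with n hn
    have h2 : 1 ≤ 2 - ρ x / ((n : ℝ) + 1) := by
      have : ρ x / ((n : ℝ) + 1) ≤ 1 := by
        rw [div_le_one (by positivity)]
        have : (N : ℝ) ≤ n := by exact_mod_cast hn
        linarith
      linarith
    change 1 = max 0 (min 1 (2 - ρ x / ((n : ℝ) + 1)))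
    rw [min_eq_left h2, max_eq_right zero_le_one]
  have hmul : ∀ n, IsLip d (χ n * u) := by
    intro n
    obtain ⟨M, hM⟩ := hb u hu (2 * ((n : ℝ) + 1))
    refine (hχ n).mul D.dist_nonneg hu (M := 1) (N := M) (fun x => ?_) (fun x hx => ?_)
    · rw [abs_of_nonneg (hχ0 n x)]
      exact hχ1 n x
    · refine hM x ?_
      by_contra! hcon
      exact hx (hsupp n x hcon.le)
  have hχm : ∀ n, AEStronglyMeasurable (χ n) ν := fun n => D.measurable_fun (hχ n)
  have hdist : ∀ n x, |χ n x - 1| ≤ 1 := fun n x => by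
    rw [abs_le]
    constructor <;> linarith [hχ0 n x, hχ1 n x]
  have huL : MemLp u 2 ν := (Lp.memLp w.fst).ae_eq hu1
  have hgL : MemLp (D.grad u) 2 ν := (Lp.memLp w.snd).ae_eq hu2
  -- the product rule splits `∇(χ u) - ∇u` into `(χ - 1) ∇u`, which tends to zero by dominated
  -- convergence, and `u ∇χ`, of size `K / (n + 1)`
  have hgrad : ∀ n, ∀ᵐ x ∂ν, D.grad (χ n * u) x - D.grad u x =
      (χ n x - 1) • D.grad u x + u x • D.grad (χ n) x := by
    intro n
    filter_upwards [D.grad_mul (hχ n) hu (hmul n)] with x hx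
    rw [hx]
    module
  have hgχ : ∀ n, ∀ᵐ x ∂ν, ‖D.grad (χ n) x‖ₑ ≤ ENNReal.ofReal (K / ((n : ℝ) + 1)) := by
    intro n
    filter_upwards [D.localLip_eq (hχ n)] with x hx
    rw [← hx]
    exact localLip_le (hχK n) x
  have hA := tendsto_eLpNorm_cutoff huL hχm hdist hlim
  have hB := tendsto_eLpNorm_cutoff hgL hχm hdist hlim
  have hm2 : ∀ n, AEStronglyMeasurable (fun x => u x • D.grad (χ n) x) ν := fun n =>
    huL.1.smul (D.measurable_grad (hχ n))
  have hC : ∀ n, eLpNorm (fun x => u x • D.grad (χ n) x) 2 ν ≤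
      ENNReal.ofReal (K / ((n : ℝ) + 1)) * eLpNorm u 2 ν := by
    intro n
    refine eLpNorm_le_mul_eLpNorm_of_ae_le_mul'' 2 huL.1 ?_
    filter_upwards [hgχ n] with x hx
    rw [enorm_smul, mul_comm]
    gcongr
  have hC0 : Tendsto (fun n : ℕ => ENNReal.ofReal (K / ((n : ℝ) + 1)) * eLpNorm u 2 ν) atTop
      (𝓝 0) := by
    have h1 : Tendsto (fun n : ℕ => K / ((n : ℝ) + 1)) atTop (𝓝 0) := by
      have := (tendsto_one_div_add_atTop_nhds_zero_nat (𝕜 := ℝ)).const_mul K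
      simpa [div_eq_mul_inv] using this
    have h2 := ENNReal.Tendsto.mul_const (b := eLpNorm u 2 ν) (ENNReal.tendsto_ofReal h1)
      (Or.inr huL.2.ne)
    simpa using h2
  have hD : ∀ n, eLpNorm (fun x => D.grad (χ n * u) x - D.grad u x) 2 ν ≤
      eLpNorm (fun x => (χ n x - 1) • D.grad u x) 2 ν +
        ENNReal.ofReal (K / ((n : ℝ) + 1)) * eLpNorm u 2 ν := by
    intro n
    rw [eLpNorm_congr_ae (hgrad n)]
    exact (eLpNorm_add_le (((hχm n).sub aestronglyMeasurable_const).smul hgL.1) (hm2 n)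
      (by norm_num)).trans (add_le_add le_rfl (hC n))
  have hD0 : Tendsto (fun n => eLpNorm (fun x => D.grad (χ n * u) x - D.grad u x) 2 ν) atTop
      (𝓝 0) :=
    tendsto_of_tendsto_of_tendsto_of_le_of_le tendsto_const_nhds
      (by simpa using hB.add hC0) (fun _ => zero_le) hD
  have hmem : ∀ n, MemLp (χ n * u) 2 ν := by
    intro n
    refine huL.mono ((hχm n).mul huL.1) (Eventually.of_forall fun x => ?_)
    rw [Pi.mul_apply, norm_mul, Real.norm_of_nonneg (hχ0 n x)]
    exact mul_le_of_le_one_left (norm_nonneg _) (hχ1 n x)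
  have hmemg : ∀ n, MemLp (D.grad (χ n * u)) 2 ν := by
    intro n
    have h1 : MemLp (fun x => D.grad (χ n * u) x - D.grad u x) 2 ν := by
      refine ⟨(D.measurable_grad (hmul n)).sub hgL.1, (hD n).trans_lt ?_⟩
      refine ENNReal.add_lt_top.2 ⟨?_, ENNReal.mul_lt_top ENNReal.ofReal_lt_top huL.2⟩
      refine lt_of_le_of_lt (eLpNorm_mono (g := D.grad u) fun x => ?_) hgL.2
      rw [norm_smul]
      exact mul_le_of_le_one_left (norm_nonneg _) (hdist n x)
    refine (h1.add hgL).ae_eq (Eventually.of_forall fun x => ?_)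
    simp
  choose p hp hp1 hp2 using fun n => D.exists_isGradOf (hmul n) (hmem n) (hmemg n)
  refine mem_closure_of_tendsto (f := p) (b := atTop) ?_ (Eventually.of_forall fun n =>
    ⟨_, hp n, 2 * ((n : ℝ) + 1), fun x hx => by simp [hsupp n x hx]⟩)
  have t1 : Tendsto (fun n => (p n).fst) atTop (𝓝 w.fst) := by
    rw [tendsto_iff_edist_tendsto_0]
    refine hA.congr fun n => ?_
    rw [Lp.edist_def]
    refine eLpNorm_congr_ae ?_
    filter_upwards [(hp n).2.1, hu1] with x h1 h2
    rw [Pi.sub_apply, h1, h2, Pi.mul_apply, smul_eq_mul]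
    ring
  have t2 : Tendsto (fun n => (p n).snd) atTop (𝓝 w.snd) := by
    rw [tendsto_iff_edist_tendsto_0]
    refine hD0.congr fun n => ?_
    rw [Lp.edist_def]
    refine eLpNorm_congr_ae ?_
    filter_upwards [(hp n).2.2, hu2] with x h1 h2
    rw [Pi.sub_apply, h1, h2]
  exact ((WithLp.prod_continuous_toLp 2 _ _).tendsto (w.fst, w.snd)).comp (t1.prodMk_nhds t2)

variable [CompleteSpace F]

instance : CompleteSpace D.closedGraph :=
  (Submodule.isClosed_topologicalClosure _).completeSpace_coe

/-- The operator `(1 + Δ)⁻¹`. -/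
def resolvent : Lp ℝ 2 ν →L[ℝ] Lp ℝ 2 ν := D.proj ∘L ContinuousLinearMap.adjoint D.proj

theorem resolvent_apply (f : Lp ℝ 2 ν) :
    D.resolvent f = D.proj (ContinuousLinearMap.adjoint D.proj f) := rfl

theorem inner_resolvent (f g : Lp ℝ 2 ν) :
    inner ℝ (D.resolvent f) g = inner ℝ f (D.resolvent g) := by
  rw [resolvent_apply, resolvent_apply, ← ContinuousLinearMap.adjoint_inner_right,
    ContinuousLinearMap.adjoint_inner_left]

/-- Only `0` is orthogonal to all Lipschitz functions in the form domain. -/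
def IsDense : Prop := ∀ f : Lp ℝ 2 ν, (∀ w ∈ D.graph, inner ℝ w.fst f = 0) → f = 0

variable {D}

theorem resolvent_injective (hD : D.IsDense) (f : Lp ℝ 2 ν) (hf : D.resolvent f = 0) : f = 0 := by
  have h1 : inner ℝ (D.resolvent f) f = 0 := by rw [hf, inner_zero_left]
  rw [resolvent_apply, ← ContinuousLinearMap.adjoint_inner_right, inner_self_eq_zero] at h1
  refine hD f fun w hw => ?_
  have h2 := ContinuousLinearMap.adjoint_inner_right D.proj
    ⟨w, Submodule.le_topologicalClosure _ hw⟩ f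
  rw [h1, inner_zero_right] at h2
  exact h2.symm

theorem resolvent_iff_energy (f h : Lp ℝ 2 ν) : D.resolvent (f + h) = f ↔
    f ∈ sobolev d ν ∧ ∀ φ ∈ sobolev d ν, energy d ν f φ = ∫ x, h x * φ x ∂ν := by
  rw [resolvent_apply, D.isRelaxation.resolvent_iff]
  refine and_congr Iff.rfl (forall_congr' fun φ => imp_congr Iff.rfl ?_)
  rw [L2.inner_def]
  have : (fun x => inner ℝ (h x) (φ x)) = fun x => h x * φ x := by
    ext x
    rw [real_inner_eq_re_inner, mul_comm]
    rfl
  rw [this]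
  exact Iff.rfl

theorem isLaplacian (hD : D.IsDense) : IsLaplacian d ν (ofResolvent D.resolvent) := by
  intro f h
  rw [mem_graph_ofResolvent (resolvent_injective hD)]
  exact resolvent_iff_energy f h

theorem isSelfAdjoint (hD : D.IsDense) : IsSelfAdjoint (ofResolvent D.resolvent) :=
  isSelfAdjoint_ofResolvent (resolvent_injective hD) D.inner_resolvent

end LipGradient

/-- An `L²` function that is orthogonal to all Lipschitz functions with bounded support is zero. -/
theorem Lp_eq_zero_of_integral_lipschitz {X : Type*} [PseudoMetricSpace X] [MeasurableSpace X]
    [BorelSpace X] {ν : Measure X} (x₀ : X) (hfin : ∀ R, ν (Metric.closedBall x₀ R) < ⊤)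
    (f : Lp ℝ 2 ν)
    (h : ∀ φ : X → ℝ, (∃ K, LipschitzWith K φ) → (∃ R, ∀ x, R ≤ dist x x₀ → φ x = 0) →
      (∀ x, |φ x| ≤ 1) → ∫ x, φ x * f x ∂ν = 0) : f = 0 := by
  have hint : ∀ R, IntegrableOn f (Metric.closedBall x₀ R) ν := by
    intro R
    have : IsFiniteMeasure (ν.restrict (Metric.closedBall x₀ R)) :=
      ⟨by simpa using hfin R⟩
    exact ((Lp.memLp f).restrict _).integrable one_le_two
  have hzero : ∀ R, ∀ s : Set X, IsClosed s → s ⊆ Metric.closedBall x₀ R → ∫ x in s, f x ∂ν = 0 := by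
    intro R s hs hsR
    obtain ⟨δ, hδ0, hδ1, hδ⟩ : ∃ δ : ℕ → ℝ, (∀ n, 0 < δ n) ∧ (∀ n, δ n ≤ 1) ∧
        Tendsto δ atTop (𝓝 0) :=
      ⟨fun n => 1 / ((n : ℝ) + 1), fun n => by positivity,
        fun n => by rw [div_le_one (by positivity)]; simp,
        tendsto_one_div_add_atTop_nhds_zero_nat⟩
    -- Lipschitz approximations of the indicator function of the closed set `s`
    let φ : ℕ → X → ℝ := fun n x => thickenedIndicator (hδ0 n) s x
    have hφ1 : ∀ n x, |φ n x| ≤ 1 := by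
      intro n x
      rw [abs_of_nonneg (NNReal.coe_nonneg _)]
      exact_mod_cast thickenedIndicator_le_one (hδ0 n) s x
    have hφsupp : ∀ n x, R + 1 ≤ dist x x₀ → φ n x = 0 := by
      intro n x hx
      have : x ∉ Metric.thickening (δ n) s := by
        intro hcon
        obtain ⟨y, hy, hxy⟩ := Metric.mem_thickening_iff.1 hcon
        have h1 := hsR hy
        rw [Metric.mem_closedBall] at h1
        have h2 := dist_triangle x y x₀
        linarith [hδ1 n]
      have h0 := thickenedIndicator_zero (hδ0 n) s this
      change ((thickenedIndicator (hδ0 n) s x : NNReal) : ℝ) = 0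
      rw [h0, NNReal.coe_zero]
    have hφL : ∀ n, ∃ K, LipschitzWith K (φ n) := fun n =>
      ⟨_, (NNReal.isometry_coe.lipschitz).comp (lipschitzWith_thickenedIndicator (hδ0 n) s)⟩
    have h0 : ∀ n, ∫ x, φ n x * f x ∂ν = 0 := fun n => h _ (hφL n) ⟨_, hφsupp n⟩ (hφ1 n)
    have hlim : Tendsto (fun n => ∫ x, φ n x * f x ∂ν) atTop
        (𝓝 (∫ x, s.indicator (fun x => f x) x ∂ν)) := by
      refine tendsto_integral_of_dominated_convergence
        (fun x => ‖(Metric.closedBall x₀ (R + 1)).indicator (fun x => f x) x‖) (fun n => ?_)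
        ((hint (R + 1)).integrable_indicator measurableSet_closedBall).norm (fun n => ?_) ?_
      · obtain ⟨K, hK⟩ := hφL n
        exact hK.continuous.measurable.aestronglyMeasurable.mul (Lp.aestronglyMeasurable f)
      · refine Eventually.of_forall fun x => ?_
        by_cases hx : x ∈ Metric.closedBall x₀ (R + 1)
        · rw [Set.indicator_of_mem hx, norm_mul]
          exact mul_le_of_le_one_left (norm_nonneg _) (hφ1 n x)
        · rw [Metric.mem_closedBall, not_le] at hx
          rw [hφsupp n x hx.le, zero_mul, norm_zero]
          exact norm_nonneg _
      · refine Eventually.of_forall fun x => ?_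
        have h1 := tendsto_pi_nhds.1 (thickenedIndicator_tendsto_indicator_closure hδ0 hδ s) x
        have h2 := ((NNReal.continuous_coe.tendsto _).comp h1).mul_const (f x)
        have e : s.indicator (fun x => f x) x =
            (((closure s).indicator (fun _ => (1 : NNReal)) x : NNReal) : ℝ) * f x := by
          rw [hs.closure_eq]
          by_cases hx : x ∈ s <;> simp [hx]
        rw [e]
        exact h2
    simp_rw [h0] at hlim
    rw [← integral_indicator hs.measurableSet]
    exact (tendsto_nhds_unique hlim tendsto_const_nhds)
  refine Lp.ext ?_
  have hR : ∀ n : ℕ, ∀ᵐ x ∂ν, x ∈ Metric.closedBall x₀ n → f x = 0 := by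
    intro n
    have h1 := ae_eq_zero_of_forall_setIntegral_isClosed_eq_zero (hint n) (fun s hs => by
      rw [Measure.restrict_restrict hs.measurableSet]
      exact hzero n _ (hs.inter Metric.isClosed_closedBall) Set.inter_subset_right)
    exact (ae_restrict_iff' measurableSet_closedBall).1 h1
  filter_upwards [ae_all_iff.2 hR, Lp.coeFn_zero ℝ 2 ν] with x hx h0
  obtain ⟨n, hn⟩ := exists_nat_ge (dist x x₀)
  rw [h0, hx n hn, Pi.zero_apply]

/-! ### The local Lipschitz constant at a point of differentiability -/

/-- If `u y - u x = ⟪a, φ y⟫ + o(d x y)` for a chart `φ` with `‖φ y‖ ≤ (1 + o(1)) d x y` such that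
the direction of `a` is realised by points with `d x y ≤ (1 + o(1)) ‖φ y‖`, then the local Lipschitz
constant of `u` at `x` is `‖a‖`. -/
theorem localLip_eq_of_chart {X F : Type*} [NormedAddCommGroup F] [InnerProductSpace ℝ F]
    {d : X → X → ℝ} {u : X → ℝ} {x : X} (φ : X → F) (a : F) (y : ℝ → X)
    (h1 : ∀ ε > 0, ∀ᶠ z in comap (d x) (𝓝[>] 0), |u z - u x - inner ℝ a (φ z)| ≤ ε * d x z)
    (h2 : ∀ ε > 0, ∀ᶠ z in comap (d x) (𝓝[>] 0), ‖φ z‖ ≤ (1 + ε) * d x z)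
    (hy : ∀ᶠ s in 𝓝[>] (0 : ℝ), φ (y s) = s • a)
    (hd : a ≠ 0 → ∀ ε > 0, ∀ᶠ s in 𝓝[>] (0 : ℝ), 0 < d x (y s) ∧
      d x (y s) ≤ (1 + ε) * (s * ‖a‖)) :
    localLip d u x = ‖a‖ₑ := by
  have hpos : ∀ᶠ z in comap (d x) (𝓝[>] 0), 0 < d x z :=
    tendsto_comap.eventually (eventually_mem_nhdsWithin (a := (0 : ℝ)) (s := Set.Ioi 0))
  rw [← ofReal_norm]
  refine le_antisymm ?_ ?_
  -- upper bound by the Cauchy-Schwarz inequality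
  · have hup : ∀ ε > 0, localLip d u x ≤ ENNReal.ofReal (‖a‖ + (‖a‖ + 1) * ε) := by
      intro ε hε
      refine limsup_le_of_le (by isBoundedDefault) ?_
      filter_upwards [h1 ε hε, h2 ε hε, hpos] with z a1 a2 a3
      refine ENNReal.ofReal_le_ofReal ?_
      rw [div_le_iff₀ a3]
      have b1 : |inner ℝ a (φ z)| ≤ ‖a‖ * ‖φ z‖ := abs_real_inner_le_norm _ _
      have b2 : |u z - u x| ≤ |u z - u x - inner ℝ a (φ z)| + |inner ℝ a (φ z)| := by
        have := abs_add_le (u z - u x - inner ℝ a (φ z)) (inner ℝ a (φ z))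
        simpa using this
      have b3 := mul_le_mul_of_nonneg_left a2 (norm_nonneg a)
      calc |u z - u x| ≤ ε * d x z + ‖a‖ * ((1 + ε) * d x z) := by linarith
        _ = _ := by ring
    have hlim : Tendsto (fun ε : ℝ => ENNReal.ofReal (‖a‖ + (‖a‖ + 1) * ε)) (𝓝[>] 0)
        (𝓝 (ENNReal.ofReal ‖a‖)) := by
      refine (ENNReal.tendsto_ofReal ?_).mono_left nhdsWithin_le_nhds
      have : Tendsto (fun ε : ℝ => ‖a‖ + (‖a‖ + 1) * ε) (𝓝 0) (𝓝 (‖a‖ + (‖a‖ + 1) * 0)) :=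
        (Continuous.tendsto (by fun_prop) 0)
      simpa using this
    exact ge_of_tendsto hlim (eventually_mem_nhdsWithin.mono fun ε hε => hup ε hε)
  · rcases eq_or_ne a 0 with rfl | ha
    · simp
    have ha' : 0 < ‖a‖ := norm_pos_iff.2 ha
    -- lower bound along the points `y s`, at which the increment is `s ‖a‖² + o(s)`
    have htend : Tendsto (fun s => d x (y s)) (𝓝[>] 0) (𝓝[>] 0) := by
      refine tendsto_nhdsWithin_iff.2 ⟨?_, (hd ha 1 one_pos).mono fun s hs => hs.1⟩
      have hlim : Tendsto (fun s : ℝ => (1 + 1) * (s * ‖a‖)) (𝓝[>] 0) (𝓝 0) := by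
        refine Tendsto.mono_left ?_ nhdsWithin_le_nhds
        have : Tendsto (fun s : ℝ => (1 + 1) * (s * ‖a‖)) (𝓝 0) (𝓝 ((1 + 1) * (0 * ‖a‖))) :=
          (Continuous.tendsto (by fun_prop) 0)
        simpa using this
      exact tendsto_of_tendsto_of_tendsto_of_le_of_le' tendsto_const_nhds hlim
        ((hd ha 1 one_pos).mono fun s hs => hs.1.le) ((hd ha 1 one_pos).mono fun s hs => hs.2)
    have hty : Tendsto y (𝓝[>] 0) (comap (d x) (𝓝[>] 0)) := tendsto_comap_iff.2 htend
    have hlow : ∀ ε > 0, ENNReal.ofReal (‖a‖ - ε - ε) ≤ localLip d u x := by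
      intro ε hε
      refine le_limsup_of_frequently_le ?_ (by isBoundedDefault)
      refine Tendsto.frequently hty (Eventually.frequently ?_)
      filter_upwards [hty.eventually (h1 ε hε), hty.eventually hpos, hy,
        hd ha (ε / ‖a‖) (by positivity), eventually_mem_nhdsWithin] with s b1 b2 b3 b4 b5
      refine ENNReal.ofReal_le_ofReal ?_
      rw [le_div_iff₀ b2]
      rw [b3, inner_smul_right, real_inner_self_eq_norm_sq] at b1
      have c1 : (‖a‖ - ε) * d x (y s) ≤ s * ‖a‖ ^ 2 := by
        by_cases hc : ‖a‖ - ε ≤ 0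
        · have : 0 ≤ s * ‖a‖ ^ 2 := mul_nonneg (le_of_lt b5) (sq_nonneg _)
          nlinarith
        · push Not at hc
          calc (‖a‖ - ε) * d x (y s) ≤ (‖a‖ - ε) * ((1 + ε / ‖a‖) * (s * ‖a‖)) := by
                gcongr; exact b4.2
            _ = (‖a‖ ^ 2 - ε ^ 2) * s := by field_simp; ring
            _ ≤ s * ‖a‖ ^ 2 := by
                have : 0 ≤ ε ^ 2 * s := mul_nonneg (sq_nonneg _) (le_of_lt b5)
                linarith
      have c2 := (abs_le.1 b1).1
      have c3 := le_abs_self (u (y s) - u x)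
      linarith
    have hlim : Tendsto (fun ε : ℝ => ENNReal.ofReal (‖a‖ - ε - ε)) (𝓝[>] 0)
        (𝓝 (ENNReal.ofReal ‖a‖)) := by
      refine (ENNReal.tendsto_ofReal ?_).mono_left nhdsWithin_le_nhds
      have : Tendsto (fun ε : ℝ => ‖a‖ - ε - ε) (𝓝 0) (𝓝 (‖a‖ - 0 - 0)) :=
        (Continuous.tendsto (by fun_prop) 0)
      simpa using this
    exact le_of_tendsto hlim (eventually_mem_nhdsWithin.mono fun ε hε => hlow ε hε)

/-! ### Lipschitz extension -/

section Extension

variable {G : Type*} [PseudoMetricSpace G]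

open Classical in
/-- A Lipschitz extension of `w` from `s` to the whole space (`0` if there is none). -/
def lipExt (s : Set G) (w : G → ℝ) : G → ℝ :=
  if h : ∃ K, LipschitzOnWith K w s then h.choose_spec.extend_real.choose else 0

theorem lipschitzWith_lipExt (s : Set G) (w : G → ℝ) : ∃ K, LipschitzWith K (lipExt s w) := by
  unfold lipExt
  split_ifs with h
  · exact ⟨_, h.choose_spec.extend_real.choose_spec.1⟩
  · exact ⟨0, LipschitzWith.const 0⟩

theorem lipExt_eq {s : Set G} {w : G → ℝ} (h : ∃ K, LipschitzOnWith K w s) {x : G} (hx : x ∈ s) :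
    lipExt s w x = w x := by
  unfold lipExt
  rw [dif_pos h]
  exact (h.choose_spec.extend_real.choose_spec.2 hx).symm

end Extension

/-! ### Geometry of the cone -/

section ConeGeometry

variable {n : ℕ} (m : ℕ) (A : Matrix (Fin n) (Fin n) ℝ)

open scoped MatrixOrder in
/-- The linear map `A^{1/2}`, as a map to Euclidean space. -/
def coneMap : (Fin n → ℝ) →ₗ[ℝ] EuclideanSpace ℝ (Fin n) :=
  (WithLp.linearEquiv 2 ℝ (Fin n → ℝ)).symm.toLinearMap ∘ₗ (CFC.sqrt A).mulVecLin

theorem cone_eq_image : cone m A = coneMap A '' {x | ∀ i : Fin n, (i : ℕ) < m → 0 ≤ x i} := rfl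

theorem convex_cone : Convex ℝ (cone m A) := by
  rw [cone_eq_image]
  refine Convex.linear_image (fun x hx y hy a b ha hb _ i hi => ?_) _
  have h1 := hx i hi
  have h2 := hy i hi
  simp only [Pi.add_apply, Pi.smul_apply, smul_eq_mul]
  positivity

theorem smul_mem_cone {s : ℝ} (hs : 0 ≤ s) {x : EuclideanSpace ℝ (Fin n)} (hx : x ∈ cone m A) :
    s • x ∈ cone m A := by
  rw [cone_eq_image] at hx ⊢
  obtain ⟨v, hv, rfl⟩ := hx
  refine ⟨s • v, fun i hi => ?_, by rw [map_smul]⟩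
  have := hv i hi
  simp only [Pi.smul_apply, smul_eq_mul]
  positivity

theorem zero_mem_cone : (0 : EuclideanSpace ℝ (Fin n)) ∈ cone m A :=
  ⟨0, fun i _ => le_rfl, by simp⟩

theorem smul_mem_cone_iff {s : ℝ} (hs : 0 < s) {x : EuclideanSpace ℝ (Fin n)} :
    s • x ∈ cone m A ↔ x ∈ cone m A := by
  refine ⟨fun h => ?_, smul_mem_cone m A hs.le⟩
  have := smul_mem_cone m A (inv_nonneg.2 hs.le) h
  rwa [smul_smul, inv_mul_cancel₀ hs.ne', one_smul] at this

open scoped MatrixOrder in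
theorem coneMap_surjective (hA : A.PosDef) : Function.Surjective (coneMap A) := by
  have h1 : CFC.sqrt A * CFC.sqrt A = A := CFC.sqrt_mul_sqrt_self A hA.posSemidef.nonneg
  have h2 : IsUnit (CFC.sqrt A) := by
    have h3 : IsUnit (CFC.sqrt A * CFC.sqrt A) := by rw [h1]; exact hA.isUnit
    exact isUnit_of_mul_isUnit_left h3
  have h4 : Function.Surjective (CFC.sqrt A).mulVecLin := by
    rw [Matrix.coe_mulVecLin]
    exact Matrix.mulVec_surjective_iff_isUnit.2 h2
  exact (WithLp.linearEquiv 2 ℝ (Fin n → ℝ)).symm.surjective.comp h4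

theorem interior_cone_nonempty (hA : A.PosDef) : (interior (cone m A)).Nonempty := by
  have ho : IsOpenMap (coneMap A) :=
    LinearMap.isOpenMap_of_finiteDimensional _ (coneMap_surjective A hA)
  have hU : IsOpen {x : Fin n → ℝ | ∀ i, 0 < x i} := by
    simp only [Set.ofPred_forall]
    exact isOpen_iInter_of_finite fun i => isOpen_lt continuous_const (continuous_apply i)
  refine ⟨coneMap A fun _ => 1, interior_maximal ?_ (ho _ hU) ⟨_, fun _ => one_pos, rfl⟩⟩
  rw [cone_eq_image]
  exact Set.image_mono fun x hx i _ => (hx i).le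

theorem ae_coneMeasure {P : cone m A → Prop}
    (h : ∀ᵐ y ∂(volume : Measure (EuclideanSpace ℝ (Fin n))), ∀ hy : y ∈ cone m A, P ⟨y, hy⟩) :
    ∀ᵐ ξ ∂(coneMeasure m A), P ξ := by
  rw [ae_iff] at h ⊢
  rw [coneMeasure, (MeasurableEmbedding.subtype_coe (measurableSet_cone m A)).comap_apply]
  refine measure_mono_null ?_ h
  rintro _ ⟨ξ, hξ, rfl⟩
  exact fun hcon => hξ (hcon ξ.2)

theorem ae_mem_interior : ∀ᵐ ξ : cone m A ∂(coneMeasure m A), (ξ : EuclideanSpace ℝ (Fin n)) ∈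
    interior (cone m A) := by
  refine ae_coneMeasure m A ?_
  have h := (convex_cone m A).addHaar_frontier volume
  filter_upwards [measure_eq_zero_iff_ae_notMem.1 h] with y hy hyC
  by_contra hcon
  exact hy ⟨subset_closure hyC, hcon⟩

theorem coneMeasure_univ_ne_zero (hA : A.PosDef) : coneMeasure m A ≠ 0 := by
  intro h0
  have h1 : coneMeasure m A Set.univ = 0 := by rw [h0]; rfl
  rw [coneMeasure, (MeasurableEmbedding.subtype_coe (measurableSet_cone m A)).comap_apply,
    Set.image_univ, Subtype.range_coe] at h1
  have h2 := (isOpen_interior (s := cone m A)).measure_pos volume (interior_cone_nonempty m A hA)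
  exact absurd (measure_mono_null interior_subset h1) h2.ne'

theorem gaussianMeasure_absolutelyContinuous (k : ℕ) :
    gaussianMeasure m A k ≪ coneMeasure m A := withDensity_absolutelyContinuous _ _

/-- The Gaussian density. -/
def gaussDensity (k : ℕ) (x : EuclideanSpace ℝ (Fin n)) : ℝ := Real.exp (-(k : ℝ) * ‖x‖ ^ 2)

theorem measurable_gaussDensity (k : ℕ) :
    Measurable fun ξ : cone m A => ENNReal.ofReal (gaussDensity k (ξ : EuclideanSpace ℝ (Fin n))) := by
  unfold gaussDensity
  fun_prop

theorem coneMeasure_absolutelyContinuous (k : ℕ) :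
    coneMeasure m A ≪ gaussianMeasure m A k := by
  refine withDensity_absolutelyContinuous' (measurable_gaussDensity m A k).aemeasurable
    (Eventually.of_forall fun ξ => ?_)
  simp only [ne_eq, ENNReal.ofReal_eq_zero, not_le]
  exact Real.exp_pos _

theorem lintegral_gaussianMeasure (k : ℕ) (f : cone m A → ℝ≥0∞) :
    ∫⁻ ξ, f ξ ∂(gaussianMeasure m A k) =
      ∫⁻ ξ, ENNReal.ofReal (gaussDensity k (ξ : EuclideanSpace ℝ (Fin n))) * f ξ
        ∂(coneMeasure m A) := by
  exact lintegral_withDensity_eq_lintegral_mul_non_measurable _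
    (measurable_gaussDensity m A k) (Eventually.of_forall fun ξ => ENNReal.ofReal_lt_top) _

theorem lintegral_coneMeasure (f : EuclideanSpace ℝ (Fin n) → ℝ≥0∞) :
    ∫⁻ ξ : cone m A, f ξ ∂(coneMeasure m A) = ∫⁻ y in cone m A, f y :=
  lintegral_subtype_comap (measurableSet_cone m A) f

end ConeGeometry

/-! ### The gradient on the cone -/

section ConeGradient

variable {n : ℕ} {m : ℕ} {A : Matrix (Fin n) (Fin n) ℝ}

open Classical in
/-- Extension by zero of a function on the cone. -/
def coneZeroExt (u : cone m A → ℝ) (y : EuclideanSpace ℝ (Fin n)) : ℝ :=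
  if h : y ∈ cone m A then u ⟨y, h⟩ else 0

theorem coneZeroExt_coe (u : cone m A → ℝ) (ξ : cone m A) : coneZeroExt u ξ = u ξ := by
  rw [coneZeroExt, dif_pos ξ.2]

/-- A Lipschitz extension to `ℝⁿ` of a Lipschitz function on the cone. -/
def coneExt (u : cone m A → ℝ) : EuclideanSpace ℝ (Fin n) → ℝ := lipExt (cone m A) (coneZeroExt u)

theorem lipschitzOnWith_coneZeroExt {u : cone m A → ℝ} (hu : IsLip dist u) :
    ∃ K, LipschitzOnWith K (coneZeroExt u) (cone m A) := by
  obtain ⟨K, hK0, hK⟩ := hu.exists_nonneg fun _ _ => dist_nonneg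
  refine ⟨⟨K, hK0⟩, LipschitzOnWith.of_dist_le_mul fun x hx y hy => ?_⟩
  have h := hK ⟨y, hy⟩ ⟨x, hx⟩
  rw [← coneZeroExt_coe u, ← coneZeroExt_coe u, dist_comm] at h
  exact h

theorem coneExt_coe {u : cone m A → ℝ} (hu : IsLip dist u) (ξ : cone m A) : coneExt u ξ = u ξ := by
  rw [coneExt, lipExt_eq (lipschitzOnWith_coneZeroExt hu) ξ.2, coneZeroExt_coe]

/-- The gradient of a Lipschitz function on the cone. -/
def coneGrad (u : cone m A → ℝ) (ξ : cone m A) : EuclideanSpace ℝ (Fin n) :=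
  gradient (coneExt u) (ξ : EuclideanSpace ℝ (Fin n))

theorem ae_hasGradientAt (u : cone m A → ℝ) : ∀ᵐ ξ : cone m A ∂(coneMeasure m A),
    (ξ : EuclideanSpace ℝ (Fin n)) ∈ interior (cone m A) ∧
      HasGradientAt (coneExt u) (coneGrad u ξ) (ξ : EuclideanSpace ℝ (Fin n)) := by
  refine (ae_mem_interior m A).and (ae_coneMeasure m A ?_)
  obtain ⟨K, hK⟩ := lipschitzWith_lipExt (cone m A) (coneZeroExt u)
  filter_upwards [hK.ae_differentiableAt] with y hy _
  exact hy.hasGradientAt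

/-- In the interior, the gradient can be computed from any differentiable local extension. -/
theorem coneGrad_eq_of_eventually {u : cone m A → ℝ} (hu : IsLip dist u) {ξ : cone m A}
    (hξ : (ξ : EuclideanSpace ℝ (Fin n)) ∈ interior (cone m A))
    {g : EuclideanSpace ℝ (Fin n) → ℝ} {v : EuclideanSpace ℝ (Fin n)}
    (hg : ∀ᶠ y in 𝓝 (ξ : EuclideanSpace ℝ (Fin n)), ∀ hy : y ∈ cone m A, g y = u ⟨y, hy⟩)
    (hv : HasGradientAt g v (ξ : EuclideanSpace ℝ (Fin n))) : coneGrad u ξ = v := by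
  refine HasGradientAt.gradient ?_
  rw [hasGradientAt_iff_hasFDerivAt] at hv ⊢
  refine hv.congr_of_eventuallyEq ?_
  filter_upwards [mem_interior_iff_mem_nhds.1 hξ, hg] with y hy h2
  exact (coneExt_coe hu ⟨y, hy⟩).trans (h2 hy).symm

theorem coneGrad_eq {u : cone m A → ℝ} (hu : IsLip dist u) {ξ : cone m A}
    (hξ : (ξ : EuclideanSpace ℝ (Fin n)) ∈ interior (cone m A))
    {g : EuclideanSpace ℝ (Fin n) → ℝ} {v : EuclideanSpace ℝ (Fin n)}
    (hg : ∀ ζ : cone m A, g ζ = u ζ) (hv : HasGradientAt g v (ξ : EuclideanSpace ℝ (Fin n))) :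
    coneGrad u ξ = v :=
  coneGrad_eq_of_eventually hu hξ (Eventually.of_forall fun y hy => hg ⟨y, hy⟩) hv

theorem measurable_coneGrad (u : cone m A → ℝ) : Measurable (coneGrad u) := by
  have h : Measurable (gradient (coneExt u)) :=
    (InnerProductSpace.toDual ℝ (EuclideanSpace ℝ (Fin n))).symm.continuous.measurable.comp
      (measurable_fderiv ℝ (coneExt u))
  exact h.comp measurable_subtype_coe

theorem IsLip.continuous_of_dist {X : Type*} [PseudoMetricSpace X] {u : X → ℝ}
    (hu : IsLip dist u) : Continuous u := by
  obtain ⟨K, hK0, hK⟩ := hu.exists_nonneg fun _ _ => dist_nonneg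
  refine (LipschitzWith.of_dist_le_mul (K := ⟨K, hK0⟩) fun x y => ?_).continuous
  rw [dist_comm x y, dist_comm (u x), Real.dist_eq, dist_comm]
  exact hK x y

/-- At an interior point of differentiability the local Lipschitz constant is the norm of the
gradient; the chart of `localLip_eq_of_chart` is the displacement. -/
theorem localLip_cone {u : cone m A → ℝ} (hu : IsLip dist u) {ξ : cone m A}
    (hξ : (ξ : EuclideanSpace ℝ (Fin n)) ∈ interior (cone m A))
    (hv : HasGradientAt (coneExt u) (coneGrad u ξ) (ξ : EuclideanSpace ℝ (Fin n))) :
    localLip dist u ξ = ‖coneGrad u ξ‖ₑ := by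
  classical
  set a := coneGrad u ξ with ha
  have hd : ∀ ζ : cone m A, dist ξ ζ = ‖(ζ : EuclideanSpace ℝ (Fin n)) - ξ‖ := by
    intro ζ
    rw [dist_comm, Subtype.dist_eq, dist_eq_norm]
  -- points in the direction of the gradient, which belong to the cone for small `s`; the junk
  -- value `ξ` is used for large `s`
  let y : ℝ → cone m A := fun s =>
    if h : (ξ : EuclideanSpace ℝ (Fin n)) + s • a ∈ cone m A then ⟨_, h⟩ else ξ
  have hy : ∀ᶠ s in 𝓝[>] (0 : ℝ), (y s : EuclideanSpace ℝ (Fin n)) - ξ = s • a := by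
    have hc : Tendsto (fun s : ℝ => (ξ : EuclideanSpace ℝ (Fin n)) + s • a) (𝓝 0) (𝓝 ξ) := by
      have : Tendsto (fun s : ℝ => (ξ : EuclideanSpace ℝ (Fin n)) + s • a) (𝓝 0)
        (𝓝 ((ξ : EuclideanSpace ℝ (Fin n)) + (0 : ℝ) • a)) := Continuous.tendsto (by fun_prop) 0
      simpa using this
    have := hc.eventually (mem_interior_iff_mem_nhds.1 hξ)
    filter_upwards [nhdsWithin_le_nhds this] with s hs
    have hs' : (ξ : EuclideanSpace ℝ (Fin n)) + s • a ∈ cone m A := hs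
    simp only [y]
    rw [dif_pos hs']
    simp
  refine localLip_eq_of_chart (fun ζ : cone m A => (ζ : EuclideanSpace ℝ (Fin n)) - ξ) a y ?_ ?_ hy ?_
  · intro ε hε
    rw [hasGradientAt_iff_isLittleO] at hv
    have h1 := hv.def hε
    have h2 : Tendsto (fun ζ : cone m A => (ζ : EuclideanSpace ℝ (Fin n)))
        (comap (dist ξ) (𝓝[>] 0)) (𝓝 (ξ : EuclideanSpace ℝ (Fin n))) := by
      rw [tendsto_iff_norm_sub_tendsto_zero]
      have := (tendsto_comap (f := fun ζ : cone m A => dist ξ ζ) (x := 𝓝[>] (0 : ℝ))).mono_right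
        nhdsWithin_le_nhds
      exact this.congr hd
    filter_upwards [h2.eventually h1] with ζ hζ
    rw [coneExt_coe hu, coneExt_coe hu] at hζ
    rw [hd]
    exact hζ
  · intro ε hε
    refine Eventually.of_forall fun ζ => ?_
    rw [hd]
    nlinarith [norm_nonneg ((ζ : EuclideanSpace ℝ (Fin n)) - ξ)]
  · intro ha0 ε hε
    filter_upwards [hy, eventually_mem_nhdsWithin] with s hs hs0
    have hs0' : 0 < s := hs0
    rw [hd, hs, norm_smul, Real.norm_of_nonneg hs0'.le]
    have h1 : 0 < s * ‖a‖ := mul_pos hs0' (norm_pos_iff.2 ha0)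
    exact ⟨h1, by nlinarith⟩

/-- The gradient on the cone for a measure that is absolutely continuous with respect to Lebesgue
measure. -/
def coneLipGradient {ν : Measure (cone m A)} (hν : ν ≪ coneMeasure m A) :
    LipGradient (dist : cone m A → cone m A → ℝ) ν (EuclideanSpace ℝ (Fin n)) where
  grad := coneGrad
  dist_nonneg _ _ := dist_nonneg
  measurable_fun hu := hu.continuous_of_dist.measurable.aestronglyMeasurable
  measurable_grad _ := (measurable_coneGrad _).aestronglyMeasurable
  localLip_eq {u} hu := by
    filter_upwards [hν.ae_le (ae_hasGradientAt u)] with ξ h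
    exact localLip_cone hu h.1 h.2
  grad_add {u v} hu hv := by
    filter_upwards [hν.ae_le (ae_hasGradientAt u), hν.ae_le (ae_hasGradientAt v)] with ξ h1 h2
    refine coneGrad_eq (hu.add hv) h1.1 (g := coneExt u + coneExt v) (fun ζ => ?_) ?_
    · rw [Pi.add_apply, Pi.add_apply, coneExt_coe hu, coneExt_coe hv]
    · have := h1.2.hasFDerivAt.add h2.2.hasFDerivAt
      rw [hasGradientAt_iff_hasFDerivAt, map_add]
      exact this
  grad_smul c {u} hu := by
    filter_upwards [hν.ae_le (ae_hasGradientAt u)] with ξ h1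
    refine coneGrad_eq (hu.smul c) h1.1 (g := c • coneExt u) (fun ζ => ?_) ?_
    · rw [Pi.smul_apply, Pi.smul_apply, coneExt_coe hu]
    · have := h1.2.hasFDerivAt.const_smul c
      rw [hasGradientAt_iff_hasFDerivAt, map_smul]
      exact this
  grad_mul {u v} hu hv huv := by
    filter_upwards [hν.ae_le (ae_hasGradientAt u), hν.ae_le (ae_hasGradientAt v)] with ξ h1 h2
    refine coneGrad_eq huv h1.1 (g := coneExt u * coneExt v) (fun ζ => ?_) ?_
    · rw [Pi.mul_apply, Pi.mul_apply, coneExt_coe hu, coneExt_coe hv]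
    · have := h1.2.hasFDerivAt.mul h2.2.hasFDerivAt
      rw [coneExt_coe hu, coneExt_coe hv] at this
      rw [hasGradientAt_iff_hasFDerivAt, map_add, map_smul, map_smul]
      exact this

end ConeGradient

/-! ### Compactly supported Lipschitz functions on the cone and the scaling identity -/

section Scaling

variable {n : ℕ} {m : ℕ} {A : Matrix (Fin n) (Fin n) ℝ}

theorem IsLip.exists_bound_cone {u : cone m A → ℝ} (hu : IsLip dist u) (R : ℝ) :
    ∃ M, ∀ ξ : cone m A, ‖(ξ : EuclideanSpace ℝ (Fin n))‖ ≤ R → |u ξ| ≤ M := by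
  obtain ⟨K, hK0, hK⟩ := hu.exists_nonneg fun _ _ => dist_nonneg
  let o : cone m A := ⟨0, zero_mem_cone m A⟩
  refine ⟨|u o| + K * R, fun ξ hξ => ?_⟩
  have h1 := hK o ξ
  have h2 : dist o ξ = ‖(ξ : EuclideanSpace ℝ (Fin n))‖ := by
    rw [dist_comm, Subtype.dist_eq, dist_eq_norm]
    simp [o]
  rw [h2] at h1
  have h3 := abs_add_le (u ξ - u o) (u o)
  rw [sub_add_cancel] at h3
  nlinarith [mul_le_mul_of_nonneg_left hξ hK0]

theorem isLip_norm_cone :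
    IsLip dist fun ξ : cone m A => ‖(ξ : EuclideanSpace ℝ (Fin n))‖ :=
  ⟨1, fun x y => by
    rw [one_mul, dist_comm, Subtype.dist_eq, dist_eq_norm]
    exact abs_norm_sub_norm_le _ _⟩

theorem exists_bound_of_support {u : cone m A → ℝ} (hu : IsLip dist u) {R : ℝ}
    (hR : ∀ ξ : cone m A, R ≤ ‖(ξ : EuclideanSpace ℝ (Fin n))‖ → u ξ = 0) :
    ∃ M, ∀ ξ, |u ξ| ≤ M := by
  obtain ⟨M, hM⟩ := hu.exists_bound_cone R
  refine ⟨max M 0, fun ξ => ?_⟩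
  rcases le_total R ‖(ξ : EuclideanSpace ℝ (Fin n))‖ with h | h
  · rw [hR ξ h, abs_zero]
    exact le_max_right _ _
  · exact (hM ξ h).trans (le_max_left _ _)

/-- A Lipschitz function with bounded support stays Lipschitz after multiplication by a smooth
function. -/
theorem IsLip.mul_contDiff {u : cone m A → ℝ} (hu : IsLip dist u) {R : ℝ}
    (hR : ∀ ξ : cone m A, R ≤ ‖(ξ : EuclideanSpace ℝ (Fin n))‖ → u ξ = 0)
    {g : EuclideanSpace ℝ (Fin n) → ℝ} (hg : ContDiff ℝ 1 g) :
    IsLip dist fun ξ : cone m A => u ξ * g ξ := by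
  obtain ⟨M, hM⟩ := exists_bound_of_support hu hR
  obtain ⟨K, hK⟩ := (hg.contDiffOn (s := Metric.closedBall 0 R)).exists_lipschitzOnWith one_ne_zero
    (convex_closedBall 0 R) (isCompact_closedBall 0 R)
  obtain ⟨L, hL⟩ := lipschitzWith_lipExt (Metric.closedBall 0 R) g
  have hv : IsLip dist fun ξ : cone m A => lipExt (Metric.closedBall 0 R) g ξ := by
    refine ⟨L, fun x y => ?_⟩
    have := hL.dist_le_mul (y : EuclideanSpace ℝ (Fin n)) x
    rwa [Real.dist_eq, dist_comm] at this
  obtain ⟨N, hN⟩ := hv.exists_bound_cone R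
  have h1 := hu.mul (fun _ _ => dist_nonneg) hv hM (N := N) (fun ξ hξ => hN ξ (by
    by_contra! hcon
    exact hξ (hR ξ hcon.le)))
  convert h1 using 1
  ext ξ
  rw [Pi.mul_apply]
  rcases le_total R ‖(ξ : EuclideanSpace ℝ (Fin n))‖ with h | h
  · rw [hR ξ h, zero_mul, zero_mul]
  · rw [lipExt_eq ⟨K, hK⟩ (by simpa using h)]

theorem coneGrad_bound {u : cone m A → ℝ} {R : ℝ} (hu : IsLip dist u)
    (hR : ∀ ξ : cone m A, R ≤ ‖(ξ : EuclideanSpace ℝ (Fin n))‖ → u ξ = 0) :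
    (∃ K : ℝ, 0 ≤ K ∧ ∀ ξ, ‖coneGrad u ξ‖ ≤ K) ∧ ∀ᵐ ξ : cone m A ∂(coneMeasure m A),
      R < ‖(ξ : EuclideanSpace ℝ (Fin n))‖ → coneGrad u ξ = 0 := by
  constructor
  · obtain ⟨K, hK⟩ := lipschitzWith_lipExt (cone m A) (coneZeroExt u)
    refine ⟨K, K.2, fun ξ => ?_⟩
    rw [coneGrad, ← (InnerProductSpace.toDual ℝ _).norm_map, toDual_gradient]
    exact norm_fderiv_le_of_lipschitz ℝ hK
  · filter_upwards [ae_mem_interior m A] with ξ hξ hlt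
    refine coneGrad_eq_of_eventually hu hξ (g := fun _ => 0) ?_ ?_
    · have h1 : ∀ᶠ y in 𝓝 (ξ : EuclideanSpace ℝ (Fin n)), R < ‖y‖ :=
        continuous_norm.continuousAt.eventually (lt_mem_nhds hlt)
      filter_upwards [h1] with y hy hyC
      exact (hR ⟨y, hyC⟩ hy.le).symm
    · rw [hasGradientAt_iff_hasFDerivAt, map_zero]
      exact hasFDerivAt_const _ _

theorem coneMeasure_closedBall_lt_top (R : ℝ) :
    coneMeasure m A {ξ | ‖(ξ : EuclideanSpace ℝ (Fin n))‖ ≤ R} < ⊤ := by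
  rw [coneMeasure, (MeasurableEmbedding.subtype_coe (measurableSet_cone m A)).comap_apply]
  refine (measure_mono ?_).trans_lt (measure_closedBall_lt_top (x := (0 : EuclideanSpace ℝ (Fin n)))
    (r := R))
  rintro _ ⟨ξ, hξ, rfl⟩
  simpa using hξ

theorem measurable_coneZeroExt {u : cone m A → ℝ} (hu : IsLip dist u) :
    Measurable (coneZeroExt u) := by
  obtain ⟨K, hK⟩ := lipschitzWith_lipExt (cone m A) (coneZeroExt u)
  have h : coneZeroExt u = (cone m A).indicator (coneExt u) := by
    ext y
    by_cases hy : y ∈ cone m A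
    · rw [Set.indicator_of_mem hy, coneExt_coe hu ⟨y, hy⟩, coneZeroExt, dif_pos hy]
    · rw [Set.indicator_of_notMem hy, coneZeroExt, dif_neg hy]
  rw [h]
  exact hK.continuous.measurable.indicator (measurableSet_cone m A)

theorem integral_coneMeasure (f : EuclideanSpace ℝ (Fin n) → ℝ) :
    ∫ ξ : cone m A, f ξ ∂(coneMeasure m A) = ∫ y in cone m A, f y :=
  integral_subtype_comap (measurableSet_cone m A) f

/-- Integration by parts for the radial vector field. There is no boundary term, since the cone is
invariant under scaling: both sides are the derivative at `s = 1` of `∫ u (s ξ) dξ`. -/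
theorem integral_inner_coneGrad {u : cone m A → ℝ} (hu : IsLip dist u) {R : ℝ}
    (hR : ∀ ξ : cone m A, R ≤ ‖(ξ : EuclideanSpace ℝ (Fin n))‖ → u ξ = 0) :
    ∫ ξ : cone m A, inner ℝ (coneGrad u ξ) (ξ : EuclideanSpace ℝ (Fin n)) ∂(coneMeasure m A) =
      -n * ∫ ξ, u ξ ∂(coneMeasure m A) := by
  classical
  obtain ⟨K, hK0, hK⟩ := hu.exists_nonneg fun _ _ => dist_nonneg
  obtain ⟨M, hM⟩ := exists_bound_of_support hu hR
  set I : ℝ → ℝ := fun s => ∫ ξ : cone m A, coneZeroExt u (s • (ξ : EuclideanSpace ℝ (Fin n)))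
    ∂(coneMeasure m A) with hI
  have hzero : ∀ y ∉ cone m A, coneZeroExt u y = 0 := fun y hy => by
    rw [coneZeroExt, dif_neg hy]
  -- change of variables: the cone is invariant under scaling
  have hIs : ∀ s : ℝ, 0 < s → I s = (s ^ n)⁻¹ * I 1 := by
    intro s hs
    have h1 : ∀ s : ℝ, 0 < s → I s = ∫ y, coneZeroExt u (s • y) := by
      intro s hs
      rw [hI]
      dsimp only
      rw [integral_coneMeasure fun y => coneZeroExt u (s • y)]
      refine setIntegral_eq_integral_of_forall_compl_eq_zero fun y hy => hzero _ ?_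
      rwa [smul_mem_cone_iff m A hs]
    rw [h1 s hs, h1 1 one_pos, Measure.integral_comp_smul_of_nonneg volume _ s (hR := hs.le)]
    simp
  have hball : ∀ s ∈ Metric.ball (1 : ℝ) (1 / 2), 1 / 2 < s := by
    intro s hs
    rw [Metric.mem_ball, Real.dist_eq, abs_lt] at hs
    linarith
  have hmeas : ∀ s : ℝ, AEStronglyMeasurable
      (fun ξ : cone m A => coneZeroExt u (s • (ξ : EuclideanSpace ℝ (Fin n))))
      (coneMeasure m A) := fun s =>
    ((measurable_coneZeroExt hu).comp (by fun_prop)).aestronglyMeasurable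
  have hfinite : ∀ c R : ℝ, Integrable (({ξ : cone m A | ‖(ξ : EuclideanSpace ℝ (Fin n))‖ ≤ R}).indicator
      fun _ => c) (coneMeasure m A) := by
    intro c R
    refine (integrable_indicator_iff ?_).2 (integrableOn_const (coneMeasure_closedBall_lt_top R).ne)
    exact measurableSet_le (by fun_prop) measurable_const
  have hval : ∀ (s : ℝ) (hs : 0 < s), ∀ ξ : cone m A, coneZeroExt u (s • (ξ : EuclideanSpace ℝ (Fin n))) =
      u ⟨s • (ξ : EuclideanSpace ℝ (Fin n)), smul_mem_cone m A hs.le ξ.2⟩ := by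
    intro s hs ξ
    exact coneZeroExt_coe u ⟨s • (ξ : EuclideanSpace ℝ (Fin n)), smul_mem_cone m A hs.le ξ.2⟩
  -- differentiation under the integral sign; for `s > 1 / 2` the integrand is supported in the
  -- ball of radius `2 |R|`
  have hderiv := hasDerivAt_integral_of_dominated_loc_of_lip (μ := coneMeasure m A) (𝕜 := ℝ)
    (F := fun s (ξ : cone m A) => coneZeroExt u (s • (ξ : EuclideanSpace ℝ (Fin n)))) (x₀ := 1)
    (F' := fun ξ : cone m A => inner ℝ (coneGrad u ξ) (ξ : EuclideanSpace ℝ (Fin n)))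
    (s := Metric.ball 1 (1 / 2))
    (bound := ({ξ : cone m A | ‖(ξ : EuclideanSpace ℝ (Fin n))‖ ≤ 2 * |R|}).indicator
      fun _ => K * (2 * |R|))
    (Metric.ball_mem_nhds 1 (by norm_num)) (Eventually.of_forall hmeas) ?_ ?_ ?_
    (hfinite _ _) ?_
  · have h2 : HasDerivAt I (-n * I 1) 1 := by
      have h3 : HasDerivAt (fun s : ℝ => (s ^ n)⁻¹ * I 1) (-n * I 1) 1 := by
        have := ((hasDerivAt_pow n (1 : ℝ)).inv (by simp)).mul_const (I 1)
        simpa using this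
      refine h3.congr_of_eventuallyEq ?_
      filter_upwards [lt_mem_nhds one_pos] with s hs
      exact hIs s hs
    have h4 := hderiv.2.unique h2
    rw [h4, hI]
    simp only [one_smul, coneZeroExt_coe]
  · -- integrability at `s = 1`
    refine (hfinite M |R|).mono' (hmeas 1) (Eventually.of_forall fun ξ => ?_)
    rw [one_smul, coneZeroExt_coe]
    by_cases h : ‖(ξ : EuclideanSpace ℝ (Fin n))‖ ≤ |R|
    · rw [Set.indicator_of_mem (by exact h)]
      exact hM ξ
    · rw [Set.indicator_of_notMem (by exact h), hR ξ ((le_abs_self R).trans (not_le.1 h).le), norm_zero]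
  · exact ((measurable_coneGrad u).inner measurable_subtype_coe).aestronglyMeasurable
  · refine Eventually.of_forall fun ξ => ?_
    by_cases h : ‖(ξ : EuclideanSpace ℝ (Fin n))‖ ≤ 2 * |R|
    · rw [Set.indicator_of_mem (by exact h)]
      refine LipschitzOnWith.of_dist_le_mul fun s hs t ht => ?_
      have hs0 : 0 < s := by linarith [hball s hs]
      have ht0 : 0 < t := by linarith [hball t ht]
      rw [hval s hs0, hval t ht0, Real.dist_eq]
      refine (hK _ _).trans ?_
      rw [dist_comm, Subtype.dist_eq, dist_eq_norm, ← sub_smul, norm_smul, Real.coe_nnabs,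
        abs_of_nonneg (by positivity), Real.dist_eq, Real.norm_eq_abs]
      calc K * (|s - t| * ‖(ξ : EuclideanSpace ℝ (Fin n))‖) ≤ K * (|s - t| * (2 * |R|)) := by gcongr
        _ = _ := by ring
    · rw [Set.indicator_of_notMem (by exact h)]
      refine LipschitzOnWith.of_dist_le_mul fun s hs t ht => ?_
      have hz : ∀ s ∈ Metric.ball (1 : ℝ) (1 / 2),
          coneZeroExt u (s • (ξ : EuclideanSpace ℝ (Fin n))) = 0 := by
        intro s hs
        have hs1 := hball s hs
        rw [hval s (by linarith)]
        refine hR _ ?_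
        dsimp only
        rw [norm_smul, Real.norm_of_nonneg (by linarith)]
        push Not at h
        have := le_abs_self R
        nlinarith [norm_nonneg (ξ : EuclideanSpace ℝ (Fin n)), abs_nonneg R]
      rw [hz s hs, hz t ht]
      simp
  · filter_upwards [ae_hasGradientAt u] with ξ hξ
    have h1 := hξ.2.hasFDerivAt
    have h2 : HasDerivAt (fun s : ℝ => s • (ξ : EuclideanSpace ℝ (Fin n)))
        (ξ : EuclideanSpace ℝ (Fin n)) 1 := by
      simpa using (hasDerivAt_id (1 : ℝ)).smul_const (ξ : EuclideanSpace ℝ (Fin n))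
    rw [← one_smul ℝ (ξ : EuclideanSpace ℝ (Fin n))] at h1
    have h3 := h1.comp_hasDerivAt (1 : ℝ) h2
    rw [InnerProductSpace.toDual_apply_apply] at h3
    refine h3.congr_of_eventuallyEq ?_
    filter_upwards [lt_mem_nhds (one_pos : (0 : ℝ) < 1)] with s hs
    rw [hval s hs, Function.comp_apply]
    exact (coneExt_coe hu ⟨s • (ξ : EuclideanSpace ℝ (Fin n)), smul_mem_cone m A hs.le ξ.2⟩).symm

end Scaling

/-! ### The harmonic oscillator identity -/

section Oscillator

variable {n : ℕ} {m : ℕ} {A : Matrix (Fin n) (Fin n) ℝ}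

theorem integrable_exp_neg_mul_sq {b : ℝ} (hb : 0 < b) :
    Integrable fun x : EuclideanSpace ℝ (Fin n) => Real.exp (-b * ‖x‖ ^ 2) := by
  have h := (GaussianFourier.integrable_cexp_neg_mul_sq_norm_add (V := EuclideanSpace ℝ (Fin n))
    (b := (b : ℂ)) (by simpa using hb) 0 0).norm
  refine h.congr (Eventually.of_forall fun x => ?_)
  simp only [Complex.norm_exp]
  congr 1
  have : (-(b : ℂ) * (‖x‖ : ℂ) ^ 2 + 0 * (inner ℝ (0 : EuclideanSpace ℝ (Fin n)) x : ℝ)) =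
      ((-b * ‖x‖ ^ 2 : ℝ) : ℂ) := by push_cast; ring
  rw [this, Complex.ofReal_re]

theorem isFiniteMeasure_gaussianMeasure {k : ℕ} (hk : 0 < k) :
    IsFiniteMeasure (gaussianMeasure m A k) := by
  refine ⟨?_⟩
  rw [← setLIntegral_one, Measure.restrict_univ, lintegral_gaussianMeasure]
  simp only [mul_one]
  rw [lintegral_coneMeasure m A fun y => ENNReal.ofReal (gaussDensity k y)]
  have h := (integrable_exp_neg_mul_sq (n := n) (b := k) (by exact_mod_cast hk)).lintegral_lt_top
  exact (setLIntegral_le_lintegral _ _).trans_lt h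

theorem integral_gaussianMeasure (k : ℕ) (f : cone m A → ℝ) :
    ∫ ξ, f ξ ∂(gaussianMeasure m A k) =
      ∫ ξ : cone m A, gaussDensity k (ξ : EuclideanSpace ℝ (Fin n)) * f ξ ∂(coneMeasure m A) := by
  have h := integral_withDensity_eq_integral_toReal_smul (μ := coneMeasure m A)
    (measurable_gaussDensity m A k) (Eventually.of_forall fun ξ => ENNReal.ofReal_lt_top) f
  refine h.trans (integral_congr_ae (Eventually.of_forall fun ξ => ?_))
  dsimp only
  rw [ENNReal.toReal_ofReal (show 0 ≤ gaussDensity k _ from (Real.exp_pos _).le), smul_eq_mul]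

theorem contDiff_exp_mul_sq (c : ℝ) :
    ContDiff ℝ 1 fun x : EuclideanSpace ℝ (Fin n) => Real.exp (c * ‖x‖ ^ 2) :=
  Real.contDiff_exp.comp (contDiff_const.mul (contDiff_norm_sq ℝ))

theorem hasGradientAt_exp_mul_sq (c : ℝ) (x : EuclideanSpace ℝ (Fin n)) :
    HasGradientAt (fun x : EuclideanSpace ℝ (Fin n) => Real.exp (c * ‖x‖ ^ 2))
      ((Real.exp (c * ‖x‖ ^ 2) * (2 * c)) • x) x := by
  have h1 := (((hasStrictFDerivAt_norm_sq x).hasFDerivAt).const_mul c).exp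
  rw [hasGradientAt_iff_hasFDerivAt]
  refine h1.congr_fderiv ?_
  ext y
  simp
  ring

/-- The Gaussian Dirichlet form is the form of the harmonic oscillator, shifted by `k n`. -/
theorem oscillator_identity {k : ℕ} (hk : 0 < k) {φ : cone m A → ℝ} (hφ : IsLip dist φ) {R : ℝ}
    (hR : ∀ ξ : cone m A, R ≤ ‖(ξ : EuclideanSpace ℝ (Fin n))‖ → φ ξ = 0) :
    ∫⁻ ξ : cone m A, (‖coneGrad φ ξ - ((k : ℝ) * φ ξ) • (ξ : EuclideanSpace ℝ (Fin n))‖ₑ ^ 2 +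
        ‖((k : ℝ) * φ ξ) • (ξ : EuclideanSpace ℝ (Fin n))‖ₑ ^ 2) ∂(gaussianMeasure m A k) =
      ∫⁻ ξ, (‖coneGrad φ ξ‖ₑ ^ 2 + ENNReal.ofReal (k * n) * ‖φ ξ‖ₑ ^ 2)
        ∂(gaussianMeasure m A k) := by
  have := isFiniteMeasure_gaussianMeasure (m := m) (A := A) hk
  set ν := gaussianMeasure m A k with hν
  obtain ⟨M, hM⟩ := exists_bound_of_support hφ hR
  obtain ⟨⟨K, hK0, hK⟩, -⟩ := coneGrad_bound hφ hR
  let b : cone m A → EuclideanSpace ℝ (Fin n) := fun ξ => φ ξ • (ξ : EuclideanSpace ℝ (Fin n))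
  let v : cone m A → EuclideanSpace ℝ (Fin n) := coneGrad φ
  have hM0 : 0 ≤ M := (abs_nonneg _).trans (hM ⟨0, zero_mem_cone m A⟩)
  have hb : ∀ ξ, ‖b ξ‖ ≤ M * |R| := by
    intro ξ
    by_cases h : R ≤ ‖(ξ : EuclideanSpace ℝ (Fin n))‖
    · simp only [b, hR ξ h, zero_smul, norm_zero]
      positivity
    · push Not at h
      rw [norm_smul]
      exact mul_le_mul (hM ξ) (h.le.trans (le_abs_self R)) (norm_nonneg _) hM0
  have hφm : Measurable φ := hφ.continuous_of_dist.measurable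
  have hvm : Measurable v := measurable_coneGrad φ
  have hbm : Measurable b := hφm.smul measurable_subtype_coe
  have hint : ∀ {f : cone m A → ℝ} (C : ℝ), Measurable f → (∀ ξ, |f ξ| ≤ C) → Integrable f ν :=
    fun C hf hC => Integrable.of_bound hf.aestronglyMeasurable C (Eventually.of_forall hC)
  have i1 : Integrable (fun ξ => ‖v ξ‖ ^ 2) ν := hint (K ^ 2) (hvm.norm.pow_const 2) fun ξ => by
    rw [abs_of_nonneg (by positivity)]
    have := hK ξ
    gcongr
  have i2 : Integrable (fun ξ => ‖b ξ‖ ^ 2) ν :=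
    hint ((M * |R|) ^ 2) (hbm.norm.pow_const 2) fun ξ => by
      rw [abs_of_nonneg (by positivity)]
      have := hb ξ
      gcongr
  have i3 : Integrable (fun ξ => φ ξ ^ 2) ν := hint (M ^ 2) (hφm.pow_const 2) fun ξ => by
    rw [abs_pow]
    have := hM ξ
    gcongr
  have i4 : Integrable (fun ξ => inner ℝ (v ξ) (b ξ)) ν :=
    hint (K * (M * |R|)) (hvm.inner hbm) fun ξ =>
      (abs_real_inner_le_norm _ _).trans (mul_le_mul (hK ξ) (hb ξ) (norm_nonneg _) hK0)
  -- the scaling identity for `φ² e^{-k|ξ|²}`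
  have key : ∫ ξ, (2 * inner ℝ (v ξ) (b ξ) - 2 * k * ‖b ξ‖ ^ 2) ∂ν = -n * ∫ ξ, φ ξ ^ 2 ∂ν := by
    have hg := contDiff_exp_mul_sq (n := n) (-(k : ℝ))
    have hφg := hφ.mul_contDiff hR hg
    have hRg : ∀ ξ : cone m A, R ≤ ‖(ξ : EuclideanSpace ℝ (Fin n))‖ →
        φ ξ * Real.exp (-(k : ℝ) * ‖(ξ : EuclideanSpace ℝ (Fin n))‖ ^ 2) = 0 := fun ξ h => by
      rw [hR ξ h, zero_mul]
    obtain ⟨N, hN⟩ := exists_bound_of_support hφg hRg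
    have hu := hφ.mul (fun _ _ => dist_nonneg) hφg hM (N := N) fun ξ _ => hN ξ
    have h1 := integral_inner_coneGrad hu (R := R) fun ξ h => by rw [Pi.mul_apply, hR ξ h, zero_mul]
    rw [hν, integral_gaussianMeasure, integral_gaussianMeasure]
    have e1 : ∫ ξ : cone m A, (φ * fun ξ : cone m A => φ ξ *
        Real.exp (-(k : ℝ) * ‖(ξ : EuclideanSpace ℝ (Fin n))‖ ^ 2)) ξ ∂(coneMeasure m A) =
        ∫ ξ : cone m A, gaussDensity k (ξ : EuclideanSpace ℝ (Fin n)) * φ ξ ^ 2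
          ∂(coneMeasure m A) := by
      refine integral_congr_ae (Eventually.of_forall fun ξ => ?_)
      simp only [Pi.mul_apply, gaussDensity]
      ring
    rw [← e1, ← h1]
    refine integral_congr_ae ?_
    filter_upwards [ae_hasGradientAt φ] with ξ hξ
    have h2 := hξ.2.hasFDerivAt
    have h3 := h2.mul (h2.mul (hasGradientAt_exp_mul_sq (-(k : ℝ))
      (ξ : EuclideanSpace ℝ (Fin n))).hasFDerivAt)
    have h4 := coneGrad_eq hu hξ.1 (g := coneExt φ * (coneExt φ * fun x =>
      Real.exp (-(k : ℝ) * ‖x‖ ^ 2)))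
      (v := (2 * φ ξ * gaussDensity k (ξ : EuclideanSpace ℝ (Fin n))) • v ξ +
        (φ ξ ^ 2 * (gaussDensity k (ξ : EuclideanSpace ℝ (Fin n)) * (2 * -(k : ℝ)))) •
          (ξ : EuclideanSpace ℝ (Fin n))) (fun ζ => by
        simp only [Pi.mul_apply, coneExt_coe hφ]) (by
        rw [hasGradientAt_iff_hasFDerivAt]
        refine h3.congr_fderiv ?_
        rw [Pi.mul_apply, coneExt_coe hφ]
        ext y
        simp [gaussDensity, v]
        ring)
    rw [h4]
    simp only [b, inner_add_left, inner_smul_left, inner_smul_right, norm_smul,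
      real_inner_self_eq_norm_sq, RCLike.conj_to_real, Real.norm_eq_abs, mul_pow, sq_abs]
    ring
  -- expand the square; `key` evaluates the mixed term
  have hfin : ∫ ξ, (‖v ξ - (k : ℝ) • b ξ‖ ^ 2 + ‖(k : ℝ) • b ξ‖ ^ 2) ∂ν =
      ∫ ξ, (‖v ξ‖ ^ 2 + k * n * φ ξ ^ 2) ∂ν := by
    have e : ∀ ξ, ‖v ξ - (k : ℝ) • b ξ‖ ^ 2 + ‖(k : ℝ) • b ξ‖ ^ 2 =
        ‖v ξ‖ ^ 2 - k * (2 * inner ℝ (v ξ) (b ξ) - 2 * k * ‖b ξ‖ ^ 2) := by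
      intro ξ
      rw [norm_sub_sq_real, inner_smul_right, norm_smul, mul_pow, Real.norm_eq_abs, sq_abs]
      ring
    simp_rw [e]
    have i6 : Integrable (fun ξ => (k : ℝ) * (2 * inner ℝ (v ξ) (b ξ) - 2 * k * ‖b ξ‖ ^ 2)) ν :=
      ((i4.const_mul 2).sub (i2.const_mul (2 * k))).const_mul k
    rw [integral_sub i1 i6,
      integral_const_mul, key, integral_add i1 (i3.const_mul _), integral_const_mul]
    ring
  have i5 : Integrable (fun ξ => ‖v ξ - (k : ℝ) • b ξ‖ ^ 2 + ‖(k : ℝ) • b ξ‖ ^ 2) ν := by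
    refine hint ((K + k * (M * |R|)) ^ 2 + (k * (M * |R|)) ^ 2) ?_ fun ξ => ?_
    · fun_prop
    · rw [abs_of_nonneg (by positivity)]
      have h1 : ‖(k : ℝ) • b ξ‖ ≤ k * (M * |R|) := by
        rw [norm_smul, Real.norm_of_nonneg (by positivity)]
        have := hb ξ
        gcongr
      have h2 : ‖v ξ - (k : ℝ) • b ξ‖ ≤ K + k * (M * |R|) :=
        (norm_sub_le _ _).trans (add_le_add (hK ξ) h1)
      gcongr
  have hconv : ∀ (x y : EuclideanSpace ℝ (Fin n)), ‖x‖ₑ ^ 2 + ‖y‖ₑ ^ 2 =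
      ENNReal.ofReal (‖x‖ ^ 2 + ‖y‖ ^ 2) := fun x y => by
    rw [enorm_sq_eq_ofReal, enorm_sq_eq_ofReal, ENNReal.ofReal_add (by positivity) (by positivity)]
  have hL : ∀ ξ : cone m A, ((k : ℝ) * φ ξ) • (ξ : EuclideanSpace ℝ (Fin n)) = (k : ℝ) • b ξ :=
    fun ξ => mul_smul _ _ _
  have hRe : ∀ ξ : cone m A, ‖coneGrad φ ξ‖ₑ ^ 2 + ENNReal.ofReal (k * n) * ‖φ ξ‖ₑ ^ 2 =
      ENNReal.ofReal (‖v ξ‖ ^ 2 + k * n * φ ξ ^ 2) := by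
    intro ξ
    rw [enorm_sq_eq_ofReal, enorm_sq_eq_ofReal, ← ENNReal.ofReal_mul (by positivity),
      ← ENNReal.ofReal_add (by positivity) (by positivity), Real.norm_eq_abs, sq_abs]
  have i7 : Integrable (fun ξ => ‖v ξ‖ ^ 2 + k * n * φ ξ ^ 2) ν := i1.add (i3.const_mul _)
  simp_rw [hRe, hconv, hL]
  rw [← ofReal_integral_eq_lintegral_ofReal i5 (Eventually.of_forall fun ξ => by positivity),
    ← ofReal_integral_eq_lintegral_ofReal i7
      (Eventually.of_forall fun ξ => by positivity), hfin]

end Oscillator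

/-! ### The Poincaré inequality on convex sets -/

section Poincare

variable {E : Type*} [NormedAddCommGroup E] [NormedSpace ℝ E]
  [MeasurableSpace E] [BorelSpace E]

theorem sq_lintegral_le {α : Type*} [MeasurableSpace α] {ρ : Measure α} [IsProbabilityMeasure ρ]
    {f : α → ℝ≥0∞} (hf : AEMeasurable f ρ) : (∫⁻ x, f x ∂ρ) ^ 2 ≤ ∫⁻ x, f x ^ 2 ∂ρ := by
  have h := eLpNorm_le_eLpNorm_of_exponent_le (μ := ρ) (p := 1) (q := 2) (f := f) (by norm_num)
    hf.aestronglyMeasurable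
  rw [eLpNorm_one_eq_lintegral_enorm] at h
  have h2 := pow_le_pow_left' h 2
  have h3 := eLpNorm_nnreal_pow_eq_lintegral (f := f) (μ := ρ) (p := 2) (by norm_num)
  simp only [NNReal.coe_ofNat, ENNReal.rpow_ofNat, ENNReal.coe_ofNat, enorm_eq_self] at h2 h3
  rwa [h3] at h2

/-- A Lipschitz function differs between the ends of a segment by at most the integral of its
gradient, provided that it is differentiable at almost all points of the segment. -/
theorem enorm_sub_sq_le_lintegral {u : E → ℝ} (hu : ∃ K, LipschitzWith K u) {x y : E}
    (h : ∀ᵐ t : ℝ, DifferentiableAt ℝ u (x + t • (y - x))) :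
    ‖u x - u y‖ₑ ^ 2 ≤
      ‖y - x‖ₑ ^ 2 * ∫⁻ t in Set.Ioc (0 : ℝ) 1, ‖fderiv ℝ u (x + t • (y - x))‖ₑ ^ 2 := by
  obtain ⟨K, hK⟩ := hu
  set c : ℝ → E := fun t => x + t • (y - x)
  have hc : ∀ t, HasDerivAt c (y - x) t := fun t => by
    simpa [c] using (((hasDerivAt_id t).smul_const (y - x)).const_add x)
  have hLc : LipschitzWith (K * ‖y - x‖₊) (u ∘ c) := by
    refine hK.comp (LipschitzWith.of_dist_le_mul fun s t => ?_)
    rw [dist_eq_norm, dist_eq_norm]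
    simp only [c, add_sub_add_left_eq_sub, ← sub_smul, norm_smul, coe_nnnorm]
    rw [mul_comm]
  have hFTC := (hLc.lipschitzOnWith (s := Set.uIcc (0 : ℝ) 1)).absolutelyContinuousOnInterval.integral_deriv_eq_sub
  have h1 : u y - u x = ∫ t in Set.Ioc (0 : ℝ) 1, deriv (u ∘ c) t := by
    rw [← intervalIntegral.integral_of_le zero_le_one, hFTC]
    simp [c]
  have h2 : ∀ᵐ t : ℝ, ‖deriv (u ∘ c) t‖ₑ ≤ ‖y - x‖ₑ * ‖fderiv ℝ u (c t)‖ₑ := by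
    filter_upwards [h] with t ht
    rw [(ht.hasFDerivAt.comp_hasDerivAt t (hc t)).deriv, mul_comm]
    exact ContinuousLinearMap.le_opENorm _ _
  have : IsProbabilityMeasure (volume.restrict (Set.Ioc (0 : ℝ) 1)) := ⟨by simp⟩
  have hm : Measurable fun t => ‖fderiv ℝ u (c t)‖ₑ :=
    ((measurable_fderiv ℝ u).comp (by fun_prop)).enorm
  rw [← enorm_neg, neg_sub, h1]
  calc _ ≤ (∫⁻ t in Set.Ioc (0 : ℝ) 1, ‖y - x‖ₑ * ‖fderiv ℝ u (c t)‖ₑ) ^ 2 := by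
        gcongr
        exact (enorm_integral_le_lintegral_enorm _).trans
          (lintegral_mono_ae (ae_restrict_of_ae h2))
    _ ≤ ∫⁻ t in Set.Ioc (0 : ℝ) 1, (‖y - x‖ₑ * ‖fderiv ℝ u (c t)‖ₑ) ^ 2 :=
        sq_lintegral_le (hm.const_mul _).aemeasurable
    _ = _ := by
        simp_rw [mul_pow]
        rw [lintegral_const_mul _ (hm.pow_const 2)]

variable [FiniteDimensional ℝ E] {μ : Measure E} [μ.IsAddHaarMeasure]

theorem lintegral_comp_homothety (x : E) {t : ℝ} (ht : t ≠ 0) {f : E → ℝ≥0∞}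
    (hf : Measurable f) : ∫⁻ y, f (x + t • (y - x)) ∂μ =
      ENNReal.ofReal |(t ^ Module.finrank ℝ E)⁻¹| * ∫⁻ y, f y ∂μ := by
  rw [lintegral_sub_right_eq_self (fun y => f (x + t • y)) x,
    ← lintegral_add_left_eq_self f x, ← smul_eq_mul, ← lintegral_smul_measure,
    ← Measure.map_addHaar_smul μ ht, lintegral_map (by fun_prop) (by fun_prop)]

/-- Averaging over all pairs in a convex set `Q` of a function at a point dividing the segment in
a fixed ratio `t`. One of `t`, `1 - t` is at least `1 / 2`, which bounds the Jacobian. -/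
theorem lintegral_lintegral_segment_le {Q : Set E} (hQ : Convex ℝ Q) (hQm : MeasurableSet Q)
    {t : ℝ} (ht0 : 0 ≤ t) (ht1 : t ≤ 1) [SFinite μ] {f : E → ℝ≥0∞} (hf : Measurable f) :
    ∫⁻ x in Q, ∫⁻ y in Q, f (x + t • (y - x)) ∂μ ∂μ ≤
      2 ^ Module.finrank ℝ E * μ Q * ∫⁻ y in Q, f y ∂μ := by
  have key : ∀ s : ℝ, 1 / 2 ≤ s → s ≤ 1 → ∀ x ∈ Q, ∫⁻ y in Q, f (x + s • (y - x)) ∂μ ≤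
      2 ^ Module.finrank ℝ E * ∫⁻ y in Q, f y ∂μ := by
    intro s hs hs1 x hx
    have hs0 : 0 < s := by linarith
    calc ∫⁻ y in Q, f (x + s • (y - x)) ∂μ
        ≤ ∫⁻ y in Q, Q.indicator f (x + s • (y - x)) ∂μ := by
          refine setLIntegral_mono' hQm fun y hy => ?_
          rw [Set.indicator_of_mem (hQ.add_smul_sub_mem hx hy ⟨hs0.le, hs1⟩)]
      _ ≤ ∫⁻ y, Q.indicator f (x + s • (y - x)) ∂μ := setLIntegral_le_lintegral _ _
      _ = ENNReal.ofReal |(s ^ Module.finrank ℝ E)⁻¹| * ∫⁻ y in Q, f y ∂μ := by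
          rw [lintegral_comp_homothety x hs0.ne' (hf.indicator hQm), lintegral_indicator hQm]
      _ ≤ 2 ^ Module.finrank ℝ E * ∫⁻ y in Q, f y ∂μ := by
          gcongr
          rw [abs_of_pos (by positivity), ← inv_pow, ENNReal.ofReal_pow (by positivity)]
          gcongr
          rw [show (2 : ℝ≥0∞) = ENNReal.ofReal 2 by simp]
          apply ENNReal.ofReal_le_ofReal
          rw [inv_le_comm₀ hs0 two_pos]
          linarith
  have key2 : ∀ s : ℝ, 1 / 2 ≤ s → s ≤ 1 → ∫⁻ x in Q, ∫⁻ y in Q, f (x + s • (y - x)) ∂μ ∂μ ≤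
      2 ^ Module.finrank ℝ E * μ Q * ∫⁻ y in Q, f y ∂μ := by
    intro s hs hs1
    refine (setLIntegral_mono' hQm (key s hs hs1)).trans ?_
    rw [setLIntegral_const, mul_right_comm]
  rcases le_total (1 / 2) t with h | h
  · exact key2 t h ht1
  · rw [lintegral_lintegral_swap (by fun_prop)]
    convert key2 (1 - t) (by linarith) (by linarith) using 6 with y x
    module

/-- The theorem of Rademacher on almost every segment starting at `x`: a homothety with centre `x`
pulls null sets back to null sets. -/
theorem ae_ae_differentiableAt_segment {u : E → ℝ} (hu : ∃ K, LipschitzWith K u) [SFinite μ]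
    (x : E) : ∀ᵐ y ∂μ, ∀ᵐ t : ℝ, DifferentiableAt ℝ u (x + t • (y - x)) := by
  obtain ⟨K, hK⟩ := hu
  have hm : MeasurableSet {z | DifferentiableAt ℝ u z} := measurableSet_of_differentiableAt ℝ u
  refine (Measure.ae_ae_comm ?_).mpr ?_
  · exact (show Measurable fun p : E × ℝ => x + p.2 • (p.1 - x) by fun_prop) hm
  · filter_upwards [(Measure.ae_ne volume (0 : ℝ))] with t ht
    have h := lintegral_comp_homothety (μ := μ) x ht
      (measurable_const.indicator hm.compl : Measurable
        ({z | DifferentiableAt ℝ u z}ᶜ.indicator fun _ => (1 : ℝ≥0∞)))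
    rw [lintegral_indicator hm.compl, setLIntegral_one,
      (show μ {z | DifferentiableAt ℝ u z}ᶜ = 0 from hK.ae_differentiableAt), mul_zero] at h
    have h0 := (lintegral_eq_zero_iff ((measurable_const.indicator hm.compl).comp
        (show Measurable fun y => x + t • (y - x) by fun_prop))).1 h
    filter_upwards [h0] with y hy
    by_contra hc
    simp [Set.indicator, hc] at hy

/-- The Poincaré inequality on a convex set, in its double integral form. -/
theorem poincare_convex {Q : Set E} (hQ : Convex ℝ Q) (hQm : MeasurableSet Q) [SFinite μ]
    {δ : ℝ≥0∞} (hδ : ∀ x ∈ Q, ∀ y ∈ Q, ‖y - x‖ₑ ≤ δ) {u : E → ℝ} (hu : ∃ K, LipschitzWith K u) :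
    ∫⁻ x in Q, ∫⁻ y in Q, ‖u x - u y‖ₑ ^ 2 ∂μ ∂μ ≤
      δ ^ 2 * (2 ^ Module.finrank ℝ E * μ Q * ∫⁻ y in Q, ‖fderiv ℝ u y‖ₑ ^ 2 ∂μ) := by
  have hm : Measurable fun z => ‖fderiv ℝ u z‖ₑ ^ 2 := (measurable_fderiv ℝ u).enorm.pow_const 2
  calc ∫⁻ x in Q, ∫⁻ y in Q, ‖u x - u y‖ₑ ^ 2 ∂μ ∂μ
      ≤ ∫⁻ x in Q, ∫⁻ y in Q, δ ^ 2 *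
          (∫⁻ t in Set.Ioc (0 : ℝ) 1, ‖fderiv ℝ u (x + t • (y - x))‖ₑ ^ 2) ∂μ ∂μ := by
        refine setLIntegral_mono' hQm fun x hx => setLIntegral_mono_ae' hQm ?_
        filter_upwards [ae_ae_differentiableAt_segment hu x] with y hy hyQ
        refine (enorm_sub_sq_le_lintegral hu hy).trans ?_
        gcongr
        exact hδ x hx y hyQ
    _ = δ ^ 2 * ∫⁻ t in Set.Ioc (0 : ℝ) 1, ∫⁻ x in Q, ∫⁻ y in Q,
          ‖fderiv ℝ u (x + t • (y - x))‖ₑ ^ 2 ∂μ ∂μ := by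
        have h3 : Measurable fun p : (E × E) × ℝ =>
            ‖fderiv ℝ u (p.1.1 + p.2 • (p.1.2 - p.1.1))‖ₑ ^ 2 := hm.comp (by fun_prop)
        have h4 : ∀ x, ∫⁻ y in Q, δ ^ 2 * (∫⁻ t in Set.Ioc (0 : ℝ) 1,
            ‖fderiv ℝ u (x + t • (y - x))‖ₑ ^ 2) ∂μ = δ ^ 2 * ∫⁻ t in Set.Ioc (0 : ℝ) 1,
              ∫⁻ y in Q, ‖fderiv ℝ u (x + t • (y - x))‖ₑ ^ 2 ∂μ := by
          intro x
          have h5 : Measurable fun p : E × ℝ => ‖fderiv ℝ u (x + p.2 • (p.1 - x))‖ₑ ^ 2 :=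
            hm.comp (by fun_prop)
          rw [lintegral_const_mul _ h5.lintegral_prod_right', lintegral_lintegral_swap]
          exact h5.aemeasurable
        simp_rw [h4]
        have h6 : Measurable fun p : E × ℝ =>
            ∫⁻ y in Q, ‖fderiv ℝ u (p.1 + p.2 • (y - p.1))‖ₑ ^ 2 ∂μ := by
          have h7 : Measurable fun p : (E × ℝ) × E =>
            ‖fderiv ℝ u (p.1.1 + p.1.2 • (p.2 - p.1.1))‖ₑ ^ 2 := hm.comp (by fun_prop)
          exact h7.lintegral_prod_right'
        rw [lintegral_const_mul _ h6.lintegral_prod_right', lintegral_lintegral_swap]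
        exact h6.aemeasurable
    _ ≤ δ ^ 2 * ∫⁻ t in Set.Ioc (0 : ℝ) 1,
          (2 ^ Module.finrank ℝ E * μ Q * ∫⁻ y in Q, ‖fderiv ℝ u y‖ₑ ^ 2 ∂μ) := by
        gcongr δ ^ 2 * ?_
        exact setLIntegral_mono' measurableSet_Ioc fun t ht =>
          lintegral_lintegral_segment_le hQ hQm ht.1.le ht.2 hm
    _ = _ := by simp

end Poincare

/-! ### Compactness of the form domain of the Gaussian cone -/

/-- An operator whose values are uniformly close to finite-dimensional subspaces is compact. -/
theorem isCompactOperator_of_approx {V H : Type*} [NormedAddCommGroup V] [InnerProductSpace ℝ V]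
    [NormedAddCommGroup H] [InnerProductSpace ℝ H] [CompleteSpace H] (π : V →L[ℝ] H)
    (h : ∀ ε : ℝ, 0 < ε → ∃ S : Submodule ℝ H, ∃ _ : FiniteDimensional ℝ S,
      ∀ v, ‖π v - S.starProjection (π v)‖ ≤ ε * ‖v‖) : IsCompactOperator π := by
  have hcl : π ∈ closure {f : V →L[ℝ] H | IsCompactOperator f} := by
    rw [Metric.mem_closure_iff]
    intro ε hε
    obtain ⟨S, _, hS⟩ := h (ε / 2) (half_pos hε)
    refine ⟨S.starProjection ∘L π, ?_, ?_⟩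
    · exact ((isCompactOperator_of_locallyCompactSpace_dom
        (S.orthogonalProjectionOnto)).clm_comp S.subtypeL).comp_clm π
    · rw [dist_eq_norm]
      refine (ContinuousLinearMap.opNorm_le_bound _ (half_pos hε).le fun v => ?_).trans_lt
        (half_lt_self hε)
      exact hS v
  rwa [isClosed_setOfPred_isCompactOperator.closure_eq] at hcl

section Compactness

variable {n : ℕ} {m : ℕ} {A : Matrix (Fin n) (Fin n) ℝ}

theorem gaussianMeasure_le (k : ℕ) : gaussianMeasure m A k ≤ coneMeasure m A := by
  refine (withDensity_mono (g := 1) (Eventually.of_forall fun ξ => ?_)).trans withDensity_one.le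
  simp only [Pi.one_apply, ENNReal.ofReal_le_one, Real.exp_le_one_iff]
  have : (0 : ℝ) ≤ k * ‖(ξ : EuclideanSpace ℝ (Fin n))‖ ^ 2 := by positivity
  linarith

theorem enorm_coneGrad (u : cone m A → ℝ) (ξ : cone m A) :
    ‖coneGrad u ξ‖ₑ = ‖fderiv ℝ (coneExt u) (ξ : EuclideanSpace ℝ (Fin n))‖ₑ := by
  rw [coneGrad, ← toDual_gradient, LinearIsometryEquiv.enorm_map]

theorem setLIntegral_coneMeasure {Q : Set (EuclideanSpace ℝ (Fin n))} (hQ : MeasurableSet Q)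
    (f : EuclideanSpace ℝ (Fin n) → ℝ≥0∞) :
    ∫⁻ ξ : cone m A in Subtype.val ⁻¹' Q, f ξ ∂(coneMeasure m A) =
      ∫⁻ y in Q ∩ cone m A, f y := by
  rw [← lintegral_indicator (measurable_subtype_coe hQ), ← setLIntegral_indicator hQ,
    ← lintegral_coneMeasure]
  rfl

theorem setLIntegral_coneMeasure_le {k : ℕ} {R : ℝ} {Q : Set (EuclideanSpace ℝ (Fin n))}
    (hQm : MeasurableSet Q) (hR : ∀ x ∈ Q, ‖x‖ ≤ R) (f : cone m A → ℝ≥0∞) :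
    ∫⁻ ξ in Subtype.val ⁻¹' Q, f ξ ∂(coneMeasure m A) ≤ ENNReal.ofReal (Real.exp (k * R ^ 2)) *
      ∫⁻ ξ in Subtype.val ⁻¹' Q, f ξ ∂(gaussianMeasure m A k) := by
  have hm := measurable_subtype_coe (p := (· ∈ cone m A)) hQm
  rw [← lintegral_indicator hm, ← lintegral_indicator hm, lintegral_gaussianMeasure,
    ← lintegral_const_mul' _ _ ENNReal.ofReal_ne_top]
  refine lintegral_mono fun ξ => ?_
  by_cases hξ : ξ ∈ (Subtype.val ⁻¹' Q : Set (cone m A))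
  · rw [Set.indicator_of_mem hξ, ← mul_assoc, ← ENNReal.ofReal_mul (Real.exp_pos _).le,
      gaussDensity, ← Real.exp_add]
    refine le_mul_of_one_le_left' ?_
    rw [ENNReal.one_le_ofReal, Real.one_le_exp_iff]
    have h1 := pow_le_pow_left₀ (norm_nonneg _) (hR _ hξ) 2
    have h2 : (0 : ℝ) ≤ k := k.cast_nonneg
    nlinarith
  · rw [Set.indicator_of_notMem hξ]
    exact zero_le

/-- The Poincaré inequality for the Gaussian measure on a bounded convex part of the cone; the
density is at least `exp (-k R²)` there. -/
theorem exists_poincare_cone (k : ℕ) {R : ℝ} {Q : Set (EuclideanSpace ℝ (Fin n))}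
    (hQ : Convex ℝ Q) (hQm : MeasurableSet Q) (hR : ∀ x ∈ Q, ‖x‖ ≤ R) {δ : ℝ≥0∞}
    (hδ : ∀ x ∈ Q, ∀ y ∈ Q, ‖y - x‖ₑ ≤ δ) {u : cone m A → ℝ} (hu : IsLip dist u) :
    ∃ c : ℝ, ∫⁻ ξ in Subtype.val ⁻¹' Q, ‖u ξ - c‖ₑ ^ 2 ∂(gaussianMeasure m A k) ≤
      δ ^ 2 * 2 ^ n * ENNReal.ofReal (Real.exp (k * R ^ 2)) *
        ∫⁻ ξ in Subtype.val ⁻¹' Q, ‖coneGrad u ξ‖ₑ ^ 2 ∂(gaussianMeasure m A k) := by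
  set Q' := Q ∩ cone m A with hQ'
  have hQm' : MeasurableSet Q' := hQm.inter (measurableSet_cone m A)
  have hL := lipschitzWith_lipExt (cone m A) (coneZeroExt u)
  change ∃ K, LipschitzWith K (coneExt u) at hL
  have hP := poincare_convex (μ := volume) (hQ.inter (convex_cone m A)) hQm' (δ := δ)
    (fun x hx y hy => hδ x hx.1 y hy.1) hL
  have hfin : volume Q' ≠ ⊤ := by
    refine ((measure_mono fun x hx => ?_).trans_lt
      (measure_closedBall_lt_top (x := (0 : EuclideanSpace ℝ (Fin n))) (r := R))).ne
    simpa using hR x hx.1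
  have hleft : ∀ c : ℝ, ∫⁻ ξ in Subtype.val ⁻¹' Q, ‖u ξ - c‖ₑ ^ 2 ∂(gaussianMeasure m A k) ≤
      ∫⁻ y in Q', ‖coneExt u y - c‖ₑ ^ 2 := by
    intro c
    rw [← setLIntegral_coneMeasure hQm]
    simp only [coneExt_coe hu]
    exact lintegral_mono' (Measure.restrict_mono le_rfl (gaussianMeasure_le k)) le_rfl
  have hright : ∫⁻ y in Q', ‖fderiv ℝ (coneExt u) y‖ₑ ^ 2 ≤
      ENNReal.ofReal (Real.exp (k * R ^ 2)) *
        ∫⁻ ξ in Subtype.val ⁻¹' Q, ‖coneGrad u ξ‖ₑ ^ 2 ∂(gaussianMeasure m A k) := by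
    rw [← setLIntegral_coneMeasure hQm]
    simp only [← enorm_coneGrad]
    exact setLIntegral_coneMeasure_le hQm hR _
  rcases eq_or_ne (volume Q') 0 with h0 | h0
  · refine ⟨0, (hleft 0).trans ?_⟩
    rw [setLIntegral_measure_zero _ _ h0]
    exact zero_le
  obtain ⟨K, hK⟩ := hL
  have hmeas : Measurable fun x : EuclideanSpace ℝ (Fin n) =>
      ∫⁻ y in Q', ‖coneExt u x - coneExt u y‖ₑ ^ 2 := by
    have hm2 : Measurable fun p : EuclideanSpace ℝ (Fin n) × EuclideanSpace ℝ (Fin n) =>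
        ‖coneExt u p.1 - coneExt u p.2‖ₑ ^ 2 :=
      (((hK.continuous.measurable.comp measurable_fst).sub
        (hK.continuous.measurable.comp measurable_snd)).enorm).pow_const 2
    exact hm2.lintegral_prod_right'
  -- the constant is the value of `u` at a point where the inner integral of the Poincaré
  -- inequality is at most its average
  obtain ⟨x, -, hx⟩ := exists_le_setLAverage h0 hfin hmeas.aemeasurable
  refine ⟨coneExt u x, (hleft _).trans ?_⟩
  calc ∫⁻ y in Q', ‖coneExt u y - coneExt u x‖ₑ ^ 2
      = ∫⁻ y in Q', ‖coneExt u x - coneExt u y‖ₑ ^ 2 := by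
        simp only [enorm_sub_rev]
    _ ≤ (δ ^ 2 * (2 ^ n * volume Q' * ∫⁻ y in Q', ‖fderiv ℝ (coneExt u) y‖ₑ ^ 2)) /
          volume Q' := by
        refine hx.trans ?_
        rw [setLAverage_eq]
        gcongr
        simpa using hP
    _ = δ ^ 2 * 2 ^ n * ∫⁻ y in Q', ‖fderiv ℝ (coneExt u) y‖ₑ ^ 2 := by
        rw [← mul_assoc, ← mul_assoc, mul_right_comm _ (volume Q'),
          ENNReal.mul_div_cancel_right h0 hfin]
    _ ≤ _ := by
        rw [mul_assoc (δ ^ 2 * 2 ^ n)]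
        gcongr

/-- The harmonic oscillator identity controls the part of `u` far from the origin. -/
theorem lintegral_far_le {k : ℕ} (hk : 0 < k) {u : cone m A → ℝ} (hu : IsLip dist u) {r : ℝ}
    (hr : ∀ ξ : cone m A, r ≤ ‖(ξ : EuclideanSpace ℝ (Fin n))‖ → u ξ = 0) {R : ℝ} (hR : 0 < R) :
    ∫⁻ ξ : cone m A in {ξ | R < ‖(ξ : EuclideanSpace ℝ (Fin n))‖}, ‖u ξ‖ₑ ^ 2
        ∂(gaussianMeasure m A k) ≤
      ENNReal.ofReal ((1 + k * n) / R ^ 2) *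
        ∫⁻ ξ, (‖coneGrad u ξ‖ₑ ^ 2 + ‖u ξ‖ₑ ^ 2) ∂(gaussianMeasure m A k) := by
  have hk1 : (1 : ℝ) ≤ k := by exact_mod_cast hk
  have hms : MeasurableSet {ξ : cone m A | R < ‖(ξ : EuclideanSpace ℝ (Fin n))‖} :=
    measurableSet_lt measurable_const (by fun_prop)
  calc ∫⁻ ξ : cone m A in {ξ | R < ‖(ξ : EuclideanSpace ℝ (Fin n))‖}, ‖u ξ‖ₑ ^ 2
        ∂(gaussianMeasure m A k)
      ≤ ∫⁻ ξ : cone m A in {ξ | R < ‖(ξ : EuclideanSpace ℝ (Fin n))‖},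
          ENNReal.ofReal (1 / R ^ 2) *
          ‖((k : ℝ) * u ξ) • (ξ : EuclideanSpace ℝ (Fin n))‖ₑ ^ 2 ∂(gaussianMeasure m A k) := by
        refine setLIntegral_mono' hms fun ξ hξ => ?_
        rw [enorm_sq_eq_ofReal, enorm_sq_eq_ofReal, ← ENNReal.ofReal_mul (by positivity)]
        apply ENNReal.ofReal_le_ofReal
        rw [norm_smul, norm_mul, Real.norm_natCast, mul_pow, mul_pow, one_div,
          le_inv_mul_iff₀ (by positivity)]
        have h1 : R ^ 2 ≤ ‖(ξ : EuclideanSpace ℝ (Fin n))‖ ^ 2 :=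
          pow_le_pow_left₀ hR.le (le_of_lt hξ) 2
        have h2 : (1 : ℝ) ≤ (k : ℝ) ^ 2 := one_le_pow₀ hk1
        calc R ^ 2 * ‖u ξ‖ ^ 2 = 1 * ‖u ξ‖ ^ 2 * R ^ 2 := by ring
          _ ≤ _ := by gcongr
    _ ≤ ∫⁻ ξ : cone m A, ENNReal.ofReal (1 / R ^ 2) *
          ‖((k : ℝ) * u ξ) • (ξ : EuclideanSpace ℝ (Fin n))‖ₑ ^ 2 ∂(gaussianMeasure m A k) :=
        setLIntegral_le_lintegral _ _
    _ ≤ ENNReal.ofReal (1 / R ^ 2) * ∫⁻ ξ, (‖coneGrad u ξ‖ₑ ^ 2 +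
          ENNReal.ofReal (k * n) * ‖u ξ‖ₑ ^ 2) ∂(gaussianMeasure m A k) := by
        rw [lintegral_const_mul' _ _ ENNReal.ofReal_ne_top, ← oscillator_identity hk hu hr]
        gcongr
        exact le_add_self
    _ ≤ ENNReal.ofReal (1 / R ^ 2) * ∫⁻ ξ, ENNReal.ofReal (1 + k * n) * (‖coneGrad u ξ‖ₑ ^ 2 +
          ‖u ξ‖ₑ ^ 2) ∂(gaussianMeasure m A k) := by
        gcongr with ξ
        rw [mul_add]
        gcongr
        · refine le_mul_of_one_le_left' ?_
          rw [ENNReal.one_le_ofReal]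
          have : (0 : ℝ) ≤ k * n := by positivity
          linarith
        · linarith
    _ = _ := by
        rw [lintegral_const_mul' _ _ ENNReal.ofReal_ne_top, ← mul_assoc,
          ← ENNReal.ofReal_mul (by positivity)]
        congr 2
        ring

/-- The part of the cell of size `δ` with index `z` that lies in the ball of radius `R`. -/
def gridCell (δ R : ℝ) (z : Fin n → ℤ) : Set (EuclideanSpace ℝ (Fin n)) :=
  {x | ‖x‖ ≤ R ∧ ∀ i, ⌊x i / δ⌋ = z i}

theorem convex_gridCell {δ : ℝ} (hδ : 0 < δ) (R : ℝ) (z : Fin n → ℤ) :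
    Convex ℝ (gridCell δ R z) := by
  have h : gridCell δ R z = Metric.closedBall 0 R ∩
      ⋂ i, (EuclideanSpace.proj (𝕜 := ℝ) i) ⁻¹' Set.Ico (δ * z i) (δ * (z i + 1)) := by
    ext x
    simp only [gridCell, Set.mem_ofPred_eq, Set.mem_inter_iff, mem_closedBall_zero_iff,
      Set.mem_iInter, Set.mem_preimage, Set.mem_Ico, Int.floor_eq_iff, PiLp.proj_apply]
    refine and_congr Iff.rfl (forall_congr' fun i => and_congr ?_ ?_)
    · rw [le_div_iff₀' hδ]
    · rw [div_lt_iff₀' hδ]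
  rw [h]
  exact (convex_closedBall 0 R).inter (convex_iInter fun i => (convex_Ico _ _).linear_preimage
    (EuclideanSpace.proj (𝕜 := ℝ) i).toLinearMap)

theorem measurableSet_gridCell (δ R : ℝ) (z : Fin n → ℤ) : MeasurableSet (gridCell δ R z) := by
  have h : gridCell δ R z = {x | ‖x‖ ≤ R} ∩ ⋂ i, {x | ⌊x i / δ⌋ = z i} := by
    ext x
    simp [gridCell]
  rw [h]
  refine (measurableSet_le measurable_norm measurable_const).inter
    (MeasurableSet.iInter fun i => ?_)
  exact (Int.measurable_floor.comp (show Measurable fun x : EuclideanSpace ℝ (Fin n) => x i / δ by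
    fun_prop)) (measurableSet_singleton (z i))

theorem enorm_sub_le_of_mem_gridCell {δ R : ℝ} (hδ : 0 < δ) {z : Fin n → ℤ}
    {x y : EuclideanSpace ℝ (Fin n)} (hx : x ∈ gridCell δ R z) (hy : y ∈ gridCell δ R z) :
    ‖y - x‖ₑ ≤ ENNReal.ofReal (n * δ) := by
  rw [← ofReal_norm]
  apply ENNReal.ofReal_le_ofReal
  have hi : ∀ i, |(y - x) i| ≤ δ := by
    intro i
    have h1 := Int.abs_sub_lt_one_of_floor_eq_floor ((hy.2 i).trans (hx.2 i).symm)
    rw [← sub_div, abs_div, abs_of_pos hδ, div_lt_one hδ] at h1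
    exact h1.le
  calc ‖y - x‖ = √(∑ i, ‖(y - x) i‖ ^ 2) := EuclideanSpace.norm_eq _
    _ ≤ √((n * δ) ^ 2) := by
        apply Real.sqrt_le_sqrt
        calc ∑ i, ‖(y - x) i‖ ^ 2 ≤ ∑ _i : Fin n, δ ^ 2 :=
              Finset.sum_le_sum fun i _ => pow_le_pow_left₀ (norm_nonneg _) (hi i) 2
          _ = n * δ ^ 2 := by simp
          _ ≤ (n * δ) ^ 2 := by
              rw [mul_pow]
              gcongr
              exact_mod_cast Nat.le_self_pow two_ne_zero n
    _ = n * δ := Real.sqrt_sq (by positivity)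

end Compactness

section GaussianSpectrum

variable {n : ℕ} {m : ℕ} {A : Matrix (Fin n) (Fin n) ℝ}

/-- The gradient of the Gaussian cone. -/
def gaussGradient (m : ℕ) (A : Matrix (Fin n) (Fin n) ℝ) (k : ℕ) :
    LipGradient dist (gaussianMeasure m A k) (EuclideanSpace ℝ (Fin n)) :=
  coneLipGradient (gaussianMeasure_absolutelyContinuous m A k)

/-- Lipschitz functions with bounded support are a core. -/
theorem mem_closure_core_gauss {k : ℕ}
    {w : WithLp 2 (Lp ℝ 2 (gaussianMeasure m A k) ×
      Lp (EuclideanSpace ℝ (Fin n)) 2 (gaussianMeasure m A k))}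
    (hw : w ∈ (gaussGradient m A k).closedGraph) :
    w ∈ closure {w | ∃ u, (gaussGradient m A k).IsGradOf w u ∧ ∃ R : ℝ, ∀ ξ : cone m A,
      R ≤ ‖(ξ : EuclideanSpace ℝ (Fin n))‖ → u ξ = 0} :=
  (gaussGradient m A k).mem_closure_core isLip_norm_cone (fun _ hu R => hu.exists_bound_cone R) hw

theorem WithLp_enorm_sq {V W : Type*} [NormedAddCommGroup V] [NormedAddCommGroup W]
    (w : WithLp 2 (V × W)) : ‖w‖ₑ ^ 2 = ‖w.fst‖ₑ ^ 2 + ‖w.snd‖ₑ ^ 2 := by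
  rw [enorm_sq_eq_ofReal, enorm_sq_eq_ofReal, enorm_sq_eq_ofReal, WithLp.prod_norm_sq_eq_of_L2,
    ENNReal.ofReal_add (by positivity) (by positivity)]

theorem LipGradient.IsGradOf.lintegral_eq {X F : Type*} [MeasurableSpace X] {d : X → X → ℝ}
    {ν : Measure X} [NormedAddCommGroup F] [InnerProductSpace ℝ F] {D : LipGradient d ν F}
    {w : WithLp 2 (Lp ℝ 2 ν × Lp F 2 ν)} {u : X → ℝ} (h : D.IsGradOf w u) :
    ∫⁻ x, ‖u x‖ₑ ^ 2 ∂ν = ‖w.fst‖ₑ ^ 2 ∧ ∫⁻ x, ‖D.grad u x‖ₑ ^ 2 ∂ν = ‖w.snd‖ₑ ^ 2 := by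
  rw [Lp_enorm_sq, Lp_enorm_sq]
  constructor
  · refine lintegral_congr_ae ?_
    filter_upwards [h.2.1] with x hx
    rw [hx]
  · refine lintegral_congr_ae ?_
    filter_upwards [h.2.2] with x hx
    rw [hx]

/-- The span of the indicator functions of the cells of size `δ` with indices in `Z`. -/
def gridSpan (k : ℕ) [IsFiniteMeasure (gaussianMeasure m A k)] (δ R : ℝ)
    (Z : Finset (Fin n → ℤ)) : Submodule ℝ (Lp ℝ 2 (gaussianMeasure m A k)) :=
  Submodule.span ℝ ((fun z => indicatorConstLp 2
    (measurable_subtype_coe (measurableSet_gridCell δ R z)) (measure_ne_top _ _) (1 : ℝ)) '' Z)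

instance (k : ℕ) [IsFiniteMeasure (gaussianMeasure m A k)] (δ R : ℝ) (Z : Finset (Fin n → ℤ)) :
    FiniteDimensional ℝ (gridSpan (m := m) (A := A) k δ R Z) :=
  FiniteDimensional.span_of_finite ℝ (Z.finite_toSet.image _)

/-- A function in the form domain is approximated by its constants of the Poincaré inequality on
the cells of a grid; outside the ball of radius `R` it is small by the oscillator identity. -/
theorem exists_gridSpan_near {k : ℕ} (hk : 0 < k) [IsFiniteMeasure (gaussianMeasure m A k)]
    {δ R : ℝ} (hδ : 0 < δ) (hR : 0 < R) {Z : Finset (Fin n → ℤ)}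
    (hZ : ∀ x : EuclideanSpace ℝ (Fin n), ‖x‖ ≤ R → (fun i => ⌊x i / δ⌋) ∈ Z)
    {w : WithLp 2 (Lp ℝ 2 (gaussianMeasure m A k) ×
      Lp (EuclideanSpace ℝ (Fin n)) 2 (gaussianMeasure m A k))} {u : cone m A → ℝ}
    (hw : (gaussGradient m A k).IsGradOf w u) {r : ℝ}
    (hr : ∀ ξ : cone m A, r ≤ ‖(ξ : EuclideanSpace ℝ (Fin n))‖ → u ξ = 0) :
    ∃ s ∈ gridSpan (m := m) (A := A) k δ R Z, ‖w.fst - s‖ₑ ^ 2 ≤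
      (ENNReal.ofReal (n * δ) ^ 2 * 2 ^ n * ENNReal.ofReal (Real.exp (k * R ^ 2)) +
        ENNReal.ofReal ((1 + k * n) / R ^ 2)) * ‖w‖ₑ ^ 2 := by
  have hu : IsLip dist u := hw.1
  choose c hc using fun z : Fin n → ℤ => exists_poincare_cone (m := m) (A := A) k
    (convex_gridCell hδ R z) (measurableSet_gridCell δ R z) (fun x hx => hx.1)
    (fun x hx y hy => enorm_sub_le_of_mem_gridCell hδ hx hy) hu
  have hmQ : ∀ z, MeasurableSet (Subtype.val ⁻¹' gridCell δ R z : Set (cone m A)) :=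
    fun z => measurable_subtype_coe (measurableSet_gridCell δ R z)
  let e : (Fin n → ℤ) → Lp ℝ 2 (gaussianMeasure m A k) := fun z => indicatorConstLp 2 (hmQ z) (measure_ne_top _ _) 1
  refine ⟨∑ z ∈ Z, c z • e z, Submodule.sum_mem _ fun z hz => Submodule.smul_mem _ _
    (Submodule.subset_span ⟨z, hz, rfl⟩), ?_⟩
  have hcell : ∀ {z z' : Fin n → ℤ} {ξ : cone m A}, ξ.1 ∈ gridCell δ R z →
      ξ.1 ∈ gridCell δ R z' → z = z' := fun h h' => funext fun i => (h.2 i).symm.trans (h'.2 i)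
  have hs : ∀ᵐ ξ ∂(gaussianMeasure m A k), (∑ z ∈ Z, c z • e z : Lp ℝ 2 (gaussianMeasure m A k)) ξ =
      ∑ z ∈ Z, c z * (Subtype.val ⁻¹' gridCell δ R z : Set (cone m A)).indicator 1 ξ := by
    have h1 : ∀ᵐ ξ ∂(gaussianMeasure m A k), ∀ z ∈ Z, (c z • e z : Lp ℝ 2 (gaussianMeasure m A k)) ξ =
        c z * (Subtype.val ⁻¹' gridCell δ R z : Set (cone m A)).indicator 1 ξ := by
      refine (Finset.eventually_all Z).2 fun z _ => ?_
      filter_upwards [Lp.coeFn_smul (c z) (e z),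
        indicatorConstLp_coeFn (p := 2) (hs := hmQ z) (hμs := measure_ne_top (gaussianMeasure m A k) _) (c := (1 : ℝ))]
        with ξ h2 h3
      rw [h2, Pi.smul_apply, h3, smul_eq_mul]
      rfl
    filter_upwards [h1, Lp.coeFn_finsetSum Z (fun z => c z • e z)] with ξ h2 h3
    rw [h3, Finset.sum_apply]
    exact Finset.sum_congr rfl h2
  set U : Set (cone m A) := ⋃ z ∈ Z, Subtype.val ⁻¹' gridCell δ R z with hU
  have hUm : MeasurableSet U := Finset.measurableSet_biUnion _ fun z _ => hmQ z
  have hdisj : Set.PairwiseDisjoint (Z : Set (Fin n → ℤ))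
      fun z => (Subtype.val ⁻¹' gridCell δ R z : Set (cone m A)) := by
    intro z _ z' _ hne
    refine Set.disjoint_left.2 fun ξ h h' => hne (hcell h h')
  have hfar : Uᶜ ⊆ {ξ : cone m A | R < ‖(ξ : EuclideanSpace ℝ (Fin n))‖} := by
    intro ξ hξ
    by_contra hle
    rw [Set.mem_ofPred_eq, not_lt] at hle
    exact hξ (Set.mem_biUnion (hZ ξ hle) ⟨hle, fun i => rfl⟩)
  have hval : ∀ z ∈ Z, ∀ ξ : cone m A, ξ.1 ∈ gridCell δ R z →
      ∑ z ∈ Z, c z * (Subtype.val ⁻¹' gridCell δ R z : Set (cone m A)).indicator 1 ξ = c z := by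
    intro z hz ξ hξ
    rw [Finset.sum_eq_single z]
    · rw [Set.indicator_of_mem (show ξ ∈ Subtype.val ⁻¹' gridCell δ R z from hξ), Pi.one_apply,
        mul_one]
    · intro z' _ hne
      rw [Set.indicator_of_notMem, mul_zero]
      exact fun h' => hne (hcell h' hξ)
    · exact fun h => absurd hz h
  have hval0 : ∀ ξ ∈ Uᶜ,
      ∑ z ∈ Z, c z * (Subtype.val ⁻¹' gridCell δ R z : Set (cone m A)).indicator 1 ξ = 0 := by
    intro ξ hξ
    refine Finset.sum_eq_zero fun z hz => ?_
    rw [Set.indicator_of_notMem, mul_zero]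
    exact fun h' => hξ (Set.mem_biUnion hz h')
  set C := ENNReal.ofReal (n * δ) ^ 2 * 2 ^ n * ENNReal.ofReal (Real.exp (k * R ^ 2))
  obtain ⟨hn1, hn2⟩ := hw.lintegral_eq
  have hw2 : ‖w‖ₑ ^ 2 = ∫⁻ ξ, (‖coneGrad u ξ‖ₑ ^ 2 + ‖u ξ‖ₑ ^ 2) ∂(gaussianMeasure m A k) := by
    rw [WithLp_enorm_sq, ← hn1, ← hn2, add_comm, ← lintegral_add_left]
    · rfl
    · exact (measurable_coneGrad u).enorm.pow_const 2
  -- split the square distance into the cells and the part outside the ball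
  calc ‖w.fst - ∑ z ∈ Z, c z • e z‖ₑ ^ 2
      = ∫⁻ ξ, ‖u ξ - ∑ z ∈ Z, c z *
          (Subtype.val ⁻¹' gridCell δ R z : Set (cone m A)).indicator 1 ξ‖ₑ ^ 2 ∂(gaussianMeasure m A k) := by
        rw [Lp_enorm_sq]
        refine lintegral_congr_ae ?_
        filter_upwards [hs, hw.2.1, Lp.coeFn_sub w.fst (∑ z ∈ Z, c z • e z)] with ξ h1 h2 h3
        rw [h3, Pi.sub_apply, h1, h2]
    _ = ∑ z ∈ Z, ∫⁻ ξ in Subtype.val ⁻¹' gridCell δ R z, ‖u ξ - c z‖ₑ ^ 2 ∂(gaussianMeasure m A k) +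
          ∫⁻ ξ in Uᶜ, ‖u ξ‖ₑ ^ 2 ∂(gaussianMeasure m A k) := by
        rw [← lintegral_add_compl _ hUm, hU, lintegral_biUnion_finset hdisj fun z _ => hmQ z]
        congr 1
        · refine Finset.sum_congr rfl fun z hz => setLIntegral_congr_fun (hmQ z) fun ξ hξ => ?_
          rw [hval z hz ξ hξ]
        · refine setLIntegral_congr_fun hUm.compl fun ξ hξ => ?_
          rw [hval0 ξ hξ, sub_zero]
    _ ≤ C * ∫⁻ ξ, ‖coneGrad u ξ‖ₑ ^ 2 ∂(gaussianMeasure m A k) +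
          ENNReal.ofReal ((1 + k * n) / R ^ 2) * ‖w‖ₑ ^ 2 := by
        gcongr
        · calc _ ≤ ∑ z ∈ Z, C * ∫⁻ ξ in Subtype.val ⁻¹' gridCell δ R z, ‖coneGrad u ξ‖ₑ ^ 2 ∂(gaussianMeasure m A k) :=
                Finset.sum_le_sum fun z _ => hc z
            _ = C * ∫⁻ ξ in U, ‖coneGrad u ξ‖ₑ ^ 2 ∂(gaussianMeasure m A k) := by
                rw [← Finset.mul_sum, hU, lintegral_biUnion_finset hdisj fun z _ => hmQ z]
            _ ≤ _ := by
                gcongr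
                exact Measure.restrict_le_self
        · rw [hw2]
          exact (lintegral_mono' (Measure.restrict_mono hfar le_rfl) le_rfl).trans
            (lintegral_far_le hk hu hr hR)
    _ ≤ (C + ENNReal.ofReal ((1 + k * n) / R ^ 2)) * ‖w‖ₑ ^ 2 := by
        rw [add_mul]
        gcongr
        rw [WithLp_enorm_sq, ← hn2]
        exact le_add_self

/-- The form domain of the Gaussian cone is compactly embedded in `L²`. -/
theorem isCompactOperator_proj_gauss {k : ℕ} (hk : 0 < k) :
    IsCompactOperator (gaussGradient m A k).proj := by
  have := isFiniteMeasure_gaussianMeasure (m := m) (A := A) hk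
  refine isCompactOperator_of_approx _ fun ε hε => ?_
  -- `R` makes the tail small; then `δ` makes the oscillation inside the ball small.
  obtain ⟨R, hR0, hR⟩ : ∃ R : ℝ, 0 < R ∧ (1 + k * n) / R ^ 2 ≤ ε ^ 2 / 2 := by
    have h1 : Tendsto (fun R : ℝ => (1 + k * n : ℝ) / R ^ 2) atTop (𝓝 0) :=
      tendsto_const_nhds.div_atTop (tendsto_pow_atTop two_ne_zero)
    have h2 : ∀ᶠ R : ℝ in atTop, (1 + k * n : ℝ) / R ^ 2 < ε ^ 2 / 2 :=
      h1.eventually (gt_mem_nhds (by positivity))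
    obtain ⟨R, h3, h4⟩ := (h2.and (eventually_gt_atTop 0)).exists
    exact ⟨R, h4, h3.le⟩
  obtain ⟨δ, hδ0, hδ⟩ : ∃ δ : ℝ, 0 < δ ∧
      (n * δ) ^ 2 * 2 ^ n * Real.exp (k * R ^ 2) ≤ ε ^ 2 / 2 := by
    have h1 : Tendsto (fun δ : ℝ => (n * δ) ^ 2 * 2 ^ n * Real.exp (k * R ^ 2)) (𝓝[>] 0)
        (𝓝 ((n * 0) ^ 2 * 2 ^ n * Real.exp (k * R ^ 2))) :=
      Tendsto.mono_left (Continuous.tendsto (by fun_prop) 0) nhdsWithin_le_nhds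
    have h2 := h1.eventually (gt_mem_nhds (show _ < ε ^ 2 / 2 by simp; positivity))
    obtain ⟨δ, h3, h4⟩ := (h2.and eventually_mem_nhdsWithin).exists
    exact ⟨δ, h4, h3.le⟩
  obtain ⟨N, hN⟩ := exists_nat_ge (R / δ + 1)
  let Z : Finset (Fin n → ℤ) := Fintype.piFinset fun _ => Finset.Icc (-(N : ℤ)) N
  have hZ : ∀ x : EuclideanSpace ℝ (Fin n), ‖x‖ ≤ R → (fun i => ⌊x i / δ⌋) ∈ Z := by
    intro x hx
    rw [Fintype.mem_piFinset]
    intro i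
    have h1 : |x i / δ| ≤ R / δ := by
      rw [abs_div, abs_of_pos hδ0]
      gcongr
      exact (PiLp.norm_apply_le x i).trans hx
    obtain ⟨h2, h3⟩ := abs_le.1 h1
    rw [Finset.mem_Icc]
    constructor
    · rw [Int.le_floor]
      push_cast
      linarith
    · have := Int.floor_le (x i / δ)
      exact_mod_cast (show (⌊x i / δ⌋ : ℝ) ≤ N by linarith)
  refine ⟨gridSpan k δ R Z, inferInstance, ?_⟩
  rintro ⟨w, hw⟩
  rw [LipGradient.proj_apply]
  change ‖w.fst - (gridSpan k δ R Z).starProjection w.fst‖ ≤ ε * ‖w‖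
  -- the estimate passes to limits, so it suffices to have it for functions with bounded support
  have hcl : IsClosed {w : WithLp 2 (Lp ℝ 2 (gaussianMeasure m A k) ×
      Lp (EuclideanSpace ℝ (Fin n)) 2 (gaussianMeasure m A k)) |
        ‖w.fst - (gridSpan k δ R Z).starProjection w.fst‖ ≤ ε * ‖w‖} := by
    have h1 : Continuous fun w : WithLp 2 (Lp ℝ 2 (gaussianMeasure m A k) ×
      Lp (EuclideanSpace ℝ (Fin n)) 2 (gaussianMeasure m A k)) => w.fst :=
      (WithLp.fstL 2 ℝ _ _).continuous
    exact isClosed_le (h1.sub ((ContinuousLinearMap.continuous _).comp h1)).norm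
      (continuous_const.mul continuous_norm)
  refine closure_minimal ?_ hcl (mem_closure_core_gauss hw)
  rintro w ⟨u, hu, r, hr⟩
  obtain ⟨s, hs, hle⟩ := exists_gridSpan_near hk hδ0 hR0 hZ hu hr
  have h1 : ‖w.fst - (gridSpan k δ R Z).starProjection w.fst‖ ≤ ‖w.fst - s‖ := by
    rw [Submodule.starProjection_minimal]
    exact ciInf_le ⟨0, Set.forall_mem_range.mpr fun _ => norm_nonneg _⟩ (⟨s, hs⟩ : gridSpan k δ R Z)
  refine h1.trans (abs_le_of_sq_le_sq' ?_ (by positivity)).2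
  rw [enorm_sq_eq_ofReal, enorm_sq_eq_ofReal, ← ENNReal.ofReal_pow (by positivity),
    show (2 : ℝ≥0∞) ^ n = ENNReal.ofReal (2 ^ n) by
      rw [ENNReal.ofReal_pow two_pos.le, ENNReal.ofReal_ofNat],
    ← ENNReal.ofReal_mul (by positivity), ← ENNReal.ofReal_mul (by positivity),
    ← ENNReal.ofReal_add (by positivity) (by positivity), ← ENNReal.ofReal_mul (by positivity),
    ENNReal.ofReal_le_ofReal_iff (by positivity)] at hle
  refine hle.trans ?_
  rw [mul_pow ε]
  exact mul_le_mul_of_nonneg_right (by linarith) (by positivity)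

/-- A Lipschitz function with bounded support belongs to the form domain. -/
theorem exists_isGradOf_gauss {k : ℕ} (hk : 0 < k) {φ : cone m A → ℝ} (hφ : IsLip dist φ) {R : ℝ}
    (hR : ∀ ξ : cone m A, R ≤ ‖(ξ : EuclideanSpace ℝ (Fin n))‖ → φ ξ = 0) :
    ∃ w, (gaussGradient m A k).IsGradOf w φ := by
  have := isFiniteMeasure_gaussianMeasure (m := m) (A := A) hk
  obtain ⟨⟨L, hL0, hL⟩, -⟩ := coneGrad_bound hφ hR
  obtain ⟨M, hM⟩ := exists_bound_of_support hφ hR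
  have hm1 : MemLp φ 2 (gaussianMeasure m A k) :=
    MemLp.of_bound hφ.continuous_of_dist.measurable.aestronglyMeasurable M (Eventually.of_forall hM)
  have hm2 : MemLp (coneGrad φ) 2 (gaussianMeasure m A k) :=
    MemLp.of_bound (measurable_coneGrad φ).aestronglyMeasurable L (Eventually.of_forall hL)
  obtain ⟨w, hw, -⟩ := (gaussGradient m A k).exists_isGradOf hφ hm1 hm2
  exact ⟨w, hw⟩

theorem isDense_gauss {k : ℕ} (hk : 0 < k) : (gaussGradient m A k).IsDense := by
  have := isFiniteMeasure_gaussianMeasure (m := m) (A := A) hk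
  intro f hf
  refine Lp_eq_zero_of_integral_lipschitz ⟨0, zero_mem_cone m A⟩ (fun R => measure_lt_top _ _) f ?_
  rintro φ ⟨K, hK⟩ ⟨R, hR⟩ h1
  have hφ : IsLip dist φ := ⟨K, fun x y => by rw [dist_comm]; exact hK.dist_le_mul y x⟩
  have hR' : ∀ ξ : cone m A, R ≤ ‖(ξ : EuclideanSpace ℝ (Fin n))‖ → φ ξ = 0 := fun ξ hξ =>
    hR ξ (by rwa [Subtype.dist_eq, dist_zero_right])
  obtain ⟨w, hw⟩ := exists_isGradOf_gauss hk hφ hR'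
  rw [← hf w ⟨φ, hw⟩, L2.inner_def]
  refine integral_congr_ae ?_
  filter_upwards [hw.2.1] with x hx
  rw [hx, Real.inner_apply]

/-- By the Poincaré inequality, the distance to the constants in `L²` of a ball is bounded by the
norm of the gradient. This passes to the closure. -/
theorem exists_const_on_ball_of_snd_eq_zero {k : ℕ} (hk : 0 < k)
    {w : WithLp 2 (Lp ℝ 2 (gaussianMeasure m A k) ×
      Lp (EuclideanSpace ℝ (Fin n)) 2 (gaussianMeasure m A k))}
    (hw : w ∈ (gaussGradient m A k).closedGraph) (h0 : w.snd = 0) (R : ℝ) :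
    ∃ c : ℝ, ∀ᵐ ξ : cone m A ∂(gaussianMeasure m A k),
      ‖(ξ : EuclideanSpace ℝ (Fin n))‖ ≤ R → w.fst ξ = c := by
  have := isFiniteMeasure_gaussianMeasure (m := m) (A := A) hk
  set B : Set (cone m A) := Subtype.val ⁻¹' Metric.closedBall 0 R with hB
  have hBm : MeasurableSet B := measurable_subtype_coe Metric.isClosed_closedBall.measurableSet
  let r := LpToLpRestrictCLM (cone m A) ℝ ℝ (gaussianMeasure m A k) 2 B
  let e : Lp ℝ 2 ((gaussianMeasure m A k).restrict B) :=
    indicatorConstLp 2 MeasurableSet.univ (measure_ne_top _ _) 1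
  have he : ∀ᵐ ξ ∂((gaussianMeasure m A k).restrict B), e ξ = 1 := by
    filter_upwards [indicatorConstLp_coeFn (p := 2) (hs := MeasurableSet.univ)
      (hμs := measure_ne_top ((gaussianMeasure m A k).restrict B) _) (c := (1 : ℝ))] with ξ hξ
    rw [hξ, Set.indicator_univ]
  set S : Submodule ℝ (Lp ℝ 2 ((gaussianMeasure m A k).restrict B)) := Submodule.span ℝ {e}
  set C : ℝ≥0∞ := ENNReal.ofReal (2 * R) ^ 2 * 2 ^ n * ENNReal.ofReal (Real.exp (k * R ^ 2))
    with hC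
  have hCtop : C ≠ ⊤ := by
    refine ENNReal.mul_ne_top (ENNReal.mul_ne_top ?_ ?_) ENNReal.ofReal_ne_top
    · exact ENNReal.pow_ne_top ENNReal.ofReal_ne_top
    · exact ENNReal.pow_ne_top ENNReal.ofNat_ne_top
  have hcl : IsClosed {w : WithLp 2 (Lp ℝ 2 (gaussianMeasure m A k) ×
      Lp (EuclideanSpace ℝ (Fin n)) 2 (gaussianMeasure m A k)) |
        ‖r w.fst - S.starProjection (r w.fst)‖ₑ ^ 2 ≤ C * ‖w.snd‖ₑ ^ 2} := by
    have h1 : Continuous fun w : WithLp 2 (Lp ℝ 2 (gaussianMeasure m A k) ×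
      Lp (EuclideanSpace ℝ (Fin n)) 2 (gaussianMeasure m A k)) => r w.fst :=
      r.continuous.comp (WithLp.fstL 2 ℝ _ _).continuous
    have h2 : Continuous fun w : WithLp 2 (Lp ℝ 2 (gaussianMeasure m A k) ×
      Lp (EuclideanSpace ℝ (Fin n)) 2 (gaussianMeasure m A k)) => w.snd :=
      (WithLp.sndL 2 ℝ _ _).continuous
    refine isClosed_le ?_ ?_
    · exact (ENNReal.continuous_pow 2).comp
        (continuous_enorm.comp (h1.sub ((ContinuousLinearMap.continuous _).comp h1)))
    · exact (ENNReal.continuous_const_mul hCtop).comp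
        ((ENNReal.continuous_pow 2).comp (continuous_enorm.comp h2))
  have hmem : ‖r w.fst - S.starProjection (r w.fst)‖ₑ ^ 2 ≤ C * ‖w.snd‖ₑ ^ 2 := by
    refine closure_minimal ?_ hcl hw
    rintro w ⟨u, hu⟩
    obtain ⟨c, hc⟩ := exists_poincare_cone (m := m) (A := A) k (convex_closedBall 0 R)
      Metric.isClosed_closedBall.measurableSet (R := R) (fun x hx => by simpa using hx)
      (δ := ENNReal.ofReal (2 * R)) (fun x hx y hy => by
        rw [← ofReal_norm]
        apply ENNReal.ofReal_le_ofReal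
        rw [mem_closedBall_zero_iff] at hx hy
        linarith [norm_sub_le y x]) hu.1
    have h1 : ‖r w.fst - S.starProjection (r w.fst)‖ ≤ ‖r w.fst - c • e‖ := by
      rw [Submodule.starProjection_minimal]
      exact ciInf_le ⟨0, Set.forall_mem_range.mpr fun _ => norm_nonneg _⟩
        (⟨c • e, Submodule.smul_mem _ _ (Submodule.mem_span_singleton_self e)⟩ : S)
    calc ‖r w.fst - S.starProjection (r w.fst)‖ₑ ^ 2 ≤ ‖r w.fst - c • e‖ₑ ^ 2 := by
          gcongr
          rw [← ofReal_norm, ← ofReal_norm]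
          exact ENNReal.ofReal_le_ofReal h1
      _ = ∫⁻ ξ in B, ‖u ξ - c‖ₑ ^ 2 ∂(gaussianMeasure m A k) := by
          rw [Lp_enorm_sq]
          refine lintegral_congr_ae ?_
          filter_upwards [ae_restrict_of_ae hu.2.1, Lp.coeFn_sub (r w.fst) (c • e),
            Lp.coeFn_smul c e, he, LpToLpRestrictCLM_coeFn ℝ B w.fst] with ξ a1 a2 a3 a4 a5
          rw [a2, Pi.sub_apply, a3, Pi.smul_apply, a4, a5, a1, smul_eq_mul, mul_one]
      _ ≤ C * ∫⁻ ξ in B, ‖coneGrad u ξ‖ₑ ^ 2 ∂(gaussianMeasure m A k) := hc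
      _ ≤ C * ‖w.snd‖ₑ ^ 2 := by
          gcongr
          rw [← hu.lintegral_eq.2]
          exact setLIntegral_le_lintegral _ _
  rw [h0, enorm_zero, zero_pow two_ne_zero, mul_zero, nonpos_iff_eq_zero, pow_eq_zero_iff two_ne_zero,
    enorm_eq_zero, sub_eq_zero] at hmem
  have hS : r w.fst ∈ S := by
    rw [hmem]
    exact Submodule.starProjection_apply_mem _ _
  obtain ⟨c, hc⟩ := Submodule.mem_span_singleton.1 hS
  refine ⟨c, ?_⟩
  have h3 : ∀ᵐ ξ ∂((gaussianMeasure m A k).restrict B), w.fst ξ = c := by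
    filter_upwards [LpToLpRestrictCLM_coeFn ℝ B w.fst, Lp.coeFn_smul c e, he] with ξ a1 a2 a3
    rw [← a1]
    change r w.fst ξ = c
    rw [← hc, a2, Pi.smul_apply, a3, smul_eq_mul, mul_one]
  rw [ae_restrict_iff' hBm] at h3
  filter_upwards [h3] with ξ h4 h5
  exact h4 (by simpa [hB] using h5)

/-- An element of the form domain with vanishing gradient is constant: it is constant on all
balls, which are convex. -/
theorem exists_const_of_snd_eq_zero (hA : A.PosDef) {k : ℕ} (hk : 0 < k)
    {w : WithLp 2 (Lp ℝ 2 (gaussianMeasure m A k) ×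
      Lp (EuclideanSpace ℝ (Fin n)) 2 (gaussianMeasure m A k))}
    (hw : w ∈ (gaussGradient m A k).closedGraph) (h0 : w.snd = 0) :
    ∃ c : ℝ, ∀ᵐ ξ ∂(gaussianMeasure m A k), w.fst ξ = c := by
  choose c hc using fun N : ℕ => exists_const_on_ball_of_snd_eq_zero hk hw h0 N
  have hne : gaussianMeasure m A k ≠ 0 := fun h =>
    coneMeasure_univ_ne_zero m A hA
      (Measure.absolutelyContinuous_zero_iff.1 (h ▸ coneMeasure_absolutelyContinuous m A k))
  obtain ⟨N₀, hN₀⟩ : ∃ N : ℕ, gaussianMeasure m A k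
      {ξ : cone m A | ‖(ξ : EuclideanSpace ℝ (Fin n))‖ ≤ N} ≠ 0 := by
    by_contra! hcon
    refine hne (Measure.measure_univ_eq_zero.1 ?_)
    rw [show (Set.univ : Set (cone m A)) =
      ⋃ N : ℕ, {ξ : cone m A | ‖(ξ : EuclideanSpace ℝ (Fin n))‖ ≤ N} from ?_]
    · exact measure_iUnion_null hcon
    · refine (Set.eq_univ_of_forall fun ξ => ?_).symm
      exact Set.mem_iUnion.2 (exists_nat_ge ‖(ξ : EuclideanSpace ℝ (Fin n))‖)
  refine ⟨c N₀, ?_⟩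
  have hall : ∀ᵐ ξ : cone m A ∂(gaussianMeasure m A k), ∀ N : ℕ,
      ‖(ξ : EuclideanSpace ℝ (Fin n))‖ ≤ N → w.fst ξ = c N := ae_all_iff.2 hc
  have hcN : ∀ N, N₀ ≤ N → c N = c N₀ := by
    intro N hN
    by_contra hcon
    refine hN₀ (measure_eq_zero_iff_ae_notMem.2 ?_)
    filter_upwards [hall] with ξ hbad h1
    refine hcon ?_
    have h2 : (N₀ : ℝ) ≤ N := by exact_mod_cast hN
    exact (hbad N (h1.trans h2)).symm.trans (hbad N₀ h1)
  filter_upwards [hall] with ξ hξ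
  obtain ⟨N, hN⟩ := exists_nat_ge ‖(ξ : EuclideanSpace ℝ (Fin n))‖
  have h1 : (N : ℝ) ≤ (max N N₀ : ℕ) := by exact_mod_cast le_max_left N N₀
  exact (hξ (max N N₀) (hN.trans h1)).trans (hcN _ (le_max_right _ _))

/-- The constant function `1`. -/
def gaussOne (m : ℕ) (A : Matrix (Fin n) (Fin n) ℝ) (k : ℕ)
    [IsFiniteMeasure (gaussianMeasure m A k)] : Lp ℝ 2 (gaussianMeasure m A k) :=
  (memLp_const (1 : ℝ)).toLp fun _ => (1 : ℝ)

theorem ae_gaussOne (k : ℕ) [IsFiniteMeasure (gaussianMeasure m A k)] :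
    ∀ᵐ ξ ∂(gaussianMeasure m A k), gaussOne m A k ξ = 1 := (memLp_const (1 : ℝ)).coeFn_toLp

theorem gaussOne_ne_zero (hA : A.PosDef) (k : ℕ) [IsFiniteMeasure (gaussianMeasure m A k)] :
    gaussOne m A k ≠ 0 := by
  intro h
  have h1 : ∀ᵐ _ξ : cone m A ∂(gaussianMeasure m A k), False := by
    filter_upwards [ae_gaussOne k, Lp.coeFn_zero ℝ 2 (gaussianMeasure m A k)] with ξ h1 h2
    rw [h, h2] at h1
    exact zero_ne_one h1
  have hne : gaussianMeasure m A k = 0 := by simpa [ae_eq_bot] using h1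
  exact coneMeasure_univ_ne_zero m A hA
    (Measure.absolutelyContinuous_zero_iff.1 (hne ▸ coneMeasure_absolutelyContinuous m A k))

theorem gaussOne_mem_closedGraph (k : ℕ) [IsFiniteMeasure (gaussianMeasure m A k)] :
    WithLp.toLp 2 (gaussOne m A k, 0) ∈ (gaussGradient m A k).closedGraph := by
  refine Submodule.le_topologicalClosure _ ⟨fun _ => 1, isLip_const (fun _ _ => dist_nonneg) 1,
    ae_gaussOne k, ?_⟩
  filter_upwards [Lp.coeFn_zero (EuclideanSpace ℝ (Fin n)) 2 (gaussianMeasure m A k),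
    (gaussianMeasure_absolutelyContinuous m A k).ae_le (ae_mem_interior m A)] with ξ h1 h2
  refine h1.trans (Eq.symm ?_)
  exact coneGrad_eq (isLip_const (fun _ _ => dist_nonneg) 1) h2 (g := fun _ => 1) (fun _ => rfl)
    (hasGradientAt_const _ _)

/-- Harmonic functions of the Gaussian cone have no energy, so they are constant. -/
theorem eigenspace_zero_gauss (hA : A.PosDef) {k : ℕ} (hk : 0 < k)
    [IsFiniteMeasure (gaussianMeasure m A k)] :
    eigenspace (ofResolvent (gaussGradient m A k).resolvent) 0 =
      Submodule.span ℝ {gaussOne m A k} := by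
  set D := gaussGradient m A k
  ext f
  rw [mem_eigenspace_ofResolvent (LipGradient.resolvent_injective (isDense_gauss hk)), zero_smul,
    add_zero, Submodule.mem_span_singleton]
  constructor
  · intro h
    -- `w` is the element of the form domain with `w.fst = f` and `‖w‖ = ‖f‖`.
    set w := ContinuousLinearMap.adjoint D.proj f with hw
    have h1 : w.1.fst = f := h
    have h2 : ‖w‖ ^ 2 = ‖f‖ ^ 2 := by
      rw [← real_inner_self_eq_norm_sq, ← real_inner_self_eq_norm_sq]
      nth_rewrite 2 [hw]
      rw [ContinuousLinearMap.adjoint_inner_right, LipGradient.proj_apply, h1]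
    have h3 : w.1.snd = 0 := by
      have h4 : ‖w‖ ^ 2 = ‖w.1.fst‖ ^ 2 + ‖w.1.snd‖ ^ 2 := WithLp.prod_norm_sq_eq_of_L2 w.1
      rw [h1, h2] at h4
      have h5 : ‖w.1.snd‖ ^ 2 = 0 := by linarith
      exact norm_eq_zero.1 (pow_eq_zero_iff two_ne_zero |>.1 h5)
    obtain ⟨c, hc⟩ := exists_const_of_snd_eq_zero hA hk w.2 h3
    refine ⟨c, Lp.ext ?_⟩
    filter_upwards [hc, Lp.coeFn_smul c (gaussOne m A k), ae_gaussOne k] with ξ a1 a2 a3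
    rw [a2, Pi.smul_apply, a3, smul_eq_mul, mul_one, ← a1, h1]
  · rintro ⟨c, rfl⟩
    rw [map_smul]
    congr 1
    -- conversely, the constant function `1` has the lift `(1, 0)`, which represents `⟨1, ·⟩`
    have h1 : ContinuousLinearMap.adjoint D.proj (gaussOne m A k) =
        ⟨_, gaussOne_mem_closedGraph k⟩ := by
      refine ext_inner_left ℝ fun v => ?_
      rw [ContinuousLinearMap.adjoint_inner_right, LipGradient.proj_apply]
      change _ = inner ℝ v.1 (WithLp.toLp 2 (gaussOne m A k, 0))
      rw [WithLp.prod_inner_apply]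
      simp
    rw [LipGradient.resolvent_apply, h1]
    rfl

theorem isCompactOperator_resolvent_gauss {k : ℕ} (hk : 0 < k) :
    IsCompactOperator (gaussGradient m A k).resolvent :=
  (isCompactOperator_proj_gauss hk).comp_clm _

end GaussianSpectrum

/-! ### The distance of the limit space -/

section LimitDistance

variable {n : ℕ} {l m : ℕ} {A : Matrix (Fin n) (Fin n) ℝ}

/-- The length of `∂/∂t` for `g_{l,∞}` at distance `ρ` from the origin. -/
def fiberScale (l : ℕ) (ρ : ℝ) : ℝ := ((l : ℝ) * √(1 + ρ ^ 2))⁻¹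

theorem fiberScale_pos (hl : 0 < l) (ρ : ℝ) : 0 < fiberScale l ρ := by
  have : (0 : ℝ) < l := by exact_mod_cast hl
  unfold fiberScale
  positivity

theorem fiberScale_anti (hl : 0 < l) {ρ ρ' : ℝ} (h0 : 0 ≤ ρ) (h : ρ ≤ ρ') :
    fiberScale l ρ' ≤ fiberScale l ρ := by
  have : (0 : ℝ) < l := by exact_mod_cast hl
  unfold fiberScale
  gcongr

theorem fiberScale_le_one (hl : 0 < l) (ρ : ℝ) : fiberScale l ρ ≤ 1 := by
  have h1 : (1 : ℝ) ≤ l := by exact_mod_cast hl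
  have h2 : 1 ≤ √(1 + ρ ^ 2) := Real.one_le_sqrt.2 (by nlinarith)
  exact inv_le_one_of_one_le₀ (one_le_mul_of_one_le_of_one_le h1 h2)

theorem continuous_fiberScale (hl : 0 < l) : Continuous (fiberScale l) := by
  have : (0 : ℝ) < l := by exact_mod_cast hl
  refine Continuous.inv₀ (by fun_prop) fun ρ => ?_
  positivity

theorem fiberScale_sq (l : ℕ) (ρ : ℝ) : fiberScale l ρ ^ 2 = ((l : ℝ) ^ 2 * (1 + ρ ^ 2))⁻¹ := by
  rw [fiberScale, inv_pow, mul_pow, Real.sq_sqrt (by positivity)]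

/-- The integrand of the length functional. -/
def curveSpeed (l : ℕ) (x : ℝ → EuclideanSpace ℝ (Fin n)) (θ : ℝ → ℝ) (τ : ℝ) : ℝ :=
  √((fiberScale l ‖x τ‖ * deriv θ τ) ^ 2 + ‖deriv x τ‖ ^ 2)

theorem curveLength_eq (l : ℕ) (x : ℝ → EuclideanSpace ℝ (Fin n)) (θ : ℝ → ℝ) :
    curveLength l x θ = ∫ τ in (0 : ℝ)..1, curveSpeed l x θ τ := by
  unfold curveLength curveSpeed
  congr 1
  ext τ
  rw [mul_pow, fiberScale_sq, div_eq_inv_mul]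

theorem continuous_curveSpeed (hl : 0 < l) {x : ℝ → EuclideanSpace ℝ (Fin n)} {θ : ℝ → ℝ}
    (hx : ContDiff ℝ 1 x) (hθ : ContDiff ℝ 1 θ) : Continuous (curveSpeed l x θ) := by
  have h1 := hx.continuous_deriv le_rfl
  have h2 := hθ.continuous_deriv le_rfl
  have h3 := (continuous_fiberScale hl).comp hx.continuous.norm
  exact (((h3.mul h2).pow 2).add (h1.norm.pow 2)).sqrt

theorem curveLength_nonneg (l : ℕ) (x : ℝ → EuclideanSpace ℝ (Fin n)) (θ : ℝ → ℝ) :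
    0 ≤ curveLength l x θ :=
  intervalIntegral.integral_nonneg zero_le_one fun _ _ => Real.sqrt_nonneg _

theorem norm_sub_le_curveLength (hl : 0 < l) {x : ℝ → EuclideanSpace ℝ (Fin n)} {θ : ℝ → ℝ}
    (hx : ContDiff ℝ 1 x) (hθ : ContDiff ℝ 1 θ) {σ τ : ℝ} (hσ : 0 ≤ σ) (hστ : σ ≤ τ)
    (hτ : τ ≤ 1) : ‖x τ - x σ‖ ≤ curveLength l x θ := by
  have hc := hx.continuous_deriv le_rfl
  have h1 : ∫ s in σ..τ, deriv x s = x τ - x σ :=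
    intervalIntegral.integral_deriv_eq_sub (fun s _ => (hx.differentiable one_ne_zero) s)
      (hc.intervalIntegrable _ _)
  rw [← h1, curveLength_eq]
  calc ‖∫ s in σ..τ, deriv x s‖ ≤ ∫ s in σ..τ, ‖deriv x s‖ :=
        intervalIntegral.norm_integral_le_integral_norm hστ
    _ ≤ ∫ s in σ..τ, curveSpeed l x θ s := by
        refine intervalIntegral.integral_mono_on hστ (hc.norm.intervalIntegrable _ _)
          ((continuous_curveSpeed hl hx hθ).intervalIntegrable _ _) fun s _ => ?_
        refine Real.le_sqrt_of_sq_le ?_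
        have := sq_nonneg (fiberScale l ‖x s‖ * deriv θ s)
        linarith
    _ ≤ ∫ s in (0 : ℝ)..1, curveSpeed l x θ s := by
        refine intervalIntegral.integral_mono_interval hσ hστ hτ
          (Eventually.of_forall fun s => Real.sqrt_nonneg _)
          ((continuous_curveSpeed hl hx hθ).intervalIntegrable _ _)

/-- In the ball of radius `M`, a curve is at least as long as for the product metric with the
factor `fiberScale l M`. -/
theorem sqrt_le_curveLength (hl : 0 < l) {x : ℝ → EuclideanSpace ℝ (Fin n)} {θ : ℝ → ℝ}
    (hx : ContDiff ℝ 1 x) (hθ : ContDiff ℝ 1 θ) {M : ℝ}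
    (hM : ∀ τ ∈ Set.Icc (0 : ℝ) 1, ‖x τ‖ ≤ M) :
    √((fiberScale l M * (θ 1 - θ 0)) ^ 2 + ‖x 1 - x 0‖ ^ 2) ≤ curveLength l x θ := by
  set c := fiberScale l M
  set a := c * (θ 1 - θ 0) with ha
  set v := x 1 - x 0 with hv
  set N := √(a ^ 2 + ‖v‖ ^ 2) with hN
  have hcx := hx.continuous_deriv le_rfl
  have hcθ := hθ.continuous_deriv le_rfl
  -- Pair the velocity with the displacement, which has the norm `N`, and use Cauchy-Schwarz.
  have h1 : ∫ τ in (0 : ℝ)..1, (a * (c * deriv θ τ) + inner ℝ v (deriv x τ)) = N ^ 2 := by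
    rw [intervalIntegral.integral_eq_sub_of_hasDerivAt
      (f := fun τ => a * (c * θ τ) + inner ℝ v (x τ))]
    · rw [hN, Real.sq_sqrt (by positivity), ← real_inner_self_eq_norm_sq]
      nth_rewrite 4 [hv]
      rw [inner_sub_right, sq]
      nth_rewrite 4 [ha]
      ring
    · intro τ _
      have h1 := ((hx.differentiable one_ne_zero) τ).hasDerivAt
      have h2 := ((hθ.differentiable one_ne_zero) τ).hasDerivAt
      have h3 := ((hasDerivAt_const τ v).inner ℝ h1)
      rw [inner_zero_left, add_zero] at h3
      exact ((h2.const_mul c).const_mul a).add h3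
    · exact Continuous.intervalIntegrable (by fun_prop) _ _
  have h2 : ∀ τ ∈ Set.Icc (0 : ℝ) 1, a * (c * deriv θ τ) + inner ℝ v (deriv x τ) ≤
      N * curveSpeed l x θ τ := by
    intro τ hτ
    have hle : c * |deriv θ τ| ≤ fiberScale l ‖x τ‖ * |deriv θ τ| :=
      mul_le_mul_of_nonneg_right (fiberScale_anti hl (norm_nonneg _) (hM τ hτ)) (abs_nonneg _)
    have hc0 : 0 < c := fiberScale_pos hl M
    set b := c * |deriv θ τ| with hb
    have hsp : √(b ^ 2 + ‖deriv x τ‖ ^ 2) ≤ curveSpeed l x θ τ := by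
      refine Real.sqrt_le_sqrt (add_le_add ?_ le_rfl)
      rw [← sq_abs (fiberScale l ‖x τ‖ * deriv θ τ), abs_mul, abs_of_pos (fiberScale_pos hl _)]
      exact pow_le_pow_left₀ (by positivity) hle 2
    refine le_trans ?_ (mul_le_mul_of_nonneg_left hsp (Real.sqrt_nonneg _))
    rw [← Real.sqrt_mul (by positivity)]
    refine Real.le_sqrt_of_sq_le ?_
    have h5 : |a * (c * deriv θ τ) + inner ℝ v (deriv x τ)| ≤ |a| * b + ‖v‖ * ‖deriv x τ‖ := by
      refine (abs_add_le _ _).trans (add_le_add ?_ (abs_real_inner_le_norm _ _))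
      rw [abs_mul a, abs_mul c (deriv θ τ), abs_of_pos hc0]
    have h6 := pow_le_pow_left₀ (abs_nonneg _) h5 2
    rw [sq_abs] at h6
    have h7 := sq_nonneg (|a| * ‖deriv x τ‖ - ‖v‖ * b)
    have h8 := sq_abs a
    nlinarith
  have h3 : N ^ 2 ≤ N * curveLength l x θ := by
    rw [← h1, curveLength_eq, ← intervalIntegral.integral_const_mul]
    exact intervalIntegral.integral_mono_on zero_le_one
      (Continuous.intervalIntegrable (by fun_prop) _ _)
      (((continuous_curveSpeed hl hx hθ).const_mul N).intervalIntegrable _ _) h2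
  rcases (Real.sqrt_nonneg (a ^ 2 + ‖v‖ ^ 2)).eq_or_lt with h0 | h0
  · rw [hN, ← h0]
    exact curveLength_nonneg l x θ
  · rw [sq] at h3
    exact le_of_mul_le_mul_left h3 h0

/-- The distance for the product metric whose circle factor is scaled by `fiberScale l ρ`. -/
def flatDist (l : ℕ) (ρ : ℝ) (p q : cone m A × S1) : ℝ :=
  √((fiberScale l ρ * ‖q.2 - p.2‖) ^ 2 +
    ‖(q.1 : EuclideanSpace ℝ (Fin n)) - (p.1 : EuclideanSpace ℝ (Fin n))‖ ^ 2)

theorem flatDist_le_mul {ρ ρ' κ : ℝ} (h1 : 1 ≤ κ) (h0 : 0 ≤ fiberScale l ρ)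
    (h : fiberScale l ρ ≤ κ * fiberScale l ρ') (p q : cone m A × S1) :
    flatDist l ρ p q ≤ κ * flatDist l ρ' p q := by
  have hκ : 0 ≤ κ := by linarith
  unfold flatDist
  rw [show κ * √((fiberScale l ρ' * ‖q.2 - p.2‖) ^ 2 + ‖(q.1 : EuclideanSpace ℝ (Fin n)) -
    (p.1 : EuclideanSpace ℝ (Fin n))‖ ^ 2) = √(κ ^ 2) * √((fiberScale l ρ' * ‖q.2 - p.2‖) ^ 2 +
    ‖(q.1 : EuclideanSpace ℝ (Fin n)) - (p.1 : EuclideanSpace ℝ (Fin n))‖ ^ 2) by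
      rw [Real.sqrt_sq hκ], ← Real.sqrt_mul (sq_nonneg κ), mul_add, ← mul_pow, ← mul_assoc]
  gcongr
  exact le_mul_of_one_le_left (by positivity) (one_le_pow₀ h1)

theorem exists_lift_norm (a : ℝ) (t s : S1) (ht : (a : S1) = t) :
    ∃ b : ℝ, (b : S1) = s ∧ |b - a| = ‖s - t‖ ∧ b - a ∈ Set.Ioc (-Real.pi) Real.pi := by
  obtain ⟨c, hc, hcs⟩ := (AddCircle.coe_image_Ioc_eq (2 * Real.pi) (-Real.pi)).symm ▸
    Set.mem_univ (s - t)
  have hc' : c ∈ Set.Ioc (-Real.pi) Real.pi := ⟨hc.1, hc.2.trans (by linarith)⟩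
  refine ⟨a + c, ?_, ?_, by simpa using hc'⟩
  · rw [AddCircle.coe_add, ht, hcs]
    abel
  · rw [add_sub_cancel_left, ← hcs, eq_comm, AddCircle.norm_coe_eq_abs_iff _ Real.two_pi_pos.ne',
      abs_of_pos Real.two_pi_pos, mul_div_cancel_left₀ _ two_ne_zero, abs_le]
    exact ⟨hc'.1.le, hc'.2⟩

theorem limitDist_nonneg (p q : cone m A × S1) : 0 ≤ limitDist l m A p q := by
  refine Real.sInf_nonneg ?_
  rintro _ ⟨x, θ, -, -, -, -, -, -, -, rfl⟩
  exact curveLength_nonneg _ _ _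

/-- Segments are curves in the convex cone, so their lengths bound the distance from above. -/
theorem limitDist_le_flatDist (hl : 0 < l) {p q : cone m A × S1} {ρ : ℝ} (h0 : 0 ≤ ρ)
    (hρ : ∀ τ ∈ Set.Icc (0 : ℝ) 1, ρ ≤ ‖(p.1 : EuclideanSpace ℝ (Fin n)) +
      τ • ((q.1 : EuclideanSpace ℝ (Fin n)) - (p.1 : EuclideanSpace ℝ (Fin n)))‖) :
    limitDist l m A p q ≤ flatDist l ρ p q := by
  obtain ⟨a, ha⟩ := QuotientAddGroup.mk_surjective p.2
  obtain ⟨b, hb, hab, -⟩ := exists_lift_norm a p.2 q.2 ha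
  let x : ℝ → EuclideanSpace ℝ (Fin n) := fun τ => (p.1 : EuclideanSpace ℝ (Fin n)) +
      τ • ((q.1 : EuclideanSpace ℝ (Fin n)) - (p.1 : EuclideanSpace ℝ (Fin n)))
  -- the lift `b` of the angle of `q` is the one closest to `a`
  let θ : ℝ → ℝ := fun τ => a + τ * (b - a)
  have hx : ContDiff ℝ 1 x := by fun_prop
  have hθ : ContDiff ℝ 1 θ := by fun_prop
  have hx' : ∀ τ, deriv x τ =
      (q.1 : EuclideanSpace ℝ (Fin n)) - (p.1 : EuclideanSpace ℝ (Fin n)) := fun τ => by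
    simpa [x] using (((hasDerivAt_id τ).smul_const ((q.1 : EuclideanSpace ℝ (Fin n)) -
      (p.1 : EuclideanSpace ℝ (Fin n)))).const_add (p.1 : EuclideanSpace ℝ (Fin n))).deriv
  have hθ' : ∀ τ, deriv θ τ = b - a := fun τ => by
    have h := ((hasDerivAt_id τ).mul_const (b - a)).const_add a
    rw [one_mul] at h
    exact h.deriv
  have hle : limitDist l m A p q ≤ curveLength l x θ := by
    refine csInf_le ⟨0, ?_⟩ ⟨x, θ, hx, hθ, ?_, ?_, ?_, ?_, ?_, rfl⟩
    · rintro _ ⟨x, θ, -, -, -, -, -, -, -, rfl⟩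
      exact curveLength_nonneg _ _ _
    · exact fun τ hτ => (convex_cone m A).add_smul_sub_mem p.1.2 q.1.2 hτ
    · simp [x]
    · simpa [θ] using ha
    · simp [x]
    · simpa [θ] using hb
  · rw [curveLength_eq] at hle
    refine hle.trans ?_
    calc ∫ τ in (0 : ℝ)..1, curveSpeed l x θ τ ≤ ∫ _τ in (0 : ℝ)..1, flatDist l ρ p q := by
          refine intervalIntegral.integral_mono_on zero_le_one
            ((continuous_curveSpeed hl hx hθ).intervalIntegrable _ _) (by simp) fun τ hτ => ?_
          unfold curveSpeed flatDist
          rw [hx', hθ', ← hab, mul_pow, mul_pow, sq_abs]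
          refine Real.sqrt_le_sqrt (add_le_add ?_ le_rfl)
          gcongr
          · exact (fiberScale_pos hl _).le
          · exact fiberScale_anti hl h0 (hρ τ hτ)
      _ = flatDist l ρ p q := by simp

theorem limitDist_le_flatDist_zero (hl : 0 < l) (p q : cone m A × S1) :
    limitDist l m A p q ≤ flatDist l 0 p q :=
  limitDist_le_flatDist hl le_rfl fun _ _ => norm_nonneg _

theorem le_limitDist {p q : cone m A × S1} {c : ℝ}
    (h : ∀ (x : ℝ → EuclideanSpace ℝ (Fin n)) (θ : ℝ → ℝ), ContDiff ℝ 1 x → ContDiff ℝ 1 θ →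
      x 0 = p.1 → x 1 = q.1 → ‖q.2 - p.2‖ ≤ |θ 1 - θ 0| → c ≤ curveLength l x θ) :
    c ≤ limitDist l m A p q := by
  refine le_csInf ?_ ?_
  · obtain ⟨a, ha⟩ := QuotientAddGroup.mk_surjective p.2
    obtain ⟨b, hb⟩ := QuotientAddGroup.mk_surjective q.2
    refine ⟨_, fun τ => (p.1 : EuclideanSpace ℝ (Fin n)) +
      τ • ((q.1 : EuclideanSpace ℝ (Fin n)) - (p.1 : EuclideanSpace ℝ (Fin n))),
      fun τ => a + τ * (b - a), by fun_prop, by fun_prop,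
      fun τ hτ => (convex_cone m A).add_smul_sub_mem p.1.2 q.1.2 hτ, by simp, by simpa using ha,
      by simp, by simpa using hb, rfl⟩
  · rintro _ ⟨x, θ, hx, hθ, -, h1, h2, h3, h4, rfl⟩
    refine h x θ hx hθ h1 h3 ?_
    rw [← h2, ← h4, ← AddCircle.coe_sub]
    exact QuotientAddGroup.norm_mk_le_norm

/-- A curve of length less than `r` stays in the ball of radius `‖p.1‖ + r`. -/
theorem min_flatDist_le_left (hl : 0 < l) (p q : cone m A × S1) (r : ℝ) :
    min r (flatDist l (‖(p.1 : EuclideanSpace ℝ (Fin n))‖ + r) p q) ≤ limitDist l m A p q := by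
  refine le_limitDist fun x θ hx hθ h1 h2 h3 => ?_
  rcases le_total r (curveLength l x θ) with h | h
  · exact (min_le_left _ _).trans h
  refine (min_le_right _ _).trans (le_trans ?_ (sqrt_le_curveLength hl hx hθ
    (M := ‖(p.1 : EuclideanSpace ℝ (Fin n))‖ + r) fun τ hτ => ?_))
  · unfold flatDist
    rw [h1, h2, mul_pow, mul_pow, ← sq_abs (θ 1 - θ 0)]
    gcongr
  · have h4 := norm_sub_le_curveLength hl hx hθ le_rfl hτ.1 hτ.2
    rw [h1] at h4
    linarith [norm_le_norm_add_norm_sub' (x τ) (p.1 : EuclideanSpace ℝ (Fin n))]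

theorem min_flatDist_le_right (hl : 0 < l) (p q : cone m A × S1) (r : ℝ) :
    min r (flatDist l (‖(q.1 : EuclideanSpace ℝ (Fin n))‖ + r) p q) ≤ limitDist l m A p q := by
  refine le_limitDist fun x θ hx hθ h1 h2 h3 => ?_
  rcases le_total r (curveLength l x θ) with h | h
  · exact (min_le_left _ _).trans h
  refine (min_le_right _ _).trans (le_trans ?_ (sqrt_le_curveLength hl hx hθ
    (M := ‖(q.1 : EuclideanSpace ℝ (Fin n))‖ + r) fun τ hτ => ?_))
  · unfold flatDist
    rw [h1, h2, mul_pow, mul_pow, ← sq_abs (θ 1 - θ 0)]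
    gcongr
  · have h4 := norm_sub_le_curveLength hl hx hθ hτ.1 hτ.2 le_rfl
    rw [h2, norm_sub_rev] at h4
    linarith [norm_le_norm_add_norm_sub' (x τ) (q.1 : EuclideanSpace ℝ (Fin n))]

theorem dist_eq_max_norm (p q : cone m A × S1) : dist p q =
    max ‖(q.1 : EuclideanSpace ℝ (Fin n)) - (p.1 : EuclideanSpace ℝ (Fin n))‖ ‖q.2 - p.2‖ := by
  rw [dist_comm, Prod.dist_eq, Subtype.dist_eq, dist_eq_norm, dist_eq_norm]

theorem flatDist_le_dist (hl : 0 < l) (ρ : ℝ) (p q : cone m A × S1) :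
    flatDist l ρ p q ≤ 2 * dist p q := by
  rw [dist_eq_max_norm]
  set a := ‖(q.1 : EuclideanSpace ℝ (Fin n)) - (p.1 : EuclideanSpace ℝ (Fin n))‖
  set b := ‖q.2 - p.2‖
  have ha : a ≤ max a b := le_max_left _ _
  have hb : b ≤ max a b := le_max_right _ _
  have h2 : fiberScale l ρ * b ≤ max a b :=
    (mul_le_of_le_one_left (norm_nonneg _) (fiberScale_le_one hl ρ)).trans hb
  have h0 : 0 ≤ max a b := (norm_nonneg _).trans ha
  refine (Real.sqrt_le_sqrt (y := (2 * max a b) ^ 2) ?_).trans_eq (Real.sqrt_sq (by positivity))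
  have h3 : (fiberScale l ρ * b) ^ 2 ≤ max a b ^ 2 :=
    pow_le_pow_left₀ (mul_nonneg (fiberScale_pos hl ρ).le (norm_nonneg _)) h2 2
  have h4 : a ^ 2 ≤ max a b ^ 2 := pow_le_pow_left₀ (norm_nonneg _) ha 2
  nlinarith

theorem mul_dist_le_flatDist (hl : 0 < l) (ρ : ℝ) (p q : cone m A × S1) :
    fiberScale l ρ * dist p q ≤ flatDist l ρ p q := by
  rw [dist_eq_max_norm, mul_max_of_nonneg _ _ (fiberScale_pos hl ρ).le]
  refine max_le ?_ ?_
  · refine (mul_le_of_le_one_left (norm_nonneg _) (fiberScale_le_one hl ρ)).trans ?_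
    refine Real.le_sqrt_of_sq_le ?_
    have := sq_nonneg (fiberScale l ρ * ‖q.2 - p.2‖)
    linarith
  · refine Real.le_sqrt_of_sq_le ?_
    have := sq_nonneg ‖(q.1 : EuclideanSpace ℝ (Fin n)) - (p.1 : EuclideanSpace ℝ (Fin n))‖
    linarith

theorem IsLip.dist_of_limitDist (hl : 0 < l) {u : cone m A × S1 → ℝ}
    (hu : IsLip (limitDist l m A) u) : IsLip dist u := by
  obtain ⟨K, hK0, hK⟩ := hu.exists_nonneg limitDist_nonneg
  refine ⟨K * 2, fun p q => (hK p q).trans ?_⟩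
  rw [mul_assoc]
  gcongr
  exact (limitDist_le_flatDist_zero hl p q).trans (flatDist_le_dist hl 0 p q)

/-- A bounded function with bounded support which is Lipschitz for the product distance is
Lipschitz for the limit distance: the distances are comparable near the support. -/
theorem IsLip.limitDist_of_dist (hl : 0 < l) {u : cone m A × S1 → ℝ} (hu : IsLip dist u) {M R : ℝ}
    (hM : ∀ p, |u p| ≤ M)
    (hR : ∀ p, R ≤ ‖(p.1 : EuclideanSpace ℝ (Fin n))‖ → u p = 0) :
    IsLip (limitDist l m A) u := by
  obtain ⟨K, hK0, hK⟩ := hu.exists_nonneg fun _ _ => dist_nonneg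
  set c := fiberScale l (max R 0 + 1) with hc
  have hc0 : 0 < c := fiberScale_pos hl _
  -- a curve starting or ending in the support either leaves the ball of radius `R + 1`, and then
  -- has length at least `1`, or stays in it, where `c` compares the metrics
  have hmin : ∀ p q : cone m A × S1, u p ≠ 0 ∨ u q ≠ 0 →
      min 1 (c * dist p q) ≤ limitDist l m A p q := by
    have hle : ∀ s : ℝ, 0 ≤ s → s ≤ R → ∀ p q : cone m A × S1,
        c * dist p q ≤ flatDist l (s + 1) p q := fun s hs0 hs p q =>
      (mul_le_mul_of_nonneg_right (fiberScale_anti hl (by linarith)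
        (by linarith [le_max_left R 0])) dist_nonneg).trans (mul_dist_le_flatDist hl _ p q)
    intro p q h
    rcases h with h | h
    · have h1 : ‖(p.1 : EuclideanSpace ℝ (Fin n))‖ ≤ R := by
        by_contra! hcon
        exact h (hR p hcon.le)
      exact (min_le_min_left 1 (hle _ (norm_nonneg _) h1 p q)).trans (min_flatDist_le_left hl p q 1)
    · have h1 : ‖(q.1 : EuclideanSpace ℝ (Fin n))‖ ≤ R := by
        by_contra! hcon
        exact h (hR q hcon.le)
      exact (min_le_min_left 1 (hle _ (norm_nonneg _) h1 p q)).trans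
        (min_flatDist_le_right hl p q 1)
  have hM0 : 0 ≤ M := (abs_nonneg _).trans (hM (⟨0, zero_mem_cone m A⟩, 0))
  refine ⟨2 * M + K / c, fun p q => ?_⟩
  by_cases h : u p ≠ 0 ∨ u q ≠ 0
  · refine le_trans ?_ (mul_le_mul_of_nonneg_left (hmin p q h) (by positivity))
    rcases le_total 1 (c * dist p q) with h1 | h1
    · rw [min_eq_left h1, mul_one]
      have h2 : |u q - u p| ≤ |u q| + |u p| := abs_sub _ _
      have h3 : 0 ≤ K / c := by positivity
      linarith [hM p, hM q]
    · rw [min_eq_right h1, add_mul]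
      have h2 : K / c * (c * dist p q) = K * dist p q := by field_simp
      rw [h2]
      have h3 : 0 ≤ 2 * M * (c * dist p q) := by positivity
      linarith [hK p q]
  · push Not at h
    rw [h.1, h.2, sub_zero, abs_zero]
    exact mul_nonneg (by positivity) (limitDist_nonneg p q)

theorem isLip_norm_fst (hl : 0 < l) :
    IsLip (limitDist l m A) fun p => ‖(p.1 : EuclideanSpace ℝ (Fin n))‖ := by
  refine ⟨1, fun p q => ?_⟩
  rw [one_mul]
  refine (abs_norm_sub_norm_le _ _).trans (le_limitDist fun x θ hx hθ h1 h2 _ => ?_)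
  rw [← h1, ← h2]
  exact norm_sub_le_curveLength hl hx hθ le_rfl zero_le_one le_rfl

theorem IsLip.exists_bound_limit (hl : 0 < l) {u : cone m A × S1 → ℝ}
    (hu : IsLip (limitDist l m A) u) (R : ℝ) :
    ∃ M, ∀ p, ‖(p.1 : EuclideanSpace ℝ (Fin n))‖ ≤ R → |u p| ≤ M := by
  obtain ⟨K, hK0, hK⟩ := (hu.dist_of_limitDist hl).exists_nonneg fun _ _ => dist_nonneg
  let o : cone m A × S1 := (⟨0, zero_mem_cone m A⟩, 0)
  refine ⟨|u o| + K * (max R Real.pi), fun p hp => ?_⟩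
  have h1 := hK o p
  have h2 : dist o p ≤ max R Real.pi := by
    rw [dist_eq_max_norm]
    refine max_le_max (by simpa [o] using hp) ?_
    have := AddCircle.norm_le_half_period (2 * Real.pi) (x := p.2 - o.2) Real.two_pi_pos.ne'
    rwa [abs_of_pos Real.two_pi_pos, mul_div_cancel_left₀ _ two_ne_zero] at this
  have h3 : |u p| ≤ |u o| + |u p - u o| := by
    have := abs_add_le (u o) (u p - u o)
    simpa using this
  have h4 := mul_le_mul_of_nonneg_left h2 hK0
  linarith

/-- Infinitesimally, the distance is at least the product distance. -/
theorem eventually_flatDist_le (hl : 0 < l) (p : cone m A × S1) {ε : ℝ} (hε : 0 < ε) :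
    ∀ᶠ q in comap (limitDist l m A p) (𝓝[>] 0),
      flatDist l ‖(p.1 : EuclideanSpace ℝ (Fin n))‖ p q ≤ (1 + ε) * limitDist l m A p q := by
  set a := ‖(p.1 : EuclideanSpace ℝ (Fin n))‖
  have h1 : Tendsto (fun r : ℝ => (1 + ε) * fiberScale l (a + r)) (𝓝[>] 0)
      (𝓝 ((1 + ε) * fiberScale l (a + 0))) :=
    Tendsto.mono_left (((continuous_fiberScale hl).comp
      (continuous_const.add continuous_id)).const_mul (1 + ε)).continuousAt nhdsWithin_le_nhds
  have h2 : fiberScale l a < (1 + ε) * fiberScale l (a + 0) := by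
    rw [add_zero]
    have := fiberScale_pos hl a
    nlinarith
  obtain ⟨r, h3, hr : 0 < r⟩ :=
    ((h1.eventually (lt_mem_nhds h2)).and eventually_mem_nhdsWithin).exists
  have h4 : ∀ᶠ q in comap (limitDist l m A p) (𝓝[>] 0), limitDist l m A p q < r :=
    tendsto_comap.eventually (nhdsWithin_le_nhds (gt_mem_nhds hr))
  filter_upwards [h4] with q hq
  have h5 : flatDist l (a + r) p q ≤ limitDist l m A p q := by
    rcases min_le_iff.1 (min_flatDist_le_left hl p q r) with h | h
    · exact absurd h (not_le.2 hq)
    · exact h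
  refine (flatDist_le_mul (by linarith) (fiberScale_pos hl a).le h3.le p q).trans ?_
  gcongr

/-- Infinitesimally, the distance is at most the product distance. -/
theorem exists_limitDist_le (hl : 0 < l) (p : cone m A × S1) {ε : ℝ} (hε : 0 < ε) :
    ∃ r > 0, ∀ q : cone m A × S1,
      ‖(q.1 : EuclideanSpace ℝ (Fin n)) - (p.1 : EuclideanSpace ℝ (Fin n))‖ < r →
      limitDist l m A p q ≤ (1 + ε) * flatDist l ‖(p.1 : EuclideanSpace ℝ (Fin n))‖ p q := by
  set a := ‖(p.1 : EuclideanSpace ℝ (Fin n))‖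
  have h1 : Tendsto (fun r : ℝ => fiberScale l (max 0 (a - r))) (𝓝[>] 0)
      (𝓝 (fiberScale l (max 0 (a - 0)))) :=
    Tendsto.mono_left ((continuous_fiberScale hl).comp
      (continuous_const.max (continuous_const.sub continuous_id))).continuousAt nhdsWithin_le_nhds
  have h2 : fiberScale l (max 0 (a - 0)) < (1 + ε) * fiberScale l a := by
    rw [sub_zero, max_eq_right (norm_nonneg _)]
    have := fiberScale_pos hl a
    nlinarith
  obtain ⟨r, h3, hr : 0 < r⟩ :=
    ((h1.eventually (gt_mem_nhds h2)).and eventually_mem_nhdsWithin).exists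
  refine ⟨r, hr, fun q hq => ?_⟩
  refine (limitDist_le_flatDist hl (le_max_left 0 (a - r)) fun τ hτ => ?_).trans
    (flatDist_le_mul (by linarith) (fiberScale_pos hl _).le h3.le p q)
  refine max_le (norm_nonneg _) ?_
  have h4 : ‖τ • ((q.1 : EuclideanSpace ℝ (Fin n)) - (p.1 : EuclideanSpace ℝ (Fin n)))‖ ≤ r := by
    rw [norm_smul, Real.norm_of_nonneg hτ.1]
    exact (mul_le_of_le_one_left (norm_nonneg _) hτ.2).trans hq.le
  have h5 := norm_sub_le_norm_add (p.1 : EuclideanSpace ℝ (Fin n))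
    (τ • ((q.1 : EuclideanSpace ℝ (Fin n)) - (p.1 : EuclideanSpace ℝ (Fin n))))
  linarith

end LimitDistance

/-! ### The gradient on the limit space -/

/-- The representative of a point of the circle in `(-π, π]`. -/
def circleRep (t : S1) : ℝ := (AddCircle.equivIoc (2 * Real.pi) (-Real.pi) t : ℝ)

theorem coe_circleRep (t : S1) : ((circleRep t : ℝ) : S1) = t := AddCircle.coe_equivIoc

theorem circleRep_mem (t : S1) : circleRep t ∈ Set.Ioc (-Real.pi) Real.pi := by
  have h := (AddCircle.equivIoc (2 * Real.pi) (-Real.pi) t).2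
  exact ⟨h.1, h.2.trans (by linarith)⟩

theorem circleRep_coe {x : ℝ} (hx : x ∈ Set.Ioc (-Real.pi) Real.pi) :
    circleRep (x : S1) = x :=
  AddCircle.equivIoc_coe_of_mem ⟨hx.1, hx.2.trans (by linarith)⟩

theorem abs_circleRep (t : S1) : |circleRep t| = ‖t‖ := by
  have h := circleRep_mem t
  nth_rewrite 2 [← coe_circleRep t]
  rw [eq_comm, AddCircle.norm_coe_eq_abs_iff _ Real.two_pi_pos.ne', abs_of_pos Real.two_pi_pos,
    mul_div_cancel_left₀ _ two_ne_zero, abs_le]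
  exact ⟨h.1.le, h.2⟩

theorem measurePreserving_circleRep : MeasurePreserving circleRep volume
    (volume.restrict (Set.Ioc (-Real.pi) (-Real.pi + 2 * Real.pi))) := by
  have h := AddCircle.measurePreserving_equivIoc (T := 2 * Real.pi) (a := -Real.pi)
  refine (⟨measurable_subtype_coe, ?_⟩ : MeasurePreserving Subtype.val _ _).comp h
  exact (MeasurableEmbedding.subtype_coe measurableSet_Ioc).map_comap volume |>.trans
    (by rw [Subtype.range_coe])

section LimitGradient

variable {n : ℕ} {l m : ℕ} {A : Matrix (Fin n) (Fin n) ℝ}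

/-- The lift of a point of `C_m(A) × S¹` to `ℝⁿ × ℝ`. -/
def liftPoint (p : cone m A × S1) : EuclideanSpace ℝ (Fin n) × ℝ := (p.1, circleRep p.2)

theorem measurable_liftPoint : Measurable (liftPoint : cone m A × S1 → _) :=
  (measurable_subtype_coe.comp measurable_fst).prodMk
    (measurePreserving_circleRep.measurable.comp measurable_snd)

theorem ae_liftPoint {P : EuclideanSpace ℝ (Fin n) × ℝ → Prop} (h : ∀ᵐ z, P z) :
    ∀ᵐ p ∂(limitMeasure m A), P (liftPoint p) := by
  have h1 : MeasurePreserving (Subtype.val : cone m A → EuclideanSpace ℝ (Fin n))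
      (coneMeasure m A) (volume.restrict (cone m A)) := by
    refine ⟨measurable_subtype_coe, ?_⟩
    rw [coneMeasure, (MeasurableEmbedding.subtype_coe (measurableSet_cone m A)).map_comap,
      Subtype.range_coe]
  have h2 := h1.prod measurePreserving_circleRep
  rw [Measure.prod_restrict] at h2
  exact h2.quasiMeasurePreserving.ae (ae_restrict_of_ae h)

theorem ae_fst_mem_interior : ∀ᵐ p ∂(limitMeasure m A),
    (p.1 : EuclideanSpace ℝ (Fin n)) ∈ interior (cone m A) :=
  Measure.quasiMeasurePreserving_fst.ae (ae_mem_interior m A)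

open Classical in
/-- The lift of a function on `C_m(A) × S¹`, extended by zero. -/
def limitLift (u : cone m A × S1 → ℝ) (z : EuclideanSpace ℝ (Fin n) × ℝ) : ℝ :=
  if h : z.1 ∈ cone m A then u (⟨z.1, h⟩, (z.2 : S1)) else 0

theorem limitLift_coe (u : cone m A × S1 → ℝ) (ξ : cone m A) (t : ℝ) :
    limitLift u (ξ, t) = u (ξ, (t : S1)) := by
  rw [limitLift, dif_pos ξ.2]

/-- A Lipschitz extension to `ℝⁿ × ℝ` of the lift of a Lipschitz function on `C_m(A) × S¹`. -/
def limitExt (u : cone m A × S1 → ℝ) : EuclideanSpace ℝ (Fin n) × ℝ → ℝ :=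
  lipExt (cone m A ×ˢ Set.univ) (limitLift u)

theorem limitExt_coe {u : cone m A × S1 → ℝ} (hu : IsLip dist u) (ξ : cone m A) (t : ℝ) :
    limitExt u (ξ, t) = u (ξ, (t : S1)) := by
  rw [limitExt, lipExt_eq _ (Set.mk_mem_prod ξ.2 (Set.mem_univ _)), limitLift_coe]
  obtain ⟨K, hK0, hK⟩ := hu.exists_nonneg fun _ _ => dist_nonneg
  refine ⟨⟨K, hK0⟩, LipschitzOnWith.of_dist_le_mul ?_⟩
  rintro ⟨x, s⟩ ⟨hx, -⟩ ⟨y, t⟩ ⟨hy, -⟩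
  have h1 := limitLift_coe u ⟨x, hx⟩ s
  have h2 := limitLift_coe u ⟨y, hy⟩ t
  dsimp only at h1 h2
  rw [h1, h2, dist_comm, Real.dist_eq]
  refine (hK _ _).trans (mul_le_mul_of_nonneg_left ?_ hK0)
  rw [Prod.dist_eq, Prod.dist_eq]
  refine max_le_max le_rfl ?_
  rw [dist_eq_norm, ← AddCircle.coe_sub, dist_eq_norm]
  exact QuotientAddGroup.norm_mk_le_norm

theorem limitExt_liftPoint {u : cone m A × S1 → ℝ} (hu : IsLip dist u) (p : cone m A × S1) :
    limitExt u (liftPoint p) = u p := by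
  rw [liftPoint, limitExt_coe hu, coe_circleRep]

/-- The derivative of the lift of `u`. -/
def limitDeriv (u : cone m A × S1 → ℝ) (p : cone m A × S1) :
    EuclideanSpace ℝ (Fin n) × ℝ →L[ℝ] ℝ :=
  fderiv ℝ (limitExt u) (liftPoint p)

theorem measurable_limitDeriv (u : cone m A × S1 → ℝ) : Measurable (limitDeriv u) :=
  (measurable_fderiv ℝ (limitExt u)).comp measurable_liftPoint

theorem ae_hasFDerivAt_limit (u : cone m A × S1 → ℝ) : ∀ᵐ p ∂(limitMeasure m A),
    (p.1 : EuclideanSpace ℝ (Fin n)) ∈ interior (cone m A) ∧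
      HasFDerivAt (limitExt u) (limitDeriv u p) (liftPoint p) := by
  refine ae_fst_mem_interior.and ?_
  obtain ⟨K, hK⟩ := lipschitzWith_lipExt (cone m A ×ˢ Set.univ) (limitLift u)
  exact ae_liftPoint (P := fun z => HasFDerivAt (limitExt u) (fderiv ℝ (limitExt u) z) z)
    ((hK.ae_differentiableAt (μ := (volume : Measure (EuclideanSpace ℝ (Fin n))).prod
      (volume : Measure ℝ))).mono fun z hz => hz.hasFDerivAt)

theorem limitDeriv_eq_of_eventually {u : cone m A × S1 → ℝ} (hu : IsLip dist u)
    {p : cone m A × S1} (hp : (p.1 : EuclideanSpace ℝ (Fin n)) ∈ interior (cone m A))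
    {g : EuclideanSpace ℝ (Fin n) × ℝ → ℝ} {L : EuclideanSpace ℝ (Fin n) × ℝ →L[ℝ] ℝ}
    (hg : ∀ᶠ z in 𝓝 (liftPoint p), ∀ hz : z.1 ∈ cone m A, g z = u (⟨z.1, hz⟩, (z.2 : S1)))
    (hL : HasFDerivAt g L (liftPoint p)) : limitDeriv u p = L := by
  refine HasFDerivAt.fderiv (hL.congr_of_eventuallyEq ?_)
  have h1 : ∀ᶠ z : EuclideanSpace ℝ (Fin n) × ℝ in 𝓝 (liftPoint p), z.1 ∈ cone m A :=
    continuous_fst.continuousAt.eventually (mem_interior_iff_mem_nhds.1 hp)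
  filter_upwards [h1, hg] with z hz h2
  rw [h2 hz, ← limitExt_coe hu ⟨z.1, hz⟩ z.2]

theorem limitDeriv_eq {u : cone m A × S1 → ℝ} (hu : IsLip dist u) {p : cone m A × S1}
    (hp : (p.1 : EuclideanSpace ℝ (Fin n)) ∈ interior (cone m A))
    {g : EuclideanSpace ℝ (Fin n) × ℝ → ℝ} {L : EuclideanSpace ℝ (Fin n) × ℝ →L[ℝ] ℝ}
    (hg : ∀ (ξ : cone m A) (t : ℝ), g (ξ, t) = u (ξ, (t : S1)))
    (hL : HasFDerivAt g L (liftPoint p)) : limitDeriv u p = L :=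
  limitDeriv_eq_of_eventually hu hp (Eventually.of_forall fun z hz => hg ⟨z.1, hz⟩ z.2) hL

/-- The `ξ`-component of a covector, as a vector. -/
def vecPart (L : EuclideanSpace ℝ (Fin n) × ℝ →L[ℝ] ℝ) : EuclideanSpace ℝ (Fin n) :=
  (InnerProductSpace.toDual ℝ (EuclideanSpace ℝ (Fin n))).symm
    (L.comp (ContinuousLinearMap.inl ℝ (EuclideanSpace ℝ (Fin n)) ℝ))

theorem inner_vecPart (L : EuclideanSpace ℝ (Fin n) × ℝ →L[ℝ] ℝ) (v : EuclideanSpace ℝ (Fin n)) :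
    inner ℝ (vecPart L) v = L (v, 0) := by
  rw [vecPart, InnerProductSpace.toDual_symm_apply]
  rfl

theorem vecPart_add (L L' : EuclideanSpace ℝ (Fin n) × ℝ →L[ℝ] ℝ) :
    vecPart (L + L') = vecPart L + vecPart L' :=
  ext_inner_right ℝ fun v => by
    rw [inner_add_left, inner_vecPart, inner_vecPart, inner_vecPart]
    rfl

theorem vecPart_smul (c : ℝ) (L : EuclideanSpace ℝ (Fin n) × ℝ →L[ℝ] ℝ) :
    vecPart (c • L) = c • vecPart L :=
  ext_inner_right ℝ fun v => by
    rw [real_inner_smul_left, inner_vecPart, inner_vecPart]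
    rfl

theorem continuous_vecPart :
    Continuous (vecPart : (EuclideanSpace ℝ (Fin n) × ℝ →L[ℝ] ℝ) → EuclideanSpace ℝ (Fin n)) :=
  (LinearIsometryEquiv.continuous _).comp
    ((ContinuousLinearMap.compL ℝ _ _ ℝ).flip
      (ContinuousLinearMap.inl ℝ (EuclideanSpace ℝ (Fin n)) ℝ)).continuous

/-- The coordinates of the vector dual to a covector, in an orthonormal frame for `g_{l,∞}` at
distance `ρ` from the origin. -/
def limitSharp (l : ℕ) (ρ : ℝ) (L : EuclideanSpace ℝ (Fin n) × ℝ →L[ℝ] ℝ) :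
    WithLp 2 (EuclideanSpace ℝ (Fin n) × ℝ) :=
  WithLp.toLp 2 (vecPart L, (fiberScale l ρ)⁻¹ * L (0, 1))

theorem limitSharp_add (ρ : ℝ) (L L' : EuclideanSpace ℝ (Fin n) × ℝ →L[ℝ] ℝ) :
    limitSharp l ρ (L + L') = limitSharp l ρ L + limitSharp l ρ L' := by
  simp only [limitSharp, vecPart_add, add_apply, mul_add]
  rfl

theorem limitSharp_smul (ρ c : ℝ) (L : EuclideanSpace ℝ (Fin n) × ℝ →L[ℝ] ℝ) :
    limitSharp l ρ (c • L) = c • limitSharp l ρ L := by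
  simp only [limitSharp, vecPart_smul, smul_apply, smul_eq_mul,
    mul_left_comm _ c]
  rfl

theorem enorm_sq_limitSharp (ρ : ℝ) (L : EuclideanSpace ℝ (Fin n) × ℝ →L[ℝ] ℝ) :
    ‖limitSharp l ρ L‖ₑ ^ 2 = ‖vecPart L‖ₑ ^ 2 + ‖(fiberScale l ρ)⁻¹ * L (0, 1)‖ₑ ^ 2 :=
  WithLp_enorm_sq _

/-- The gradient of a function on the limit space, in an orthonormal frame. -/
def limitGrad (l : ℕ) (u : cone m A × S1 → ℝ) (p : cone m A × S1) :
    WithLp 2 (EuclideanSpace ℝ (Fin n) × ℝ) :=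
  limitSharp l ‖(p.1 : EuclideanSpace ℝ (Fin n))‖ (limitDeriv u p)

theorem measurable_limitGrad (hl : 0 < l) (u : cone m A × S1 → ℝ) :
    Measurable (limitGrad l u) := by
  have h1 : Measurable fun p => vecPart (limitDeriv u p) :=
    continuous_vecPart.measurable.comp (measurable_limitDeriv u)
  have h2 : Measurable fun p : cone m A × S1 =>
      (fiberScale l ‖(p.1 : EuclideanSpace ℝ (Fin n))‖)⁻¹ :=
    ((continuous_fiberScale hl).measurable.comp
      (measurable_norm.comp (measurable_subtype_coe.comp measurable_fst))).inv
  have h3 : Measurable fun p => limitDeriv u p (0, 1) :=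
    (ContinuousLinearMap.measurable_apply _).comp (measurable_limitDeriv u)
  exact (WithLp.measurable_toLp 2 _).comp (h1.prodMk (h2.mul h3))

end LimitGradient

section LimitSlope

variable {n : ℕ} {l m : ℕ} {A : Matrix (Fin n) (Fin n) ℝ}

/-- Coordinates near `p` which are isometric at `p` to first order. -/
def limitChart (l : ℕ) (p q : cone m A × S1) : WithLp 2 (EuclideanSpace ℝ (Fin n) × ℝ) :=
  WithLp.toLp 2 ((q.1 : EuclideanSpace ℝ (Fin n)) - (p.1 : EuclideanSpace ℝ (Fin n)),
    fiberScale l ‖(p.1 : EuclideanSpace ℝ (Fin n))‖ * circleRep (q.2 - p.2))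

theorem norm_limitChart (p q : cone m A × S1) :
    ‖limitChart l p q‖ = flatDist l ‖(p.1 : EuclideanSpace ℝ (Fin n))‖ p q := by
  rw [WithLp.prod_norm_eq_of_L2, flatDist, add_comm]
  congr 2
  rw [limitChart, Real.norm_eq_abs, sq_abs]
  change (fiberScale l _ * circleRep (q.2 - p.2)) ^ 2 = _
  rw [mul_pow, mul_pow, ← abs_circleRep, sq_abs]

theorem inner_limitSharp_limitChart (hl : 0 < l) (p q : cone m A × S1)
    (L : EuclideanSpace ℝ (Fin n) × ℝ →L[ℝ] ℝ) :
    inner ℝ (limitSharp l ‖(p.1 : EuclideanSpace ℝ (Fin n))‖ L) (limitChart l p q) =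
      L ((q.1 : EuclideanSpace ℝ (Fin n)) - (p.1 : EuclideanSpace ℝ (Fin n)),
        circleRep (q.2 - p.2)) := by
  have h0 := (fiberScale_pos hl ‖(p.1 : EuclideanSpace ℝ (Fin n))‖).ne'
  rw [WithLp.prod_inner_apply]
  simp only [limitSharp, limitChart]
  rw [inner_vecPart, Real.inner_apply]
  have h1 : L ((q.1 : EuclideanSpace ℝ (Fin n)) - (p.1 : EuclideanSpace ℝ (Fin n)),
      circleRep (q.2 - p.2)) = L ((q.1 : EuclideanSpace ℝ (Fin n)) -
        (p.1 : EuclideanSpace ℝ (Fin n)), 0) + L (circleRep (q.2 - p.2) • (0, 1)) := by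
    rw [← map_add]
    simp
  rw [h1, map_smul, smul_eq_mul]
  field_simp

theorem limitDist_pos (hl : 0 < l) {p q : cone m A × S1} {ρ : ℝ} (h : 0 < flatDist l ρ p q) :
    0 < limitDist l m A p q := by
  have h0 : 0 < dist p q := by
    have := flatDist_le_dist hl ρ p q
    linarith
  have h1 := mul_dist_le_flatDist hl (‖(p.1 : EuclideanSpace ℝ (Fin n))‖ + 1) p q
  have h2 := mul_pos (fiberScale_pos hl (‖(p.1 : EuclideanSpace ℝ (Fin n))‖ + 1)) h0
  exact (lt_min one_pos (h2.trans_le h1)).trans_le (min_flatDist_le_left hl p q 1)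

/-- At a point of differentiability over the interior of the cone, the local Lipschitz constant is
the norm of the Riemannian gradient. The chart of `localLip_eq_of_chart` is the displacement,
measured in the metric at `p`. -/
theorem localLip_limit (hl : 0 < l) {u : cone m A × S1 → ℝ} (hu : IsLip dist u)
    {p : cone m A × S1} (hp : (p.1 : EuclideanSpace ℝ (Fin n)) ∈ interior (cone m A))
    (hd : HasFDerivAt (limitExt u) (limitDeriv u p) (liftPoint p)) :
    localLip (limitDist l m A) u p = ‖limitGrad l u p‖ₑ := by
  classical
  set ρ := ‖(p.1 : EuclideanSpace ℝ (Fin n))‖ with hρ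
  have hs0 := fiberScale_pos hl ρ
  set a := limitGrad l u p with ha
  -- the displacement in the lift
  let h : cone m A × S1 → EuclideanSpace ℝ (Fin n) × ℝ := fun q =>
    ((q.1 : EuclideanSpace ℝ (Fin n)) - (p.1 : EuclideanSpace ℝ (Fin n)), circleRep (q.2 - p.2))
  have hext : ∀ q, limitExt u (liftPoint p + h q) = u q := by
    intro q
    have h1 : liftPoint p + h q = ((q.1 : EuclideanSpace ℝ (Fin n)),
        circleRep p.2 + circleRep (q.2 - p.2)) := by
      simp [liftPoint, h]
    rw [h1, limitExt_coe hu, AddCircle.coe_add, coe_circleRep, coe_circleRep]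
    simp
  have hnorm : ∀ q, ‖h q‖ = dist p q := by
    intro q
    rw [dist_eq_max_norm, Prod.norm_def, Real.norm_eq_abs, abs_circleRep]
  -- points in the direction of the gradient, as for the cone
  let y : ℝ → cone m A × S1 := fun s =>
    if hh : (p.1 : EuclideanSpace ℝ (Fin n)) + s • a.fst ∈ cone m A then
      (⟨_, hh⟩, p.2 + ((s * ((fiberScale l ρ)⁻¹ * a.snd) : ℝ) : S1)) else p
  have hy : ∀ᶠ s in 𝓝[>] (0 : ℝ), limitChart l p (y s) = s • a := by
    have hc : Tendsto (fun s : ℝ => (p.1 : EuclideanSpace ℝ (Fin n)) + s • a.fst) (𝓝 0)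
        (𝓝 p.1) := by
      have : Tendsto (fun s : ℝ => (p.1 : EuclideanSpace ℝ (Fin n)) + s • a.fst) (𝓝 0)
        (𝓝 ((p.1 : EuclideanSpace ℝ (Fin n)) + (0 : ℝ) • a.fst)) :=
        Continuous.tendsto (by fun_prop) 0
      simpa using this
    have hc2 : Tendsto (fun s : ℝ => s * ((fiberScale l ρ)⁻¹ * a.snd)) (𝓝 0) (𝓝 0) := by
      have : Tendsto (fun s : ℝ => s * ((fiberScale l ρ)⁻¹ * a.snd)) (𝓝 0)
        (𝓝 (0 * ((fiberScale l ρ)⁻¹ * a.snd))) := Continuous.tendsto (by fun_prop) 0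
      simpa using this
    have hpi : Set.Ioo (-Real.pi) Real.pi ∈ 𝓝 (0 : ℝ) :=
      Ioo_mem_nhds (by linarith [Real.pi_pos]) Real.pi_pos
    filter_upwards [nhdsWithin_le_nhds (hc.eventually (mem_interior_iff_mem_nhds.1 hp)),
      nhdsWithin_le_nhds (hc2.eventually hpi)] with s hs hs2
    have hs' : (p.1 : EuclideanSpace ℝ (Fin n)) + s • a.fst ∈ cone m A := hs
    simp only [y]
    rw [dif_pos hs', limitChart]
    simp only [add_sub_cancel_left]
    rw [circleRep_coe ⟨hs2.1, hs2.2.le⟩]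
    have h3 : fiberScale l ρ * (s * ((fiberScale l ρ)⁻¹ * a.snd)) = s * a.snd := by
      field_simp
    rw [← hρ, h3]
    rfl
  refine localLip_eq_of_chart (limitChart l p) a y ?_ ?_ hy ?_
  · intro ε hε
    set c := fiberScale l ρ
    have h1 := (hasFDerivAt_iff_isLittleO_nhds_zero.1 hd).def (show 0 < ε * c / 2 by positivity)
    have hbd : ∀ᶠ q in comap (limitDist l m A p) (𝓝[>] 0),
        ‖h q‖ ≤ 2 / c * limitDist l m A p q := by
      filter_upwards [eventually_flatDist_le hl p one_pos] with q hq
      rw [hnorm, div_mul_eq_mul_div, le_div_iff₀ hs0, mul_comm]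
      refine (mul_dist_le_flatDist hl ρ p q).trans (hq.trans_eq ?_)
      ring
    have h2 : Tendsto h (comap (limitDist l m A p) (𝓝[>] 0)) (𝓝 0) := by
      rw [tendsto_zero_iff_norm_tendsto_zero]
      have h3 : Tendsto (fun q => 2 / c * limitDist l m A p q)
          (comap (limitDist l m A p) (𝓝[>] 0)) (𝓝 (2 / c * 0)) :=
        (tendsto_comap.mono_right nhdsWithin_le_nhds).const_mul _
      rw [mul_zero] at h3
      exact tendsto_of_tendsto_of_tendsto_of_le_of_le' tendsto_const_nhds h3
        (Eventually.of_forall fun q => norm_nonneg _) hbd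
    filter_upwards [h2.eventually h1, hbd] with q hq1 hq2
    rw [hext, limitExt_liftPoint hu] at hq1
    rw [ha, limitGrad, inner_limitSharp_limitChart hl]
    refine le_trans hq1 ?_
    calc ε * c / 2 * ‖h q‖ ≤ ε * c / 2 * (2 / c * limitDist l m A p q) := by gcongr
      _ = ε * limitDist l m A p q := by field_simp
  · intro ε hε
    filter_upwards [eventually_flatDist_le hl p hε] with q hq
    rwa [norm_limitChart]
  · intro ha0 ε hε
    obtain ⟨r, hr0, hr⟩ := exists_limitDist_le hl p hε
    have hsm : ∀ᶠ s in 𝓝[>] (0 : ℝ), s * ‖a‖ < r := by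
      have : Tendsto (fun s : ℝ => s * ‖a‖) (𝓝 0) (𝓝 (0 * ‖a‖)) :=
        Continuous.tendsto (by fun_prop) 0
      rw [zero_mul] at this
      exact nhdsWithin_le_nhds (this.eventually (gt_mem_nhds hr0))
    filter_upwards [hy, eventually_mem_nhdsWithin, hsm] with s hs hs0 hs1
    have hs0' : 0 < s := hs0
    have h2 : flatDist l ρ p (y s) = s * ‖a‖ := by
      rw [← norm_limitChart, hs, norm_smul, Real.norm_of_nonneg hs0'.le]
    have h3 : 0 < s * ‖a‖ := mul_pos hs0' (norm_pos_iff.2 ha0)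
    refine ⟨limitDist_pos hl (h2 ▸ h3), ?_⟩
    rw [← h2]
    refine hr _ (lt_of_le_of_lt ?_ hs1)
    rw [← h2]
    refine Real.le_sqrt_of_sq_le ?_
    have := sq_nonneg (fiberScale l ρ * ‖(y s).2 - p.2‖)
    linarith

/-- The gradient of the limit space. -/
def limitGradient (hl : 0 < l) (m : ℕ) (A : Matrix (Fin n) (Fin n) ℝ) :
    LipGradient (limitDist l m A) (limitMeasure m A)
      (WithLp 2 (EuclideanSpace ℝ (Fin n) × ℝ)) where
  grad := limitGrad l
  dist_nonneg := limitDist_nonneg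
  measurable_fun hu :=
    (hu.dist_of_limitDist hl).continuous_of_dist.measurable.aestronglyMeasurable
  measurable_grad _ := (measurable_limitGrad hl _).aestronglyMeasurable
  localLip_eq {u} hu := by
    filter_upwards [ae_hasFDerivAt_limit u] with p h
    exact localLip_limit hl (hu.dist_of_limitDist hl) h.1 h.2
  grad_add {u v} hu hv := by
    have hu' := hu.dist_of_limitDist hl
    have hv' := hv.dist_of_limitDist hl
    filter_upwards [ae_hasFDerivAt_limit u, ae_hasFDerivAt_limit v] with p h1 h2
    rw [limitGrad, limitDeriv_eq (hu'.add hv') h1.1 (g := limitExt u + limitExt v)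
      (fun ξ t => ?_) (h1.2.add h2.2), limitSharp_add]
    · rfl
    · rw [Pi.add_apply, Pi.add_apply, limitExt_coe hu', limitExt_coe hv']
  grad_smul c {u} hu := by
    have hu' := hu.dist_of_limitDist hl
    filter_upwards [ae_hasFDerivAt_limit u] with p h1
    rw [limitGrad, limitDeriv_eq (hu'.smul c) h1.1 (g := c • limitExt u)
      (fun ξ t => ?_) (h1.2.const_smul c), limitSharp_smul]
    · rfl
    · rw [Pi.smul_apply, Pi.smul_apply, limitExt_coe hu']
  grad_mul {u v} hu hv huv := by
    have hu' := hu.dist_of_limitDist hl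
    have hv' := hv.dist_of_limitDist hl
    filter_upwards [ae_hasFDerivAt_limit u, ae_hasFDerivAt_limit v] with p h1 h2
    rw [limitGrad, limitDeriv_eq (huv.dist_of_limitDist hl) h1.1 (g := limitExt u * limitExt v)
      (fun ξ t => ?_) (h1.2.mul h2.2), limitSharp_add, limitSharp_smul, limitSharp_smul,
      limitExt_liftPoint hu', limitExt_liftPoint hv']
    · rfl
    · rw [Pi.mul_apply, Pi.mul_apply, limitExt_coe hu', limitExt_coe hv']

theorem memLp_two_of_bound {X F : Type*} [MeasurableSpace X] {ν : Measure X}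
    [NormedAddCommGroup F] {f : X → F} (hf : AEStronglyMeasurable f ν) {C : ℝ} {s : Set X}
    (hs : MeasurableSet s) (hν : ν s ≠ ⊤) (hC : ∀ᵐ x ∂ν, ‖f x‖ ≤ C)
    (h0 : ∀ᵐ x ∂ν, x ∉ s → f x = 0) : MemLp f 2 ν := by
  have h1 : MemLp (s.indicator fun _ => C) 2 ν := memLp_indicator_const 2 hs C (Or.inr hν)
  refine h1.mono hf ?_
  filter_upwards [hC, h0] with x hx hx0
  by_cases hxs : x ∈ s
  · rw [Set.indicator_of_mem hxs]
    exact hx.trans (le_abs_self C)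
  · rw [hx0 hxs, norm_zero]
    exact norm_nonneg _

theorem measurableSet_fst_le (R : ℝ) :
    MeasurableSet {p : cone m A × S1 | ‖(p.1 : EuclideanSpace ℝ (Fin n))‖ ≤ R} :=
  measurableSet_le (measurable_norm.comp (measurable_subtype_coe.comp measurable_fst))
    measurable_const

theorem limitMeasure_fst_le_ne_top (R : ℝ) :
    limitMeasure m A {p | ‖(p.1 : EuclideanSpace ℝ (Fin n))‖ ≤ R} ≠ ⊤ := by
  have h : {p : cone m A × S1 | ‖(p.1 : EuclideanSpace ℝ (Fin n))‖ ≤ R} =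
      {ξ : cone m A | ‖(ξ : EuclideanSpace ℝ (Fin n))‖ ≤ R} ×ˢ Set.univ := by
    ext p
    simp
  rw [h, limitMeasure, Measure.prod_prod]
  exact ENNReal.mul_ne_top (coneMeasure_closedBall_lt_top R).ne (measure_ne_top _ _)

/-- Away from the support of `u`, the gradient vanishes. -/
theorem ae_limitGrad_eq_zero {u : cone m A × S1 → ℝ} (hu : IsLip dist u) {R : ℝ}
    (hR : ∀ p, R ≤ ‖(p.1 : EuclideanSpace ℝ (Fin n))‖ → u p = 0) :
    ∀ᵐ p ∂(limitMeasure m A), R < ‖(p.1 : EuclideanSpace ℝ (Fin n))‖ → limitDeriv u p = 0 := by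
  refine ae_fst_mem_interior.mono fun p hp hpR => ?_
  have h1 : ∀ᶠ z : EuclideanSpace ℝ (Fin n) × ℝ in 𝓝 (liftPoint p), R < ‖z.1‖ :=
    (continuous_fst.norm).continuousAt.eventually (lt_mem_nhds hpR)
  have h2 : ∀ᶠ z : EuclideanSpace ℝ (Fin n) × ℝ in 𝓝 (liftPoint p), ∀ hz : z.1 ∈ cone m A,
      (0 : ℝ) = u (⟨z.1, hz⟩, (z.2 : S1)) := by
    filter_upwards [h1] with z hz hzc
    exact (hR (⟨z.1, hzc⟩, (z.2 : S1)) hz.le).symm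
  have h3 : HasFDerivAt (fun _ : EuclideanSpace ℝ (Fin n) × ℝ => (0 : ℝ))
      (0 : EuclideanSpace ℝ (Fin n) × ℝ →L[ℝ] ℝ) (liftPoint p) := hasFDerivAt_const 0 _
  exact limitDeriv_eq_of_eventually hu hp h2 h3

/-- A Lipschitz function with bounded support belongs to the form domain. -/
theorem exists_isGradOf_limit (hl : 0 < l) {u : cone m A × S1 → ℝ}
    (hu : IsLip (limitDist l m A) u) {R : ℝ}
    (hR : ∀ p, R ≤ ‖(p.1 : EuclideanSpace ℝ (Fin n))‖ → u p = 0) :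
    ∃ w, (limitGradient hl m A).IsGradOf w u := by
  have hu' := hu.dist_of_limitDist hl
  obtain ⟨M, hM⟩ := hu.exists_bound_limit hl R
  obtain ⟨K, hK0, hK⟩ := hu.exists_nonneg limitDist_nonneg
  have h1 : MemLp u 2 (limitMeasure m A) := by
    refine memLp_two_of_bound hu'.continuous_of_dist.measurable.aestronglyMeasurable
      (C := max M 0) (measurableSet_fst_le R) (limitMeasure_fst_le_ne_top R)
      (Eventually.of_forall fun p => ?_) (Eventually.of_forall fun p hp => ?_)
    · rcases le_total R ‖(p.1 : EuclideanSpace ℝ (Fin n))‖ with h | h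
      · rw [hR p h, norm_zero]
        exact le_max_right _ _
      · exact (hM p h).trans (le_max_left _ _)
    · exact hR p (not_le.1 hp).le
  have h2 : MemLp (limitGrad l u) 2 (limitMeasure m A) := by
    refine memLp_two_of_bound (measurable_limitGrad hl u).aestronglyMeasurable (C := K)
      (measurableSet_fst_le R) (limitMeasure_fst_le_ne_top R) ?_ ?_
    · filter_upwards [(limitGradient hl m A).localLip_eq hu] with p hp
      have h3 := localLip_le hK p
      rw [hp, ← ofReal_norm, ENNReal.ofReal_le_ofReal_iff hK0] at h3
      exact h3
    · filter_upwards [ae_limitGrad_eq_zero hu' hR] with p hp hpR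
      rw [limitGrad, hp (not_le.1 hpR)]
      simpa using limitSharp_smul (l := l) ‖(p.1 : EuclideanSpace ℝ (Fin n))‖ 0 0
  obtain ⟨w, hw, -⟩ := (limitGradient hl m A).exists_isGradOf hu h1 h2
  exact ⟨w, hw⟩

theorem isDense_limit (hl : 0 < l) : (limitGradient hl m A).IsDense := by
  intro f hf
  let o : cone m A × S1 := (⟨0, zero_mem_cone m A⟩, 0)
  have ho : ∀ p : cone m A × S1, ‖(p.1 : EuclideanSpace ℝ (Fin n))‖ ≤ dist p o := fun p => by
    rw [dist_comm, dist_eq_max_norm]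
    simp [o]
  refine Lp_eq_zero_of_integral_lipschitz o (fun R => ?_) f ?_
  · refine (measure_mono fun p hp => ?_).trans_lt (limitMeasure_fst_le_ne_top R).lt_top
    exact (ho p).trans hp
  rintro φ ⟨K, hK⟩ ⟨R, hR⟩ h1
  have hR' : ∀ p, R ≤ ‖(p.1 : EuclideanSpace ℝ (Fin n))‖ → φ p = 0 := fun p hp =>
    hR p (hp.trans (ho p))
  have hφ : IsLip (limitDist l m A) φ := by
    refine IsLip.limitDist_of_dist hl ⟨K, fun x y => ?_⟩ h1 hR'
    rw [dist_comm]
    exact hK.dist_le_mul y x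
  obtain ⟨w, hw⟩ := exists_isGradOf_limit hl hφ hR'
  rw [← hf w ⟨φ, hw⟩, L2.inner_def]
  refine integral_congr_ae ?_
  filter_upwards [hw.2.1] with x hx
  rw [hx, Real.inner_apply]

/-- Lipschitz functions with bounded support are a core. -/
theorem mem_closure_core_limit (hl : 0 < l)
    {w : WithLp 2 (Lp ℝ 2 (limitMeasure m A) ×
      Lp (WithLp 2 (EuclideanSpace ℝ (Fin n) × ℝ)) 2 (limitMeasure m A))}
    (hw : w ∈ (limitGradient hl m A).closedGraph) :
    w ∈ closure {w | ∃ u, (limitGradient hl m A).IsGradOf w u ∧ ∃ R : ℝ, ∀ p : cone m A × S1,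
      R ≤ ‖(p.1 : EuclideanSpace ℝ (Fin n))‖ → u p = 0} :=
  (limitGradient hl m A).mem_closure_core (isLip_norm_fst hl)
    (fun _ hu R => hu.exists_bound_limit hl R) hw

end LimitSlope

/-! ### The Fourier modes of frequency `j` on the circle -/

/-- The normalised modes `cos (j t) / √π` (for `false`) and `sin (j t) / √π` (for `true`). -/
def circleMode (j : ℕ) (b : Bool) (t : S1) : ℝ :=
  (√Real.pi)⁻¹ * if b then (fourier (j : ℤ) t).im else (fourier (j : ℤ) t).re

/-- The lift of `circleMode` to the real line. -/
def realMode (j : ℕ) (b : Bool) (x : ℝ) : ℝ :=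
  (√Real.pi)⁻¹ * if b then Real.sin (j * x) else Real.cos (j * x)

theorem fourier_coe_eq (j : ℕ) (x : ℝ) : (fourier (j : ℤ) (x : S1) : ℂ) =
    Complex.cos ((j * x : ℝ) : ℂ) + Complex.sin ((j * x : ℝ) : ℂ) * Complex.I := by
  rw [fourier_coe_apply, ← Complex.exp_mul_I]
  congr 1
  push_cast
  have : (Real.pi : ℂ) ≠ 0 := by exact_mod_cast Real.pi_ne_zero
  field_simp

theorem circleMode_coe (j : ℕ) (b : Bool) (x : ℝ) : circleMode j b (x : S1) = realMode j b x := by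
  unfold circleMode realMode
  have h1 := Complex.ofReal_cos ((j : ℝ) * x)
  have h2 := Complex.ofReal_sin ((j : ℝ) * x)
  rw [fourier_coe_eq, ← h1, ← h2]
  cases b
  · simp only [Bool.false_eq_true, ↓reduceIte, Complex.add_re, Complex.mul_re, Complex.ofReal_re,
      Complex.ofReal_im, Complex.I_re, mul_zero, zero_mul, sub_zero, add_zero]
  · simp only [↓reduceIte, Complex.add_im, Complex.mul_im, Complex.ofReal_re,
      Complex.ofReal_im, Complex.I_re, Complex.I_im, mul_zero, mul_one, zero_add, add_zero]

/-- The sign in the derivative of `circleMode`. -/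
def modeSign (b : Bool) : ℝ := if b then 1 else -1

theorem modeSign_sq (b : Bool) : modeSign b ^ 2 = 1 := by cases b <;> simp [modeSign]

theorem hasDerivAt_realMode (j : ℕ) (b : Bool) (x : ℝ) :
    HasDerivAt (realMode j b) (modeSign b * j * realMode j (!b) x) x := by
  have h1 : HasDerivAt (fun x : ℝ => (j : ℝ) * x) j x := by
    simpa using (hasDerivAt_id x).const_mul (j : ℝ)
  cases b
  · have h2 := (h1.cos).const_mul (√Real.pi)⁻¹
    have h3 : HasDerivAt (realMode j false) ((√Real.pi)⁻¹ * (-Real.sin (j * x) * j)) x := h2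
    convert h3 using 1
    simp [realMode, modeSign]
    ring
  · have h2 := (h1.sin).const_mul (√Real.pi)⁻¹
    have h3 : HasDerivAt (realMode j true) ((√Real.pi)⁻¹ * (Real.cos (j * x) * j)) x := h2
    convert h3 using 1
    simp [realMode, modeSign]
    ring

theorem continuous_circleMode (j : ℕ) (b : Bool) : Continuous (circleMode j b) := by
  unfold circleMode
  cases b
  · exact continuous_const.mul (Complex.continuous_re.comp (fourier (j : ℤ)).continuous)
  · exact continuous_const.mul (Complex.continuous_im.comp (fourier (j : ℤ)).continuous)

theorem abs_realMode_le (j : ℕ) (b : Bool) (x : ℝ) : |realMode j b x| ≤ 1 := by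
  have h1 : (√Real.pi)⁻¹ ≤ 1 :=
    inv_le_one_of_one_le₀ (Real.one_le_sqrt.2 (by linarith [Real.pi_gt_three]))
  rw [realMode, abs_mul, abs_of_nonneg (by positivity)]
  refine mul_le_one₀ h1 (abs_nonneg _) ?_
  split_ifs
  · exact Real.abs_sin_le_one _
  · exact Real.abs_cos_le_one _

theorem lipschitzWith_realMode (j : ℕ) (b : Bool) : LipschitzWith (j : NNReal) (realMode j b) :=
  lipschitzWith_of_nnnorm_deriv_le (fun x => (hasDerivAt_realMode j b x).differentiableAt)
    fun x => by
      rw [(hasDerivAt_realMode j b x).deriv, ← NNReal.coe_le_coe, coe_nnnorm, norm_mul, norm_mul]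
      have h1 : ‖modeSign b‖ = 1 := by cases b <;> simp [modeSign]
      rw [h1, one_mul]
      simpa using mul_le_of_le_one_right (Nat.cast_nonneg' (α := ℝ) j) (abs_realMode_le j (!b) x)

theorem abs_circleMode_sub_le (j : ℕ) (b : Bool) (t t' : S1) :
    |circleMode j b t' - circleMode j b t| ≤ j * dist t t' := by
  have h1 : ((circleRep t + circleRep (t' - t) : ℝ) : S1) = t' := by
    rw [AddCircle.coe_add, coe_circleRep, coe_circleRep, add_sub_cancel]
  have h2 := (lipschitzWith_realMode j b).dist_le_mul (circleRep t + circleRep (t' - t))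
    (circleRep t)
  rw [← circleMode_coe, ← circleMode_coe, h1, coe_circleRep, Real.dist_eq, Real.dist_eq,
    add_sub_cancel_left, abs_circleRep, ← dist_eq_norm, dist_comm t'] at h2
  exact h2

theorem abs_circleMode_le (j : ℕ) (b : Bool) (t : S1) : |circleMode j b t| ≤ 1 := by
  rw [← coe_circleRep t, circleMode_coe]
  exact abs_realMode_le j b _

theorem integral_circle_eq {F : Type*} [NormedAddCommGroup F] [NormedSpace ℝ F] (f : S1 → F) :
    ∫ t, f t = ∫ x in (-Real.pi)..Real.pi, f (x : S1) := by
  rw [← AddCircle.intervalIntegral_preimage (2 * Real.pi) (-Real.pi) f]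
  congr 1
  ring

/-- The modes are orthonormal in `L²(S¹)`. -/
theorem integral_circleMode_mul {j : ℕ} (hj : 0 < j) (b c : Bool) :
    ∫ t, circleMode j b t * circleMode j c t = if b = c then 1 else 0 := by
  have hj' : (j : ℝ) ≠ 0 := by exact_mod_cast hj.ne'
  have hpi : (√Real.pi)⁻¹ * (√Real.pi)⁻¹ = Real.pi⁻¹ := by
    rw [← mul_inv, Real.mul_self_sqrt Real.pi_pos.le]
  have hs : Real.sin (j * Real.pi) = 0 := Real.sin_nat_mul_pi j
  have hcos : ∫ x in (-Real.pi)..Real.pi, Real.cos (j * x) ^ 2 = Real.pi := by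
    rw [intervalIntegral.integral_comp_mul_left (fun y => Real.cos y ^ 2) hj', integral_cos_sq,
      mul_neg, Real.sin_neg, hs, smul_eq_mul]
    field_simp
    ring
  have hsin : ∫ x in (-Real.pi)..Real.pi, Real.sin (j * x) ^ 2 = Real.pi := by
    rw [intervalIntegral.integral_comp_mul_left (fun y => Real.sin y ^ 2) hj', integral_sin_sq,
      mul_neg, Real.sin_neg, hs, smul_eq_mul]
    field_simp
    ring
  have hsc : ∫ x in (-Real.pi)..Real.pi, Real.sin (j * x) * Real.cos (j * x) = 0 := by
    rw [intervalIntegral.integral_comp_mul_left (fun y => Real.sin y * Real.cos y) hj',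
      integral_sin_mul_cos₁, mul_neg, Real.sin_neg, hs]
    simp
  have hcs : ∫ x in (-Real.pi)..Real.pi, Real.cos (j * x) * Real.sin (j * x) = 0 := by
    simpa only [mul_comm] using hsc
  have hmul : ∀ x : ℝ, circleMode j b (x : S1) * circleMode j c (x : S1) = Real.pi⁻¹ *
      ((if b then Real.sin (j * x) else Real.cos (j * x)) *
        if c then Real.sin (j * x) else Real.cos (j * x)) := fun x => by
    rw [circleMode_coe, circleMode_coe, realMode, realMode, ← hpi]
    ring
  rw [integral_circle_eq]
  simp only [hmul]
  rw [intervalIntegral.integral_const_mul]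
  cases b <;> cases c
  · simp only [Bool.false_eq_true, ↓reduceIte, ← sq, hcos]
    exact inv_mul_cancel₀ Real.pi_ne_zero
  · simp only [Bool.false_eq_true, ↓reduceIte, hcs]
    simp
  · simp only [Bool.false_eq_true, ↓reduceIte, hsc]
    simp
  · simp only [↓reduceIte, ← sq, hsin]
    exact inv_mul_cancel₀ Real.pi_ne_zero

/-! ### The modes of the limit space -/

section ModeOperator

variable {n : ℕ} {m : ℕ} {A : Matrix (Fin n) (Fin n) ℝ}

theorem ae_fst_of_gauss {k : ℕ} {P : cone m A → Prop} (h : ∀ᵐ ξ ∂(gaussianMeasure m A k), P ξ) :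
    ∀ᵐ p ∂(limitMeasure m A), P p.1 :=
  Measure.quasiMeasurePreserving_fst.ae ((coneMeasure_absolutelyContinuous m A k).ae_le h)

/-- The ground state profile `exp (-k ‖ξ‖² / 2)`. -/
def gaussHalf (k : ℕ) (x : EuclideanSpace ℝ (Fin n)) : ℝ := Real.exp (-((k : ℝ) * ‖x‖ ^ 2 / 2))

theorem gaussHalf_mul_self (k : ℕ) (x : EuclideanSpace ℝ (Fin n)) :
    gaussHalf k x * gaussHalf k x = gaussDensity k x := by
  rw [gaussHalf, gaussDensity, ← Real.exp_add]
  congr 1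
  ring

theorem gaussHalf_pos (k : ℕ) (x : EuclideanSpace ℝ (Fin n)) : 0 < gaussHalf k x := Real.exp_pos _

theorem measurable_gaussHalf (k : ℕ) :
    Measurable fun ξ : cone m A => gaussHalf k (ξ : EuclideanSpace ℝ (Fin n)) := by
  unfold gaussHalf
  fun_prop

/-- The function `exp (-k ‖ξ‖² / 2) φ(ξ) χ_b(t)`, where `χ_b` is a normalised mode. -/
def modeFun (k j : ℕ) (b : Bool) (φ : cone m A → ℝ) (p : cone m A × S1) : ℝ :=
  gaussHalf k (p.1 : EuclideanSpace ℝ (Fin n)) * φ p.1 * circleMode j b p.2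

theorem lintegral_enorm_circleMode_sq {j : ℕ} (hj : 0 < j) (b : Bool) :
    ∫⁻ t, ‖circleMode j b t‖ₑ ^ 2 = 1 := by
  have h1 := integral_circleMode_mul hj b b
  rw [if_pos rfl] at h1
  rw [← ENNReal.ofReal_one, ← h1, ofReal_integral_eq_lintegral_ofReal]
  · refine lintegral_congr fun t => ?_
    rw [enorm_sq_eq_ofReal, Real.norm_eq_abs, sq_abs, sq]
  · exact ((continuous_circleMode j b).mul (continuous_circleMode j b)).integrable_of_hasCompactSupport
      (HasCompactSupport.of_compactSpace _)
  · exact Eventually.of_forall fun t => mul_self_nonneg _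

theorem lintegral_modeFun {k j : ℕ} (hj : 0 < j) (b : Bool) {φ : cone m A → ℝ}
    (hφ : AEStronglyMeasurable φ (gaussianMeasure m A k)) :
    ∫⁻ p, ‖modeFun k j b φ p‖ₑ ^ 2 ∂(limitMeasure m A) =
      ∫⁻ ξ, ‖φ ξ‖ₑ ^ 2 ∂(gaussianMeasure m A k) := by
  have hφ' := hφ.mono_ac (coneMeasure_absolutelyContinuous m A k)
  have h1 : ∀ p : cone m A × S1, ‖modeFun k j b φ p‖ₑ ^ 2 =
      ‖gaussHalf k (p.1 : EuclideanSpace ℝ (Fin n)) * φ p.1‖ₑ ^ 2 * ‖circleMode j b p.2‖ₑ ^ 2 :=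
    fun p => by rw [modeFun, enorm_mul, mul_pow]
  simp_rw [h1]
  rw [limitMeasure, lintegral_prod_mul (f := fun ξ : cone m A =>
      ‖gaussHalf k (ξ : EuclideanSpace ℝ (Fin n)) * φ ξ‖ₑ ^ 2)
      (g := fun t => ‖circleMode j b t‖ₑ ^ 2), lintegral_enorm_circleMode_sq hj, mul_one,
    lintegral_gaussianMeasure]
  · refine lintegral_congr fun ξ => ?_
    rw [enorm_mul, mul_pow]
    congr 1
    rw [enorm_sq_eq_ofReal, Real.norm_eq_abs, sq_abs, sq, gaussHalf_mul_self]
  · exact (((measurable_gaussHalf k).aestronglyMeasurable.mul hφ').enorm).pow_const 2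
  · exact ((continuous_circleMode j b).measurable.enorm.pow_const 2).aemeasurable

theorem memLp_modeFun {k j : ℕ} (hj : 0 < j) (b : Bool) {φ : cone m A → ℝ}
    (hφ : MemLp φ 2 (gaussianMeasure m A k)) : MemLp (modeFun k j b φ) 2 (limitMeasure m A) := by
  have hφ' := hφ.1.mono_ac (coneMeasure_absolutelyContinuous m A k)
  have h1 : AEStronglyMeasurable (modeFun k j b φ) (limitMeasure m A) := by
    have h2 : AEStronglyMeasurable (fun p : cone m A × S1 =>
        gaussHalf k (p.1 : EuclideanSpace ℝ (Fin n)) * φ p.1) (limitMeasure m A) :=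
      ((measurable_gaussHalf k).aestronglyMeasurable.mul hφ').comp_fst
    exact h2.mul ((continuous_circleMode j b).measurable.comp measurable_snd).aestronglyMeasurable
  rw [memLp_two_iff h1, lintegral_modeFun hj b hφ.1]
  exact (memLp_two_iff hφ.1).1 hφ

/-- The isometric embedding `φ ↦ exp (-k ‖ξ‖² / 2) φ(ξ) χ_b(t)` of `L²` of the Gaussian cone into
`L²` of the limit space. -/
def modeOp (k : ℕ) {j : ℕ} (hj : 0 < j) (b : Bool) :
    Lp ℝ 2 (gaussianMeasure m A k) →L[ℝ] Lp ℝ 2 (limitMeasure m A) :=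
  LinearMap.mkContinuous
    { toFun := fun φ => (memLp_modeFun hj b (Lp.memLp φ)).toLp _
      map_add' := fun φ φ' => by
        refine Lp.ext ?_
        filter_upwards [(memLp_modeFun hj b (Lp.memLp (φ + φ'))).coeFn_toLp,
          (memLp_modeFun hj b (Lp.memLp φ)).coeFn_toLp, (memLp_modeFun hj b (Lp.memLp φ')).coeFn_toLp,
          Lp.coeFn_add ((memLp_modeFun hj b (Lp.memLp φ)).toLp _)
            ((memLp_modeFun hj b (Lp.memLp φ')).toLp _), ae_fst_of_gauss (Lp.coeFn_add φ φ')]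
          with p h1 h2 h3 h4 h5
        rw [h1, h4, Pi.add_apply, h2, h3, modeFun, h5, Pi.add_apply, modeFun, modeFun]
        ring
      map_smul' := fun c φ => by
        refine Lp.ext ?_
        filter_upwards [(memLp_modeFun hj b (Lp.memLp (c • φ))).coeFn_toLp,
          (memLp_modeFun hj b (Lp.memLp φ)).coeFn_toLp,
          Lp.coeFn_smul c ((memLp_modeFun hj b (Lp.memLp φ)).toLp _),
          ae_fst_of_gauss (Lp.coeFn_smul c φ)] with p h1 h2 h4 h5
        rw [h1, RingHom.id_apply, h4, Pi.smul_apply, h2, modeFun, h5, Pi.smul_apply, modeFun,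
          smul_eq_mul, smul_eq_mul]
        ring } 1 fun φ => by
    rw [one_mul]
    refine (abs_le_of_sq_le_sq' ?_ (norm_nonneg _)).2
    rw [← ENNReal.ofReal_le_ofReal_iff (by positivity), ← enorm_sq_eq_ofReal,
      ← enorm_sq_eq_ofReal, Lp_enorm_sq, Lp_enorm_sq, ← lintegral_modeFun hj b (Lp.memLp φ).1]
    refine le_of_eq (lintegral_congr_ae ?_)
    filter_upwards [(memLp_modeFun hj b (Lp.memLp φ)).coeFn_toLp] with p hp
    rw [← hp]
    rfl

theorem modeOp_apply {k j : ℕ} (hj : 0 < j) (b : Bool) (φ : Lp ℝ 2 (gaussianMeasure m A k)) :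
    ∀ᵐ p ∂(limitMeasure m A), modeOp k hj b φ p = modeFun k j b φ p :=
  (memLp_modeFun hj b (Lp.memLp φ)).coeFn_toLp

theorem inner_modeOp {k j : ℕ} (hj : 0 < j) (b c : Bool)
    (φ φ' : Lp ℝ 2 (gaussianMeasure m A k)) :
    inner ℝ (modeOp k hj b φ) (modeOp k hj c φ') = if b = c then inner ℝ φ φ' else 0 := by
  have h1 : inner ℝ (modeOp k hj b φ) (modeOp k hj c φ') =
      ∫ p : cone m A × S1, (gaussDensity k (p.1 : EuclideanSpace ℝ (Fin n)) * (φ p.1 * φ' p.1)) *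
        (circleMode j b p.2 * circleMode j c p.2) ∂((coneMeasure m A).prod volume) := by
    rw [L2.inner_def]
    refine integral_congr_ae ?_
    filter_upwards [modeOp_apply hj b φ, modeOp_apply hj c φ'] with p h1 h2
    rw [h1, h2, Real.inner_apply, modeFun, modeFun, ← gaussHalf_mul_self]
    ring
  rw [h1, integral_prod_mul (fun ξ : cone m A =>
      gaussDensity k (ξ : EuclideanSpace ℝ (Fin n)) * (φ ξ * φ' ξ))
      (fun t => circleMode j b t * circleMode j c t), integral_circleMode_mul hj]
  split_ifs with h
  · rw [mul_one, L2.inner_def, integral_gaussianMeasure]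
    refine integral_congr_ae (Eventually.of_forall fun ξ => ?_)
    simp only [Real.inner_apply]
  · rw [mul_zero]

theorem adjoint_modeOp_modeOp {k j : ℕ} (hj : 0 < j) (b c : Bool)
    (φ : Lp ℝ 2 (gaussianMeasure m A k)) :
    ContinuousLinearMap.adjoint (modeOp k hj b) (modeOp k hj c φ) = if b = c then φ else 0 := by
  refine ext_inner_left ℝ fun ψ => ?_
  rw [ContinuousLinearMap.adjoint_inner_right, inner_modeOp]
  split_ifs <;> simp

end ModeOperator

/-! ### Fourier coefficients along the circle -/

section Bessel

variable {V : Type*} [NormedAddCommGroup V] [InnerProductSpace ℝ V]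

theorem integrable_circleMode_smul (j : ℕ) (b : Bool) {g : S1 → V} (hg : Integrable g) :
    Integrable fun t => circleMode j b t • g t :=
  hg.bdd_smul 1 (continuous_circleMode j b).aestronglyMeasurable
    (Eventually.of_forall fun t => abs_circleMode_le j b t)

/-- Bessel's inequality for the two modes of frequency `j`. -/
theorem bessel_circleMode [CompleteSpace V] {j : ℕ} (hj : 0 < j) {g : S1 → V} (hg : AEStronglyMeasurable g volume)
    {C : ℝ} (hC : ∀ t, ‖g t‖ ≤ C) :
    ‖∫ t, circleMode j false t • g t‖ₑ ^ 2 + ‖∫ t, circleMode j true t • g t‖ₑ ^ 2 ≤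
      ∫⁻ t, ‖g t‖ₑ ^ 2 := by
  set a : Bool → V := fun b => ∫ t, circleMode j b t • g t with ha
  have hgi : Integrable g := Integrable.of_bound hg C (Eventually.of_forall hC)
  have hg2 : Integrable fun t => ‖g t‖ ^ 2 :=
    Integrable.of_bound (hg.norm.pow 2) (C ^ 2) (Eventually.of_forall fun t => by
      rw [Real.norm_of_nonneg (by positivity)]
      have := hC t
      gcongr)
  have hlin : ∀ b, Integrable fun t => inner ℝ (a b) (circleMode j b t • g t) := fun b =>
    (integrable_circleMode_smul j b hgi).const_inner (a b)
  have hint : ∀ b, ∫ t, inner ℝ (a b) (circleMode j b t • g t) = ‖a b‖ ^ 2 := fun b => by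
    rw [integral_inner (integrable_circleMode_smul j b hgi), real_inner_self_eq_norm_sq]
  have hmm : ∀ b c, Integrable fun t => circleMode j b t * circleMode j c t := fun b c =>
    ((continuous_circleMode j b).mul (continuous_circleMode j c)).integrable_of_hasCompactSupport
      (HasCompactSupport.of_compactSpace _)
  -- expand the square of the remainder of `g` after subtracting its two components
  have h1 : ∀ t, ‖g t - (circleMode j false t • a false + circleMode j true t • a true)‖ ^ 2 =
      ‖g t‖ ^ 2 - 2 * (inner ℝ (a false) (circleMode j false t • g t) +
        inner ℝ (a true) (circleMode j true t • g t)) +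
        (circleMode j false t * circleMode j false t * ‖a false‖ ^ 2 +
          circleMode j true t * circleMode j true t * ‖a true‖ ^ 2 +
          circleMode j false t * circleMode j true t * (2 * inner ℝ (a false) (a true))) := by
    intro t
    rw [norm_sub_sq_real, norm_add_sq_real]
    simp only [inner_add_right, real_inner_smul_right, real_inner_smul_left, norm_smul, mul_pow,
      Real.norm_eq_abs, sq_abs, real_inner_comm]
    ring
  have h2 : 0 ≤ ∫ t, ‖g t - (circleMode j false t • a false + circleMode j true t • a true)‖ ^ 2 :=
    integral_nonneg fun t => by positivity
  have h3 : ∫ t, ‖g t - (circleMode j false t • a false + circleMode j true t • a true)‖ ^ 2 =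
      (∫ t, ‖g t‖ ^ 2) - (‖a false‖ ^ 2 + ‖a true‖ ^ 2) := by
    simp_rw [h1]
    rw [integral_add, integral_sub hg2, integral_const_mul, integral_add (hlin _) (hlin _), hint,
      hint, integral_add, integral_add, integral_mul_const, integral_mul_const, integral_mul_const,
      integral_circleMode_mul hj, integral_circleMode_mul hj, integral_circleMode_mul hj]
    · simp
      ring
    · exact (hmm _ _).mul_const _
    · exact (hmm _ _).mul_const _
    · exact ((hmm _ _).mul_const _).add ((hmm _ _).mul_const _)
    · exact (hmm _ _).mul_const _
    · exact ((hlin _).add (hlin _)).const_mul 2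
    · exact hg2.sub (((hlin _).add (hlin _)).const_mul 2)
    · exact (((hmm _ _).mul_const _).add ((hmm _ _).mul_const _)).add ((hmm _ _).mul_const _)
  have h4 : ∫⁻ t, ‖g t‖ₑ ^ 2 = ENNReal.ofReal (∫ t, ‖g t‖ ^ 2) := by
    rw [ofReal_integral_eq_lintegral_ofReal hg2 (Eventually.of_forall fun t => by positivity)]
    exact lintegral_congr fun t => enorm_sq_eq_ofReal _
  rw [h4, enorm_sq_eq_ofReal, enorm_sq_eq_ofReal, ← ENNReal.ofReal_add (by positivity)
    (by positivity)]
  exact ENNReal.ofReal_le_ofReal (sub_nonneg.1 (h3 ▸ h2))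

end Bessel

section ModeCoeff

variable {n : ℕ} {m : ℕ} {A : Matrix (Fin n) (Fin n) ℝ}

/-- The coefficient of `u (ξ, ·)` with respect to a mode of the circle. -/
def modeCoeff (j : ℕ) (b : Bool) (u : cone m A × S1 → ℝ) (ξ : cone m A) : ℝ :=
  ∫ t, circleMode j b t * u (ξ, t)

theorem modeCoeff_eq_zero (j : ℕ) (b : Bool) {u : cone m A × S1 → ℝ} {ξ : cone m A}
    (h : ∀ t, u (ξ, t) = 0) : modeCoeff j b u ξ = 0 := by
  simp [modeCoeff, h]

theorem integrable_slice (j : ℕ) (b : Bool) {u : cone m A × S1 → ℝ} (hu : IsLip dist u)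
    (ξ : cone m A) : Integrable fun t => circleMode j b t * u (ξ, t) :=
  ((continuous_circleMode j b).mul (hu.continuous_of_dist.comp
    (Continuous.prodMk_right ξ))).integrable_of_hasCompactSupport
      (HasCompactSupport.of_compactSpace _)

theorem isLip_modeCoeff (j : ℕ) (b : Bool) {u : cone m A × S1 → ℝ} (hu : IsLip dist u) :
    IsLip dist (modeCoeff j b u) := by
  obtain ⟨K, hK0, hK⟩ := hu.exists_nonneg fun _ _ => dist_nonneg
  refine ⟨K * (volume : Measure S1).real Set.univ, fun x y => ?_⟩
  rw [modeCoeff, modeCoeff, ← integral_sub (integrable_slice j b hu y) (integrable_slice j b hu x),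
    mul_right_comm, ← Real.norm_eq_abs]
  refine norm_integral_le_of_norm_le_const (Eventually.of_forall fun t => ?_)
  rw [← mul_sub, norm_mul]
  refine (mul_le_mul (abs_circleMode_le j b t) (hK (x, t) (y, t)) (abs_nonneg _)
    zero_le_one).trans ?_
  rw [one_mul, Prod.dist_eq]
  simp

theorem measurable_vecPart_slice (u : cone m A × S1 → ℝ) (ξ : cone m A) :
    Measurable fun t => vecPart (limitDeriv u (ξ, t)) :=
  continuous_vecPart.measurable.comp ((measurable_limitDeriv u).comp measurable_prodMk_left)

theorem norm_limitDeriv_le {u : cone m A × S1 → ℝ} {K : NNReal}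
    (hK : LipschitzWith K (limitExt u)) (p : cone m A × S1) : ‖limitDeriv u p‖ ≤ K :=
  norm_fderiv_le_of_lipschitz ℝ hK

theorem norm_vecPart_le (L : EuclideanSpace ℝ (Fin n) × ℝ →L[ℝ] ℝ) : ‖vecPart L‖ ≤ ‖L‖ := by
  rw [vecPart, LinearIsometryEquiv.norm_map]
  refine ContinuousLinearMap.opNorm_le_bound _ (norm_nonneg _) fun v => ?_
  refine (L.le_opNorm _).trans (le_of_eq ?_)
  simp

/-- Differentiation under the integral sign for a coefficient along the circle. -/
theorem hasFDerivAt_integral_circleMode (j : ℕ) (b : Bool) {u : cone m A × S1 → ℝ} (ξ : cone m A)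
    (hξ : ∀ᵐ t : S1, (ξ : EuclideanSpace ℝ (Fin n)) ∈ interior (cone m A) ∧
      HasFDerivAt (limitExt u) (limitDeriv u (ξ, t)) (liftPoint (ξ, t))) {K : NNReal}
    (hK : LipschitzWith K (limitExt u))
    (hint : Integrable fun t => circleMode j b t * limitExt u (ξ, circleRep t)) :
    HasFDerivAt (fun x => ∫ t, circleMode j b t * limitExt u (x, circleRep t))
      (InnerProductSpace.toDual ℝ (EuclideanSpace ℝ (Fin n))
        (∫ t, circleMode j b t • vecPart (limitDeriv u (ξ, t))))
      (ξ : EuclideanSpace ℝ (Fin n)) := by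
  have hmeas : ∀ x : EuclideanSpace ℝ (Fin n),
      AEStronglyMeasurable (fun t => circleMode j b t * limitExt u (x, circleRep t)) volume :=
    fun x => ((continuous_circleMode j b).measurable.mul (hK.continuous.measurable.comp
      (measurable_const.prodMk measurePreserving_circleRep.measurable))).aestronglyMeasurable
  have hm : Measurable fun t => circleMode j b t • vecPart (limitDeriv u (ξ, t)) :=
    (continuous_circleMode j b).measurable.smul (measurable_vecPart_slice u ξ)
  have hi : Integrable fun t => circleMode j b t • vecPart (limitDeriv u (ξ, t)) :=
    integrable_circleMode_smul j b (Integrable.of_bound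
      (measurable_vecPart_slice u ξ).aestronglyMeasurable K (Eventually.of_forall fun t =>
        (norm_vecPart_le _).trans (norm_limitDeriv_le hK _)))
  have h2 : ∫ t, InnerProductSpace.toDual ℝ (EuclideanSpace ℝ (Fin n))
      (circleMode j b t • vecPart (limitDeriv u (ξ, t))) =
      InnerProductSpace.toDual ℝ (EuclideanSpace ℝ (Fin n))
        (∫ t, circleMode j b t • vecPart (limitDeriv u (ξ, t))) :=
    (innerSL ℝ).integral_comp_comm hi
  rw [← h2]
  refine (hasFDerivAt_integral_of_dominated_loc_of_lip (bound := fun _ => (K : ℝ))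
    (s := Set.univ) univ_mem (Eventually.of_forall hmeas) hint ?_ ?_ (integrable_const _) ?_).2
  · exact (LinearIsometryEquiv.continuous _).comp_aestronglyMeasurable hm.aestronglyMeasurable
  · refine Eventually.of_forall fun t => LipschitzWith.lipschitzOnWith
      (LipschitzWith.of_dist_le_mul fun x y => ?_)
    rw [Real.dist_eq, ← mul_sub, abs_mul, ← Real.dist_eq]
    refine (mul_le_mul (abs_circleMode_le j b t) (hK.dist_le_mul _ _) dist_nonneg
      zero_le_one).trans ?_
    simp [Prod.dist_eq]
  · refine hξ.mono fun t ht => ?_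
    have h1 : HasFDerivAt (fun x : EuclideanSpace ℝ (Fin n) => (x, circleRep t))
      (ContinuousLinearMap.inl ℝ (EuclideanSpace ℝ (Fin n)) ℝ)
      (ξ : EuclideanSpace ℝ (Fin n)) := hasFDerivAt_prodMk_left _ _
    have h3 := (HasFDerivAt.comp (ξ : EuclideanSpace ℝ (Fin n)) ht.2 h1).const_mul
      (circleMode j b t)
    refine h3.congr_fderiv (ContinuousLinearMap.ext fun v => ?_)
    rw [InnerProductSpace.toDual_apply_apply, real_inner_smul_left, inner_vecPart]
    rfl

/-- Differentiation under the integral sign. -/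
theorem coneGrad_modeCoeff (j : ℕ) (b : Bool) {u : cone m A × S1 → ℝ} (hu : IsLip dist u) :
    ∀ᵐ ξ : cone m A ∂(coneMeasure m A), coneGrad (modeCoeff j b u) ξ =
      ∫ t, circleMode j b t • vecPart (limitDeriv u (ξ, t)) := by
  have h0 := Measure.ae_ae_of_ae_prod (μ := coneMeasure m A) (ν := (volume : Measure S1))
    (ae_hasFDerivAt_limit u)
  filter_upwards [h0, ae_mem_interior m A] with ξ hξ hint
  obtain ⟨K, hK⟩ : ∃ K, LipschitzWith K (limitExt u) := lipschitzWith_lipExt _ _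
  have hslice : ∀ ζ : cone m A, ∀ t, limitExt u (ζ, circleRep t) = u (ζ, t) := fun ζ t => by
    rw [limitExt_coe hu, coe_circleRep]
  have hd := hasFDerivAt_integral_circleMode j b ξ hξ hK (by
    simpa only [hslice] using integrable_slice j b hu ξ)
  refine coneGrad_eq (isLip_modeCoeff j b hu) hint (fun ζ => ?_)
    (hasGradientAt_iff_hasFDerivAt.2 hd)
  simp only [hslice, modeCoeff]

/-- Integration by parts on the circle. -/
theorem integral_circleMode_limitDeriv (j : ℕ) (b : Bool) {u : cone m A × S1 → ℝ}
    (hu : IsLip dist u) : ∀ᵐ ξ : cone m A ∂(coneMeasure m A),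
      ∫ t, circleMode j b t * limitDeriv u (ξ, t) (0, 1) =
        -(modeSign b * j * modeCoeff j (!b) u ξ) := by
  have h0 := Measure.ae_ae_of_ae_prod (μ := coneMeasure m A) (ν := (volume : Measure S1))
    (ae_hasFDerivAt_limit u)
  filter_upwards [h0] with ξ hξ
  obtain ⟨K, hK⟩ : ∃ K, LipschitzWith K (limitExt u) := lipschitzWith_lipExt _ _
  set w : ℝ → ℝ := fun s => limitExt u ((ξ : EuclideanSpace ℝ (Fin n)), s) with hw
  have hwu : ∀ s, w s = u (ξ, (s : S1)) := fun s => limitExt_coe hu ξ s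
  have hwL : LipschitzWith K w := LipschitzWith.of_dist_le_mul fun s t => by
    refine (hK.dist_le_mul _ _).trans ?_
    simp [Prod.dist_eq]
  have hderiv : ∀ᵐ t : S1, limitDeriv u (ξ, t) (0, 1) = deriv w (circleRep t) := by
    filter_upwards [hξ] with t ht
    have h1 : HasFDerivAt (fun s : ℝ => ((ξ : EuclideanSpace ℝ (Fin n)), s))
      (ContinuousLinearMap.inr ℝ (EuclideanSpace ℝ (Fin n)) ℝ) (circleRep t) :=
        hasFDerivAt_prodMk_right _ _
    have h2 := (HasFDerivAt.comp (circleRep t) ht.2 h1).hasDerivAt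
    exact h2.deriv.symm
  have hle : -Real.pi ≤ Real.pi := by linarith [Real.pi_pos]
  have h1 : ∫ t, circleMode j b t * limitDeriv u (ξ, t) (0, 1) =
      ∫ s in (-Real.pi)..Real.pi, realMode j b s * deriv w s := by
    rw [integral_congr_ae (hderiv.mono fun t ht => by rw [ht]), integral_circle_eq]
    refine intervalIntegral.integral_congr_ae (Eventually.of_forall fun s hs => ?_)
    rw [Set.uIoc_of_le hle] at hs
    rw [circleMode_coe, circleRep_coe hs]
  -- the boundary terms cancel by periodicity
  have hper : ((-Real.pi : ℝ) : S1) = (Real.pi : ℝ) := by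
    rw [← AddCircle.coe_add_period (2 * Real.pi) (-Real.pi)]
    congr 1
    ring
  rw [h1, AbsolutelyContinuousOnInterval.integral_mul_deriv_eq_deriv_mul
    (lipschitzWith_realMode j b).lipschitzOnWith.absolutelyContinuousOnInterval
    hwL.lipschitzOnWith.absolutelyContinuousOnInterval, hwu, hwu, ← circleMode_coe,
    ← circleMode_coe, hper, sub_self, zero_sub, modeCoeff, integral_circle_eq,
    ← intervalIntegral.integral_const_mul]
  congr 1
  refine intervalIntegral.integral_congr fun s _ => ?_
  simp only [(hasDerivAt_realMode j b s).deriv, hwu, circleMode_coe]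
  ring

end ModeCoeff

/-! ### Comparison of the two Dirichlet forms -/

section Comparison

variable {n : ℕ} {l m : ℕ} {A : Matrix (Fin n) (Fin n) ℝ}

theorem enorm_mul_self_gaussHalf (k : ℕ) (x : EuclideanSpace ℝ (Fin n)) :
    ‖gaussHalf k x‖ₑ ^ 2 = ENNReal.ofReal (gaussDensity k x) := by
  rw [enorm_sq_eq_ofReal, Real.norm_eq_abs, sq_abs, sq, gaussHalf_mul_self]

theorem inv_fiberScale_sq (l : ℕ) (ρ : ℝ) : ((fiberScale l ρ)⁻¹) ^ 2 = (l : ℝ) ^ 2 * (1 + ρ ^ 2) := by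
  rw [inv_pow, fiberScale_sq, inv_inv]

/-- The energy density on a circle `{ξ} × S¹` dominates the one of the two modes. -/
theorem modeCoeff_energy_le {j k : ℕ} (hj : 0 < j) (hk : k = j * l)
    {u : cone m A × S1 → ℝ} (hu : IsLip dist u) : ∀ᵐ ξ : cone m A ∂(coneMeasure m A),
      (‖coneGrad (modeCoeff j false u) ξ‖ₑ ^ 2 +
          ENNReal.ofReal ((k : ℝ) ^ 2 * (1 + ‖(ξ : EuclideanSpace ℝ (Fin n))‖ ^ 2)) *
            ‖modeCoeff j false u ξ‖ₑ ^ 2) +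
        (‖coneGrad (modeCoeff j true u) ξ‖ₑ ^ 2 +
          ENNReal.ofReal ((k : ℝ) ^ 2 * (1 + ‖(ξ : EuclideanSpace ℝ (Fin n))‖ ^ 2)) *
            ‖modeCoeff j true u ξ‖ₑ ^ 2) ≤
      ∫⁻ t, ‖limitGrad l u (ξ, t)‖ₑ ^ 2 := by
  obtain ⟨K, hK⟩ : ∃ K, LipschitzWith K (limitExt u) := lipschitzWith_lipExt _ _
  filter_upwards [coneGrad_modeCoeff j false hu, coneGrad_modeCoeff j true hu,
    integral_circleMode_limitDeriv j false hu, integral_circleMode_limitDeriv j true hu]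
    with ξ h1 h2 h3 h4
  set ρ := ‖(ξ : EuclideanSpace ℝ (Fin n))‖ with hρ
  set c := (fiberScale l ρ)⁻¹ with hc
  have hm : Measurable fun t : S1 => limitDeriv u (ξ, t) (0, 1) :=
    (ContinuousLinearMap.measurable_apply _).comp
      ((measurable_limitDeriv u).comp measurable_prodMk_left)
  -- Bessel for the cone component of the gradient and for the circle component
  have hb1 := bessel_circleMode hj (measurable_vecPart_slice u ξ).aestronglyMeasurable
    (fun t => (norm_vecPart_le _).trans (norm_limitDeriv_le hK (ξ, t)))
  have hb2 := bessel_circleMode hj (g := fun t => c * limitDeriv u (ξ, t) (0, 1))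
    (measurable_const.mul hm).aestronglyMeasurable (C := |c| * K) fun t => by
      rw [norm_mul]
      refine mul_le_mul_of_nonneg_left ?_ (abs_nonneg _)
      refine ((limitDeriv u (ξ, t)).le_opNorm _).trans ?_
      have h5 : ‖((0 : EuclideanSpace ℝ (Fin n)), (1 : ℝ))‖ = 1 := by simp
      rw [h5, mul_one]
      exact norm_limitDeriv_le hK (ξ, t)
  -- integration by parts exchanges the two modes and gives the factor `j`; the inverse metric
  -- gives `l² (1 + ρ²)`, and `j² l² = k²`
  have hcoef : ∀ b : Bool, (∫ t, circleMode j b t * limitDeriv u (ξ, t) (0, 1) =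
      -(modeSign b * j * modeCoeff j (!b) u ξ)) →
      ‖∫ t, circleMode j b t • (c * limitDeriv u (ξ, t) (0, 1))‖ₑ ^ 2 =
        ENNReal.ofReal ((k : ℝ) ^ 2 * (1 + ρ ^ 2)) * ‖modeCoeff j (!b) u ξ‖ₑ ^ 2 := by
    intro b hb
    have h5 : ∫ t, circleMode j b t • (c * limitDeriv u (ξ, t) (0, 1)) =
        c * -(modeSign b * j * modeCoeff j (!b) u ξ) := by
      rw [← hb, ← integral_const_mul]
      refine integral_congr_ae (Eventually.of_forall fun t => ?_)
      simp only [smul_eq_mul]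
      ring
    rw [h5, enorm_sq_eq_ofReal, enorm_sq_eq_ofReal, ← ENNReal.ofReal_mul (by positivity)]
    congr 1
    rw [Real.norm_eq_abs, Real.norm_eq_abs, sq_abs, sq_abs, mul_pow, inv_fiberScale_sq, neg_sq,
      mul_pow, mul_pow, modeSign_sq, hk]
    push_cast
    ring
  have h5 := hcoef false h3
  have h6 := hcoef true h4
  rw [Bool.not_false] at h5
  rw [Bool.not_true] at h6
  have h7 : ∫⁻ t, ‖limitGrad l u (ξ, t)‖ₑ ^ 2 = (∫⁻ t, ‖vecPart (limitDeriv u (ξ, t))‖ₑ ^ 2) +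
      ∫⁻ t, ‖c * limitDeriv u (ξ, t) (0, 1)‖ₑ ^ 2 := by
    have hm' : Measurable fun t : S1 => ‖vecPart (limitDeriv u (ξ, t))‖ₑ ^ 2 :=
      (measurable_vecPart_slice u ξ).enorm.pow_const 2
    rw [← lintegral_add_left hm']
    exact lintegral_congr fun t => enorm_sq_limitSharp _ _
  rw [h7, h1, h2, ← h5, ← h6]
  refine le_trans (le_of_eq ?_) (add_le_add hb1 hb2)
  ring

/-- Conjugation of the Gaussian Dirichlet form by the ground state. -/
theorem ground_energy {k : ℕ} (hk : 0 < k) {φ : cone m A → ℝ} (hφ : IsLip dist φ) {R : ℝ}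
    (hR : ∀ ξ : cone m A, R ≤ ‖(ξ : EuclideanSpace ℝ (Fin n))‖ → φ ξ = 0)
    {v : cone m A → ℝ} (hv : IsLip dist v)
    (hvφ : ∀ ξ : cone m A, v ξ = φ ξ * gaussHalf k (ξ : EuclideanSpace ℝ (Fin n))) :
    ∫⁻ ξ : cone m A, (‖coneGrad v ξ‖ₑ ^ 2 +
        ENNReal.ofReal ((k : ℝ) ^ 2 * (1 + ‖(ξ : EuclideanSpace ℝ (Fin n))‖ ^ 2)) * ‖v ξ‖ₑ ^ 2)
        ∂(coneMeasure m A) =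
      ∫⁻ ξ, (‖coneGrad φ ξ‖ₑ ^ 2 + ENNReal.ofReal ((k : ℝ) ^ 2 + k * n) * ‖φ ξ‖ₑ ^ 2)
        ∂(gaussianMeasure m A k) := by
  have hφm' : Measurable fun ξ => ENNReal.ofReal ((k : ℝ) ^ 2) * ‖φ ξ‖ₑ ^ 2 :=
    (hφ.continuous_of_dist.measurable.enorm.pow_const 2).const_mul _
  -- `∇ (φ exp (-k |ξ|² / 2)) = exp (-k |ξ|² / 2) (∇φ - k φ ξ)`
  have h1 : ∀ᵐ ξ : cone m A ∂(coneMeasure m A), coneGrad v ξ =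
      gaussHalf k (ξ : EuclideanSpace ℝ (Fin n)) •
        (coneGrad φ ξ - ((k : ℝ) * φ ξ) • (ξ : EuclideanSpace ℝ (Fin n))) := by
    filter_upwards [ae_hasGradientAt φ] with ξ h
    have h2 := hasGradientAt_exp_mul_sq (-((k : ℝ) / 2)) (ξ : EuclideanSpace ℝ (Fin n))
    have h3 : (fun x : EuclideanSpace ℝ (Fin n) => Real.exp (-((k : ℝ) / 2) * ‖x‖ ^ 2)) =
        gaussHalf k := by
      funext x
      rw [gaussHalf]
      congr 1
      ring
    have h4 : Real.exp (-((k : ℝ) / 2) * ‖(ξ : EuclideanSpace ℝ (Fin n))‖ ^ 2) =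
        gaussHalf k (ξ : EuclideanSpace ℝ (Fin n)) := congrFun h3 _
    rw [h3, h4, hasGradientAt_iff_hasFDerivAt] at h2
    have h5 := (hasGradientAt_iff_hasFDerivAt.1 h.2).mul h2
    refine coneGrad_eq hv h.1 (g := coneExt φ * gaussHalf k) (fun ζ => ?_)
      (hasGradientAt_iff_hasFDerivAt.2 (h5.congr_fderiv ?_))
    · rw [Pi.mul_apply, coneExt_coe hφ, hvφ]
    · rw [coneExt_coe hφ, ← map_smul, ← map_smul, ← map_add]
      congr 1
      module
  have h2 : ENNReal.ofReal ((k : ℝ) ^ 2 + k * n) =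
      ENNReal.ofReal ((k : ℝ) ^ 2) + ENNReal.ofReal (k * n) :=
    ENNReal.ofReal_add (by positivity) (by positivity)
  have h3 : ∫⁻ ξ, (‖coneGrad φ ξ‖ₑ ^ 2 + ENNReal.ofReal ((k : ℝ) ^ 2 + k * n) * ‖φ ξ‖ₑ ^ 2)
        ∂(gaussianMeasure m A k) =
      (∫⁻ ξ, (‖coneGrad φ ξ‖ₑ ^ 2 + ENNReal.ofReal (k * n) * ‖φ ξ‖ₑ ^ 2)
        ∂(gaussianMeasure m A k)) +
      ∫⁻ ξ, ENNReal.ofReal ((k : ℝ) ^ 2) * ‖φ ξ‖ₑ ^ 2 ∂(gaussianMeasure m A k) := by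
    rw [← lintegral_add_right _ hφm']
    refine lintegral_congr fun ξ => ?_
    rw [h2]
    ring
  -- after the oscillator identity both integrands agree, up to the density of the Gaussian measure
  rw [h3, ← oscillator_identity hk hφ hR,
    ← lintegral_add_right _ hφm',
    lintegral_gaussianMeasure]
  refine lintegral_congr_ae ?_
  filter_upwards [h1] with ξ hξ
  have h4 : ‖v ξ‖ₑ ^ 2 =
      ENNReal.ofReal (gaussDensity k (ξ : EuclideanSpace ℝ (Fin n))) * ‖φ ξ‖ₑ ^ 2 := by
    rw [hvφ, enorm_mul, mul_pow, enorm_mul_self_gaussHalf, mul_comm]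
  have h5 : ‖((k : ℝ) * φ ξ) • (ξ : EuclideanSpace ℝ (Fin n))‖ₑ ^ 2 =
      ENNReal.ofReal ((k : ℝ) ^ 2 * ‖(ξ : EuclideanSpace ℝ (Fin n))‖ ^ 2) * ‖φ ξ‖ₑ ^ 2 := by
    rw [enorm_sq_eq_ofReal, enorm_sq_eq_ofReal, ← ENNReal.ofReal_mul (by positivity), norm_smul,
      norm_mul, Real.norm_natCast]
    congr 1
    ring
  have h6 : ENNReal.ofReal ((k : ℝ) ^ 2 * (1 + ‖(ξ : EuclideanSpace ℝ (Fin n))‖ ^ 2)) =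
      ENNReal.ofReal ((k : ℝ) ^ 2) +
        ENNReal.ofReal ((k : ℝ) ^ 2 * ‖(ξ : EuclideanSpace ℝ (Fin n))‖ ^ 2) := by
    rw [← ENNReal.ofReal_add (by positivity) (by positivity)]
    congr 1
    ring
  rw [hξ, enorm_smul, mul_pow, enorm_mul_self_gaussHalf, h4, h5, h6]
  ring

theorem contDiff_gaussHalf (k : ℕ) :
    ContDiff ℝ 1 (gaussHalf k : EuclideanSpace ℝ (Fin n) → ℝ) := by
  have h : (gaussHalf k : EuclideanSpace ℝ (Fin n) → ℝ) =
      fun x => Real.exp (-((k : ℝ) / 2) * ‖x‖ ^ 2) := by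
    funext x
    rw [gaussHalf]
    congr 1
    ring
  rw [h]
  exact contDiff_exp_mul_sq _

theorem contDiff_inv_gaussHalf (k : ℕ) :
    ContDiff ℝ 1 fun x : EuclideanSpace ℝ (Fin n) => (gaussHalf k x)⁻¹ :=
  (contDiff_gaussHalf k).inv fun x => (gaussHalf_pos k x).ne'

/-- The component of `f` along a mode is given by the Fourier coefficient, conjugated by the
ground state. -/
theorem adjoint_modeOp_eq {k j : ℕ} (hj : 0 < j) (b : Bool)
    {f : Lp ℝ 2 (limitMeasure m A)} {u : cone m A × S1 → ℝ}
    (hf : ∀ᵐ p ∂(limitMeasure m A), f p = u p) {g : Lp ℝ 2 (gaussianMeasure m A k)}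
    (hg : ∀ᵐ ξ : cone m A ∂(gaussianMeasure m A k),
      g ξ = modeCoeff j b u ξ * (gaussHalf k (ξ : EuclideanSpace ℝ (Fin n)))⁻¹) :
    ContinuousLinearMap.adjoint (modeOp k hj b) f = g := by
  refine ext_inner_left ℝ fun ψ => ?_
  rw [ContinuousLinearMap.adjoint_inner_right]
  have hI : Integrable (fun p : cone m A × S1 => modeFun k j b ψ p * u p) (limitMeasure m A) := by
    refine (L2.integrable_inner (𝕜 := ℝ) (modeOp k hj b ψ) f).congr ?_
    filter_upwards [modeOp_apply hj b ψ, hf] with p h1 h2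
    rw [Real.inner_apply, h1, h2]
  have h1 : inner ℝ (modeOp k hj b ψ) f = ∫ p, modeFun k j b ψ p * u p ∂(limitMeasure m A) := by
    rw [L2.inner_def]
    refine integral_congr_ae ?_
    filter_upwards [modeOp_apply hj b ψ, hf] with p h1 h2
    rw [Real.inner_apply, h1, h2]
  rw [h1, limitMeasure, integral_prod _ hI, L2.inner_def]
  have h2 : ∫ ξ, inner ℝ (ψ ξ) (g ξ) ∂(gaussianMeasure m A k) =
      ∫ ξ : cone m A, ψ ξ * (modeCoeff j b u ξ *
        (gaussHalf k (ξ : EuclideanSpace ℝ (Fin n)))⁻¹) ∂(gaussianMeasure m A k) := by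
    refine integral_congr_ae ?_
    filter_upwards [hg] with ξ h
    rw [Real.inner_apply, h]
  rw [h2, integral_gaussianMeasure]
  refine integral_congr_ae (Eventually.of_forall fun ξ => ?_)
  have h3 := (gaussHalf_pos k (ξ : EuclideanSpace ℝ (Fin n))).ne'
  have h4 : ∫ t, modeFun k j b ψ (ξ, t) * u (ξ, t) =
      gaussHalf k (ξ : EuclideanSpace ℝ (Fin n)) * ψ ξ * modeCoeff j b u ξ := by
    rw [modeCoeff, ← integral_const_mul]
    refine integral_congr_ae (Eventually.of_forall fun t => ?_)
    simp only [modeFun]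
    ring
  simp only [h4, ← gaussHalf_mul_self]
  field_simp

/-- The Gaussian energy of the component of `f` along a mode, shifted by the bottom of the spectrum
`k ^ 2 + k n`. -/
def modeEnergy (k : ℕ) {j : ℕ} (hj : 0 < j) (b : Bool) (f : Lp ℝ 2 (limitMeasure m A)) : ℝ≥0∞ :=
  liftNormSq (gaussGradient m A k).proj (ContinuousLinearMap.adjoint (modeOp k hj b) f) +
    ENNReal.ofReal ((k : ℝ) ^ 2 + k * n - 1) *
      ‖ContinuousLinearMap.adjoint (modeOp k hj b) f‖ₑ ^ 2

theorem lowerSemicontinuous_modeEnergy (k : ℕ) {j : ℕ} (hj : 0 < j) (b : Bool) :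
    LowerSemicontinuous
      (modeEnergy k hj b : Lp ℝ 2 (limitMeasure m A) → ℝ≥0∞) := by
  refine LowerSemicontinuous.add ((lowerSemicontinuous_liftNormSq _).comp
    (ContinuousLinearMap.continuous _)) (Continuous.lowerSemicontinuous ?_)
  exact (ENNReal.continuous_const_mul ENNReal.ofReal_ne_top).comp
    ((ENNReal.continuous_pow 2).comp (ContinuousLinearMap.continuous _).enorm)

/-- On the core the coefficient along a mode, divided by `exp (-k |ξ|² / 2)`, is a Lipschitz
function with bounded support, to which `ground_energy` applies. -/
theorem modeEnergy_le_of_core {j k : ℕ} (hk0 : 0 < k) (hj : 0 < j)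
    {u : cone m A × S1 → ℝ} (hu : IsLip dist u) {R : ℝ}
    (hR : ∀ p : cone m A × S1, R ≤ ‖(p.1 : EuclideanSpace ℝ (Fin n))‖ → u p = 0)
    {f : Lp ℝ 2 (limitMeasure m A)} (hf : ∀ᵐ p ∂(limitMeasure m A), f p = u p) (b : Bool) :
    modeEnergy k hj b f ≤ ∫⁻ ξ : cone m A, (‖coneGrad (modeCoeff j b u) ξ‖ₑ ^ 2 +
          ENNReal.ofReal ((k : ℝ) ^ 2 * (1 + ‖(ξ : EuclideanSpace ℝ (Fin n))‖ ^ 2)) *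
            ‖modeCoeff j b u ξ‖ₑ ^ 2) ∂(coneMeasure m A) := by
  have hv := isLip_modeCoeff j b hu
  have hvR : ∀ ξ : cone m A, R ≤ ‖(ξ : EuclideanSpace ℝ (Fin n))‖ → modeCoeff j b u ξ = 0 :=
    fun ξ hξ => modeCoeff_eq_zero j b fun t => hR (ξ, t) hξ
  have hφ := hv.mul_contDiff hvR (contDiff_inv_gaussHalf k)
  have hφR : ∀ ξ : cone m A, R ≤ ‖(ξ : EuclideanSpace ℝ (Fin n))‖ →
      modeCoeff j b u ξ * (gaussHalf k (ξ : EuclideanSpace ℝ (Fin n)))⁻¹ = 0 :=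
    fun ξ hξ => by rw [hvR ξ hξ, zero_mul]
  obtain ⟨w, hw⟩ := exists_isGradOf_gauss hk0 hφ hφR
  have hk1 : (1 : ℝ) ≤ k := by exact_mod_cast hk0
  have hk2 : (0 : ℝ) ≤ (k : ℝ) ^ 2 + k * n - 1 := by
    have : (0 : ℝ) ≤ k * n := by positivity
    nlinarith
  have hmem : w ∈ (gaussGradient m A k).closedGraph := Submodule.le_topologicalClosure _ ⟨_, hw⟩
  rw [modeEnergy, adjoint_modeOp_eq hj b hf hw.2.1,
    ground_energy hk0 hφ hφR hv fun ξ => (inv_mul_cancel_right₀ (gaussHalf_pos k _).ne' _).symm]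
  have h1 := liftNormSq_le (gaussGradient m A k).proj ⟨w, hmem⟩
  rw [(gaussGradient m A k).proj_apply] at h1
  have h2 : ‖(⟨w, hmem⟩ : (gaussGradient m A k).closedGraph)‖ₑ ^ 2 = ‖w.fst‖ₑ ^ 2 + ‖w.snd‖ₑ ^ 2 :=
    WithLp_enorm_sq w
  rw [h2] at h1
  obtain ⟨h3, h4⟩ := hw.lintegral_eq
  have h5 : ∫⁻ ξ : cone m A, (‖coneGrad (fun ξ : cone m A => modeCoeff j b u ξ *
        (gaussHalf k (ξ : EuclideanSpace ℝ (Fin n)))⁻¹) ξ‖ₑ ^ 2 +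
      ENNReal.ofReal ((k : ℝ) ^ 2 + k * n) * ‖modeCoeff j b u ξ *
        (gaussHalf k (ξ : EuclideanSpace ℝ (Fin n)))⁻¹‖ₑ ^ 2) ∂(gaussianMeasure m A k) =
      ‖w.snd‖ₑ ^ 2 + ENNReal.ofReal ((k : ℝ) ^ 2 + k * n) * ‖w.fst‖ₑ ^ 2 := by
    rw [lintegral_add_left ((measurable_coneGrad _).enorm.pow_const 2), lintegral_const_mul'
      _ _ ENNReal.ofReal_ne_top, h3]
    congr 1
  rw [h5]
  refine (add_le_add_left h1 _).trans (le_of_eq ?_)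
  have h6 : ENNReal.ofReal ((k : ℝ) ^ 2 + k * n) = 1 + ENNReal.ofReal ((k : ℝ) ^ 2 + k * n - 1) := by
    rw [← ENNReal.ofReal_one, ← ENNReal.ofReal_add zero_le_one hk2]
    congr 1
    ring
  rw [h6]
  ring

/-- The energy on the limit space dominates the shifted Gaussian energies of the components along
the two modes of frequency `j = k / l`. -/
theorem modeEnergy_le (hl : 0 < l) {j k : ℕ} (hj : 0 < j) (hk : k = j * l)
    {w : WithLp 2 (Lp ℝ 2 (limitMeasure m A) ×
      Lp (WithLp 2 (EuclideanSpace ℝ (Fin n) × ℝ)) 2 (limitMeasure m A))}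
    (hw : w ∈ (limitGradient hl m A).closedGraph) :
    modeEnergy k hj false w.fst + modeEnergy k hj true w.fst ≤ ‖w.snd‖ₑ ^ 2 := by
  have hk0 : 0 < k := hk ▸ Nat.mul_pos hj hl
  have hfst : Continuous fun w : WithLp 2 (Lp ℝ 2 (limitMeasure m A) ×
      Lp (WithLp 2 (EuclideanSpace ℝ (Fin n) × ℝ)) 2 (limitMeasure m A)) => w.fst :=
    (WithLp.fstL 2 ℝ _ _).continuous
  have hsnd : Continuous fun w : WithLp 2 (Lp ℝ 2 (limitMeasure m A) ×
      Lp (WithLp 2 (EuclideanSpace ℝ (Fin n) × ℝ)) 2 (limitMeasure m A)) => w.snd :=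
    (WithLp.sndL 2 ℝ _ _).continuous
  have hlsc := ((lowerSemicontinuous_modeEnergy (m := m) (A := A) k hj false).add
    (lowerSemicontinuous_modeEnergy k hj true)).comp hfst
  -- the inequality describes a closed set, by lower semicontinuity, so it suffices to prove it on
  -- the core
  have hclosed := hlsc.isClosed_epigraph.preimage
    (continuous_id.prodMk ((ENNReal.continuous_pow 2).comp hsnd.enorm))
  refine closure_minimal (fun w hw => ?_) hclosed (mem_closure_core_limit hl hw)
  obtain ⟨u, hu, R, hR⟩ := hw
  have hu' : IsLip dist u := hu.1.dist_of_limitDist hl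
  change modeEnergy k hj false w.fst + modeEnergy k hj true w.fst ≤ ‖w.snd‖ₑ ^ 2
  have hmeas : Measurable fun ξ : cone m A => ‖coneGrad (modeCoeff j false u) ξ‖ₑ ^ 2 +
      ENNReal.ofReal ((k : ℝ) ^ 2 * (1 + ‖(ξ : EuclideanSpace ℝ (Fin n))‖ ^ 2)) *
        ‖modeCoeff j false u ξ‖ₑ ^ 2 := by
    have h1 : Measurable fun ξ : cone m A => ‖coneGrad (modeCoeff j false u) ξ‖ₑ ^ 2 :=
      (measurable_coneGrad _).enorm.pow_const 2
    have h2 : Measurable fun ξ : cone m A => ‖modeCoeff j false u ξ‖ₑ ^ 2 :=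
      (isLip_modeCoeff j false hu').continuous_of_dist.measurable.enorm.pow_const 2
    fun_prop
  calc modeEnergy k hj false w.fst + modeEnergy k hj true w.fst
      ≤ _ := add_le_add (modeEnergy_le_of_core hk0 hj hu' hR hu.2.1 false)
        (modeEnergy_le_of_core hk0 hj hu' hR hu.2.1 true)
    _ ≤ ∫⁻ ξ, (∫⁻ t, ‖limitGrad l u (ξ, t)‖ₑ ^ 2) ∂(coneMeasure m A) := by
        rw [← lintegral_add_left hmeas]
        exact lintegral_mono_ae (modeCoeff_energy_le hj hk hu')
    _ = ‖w.snd‖ₑ ^ 2 := by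
        rw [← hu.lintegral_eq.2]
        exact (lintegral_prod _ ((measurable_limitGrad hl u).enorm.pow_const 2).aemeasurable).symm

end Comparison

/-! ### The ground state of the limit space -/

/-- A vector which attains the lower bound `‖q‖² ≥ ‖π q‖² + μ ⟨S π q, π q⟩` is determined by the
vanishing of the first variation. -/
theorem adjoint_eq_of_minimal {V H : Type*} [NormedAddCommGroup V] [InnerProductSpace ℝ V]
    [CompleteSpace V] [NormedAddCommGroup H] [InnerProductSpace ℝ H] [CompleteSpace H]
    (π : V →L[ℝ] H) (S : H →L[ℝ] H) (hS : ∀ f g, inner ℝ (S f) g = inner ℝ f (S g)) {μ : ℝ}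
    (hQ : ∀ q, ‖π q‖ ^ 2 + μ * inner ℝ (S (π q)) (π q) ≤ ‖q‖ ^ 2) {p : V} {E : H} (hp : π p = E)
    (hE : S E = E) (hle : ‖p‖ ^ 2 ≤ (1 + μ) * ‖E‖ ^ 2) :
    ContinuousLinearMap.adjoint π ((1 + μ) • E) = p := by
  refine ext_inner_right ℝ fun q => ?_
  rw [ContinuousLinearMap.adjoint_inner_left, real_inner_smul_left, eq_comm, ← sub_eq_zero]
  set β := inner ℝ p q - (1 + μ) * inner ℝ E (π q) with hβ
  set c := ‖q‖ ^ 2 - (‖π q‖ ^ 2 + μ * inner ℝ (S (π q)) (π q)) with hc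
  have hc0 : 0 ≤ c := sub_nonneg.2 (hQ q)
  -- the bound at `p + s q`, where the terms without `s` are controlled by `hle`
  have hvar : ∀ s : ℝ, 0 ≤ 2 * s * β + s ^ 2 * c := by
    intro s
    have h1 := hQ (p + s • q)
    rw [map_add, map_smul, hp, map_add, map_smul, hE, norm_add_sq_real, norm_add_sq_real,
      inner_add_left, inner_add_right, inner_add_right] at h1
    simp only [real_inner_smul_left, real_inner_smul_right, norm_smul, mul_pow, Real.norm_eq_abs,
      sq_abs, real_inner_self_eq_norm_sq, hS _ E, hE] at h1
    rw [real_inner_comm E (π q)] at h1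
    rw [hβ, hc]
    linarith
  -- at this value the quadratic expression is negative unless `β = 0`; the denominator `c + 1`
  -- does not vanish
  have h3 := hvar (-β / (c + 1))
  have h4 : 2 * (-β / (c + 1)) * β + (-β / (c + 1)) ^ 2 * c = -(β ^ 2 * (c + 2)) / (c + 1) ^ 2 := by
    field_simp
    ring
  rw [h4, le_div_iff₀ (by positivity), zero_mul] at h3
  have h5 : β ^ 2 = 0 := by nlinarith [sq_nonneg β]
  exact pow_eq_zero_iff two_ne_zero |>.1 h5

section GroundState

variable {n : ℕ} {l m : ℕ} {A : Matrix (Fin n) (Fin n) ℝ}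

theorem isLip_mul_circleMode (j : ℕ) (b : Bool) {v : cone m A → ℝ} (hv : IsLip dist v) {M : ℝ}
    (hM : ∀ ξ, |v ξ| ≤ M) :
    IsLip dist fun p : cone m A × S1 => v p.1 * circleMode j b p.2 := by
  obtain ⟨K, hK0, hK⟩ := hv.exists_nonneg fun _ _ => dist_nonneg
  refine ⟨K + M * j, fun p q => ?_⟩
  have h1 : dist p.1 q.1 ≤ dist p q := le_max_left _ _
  have h2 : dist p.2 q.2 ≤ dist p q := le_max_right _ _
  have hM0 : 0 ≤ M := (abs_nonneg _).trans (hM p.1)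
  have e : v q.1 * circleMode j b q.2 - v p.1 * circleMode j b p.2 =
      (v q.1 - v p.1) * circleMode j b q.2 + v p.1 * (circleMode j b q.2 - circleMode j b p.2) := by
    ring
  rw [e, add_mul]
  refine (abs_add_le _ _).trans (add_le_add ?_ ?_)
  · rw [abs_mul]
    calc |v q.1 - v p.1| * |circleMode j b q.2| ≤ K * dist p.1 q.1 * 1 :=
          mul_le_mul (hK _ _) (abs_circleMode_le j b _) (abs_nonneg _) (by positivity)
      _ ≤ K * dist p q := by rw [mul_one]; gcongr
  · rw [abs_mul, mul_assoc]
    refine mul_le_mul (hM _) ((abs_circleMode_sub_le j b _ _).trans ?_) (abs_nonneg _) hM0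
    gcongr

/-- The energy density of a product of a function on the cone and a mode of the circle. -/
theorem enorm_limitGrad_mul_circleMode {j k : ℕ} (hk : k = j * l) (b : Bool) {v : cone m A → ℝ}
    (hv : IsLip dist v) {M : ℝ} (hM : ∀ ξ, |v ξ| ≤ M) : ∀ᵐ p ∂(limitMeasure m A),
      ‖limitGrad l (fun p : cone m A × S1 => v p.1 * circleMode j b p.2) p‖ₑ ^ 2 =
        ‖coneGrad v p.1‖ₑ ^ 2 * ‖circleMode j b p.2‖ₑ ^ 2 +
        ENNReal.ofReal ((k : ℝ) ^ 2 * (1 + ‖(p.1 : EuclideanSpace ℝ (Fin n))‖ ^ 2)) *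
          ‖v p.1‖ₑ ^ 2 * ‖circleMode j (!b) p.2‖ₑ ^ 2 := by
  have h0 : ∀ᵐ p ∂(limitMeasure m A), (p.1 : EuclideanSpace ℝ (Fin n)) ∈ interior (cone m A) ∧
      HasGradientAt (coneExt v) (coneGrad v p.1) (p.1 : EuclideanSpace ℝ (Fin n)) :=
    Measure.quasiMeasurePreserving_fst.ae (ae_hasGradientAt v)
  filter_upwards [h0] with p hp
  set u : cone m A × S1 → ℝ := fun p => v p.1 * circleMode j b p.2
  -- the differential of the product in the lift to `ℝⁿ × ℝ`
  set L : EuclideanSpace ℝ (Fin n) × ℝ →L[ℝ] ℝ :=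
    coneExt v p.1 • ((modeSign b * j * realMode j (!b) (circleRep p.2)) •
      ContinuousLinearMap.snd ℝ (EuclideanSpace ℝ (Fin n)) ℝ) +
    realMode j b (circleRep p.2) • (InnerProductSpace.toDual ℝ (EuclideanSpace ℝ (Fin n))
      (coneGrad v p.1)).comp (ContinuousLinearMap.fst ℝ (EuclideanSpace ℝ (Fin n)) ℝ) with hL
  have hd : HasFDerivAt (fun z : EuclideanSpace ℝ (Fin n) × ℝ => coneExt v z.1 * realMode j b z.2)
      L (liftPoint p) := by
    have h1 : HasFDerivAt (fun z : EuclideanSpace ℝ (Fin n) × ℝ => coneExt v z.1) _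
      (liftPoint p) := HasFDerivAt.comp (liftPoint p)
        (hasGradientAt_iff_hasFDerivAt.1 hp.2) hasFDerivAt_fst
    have h2 : HasFDerivAt (fun z : EuclideanSpace ℝ (Fin n) × ℝ => realMode j b z.2)
        ((modeSign b * j * realMode j (!b) (circleRep p.2)) •
          ContinuousLinearMap.snd ℝ (EuclideanSpace ℝ (Fin n)) ℝ) (liftPoint p) :=
      HasDerivAt.comp_hasFDerivAt (h₂ := realMode j b) (liftPoint p)
        (hasDerivAt_realMode j b (circleRep p.2)) hasFDerivAt_snd
    exact h1.mul h2
  have hLp : limitDeriv u p = L := by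
    refine limitDeriv_eq (isLip_mul_circleMode j b hv hM) hp.1 (fun ξ t => ?_) hd
    simp only [circleMode_coe, coneExt_coe hv]
  have hvec : vecPart L = circleMode j b p.2 • coneGrad v p.1 := by
    refine ext_inner_right ℝ fun y => ?_
    rw [inner_vecPart, real_inner_smul_left, hL]
    have h3 : circleMode j b p.2 = realMode j b (circleRep p.2) := by
      rw [← circleMode_coe, coe_circleRep]
    simp [h3]
  have hsnd : L (0, 1) = v p.1 * (modeSign b * j * circleMode j (!b) p.2) := by
    have h3 : circleMode j (!b) p.2 = realMode j (!b) (circleRep p.2) := by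
      rw [← circleMode_coe, coe_circleRep]
    rw [hL, h3, coneExt_coe hv]
    simp
  rw [limitGrad, hLp, enorm_sq_limitSharp, hvec, hsnd, enorm_smul, mul_pow, mul_comm (_ ^ 2)]
  congr 1
  rw [enorm_sq_eq_ofReal, enorm_sq_eq_ofReal, enorm_sq_eq_ofReal,
    ← ENNReal.ofReal_mul (by positivity), ← ENNReal.ofReal_mul (by positivity)]
  congr 1
  simp only [Real.norm_eq_abs, sq_abs, mul_pow, inv_fiberScale_sq, modeSign_sq, hk]
  push_cast
  ring

/-- A Lipschitz function on the Gaussian cone with bounded support gives an element of the form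
domain of the limit space, and its energy is the Gaussian energy, shifted by `k ^ 2 + k n`. -/
theorem exists_modeOp_of_core (hl : 0 < l) {j k : ℕ} (hj : 0 < j) (hk : k = j * l) (b : Bool)
    {w : WithLp 2 (Lp ℝ 2 (gaussianMeasure m A k) ×
      Lp (EuclideanSpace ℝ (Fin n)) 2 (gaussianMeasure m A k))} {φ : cone m A → ℝ}
    (hw : (gaussGradient m A k).IsGradOf w φ) {R : ℝ}
    (hR : ∀ ξ : cone m A, R ≤ ‖(ξ : EuclideanSpace ℝ (Fin n))‖ → φ ξ = 0) :
    ∃ p ∈ (limitGradient hl m A).closedGraph, p.fst = modeOp k hj b w.fst ∧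
      ‖p.snd‖ₑ ^ 2 = ‖w.snd‖ₑ ^ 2 + ENNReal.ofReal ((k : ℝ) ^ 2 + k * n) * ‖w.fst‖ₑ ^ 2 := by
  have hk0 : 0 < k := hk ▸ Nat.mul_pos hj hl
  have hφ : IsLip dist φ := hw.1
  set v : cone m A → ℝ := fun ξ => φ ξ * gaussHalf k (ξ : EuclideanSpace ℝ (Fin n)) with hv
  have hvL : IsLip dist v := hφ.mul_contDiff hR (contDiff_gaussHalf k)
  have hvR : ∀ ξ : cone m A, R ≤ ‖(ξ : EuclideanSpace ℝ (Fin n))‖ → v ξ = 0 := fun ξ hξ => by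
    rw [hv]
    simp only [hR ξ hξ, zero_mul]
  obtain ⟨M, hM⟩ := exists_bound_of_support hvL hvR
  have huL := isLip_mul_circleMode j b hvL hM
  have huR : ∀ p : cone m A × S1, R ≤ ‖(p.1 : EuclideanSpace ℝ (Fin n))‖ →
      v p.1 * circleMode j b p.2 = 0 := fun p hp => by rw [hvR p.1 hp, zero_mul]
  have huM : ∀ p : cone m A × S1, |v p.1 * circleMode j b p.2| ≤ M := fun p => by
    rw [abs_mul]
    refine (mul_le_mul (hM _) (abs_circleMode_le j b _) (abs_nonneg _)
      ((abs_nonneg _).trans (hM p.1))).trans (mul_one M).le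
  obtain ⟨p, hp⟩ := exists_isGradOf_limit hl (huL.limitDist_of_dist hl huM huR) huR
  refine ⟨p, Submodule.le_topologicalClosure _ ⟨_, hp⟩, ?_, ?_⟩
  · refine Lp.ext ?_
    filter_upwards [hp.2.1, modeOp_apply hj b w.fst, ae_fst_of_gauss hw.2.1] with q h1 h2 h3
    rw [h1, h2, modeFun, h3]
    ring
  · obtain ⟨h1, h2⟩ := hw.lintegral_eq
    have h3 : ∫⁻ ξ, (‖coneGrad φ ξ‖ₑ ^ 2 + ENNReal.ofReal ((k : ℝ) ^ 2 + k * n) * ‖φ ξ‖ₑ ^ 2)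
        ∂(gaussianMeasure m A k) =
        ‖w.snd‖ₑ ^ 2 + ENNReal.ofReal ((k : ℝ) ^ 2 + k * n) * ‖w.fst‖ₑ ^ 2 := by
      rw [lintegral_add_left ((measurable_coneGrad _).enorm.pow_const 2), lintegral_const_mul'
        _ _ ENNReal.ofReal_ne_top, h1]
      congr 1
    rw [← h3, ← ground_energy hk0 hφ hR hvL fun _ => rfl, ← hp.lintegral_eq.2]
    refine (lintegral_congr_ae (enorm_limitGrad_mul_circleMode hk b hvL hM)).trans ?_
    have hm1 : Measurable fun ξ : cone m A => ‖coneGrad v ξ‖ₑ ^ 2 :=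
      (measurable_coneGrad _).enorm.pow_const 2
    have hm2 : Measurable fun ξ : cone m A =>
        ENNReal.ofReal ((k : ℝ) ^ 2 * (1 + ‖(ξ : EuclideanSpace ℝ (Fin n))‖ ^ 2)) * ‖v ξ‖ₑ ^ 2 := by
      have h2 : Measurable fun ξ : cone m A => ‖v ξ‖ₑ ^ 2 :=
        hvL.continuous_of_dist.measurable.enorm.pow_const 2
      fun_prop
    have hm3 : ∀ c : Bool, Measurable fun t : S1 => ‖circleMode j c t‖ₑ ^ 2 := fun c =>
      (continuous_circleMode j c).measurable.enorm.pow_const 2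
    have hm4 : Measurable fun p : cone m A × S1 =>
        ‖coneGrad v p.1‖ₑ ^ 2 * ‖circleMode j b p.2‖ₑ ^ 2 :=
      (hm1.comp measurable_fst).mul ((hm3 b).comp measurable_snd)
    rw [lintegral_add_left hm4, limitMeasure, lintegral_prod_mul (f := fun ξ : cone m A => ‖coneGrad v ξ‖ₑ ^ 2)
        (g := fun t => ‖circleMode j b t‖ₑ ^ 2) hm1.aemeasurable (hm3 b).aemeasurable,
      lintegral_prod_mul (f := fun ξ : cone m A =>
        ENNReal.ofReal ((k : ℝ) ^ 2 * (1 + ‖(ξ : EuclideanSpace ℝ (Fin n))‖ ^ 2)) * ‖v ξ‖ₑ ^ 2)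
        (g := fun t => ‖circleMode j (!b) t‖ₑ ^ 2) hm2.aemeasurable (hm3 _).aemeasurable,
      lintegral_enorm_circleMode_sq hj, lintegral_enorm_circleMode_sq hj, mul_one, mul_one,
      lintegral_add_left hm1]

theorem norm_modeOp {j k : ℕ} (hj : 0 < j) (b : Bool) (f : Lp ℝ 2 (gaussianMeasure m A k)) :
    ‖modeOp k hj b f‖ = ‖f‖ := by
  have h := inner_modeOp hj b b f f
  rw [if_pos rfl, real_inner_self_eq_norm_sq, real_inner_self_eq_norm_sq] at h
  exact (sq_eq_sq₀ (norm_nonneg _) (norm_nonneg _)).1 h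

/-- The upper bound for the energy of `modeOp φ`, extended from the core to the form domain by
lower semicontinuity. -/
theorem liftNormSq_modeOp_le (hl : 0 < l) {j k : ℕ} (hj : 0 < j) (hk : k = j * l) (b : Bool)
    {w : WithLp 2 (Lp ℝ 2 (gaussianMeasure m A k) ×
      Lp (EuclideanSpace ℝ (Fin n)) 2 (gaussianMeasure m A k))}
    (hw : w ∈ (gaussGradient m A k).closedGraph) :
    liftNormSq (limitGradient hl m A).proj (modeOp k hj b w.fst) ≤
      ‖w.snd‖ₑ ^ 2 + ENNReal.ofReal (1 + ((k : ℝ) ^ 2 + k * n)) * ‖w.fst‖ₑ ^ 2 := by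
  have hfst : Continuous fun w : WithLp 2 (Lp ℝ 2 (gaussianMeasure m A k) ×
      Lp (EuclideanSpace ℝ (Fin n)) 2 (gaussianMeasure m A k)) => w.fst :=
    (WithLp.fstL 2 ℝ _ _).continuous
  have hsnd : Continuous fun w : WithLp 2 (Lp ℝ 2 (gaussianMeasure m A k) ×
      Lp (EuclideanSpace ℝ (Fin n)) 2 (gaussianMeasure m A k)) => w.snd :=
    (WithLp.sndL 2 ℝ _ _).continuous
  have hlsc := (lowerSemicontinuous_liftNormSq (limitGradient hl m A).proj).comp
    ((modeOp k hj b).continuous.comp hfst)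
  -- the bound describes a closed set, so the core suffices
  have hclosed := hlsc.isClosed_epigraph.preimage (continuous_id.prodMk
    (((ENNReal.continuous_pow 2).comp hsnd.enorm).add
      ((ENNReal.continuous_const_mul (ENNReal.ofReal_ne_top
        (r := 1 + ((k : ℝ) ^ 2 + k * n)))).comp ((ENNReal.continuous_pow 2).comp hfst.enorm))))
  refine closure_minimal (fun w hw => ?_) hclosed (mem_closure_core_gauss hw)
  obtain ⟨φ, hφ, R, hR⟩ := hw
  obtain ⟨p, hp, hp1, hp2⟩ := exists_modeOp_of_core hl hj hk b hφ hR
  change liftNormSq (limitGradient hl m A).proj (modeOp k hj b w.fst) ≤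
      ‖w.snd‖ₑ ^ 2 + ENNReal.ofReal (1 + ((k : ℝ) ^ 2 + k * n)) * ‖w.fst‖ₑ ^ 2
  have h1 := liftNormSq_le (limitGradient hl m A).proj ⟨p, hp⟩
  have h2 : ‖(⟨p, hp⟩ : (limitGradient hl m A).closedGraph)‖ₑ ^ 2 = ‖p.fst‖ₑ ^ 2 + ‖p.snd‖ₑ ^ 2 :=
    WithLp_enorm_sq p
  rw [(limitGradient hl m A).proj_apply, h2, hp2, hp1] at h1
  refine h1.trans (le_of_eq ?_)
  rw [enorm_sq_eq_ofReal, norm_modeOp, ← enorm_sq_eq_ofReal, ENNReal.ofReal_add zero_le_one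
    (by positivity), ENNReal.ofReal_one]
  ring

/-- Every mode component contributes at least `k ^ 2 + k n` times its square norm to the energy. -/
theorem mul_sq_modes_le (hl : 0 < l) {j k : ℕ} (hj : 0 < j) (hk : k = j * l)
    {w : WithLp 2 (Lp ℝ 2 (limitMeasure m A) ×
      Lp (WithLp 2 (EuclideanSpace ℝ (Fin n) × ℝ)) 2 (limitMeasure m A))}
    (hw : w ∈ (limitGradient hl m A).closedGraph) :
    ((k : ℝ) ^ 2 + k * n) *
      (‖ContinuousLinearMap.adjoint (modeOp k hj false) w.fst‖ ^ 2 +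
        ‖ContinuousLinearMap.adjoint (modeOp k hj true) w.fst‖ ^ 2) ≤ ‖w.snd‖ ^ 2 := by
  have hk0 : 0 < k := hk ▸ Nat.mul_pos hj hl
  have hk1 : (1 : ℝ) ≤ k := by exact_mod_cast hk0
  have hk2 : (0 : ℝ) ≤ (k : ℝ) ^ 2 + k * n - 1 := by
    have : (0 : ℝ) ≤ k * n := by positivity
    nlinarith
  have h1 : ∀ b : Bool, ENNReal.ofReal (((k : ℝ) ^ 2 + k * n) *
      ‖ContinuousLinearMap.adjoint (modeOp k hj b) w.fst‖ ^ 2) ≤ modeEnergy k hj b w.fst := by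
    intro b
    have h2 : ‖ContinuousLinearMap.adjoint (modeOp k hj b) w.fst‖ₑ ^ 2 ≤
        liftNormSq (gaussGradient m A k).proj
          (ContinuousLinearMap.adjoint (modeOp k hj b) w.fst) := by
      rw [← (gaussGradient m A k).isRelaxation]
      exact le_add_self
    refine le_trans (le_of_eq ?_) (add_le_add_left h2 _)
    rw [enorm_sq_eq_ofReal, ← ENNReal.ofReal_mul hk2, ← ENNReal.ofReal_add (by positivity)
      (by positivity)]
    congr 1
    ring
  have h3 := (add_le_add (h1 false) (h1 true)).trans (modeEnergy_le hl hj hk hw)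
  rw [enorm_sq_eq_ofReal, ← ENNReal.ofReal_add (by positivity) (by positivity),
    ENNReal.ofReal_le_ofReal_iff (by positivity)] at h3
  linarith

/-- The orthogonal projection onto the span of the two modes of frequency `j`. -/
def modeProj (k : ℕ) {j : ℕ} (hj : 0 < j) :
    Lp ℝ 2 (limitMeasure m A) →L[ℝ] Lp ℝ 2 (limitMeasure m A) :=
  modeOp k hj false ∘L ContinuousLinearMap.adjoint (modeOp k hj false) +
    modeOp k hj true ∘L ContinuousLinearMap.adjoint (modeOp k hj true)

theorem inner_modeProj (k : ℕ) {j : ℕ} (hj : 0 < j) (f g : Lp ℝ 2 (limitMeasure m A)) :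
    inner ℝ (modeProj k hj f) g =
      inner ℝ (ContinuousLinearMap.adjoint (modeOp k hj false) f)
        (ContinuousLinearMap.adjoint (modeOp k hj false) g) +
      inner ℝ (ContinuousLinearMap.adjoint (modeOp k hj true) f)
        (ContinuousLinearMap.adjoint (modeOp k hj true) g) := by
  rw [ContinuousLinearMap.adjoint_inner_right, ContinuousLinearMap.adjoint_inner_right,
    ← inner_add_left]
  rfl

theorem modeProj_symm (k : ℕ) {j : ℕ} (hj : 0 < j) (f g : Lp ℝ 2 (limitMeasure m A)) :
    inner ℝ (modeProj k hj f) g = inner ℝ f (modeProj k hj g) := by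
  rw [inner_modeProj, ← real_inner_comm f, inner_modeProj]
  congr 1 <;> exact real_inner_comm _ _

theorem modeProj_modeOp {j k : ℕ} (hj : 0 < j) (b : Bool) (f : Lp ℝ 2 (gaussianMeasure m A k)) :
    modeProj k hj (modeOp k hj b f) = modeOp k hj b f := by
  change modeOp k hj false (ContinuousLinearMap.adjoint (modeOp k hj false) (modeOp k hj b f)) +
    modeOp k hj true (ContinuousLinearMap.adjoint (modeOp k hj true) (modeOp k hj b f)) = _
  rw [adjoint_modeOp_modeOp, adjoint_modeOp_modeOp]
  cases b <;> simp

theorem sq_norm_closedGraph {X F : Type*} [MeasurableSpace X] {d : X → X → ℝ} {ν : Measure X}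
    [NormedAddCommGroup F] [InnerProductSpace ℝ F] (D : LipGradient d ν F) (q : D.closedGraph) :
    ‖q‖ ^ 2 = ‖D.proj q‖ ^ 2 + ‖(q : WithLp 2 (Lp ℝ 2 ν × Lp F 2 ν)).snd‖ ^ 2 :=
  WithLp.prod_norm_sq_eq_of_L2 _

/-- The modes of the ground state attain the lower bound `mul_sq_modes_le`. -/
theorem exists_ground_lift (hl : 0 < l) {j k : ℕ} (hj : 0 < j) (hk : k = j * l) (b : Bool)
    [IsFiniteMeasure (gaussianMeasure m A k)] :
    ∃ p, (limitGradient hl m A).proj p = modeOp k hj b (gaussOne m A k) ∧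
      ‖p‖ ^ 2 ≤ (1 + ((k : ℝ) ^ 2 + k * n)) * ‖modeOp k hj b (gaussOne m A k)‖ ^ 2 := by
  have h1 := liftNormSq_modeOp_le hl hj hk b (gaussOne_mem_closedGraph (m := m) (A := A) k)
  change liftNormSq (limitGradient hl m A).proj (modeOp k hj b (gaussOne m A k)) ≤
    ‖(0 : Lp (EuclideanSpace ℝ (Fin n)) 2 (gaussianMeasure m A k))‖ₑ ^ 2 +
      ENNReal.ofReal (1 + ((k : ℝ) ^ 2 + k * n)) * ‖gaussOne m A k‖ₑ ^ 2 at h1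
  rw [enorm_zero, zero_pow two_ne_zero, zero_add, enorm_sq_eq_ofReal, ← norm_modeOp hj b,
    ← ENNReal.ofReal_mul (by positivity)] at h1
  obtain ⟨w, hw⟩ : ∃ w, (limitGradient hl m A).proj w = modeOp k hj b (gaussOne m A k) := by
    by_contra! hcon
    have h2 : liftNormSq (limitGradient hl m A).proj (modeOp k hj b (gaussOne m A k)) = ⊤ := by
      simp [liftNormSq, hcon]
    rw [h2, top_le_iff] at h1
    exact ENNReal.ofReal_ne_top h1
  obtain ⟨p, hp, hpw⟩ := exists_orthogonal_lift (limitGradient hl m A).proj w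
  rw [hw] at hpw
  refine ⟨p, hpw, ?_⟩
  have h2 := liftNormSq_of_mem_orthogonal (limitGradient hl m A).proj hp
  rw [hpw] at h2
  rwa [h2, enorm_sq_eq_ofReal, ENNReal.ofReal_le_ofReal_iff (by positivity)] at h1

/-- The modes of the ground state are eigenfunctions for the eigenvalue `k ^ 2 + k n`: they attain
the lower bound `mul_sq_modes_le`, so the first variation vanishes. -/
theorem resolvent_ground (hl : 0 < l) {j k : ℕ} (hj : 0 < j) (hk : k = j * l) (b : Bool)
    [IsFiniteMeasure (gaussianMeasure m A k)] :
    (limitGradient hl m A).resolvent ((1 + ((k : ℝ) ^ 2 + k * n)) •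
      modeOp k hj b (gaussOne m A k)) = modeOp k hj b (gaussOne m A k) := by
  obtain ⟨p, hp, hle⟩ := exists_ground_lift (m := m) (A := A) hl hj hk b
  have hQ : ∀ q, ‖(limitGradient hl m A).proj q‖ ^ 2 + ((k : ℝ) ^ 2 + k * n) *
      inner ℝ (modeProj k hj ((limitGradient hl m A).proj q)) ((limitGradient hl m A).proj q) ≤
      ‖q‖ ^ 2 := fun q => by
    have h3 := mul_sq_modes_le hl hj hk q.2
    rw [sq_norm_closedGraph, inner_modeProj, real_inner_self_eq_norm_sq,
      real_inner_self_eq_norm_sq, (limitGradient hl m A).proj_apply]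
    exact add_le_add_right h3 _
  have h4 := adjoint_eq_of_minimal (limitGradient hl m A).proj (modeProj k hj)
    (modeProj_symm k hj) hQ hp (modeProj_modeOp hj b _) hle
  exact (congrArg (limitGradient hl m A).proj h4).trans hp

end GroundState

/-! ### Real and imaginary parts of square integrable functions -/

section ComplexParts

variable {X : Type*} [MeasurableSpace X] {ν : Measure X}

theorem ae_rePart (f : Lp ℂ 2 ν) : ∀ᵐ x ∂ν, rePart f x = (f x).re :=
  Complex.reCLM.coeFn_compLp f

theorem ae_imPart (f : Lp ℂ 2 ν) : ∀ᵐ x ∂ν, imPart f x = (f x).im :=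
  Complex.imCLM.coeFn_compLp f

/-- The complex function with given real and imaginary part. -/
def complexOf (a b : Lp ℝ 2 ν) : Lp ℂ 2 ν :=
  Complex.ofRealCLM.compLpL 2 ν a + Complex.I • Complex.ofRealCLM.compLpL 2 ν b

theorem ae_complexOf (a b : Lp ℝ 2 ν) : ∀ᵐ x ∂ν, complexOf a b x = a x + Complex.I * b x := by
  filter_upwards [Lp.coeFn_add (Complex.ofRealCLM.compLpL 2 ν a)
      (Complex.I • Complex.ofRealCLM.compLpL 2 ν b),
    Lp.coeFn_smul Complex.I (Complex.ofRealCLM.compLpL 2 ν b),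
    Complex.ofRealCLM.coeFn_compLpL (p := 2) a, Complex.ofRealCLM.coeFn_compLpL (p := 2) b]
    with x h1 h2 h3 h4
  rw [complexOf, h1, Pi.add_apply, h2, Pi.smul_apply, h3, h4]
  rfl

@[simp]
theorem rePart_complexOf (a b : Lp ℝ 2 ν) : rePart (complexOf a b) = a := by
  refine Lp.ext ?_
  filter_upwards [ae_rePart (complexOf a b), ae_complexOf a b] with x h1 h2
  rw [h1, h2]
  simp

@[simp]
theorem imPart_complexOf (a b : Lp ℝ 2 ν) : imPart (complexOf a b) = b := by
  refine Lp.ext ?_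
  filter_upwards [ae_imPart (complexOf a b), ae_complexOf a b] with x h1 h2
  rw [h1, h2]
  simp

theorem ext_rePart_imPart {f g : Lp ℂ 2 ν} (h1 : rePart f = rePart g) (h2 : imPart f = imPart g) :
    f = g := by
  refine Lp.ext ?_
  filter_upwards [ae_rePart f, ae_imPart f, ae_rePart g, ae_imPart g] with x a1 a2 a3 a4
  refine Complex.ext ?_ ?_
  · rw [← a1, ← a3, h1]
  · rw [← a2, ← a4, h2]

theorem rePart_add (f g : Lp ℂ 2 ν) : rePart (f + g) = rePart f + rePart g :=
  map_add (Complex.reCLM.compLpL 2 ν) f g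

theorem imPart_add (f g : Lp ℂ 2 ν) : imPart (f + g) = imPart f + imPart g :=
  map_add (Complex.imCLM.compLpL 2 ν) f g

theorem rePart_smul (c : ℂ) (f : Lp ℂ 2 ν) :
    rePart (c • f) = c.re • rePart f - c.im • imPart f := by
  refine Lp.ext ?_
  filter_upwards [ae_rePart (c • f), Lp.coeFn_smul c f, ae_rePart f, ae_imPart f,
    Lp.coeFn_sub (c.re • rePart f) (c.im • imPart f), Lp.coeFn_smul c.re (rePart f),
    Lp.coeFn_smul c.im (imPart f)] with x h1 h2 h3 h4 h5 h6 h7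
  rw [h1, h2, h5, Pi.sub_apply, h6, h7, Pi.smul_apply, Pi.smul_apply, Pi.smul_apply, h3, h4]
  simp

theorem imPart_smul (c : ℂ) (f : Lp ℂ 2 ν) :
    imPart (c • f) = c.re • imPart f + c.im • rePart f := by
  refine Lp.ext ?_
  filter_upwards [ae_imPart (c • f), Lp.coeFn_smul c f, ae_rePart f, ae_imPart f,
    Lp.coeFn_add (c.re • imPart f) (c.im • rePart f), Lp.coeFn_smul c.re (imPart f),
    Lp.coeFn_smul c.im (rePart f)] with x h1 h2 h3 h4 h5 h6 h7
  rw [h1, h2, h5, Pi.add_apply, h6, h7, Pi.smul_apply, Pi.smul_apply, Pi.smul_apply, h3, h4]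
  simp

theorem inner_complex_eq (f g : Lp ℂ 2 ν) : inner ℂ f g =
    ((inner ℝ (rePart f) (rePart g) + inner ℝ (imPart f) (imPart g) : ℝ) : ℂ) +
      ((inner ℝ (rePart f) (imPart g) - inner ℝ (imPart f) (rePart g) : ℝ) : ℂ) * Complex.I := by
  have hi : ∀ a b : Lp ℝ 2 ν, Integrable (fun x => inner ℝ (a x) (b x)) ν := fun a b =>
    L2.integrable_inner a b
  rw [L2.inner_def, L2.inner_def, L2.inner_def, L2.inner_def, L2.inner_def, ← integral_add (hi _ _)
    (hi _ _), ← integral_sub (hi _ _) (hi _ _), ← integral_complex_ofReal, ← integral_complex_ofReal,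
    ← integral_mul_const, ← integral_add]
  · refine integral_congr_ae ?_
    filter_upwards [ae_rePart f, ae_imPart f, ae_rePart g, ae_imPart g] with x a1 a2 a3 a4
    rw [a1, a2, a3, a4]
    refine Complex.ext ?_ ?_
    · simp
    · simp
      ring
  · exact ((hi _ _).add (hi _ _)).ofReal
  · exact ((hi _ _).sub (hi _ _)).ofReal.mul_const _

end ComplexParts

/-! ### The isotypic part of `L²` of the limit space -/

section Isotypic

variable {n : ℕ} {l m : ℕ} {A : Matrix (Fin n) (Fin n) ℝ}

theorem mem_rhoPart_iff {k : ℕ} {f : Lp ℂ 2 (limitMeasure m A)} : f ∈ rhoPart l m A k ↔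
    ∀ τ : S1, fourier (k : ℤ) τ • Lp.compMeasurePreserving (circleAct l m A τ)
      (measurePreserving_circleAct l m A τ) f = f := by
  simp only [rhoPart, Submodule.mem_iInf, LinearMap.mem_ker]
  refine forall_congr' fun τ => ?_
  exact sub_eq_zero

theorem fourier_mul_eq (j l : ℕ) (τ : S1) :
    fourier ((j * l : ℕ) : ℤ) τ = fourier (j : ℤ) (l • τ) := by
  rw [fourier_apply, fourier_apply]
  congr 2
  push_cast
  rw [mul_smul, natCast_zsmul, natCast_zsmul, natCast_zsmul]

theorem mem_rhoPart_iff_ae {k : ℕ} {f : Lp ℂ 2 (limitMeasure m A)} : f ∈ rhoPart l m A k ↔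
    ∀ τ : S1, ∀ᵐ p ∂(limitMeasure m A), fourier (k : ℤ) τ * f (circleAct l m A τ p) = f p := by
  rw [mem_rhoPart_iff]
  refine forall_congr' fun τ => ?_
  have h : ∀ᵐ p ∂(limitMeasure m A), (fourier (k : ℤ) τ • Lp.compMeasurePreserving
      (circleAct l m A τ) (measurePreserving_circleAct l m A τ) f) p =
      fourier (k : ℤ) τ * f (circleAct l m A τ p) := by
    filter_upwards [Lp.coeFn_smul (fourier (k : ℤ) τ) (Lp.compMeasurePreserving
      (circleAct l m A τ) (measurePreserving_circleAct l m A τ) f),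
      Lp.coeFn_compMeasurePreserving f (measurePreserving_circleAct l m A τ)] with p h1 h2
    rw [h1, Pi.smul_apply, h2]
    rfl
  constructor
  · intro hf
    rw [hf] at h
    filter_upwards [h] with p hp
    exact hp.symm
  · intro hf
    refine Lp.ext ?_
    filter_upwards [h, hf] with p h1 h2
    rw [h1, h2]

theorem surjective_nsmul_circle (hl : 0 < l) (s : S1) : ∃ τ : S1, l • τ = s := by
  refine ⟨((circleRep s / l : ℝ) : S1), ?_⟩
  have hl' : (l : ℝ) ≠ 0 := by exact_mod_cast hl.ne'
  rw [← AddCircle.coe_nsmul, nsmul_eq_mul, mul_div_cancel₀ _ hl', coe_circleRep]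

/-- An element of the isotypic part is `exp (-i j t)` times a function on the cone. -/
theorem exists_factor_of_mem_rhoPart (hl : 0 < l) {j k : ℕ} (hk : k = j * l)
    {f : Lp ℂ 2 (limitMeasure m A)} (hf : f ∈ rhoPart l m A k) :
    ∃ G : cone m A → ℂ, StronglyMeasurable G ∧
      ∀ᵐ p ∂(limitMeasure m A), f p = fourier (-(j : ℤ)) p.2 * G p.1 := by
  have hfm : StronglyMeasurable f := Lp.stronglyMeasurable f
  have h1 : ∀ s : S1, ∀ᵐ p ∂(limitMeasure m A), fourier (j : ℤ) s * f (p.1, p.2 + s) = f p := by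
    intro s
    obtain ⟨τ, rfl⟩ := surjective_nsmul_circle hl s
    have h2 := mem_rhoPart_iff_ae.1 hf τ
    rw [hk, fourier_mul_eq] at h2
    exact h2
  have hmeas : MeasurableSet {z : S1 × (cone m A × S1) |
      fourier (j : ℤ) z.1 * f (z.2.1, z.2.2 + z.1) = f z.2} := by
    refine measurableSet_eq_fun ?_ (hfm.measurable.comp measurable_snd)
    refine ((fourier (j : ℤ)).continuous.measurable.comp measurable_fst).mul
      (hfm.measurable.comp ?_)
    exact (measurable_fst.comp measurable_snd).prodMk
      ((measurable_snd.comp measurable_snd).add measurable_fst)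
  have : SFinite (limitMeasure m A) := by
    unfold limitMeasure
    infer_instance
  -- Fubini: the exceptional null set can be taken in the rotation variable
  have h2 : ∀ᵐ p ∂(limitMeasure m A), ∀ᵐ s : S1, fourier (j : ℤ) s * f (p.1, p.2 + s) = f p :=
    (Measure.ae_ae_comm hmeas).1 (Eventually.of_forall h1)
  -- average `f` along the circle
  refine ⟨fun ξ => ((2 * Real.pi : ℝ) : ℂ)⁻¹ * ∫ s, fourier (j : ℤ) s * f (ξ, s), ?_, ?_⟩
  · refine stronglyMeasurable_const.mul (StronglyMeasurable.integral_prod_right (f := fun ξ s =>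
      fourier (j : ℤ) s * f (ξ, s)) ?_)
    exact ((fourier (j : ℤ)).continuous.stronglyMeasurable.comp_measurable measurable_snd).mul hfm
  · filter_upwards [h2] with p hp
    have h3 : ∫ s, fourier (j : ℤ) s * f (p.1, p.2 + s) = ((2 * Real.pi : ℝ) : ℂ) * f p := by
      rw [integral_congr_ae hp, integral_const, Measure.real, AddCircle.measure_univ,
        ENNReal.toReal_ofReal Real.two_pi_pos.le]
      exact Complex.real_smul
    have h4 : ∫ s, fourier (j : ℤ) s * f (p.1, p.2 + s) =
        fourier (-(j : ℤ)) p.2 * ∫ s, fourier (j : ℤ) s * f (p.1, s) := by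
      rw [← integral_add_left_eq_self (fun s => fourier (j : ℤ) s * f (p.1, s)) p.2,
        ← integral_const_mul]
      refine integral_congr_ae (Eventually.of_forall fun s => ?_)
      have h5 : (fourier (j : ℤ) (p.2 + s) : ℂ) = fourier (j : ℤ) p.2 * fourier (j : ℤ) s := by
        rw [fourier_apply, fourier_apply, fourier_apply, smul_add, AddCircle.toCircle_add,
          Circle.coe_mul]
      have h6 : (fourier (-(j : ℤ)) p.2 : ℂ) * fourier (j : ℤ) p.2 = 1 := by
        rw [← fourier_add, neg_add_cancel, fourier_zero]
      simp only [h5]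
      rw [← mul_assoc, ← mul_assoc, h6, one_mul]
    have hpi : ((2 * Real.pi : ℝ) : ℂ) ≠ 0 := by exact_mod_cast Real.two_pi_pos.ne'
    rw [mul_left_comm, ← h4, h3, inv_mul_cancel_left₀ hpi]

theorem fourier_neg_eq_modes (j : ℕ) (t : S1) : (fourier (-(j : ℤ)) t : ℂ) =
    ((√Real.pi * circleMode j false t : ℝ) : ℂ) -
      ((√Real.pi * circleMode j true t : ℝ) : ℂ) * Complex.I := by
  have hpi : √Real.pi ≠ 0 := (Real.sqrt_pos.2 Real.pi_pos).ne'
  rw [fourier_neg, circleMode, circleMode, mul_inv_cancel_left₀ hpi, mul_inv_cancel_left₀ hpi]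
  refine Complex.ext ?_ ?_ <;> simp

/-- The real and imaginary parts of an element of the isotypic part are combinations of the two
modes of frequency `j = k / l`. -/
theorem exists_modes_of_mem_rhoPart (hl : 0 < l) {j k : ℕ} (hj : 0 < j) (hk : k = j * l)
    {f : Lp ℂ 2 (limitMeasure m A)} (hf : f ∈ rhoPart l m A k) :
    ∃ α β : Lp ℝ 2 (gaussianMeasure m A k),
      rePart f = modeOp k hj false α + modeOp k hj true β ∧
      imPart f = modeOp k hj false β - modeOp k hj true α := by
  obtain ⟨G, hGm, hG⟩ := exists_factor_of_mem_rhoPart hl hk hf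
  have hpi : 0 < √Real.pi := Real.sqrt_pos.2 Real.pi_pos
  -- `f = exp (-i j t) G`, so the components are the real and imaginary parts of `G`, divided by
  -- the normalisations in `modeOp`; here `c` stands for `re` or `im`
  let φ : (ℂ → ℝ) → cone m A → ℝ := fun c ξ =>
    √Real.pi * c (G ξ) * (gaussHalf k (ξ : EuclideanSpace ℝ (Fin n)))⁻¹
  have hφ : ∀ c : ℂ → ℝ, Measurable c → (∀ z, |c z| ≤ ‖z‖) →
      MemLp (φ c) 2 (gaussianMeasure m A k) := by
    intro c hc hcz
    have hm : AEStronglyMeasurable (φ c) (gaussianMeasure m A k) :=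
      (((hc.comp hGm.measurable).const_mul _).mul (measurable_gaussHalf k).inv).aestronglyMeasurable
    rw [memLp_two_iff hm, ← lintegral_modeFun hj false hm]
    -- one mode of `φ c` is pointwise at most `|f|`, and its norm is the one of `φ c`
    refine lt_of_le_of_lt (lintegral_mono_ae ?_) ((memLp_two_iff (Lp.memLp f).1).1 (Lp.memLp f))
    filter_upwards [hG] with p hp
    have h1 : ‖modeFun k j false (φ c) p‖ ≤ ‖f p‖ := by
      have h2 : modeFun k j false (φ c) p = c (G p.1) * (√Real.pi * circleMode j false p.2) := by
        have := (gaussHalf_pos k (p.1 : EuclideanSpace ℝ (Fin n))).ne'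
        simp only [modeFun, φ]
        field_simp
      have h3 : ‖(fourier (-(j : ℤ)) p.2 : ℂ)‖ = 1 := Circle.norm_coe _
      have h4 : |√Real.pi * circleMode j false p.2| ≤ 1 := by
        rw [← h3, fourier_neg_eq_modes]
        refine le_trans (le_of_eq ?_) (Complex.abs_re_le_norm _)
        simp
      have h5 : ‖f p‖ = ‖G p.1‖ := by rw [hp, norm_mul, h3, one_mul]
      rw [h2, h5, norm_mul]
      exact (mul_le_mul (hcz _) h4 (abs_nonneg _) (norm_nonneg _)).trans (mul_one _).le
    rw [enorm_sq_eq_ofReal, enorm_sq_eq_ofReal]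
    gcongr
  have hre := hφ Complex.re Complex.measurable_re Complex.abs_re_le_norm
  have him := hφ Complex.im Complex.measurable_im Complex.abs_im_le_norm
  have hmode : ∀ (c : ℂ → ℝ) (h : MemLp (φ c) 2 (gaussianMeasure m A k)) (b : Bool),
      ∀ᵐ p ∂(limitMeasure m A), modeOp k hj b (h.toLp _) p =
        c (G p.1) * (√Real.pi * circleMode j b p.2) := by
    intro c h b
    filter_upwards [modeOp_apply hj b (h.toLp _), ae_fst_of_gauss h.coeFn_toLp] with p h1 h2
    have := (gaussHalf_pos k (p.1 : EuclideanSpace ℝ (Fin n))).ne'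
    rw [h1, modeFun, h2]
    simp only [φ]
    field_simp
  refine ⟨hre.toLp _, him.toLp _, Lp.ext ?_, Lp.ext ?_⟩
  · filter_upwards [ae_rePart f, hG, hmode _ hre false, hmode _ him true, Lp.coeFn_add
      (modeOp k hj false (hre.toLp _)) (modeOp k hj true (him.toLp _))] with p h1 h2 h3 h4 h5
    rw [h1, h2, h5, Pi.add_apply, h3, h4, fourier_neg_eq_modes]
    simp
    ring
  · filter_upwards [ae_imPart f, hG, hmode _ him false, hmode _ hre true, Lp.coeFn_sub
      (modeOp k hj false (him.toLp _)) (modeOp k hj true (hre.toLp _))] with p h1 h2 h3 h4 h5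
    rw [h1, h2, h5, Pi.sub_apply, h3, h4, fourier_neg_eq_modes]
    simp
    ring

/-- The complex ground state `exp (-k ‖ξ‖² / 2 - i j t)`. -/
def groundState (k : ℕ) {j : ℕ} (hj : 0 < j) [IsFiniteMeasure (gaussianMeasure m A k)] :
    Lp ℂ 2 (limitMeasure m A) :=
  complexOf (√Real.pi • modeOp k hj false (gaussOne m A k))
    (-(√Real.pi • modeOp k hj true (gaussOne m A k)))

theorem ae_groundState {j k : ℕ} (hj : 0 < j) [IsFiniteMeasure (gaussianMeasure m A k)] :
    ∀ᵐ p ∂(limitMeasure m A), groundState (m := m) (A := A) k hj p =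
      (gaussHalf k (p.1 : EuclideanSpace ℝ (Fin n)) : ℂ) * fourier (-(j : ℤ)) p.2 := by
  have h0 : ∀ b : Bool, ∀ᵐ p ∂(limitMeasure m A),
      (√Real.pi • modeOp k hj b (gaussOne m A k) : Lp ℝ 2 (limitMeasure m A)) p =
        √Real.pi * (gaussHalf k (p.1 : EuclideanSpace ℝ (Fin n)) * circleMode j b p.2) := by
    intro b
    filter_upwards [Lp.coeFn_smul (√Real.pi) (modeOp k hj b (gaussOne m A k)),
      modeOp_apply hj b (gaussOne m A k), ae_fst_of_gauss (ae_gaussOne (m := m) (A := A) k)]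
      with p h1 h2 h3
    rw [h1, Pi.smul_apply, h2, modeFun, h3, mul_one, smul_eq_mul]
  filter_upwards [ae_complexOf (√Real.pi • modeOp k hj false (gaussOne m A k))
    (-(√Real.pi • modeOp k hj true (gaussOne m A k))), h0 false, h0 true,
    Lp.coeFn_neg (√Real.pi • modeOp k hj true (gaussOne m A k))] with p h1 h2 h3 h4
  rw [groundState, h1, h2, h4, Pi.neg_apply, h3, fourier_neg_eq_modes]
  push_cast
  ring

theorem groundState_mem_rhoPart {j k : ℕ} (hj : 0 < j) (hk : k = j * l)
    [IsFiniteMeasure (gaussianMeasure m A k)] :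
    groundState (m := m) (A := A) k hj ∈ rhoPart l m A k := by
  refine mem_rhoPart_iff_ae.2 fun τ => ?_
  filter_upwards [ae_groundState (m := m) (A := A) (k := k) hj,
    (measurePreserving_circleAct l m A τ).quasiMeasurePreserving.ae
      (ae_groundState (m := m) (A := A) (k := k) hj)] with p h1 h2
  have h3 : (fourier (k : ℤ) τ : ℂ) = fourier (j : ℤ) (l • τ) := by rw [hk, fourier_mul_eq]
  have h4 : (fourier (-(j : ℤ)) (p.2 + l • τ) : ℂ) =
      fourier (-(j : ℤ)) p.2 * fourier (-(j : ℤ)) (l • τ) := by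
    rw [fourier_apply, fourier_apply, fourier_apply, smul_add, AddCircle.toCircle_add,
      Circle.coe_mul]
  have h6 : (fourier (j : ℤ) (l • τ) : ℂ) * fourier (-(j : ℤ)) (l • τ) = 1 := by
    rw [← fourier_add, add_neg_cancel, fourier_zero]
  rw [h1, h2, h3]
  simp only [circleAct, h4]
  linear_combination (gaussHalf k (p.1 : EuclideanSpace ℝ (Fin n)) : ℂ) *
    fourier (-(j : ℤ)) p.2 * h6

end Isotypic

/-! ### Invariance under isometries -/

section Isometry

variable {X : Type*} {d : X → X → ℝ}

theorem IsLip.comp_isometry {u : X → ℝ} (hu : IsLip d u) {e : X → X}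
    (he : ∀ x y, d (e x) (e y) = d x y) : IsLip d (u ∘ e) := by
  obtain ⟨K, hK⟩ := hu
  exact ⟨K, fun x y => (hK _ _).trans_eq (by rw [he])⟩

theorem localLip_comp_isometry (u : X → ℝ) {e : X → X} (hs : Function.Surjective e)
    (he : ∀ x y, d (e x) (e y) = d x y) (x : X) : localLip d (u ∘ e) x = localLip d u (e x) := by
  have h1 : d x = d (e x) ∘ e := funext fun y => (he x y).symm
  have h2 : map e (comap (d x) (𝓝[>] 0)) = comap (d (e x)) (𝓝[>] 0) := by
    rw [h1, ← comap_comap, map_comap_of_surjective hs]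
  rw [localLip, localLip, ← h2, limsup, limsup, map_map]
  congr 2
  funext y
  simp only [Function.comp_apply, he]

variable [MeasurableSpace X] {ν : Measure X}

/-- Competitors in the definition of the Cheeger energy can be composed with an isometry. -/
theorem cheeger_comp_le (e : X ≃ᵐ X) (hν : MeasurePreserving e ν ν)
    (he : ∀ x y, d (e x) (e y) = d x y) (f : Lp ℝ 2 ν) :
    cheeger d ν (Lp.compMeasurePreserving e hν f) ≤ cheeger d ν f := by
  refine le_iInf fun u => le_iInf fun hu => le_iInf fun hlim => ?_
  refine iInf_le_of_le (fun i => u i ∘ e) (iInf_le_of_le (fun i => (hu i).comp_isometry he)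
    (iInf_le_of_le ?_ (le_of_eq ?_)))
  · refine hlim.congr fun i => ?_
    have h1 : eLpNorm (fun x => u i x - f x) 2 ν =
        eLpNorm ((fun x => u i x - f x) ∘ e) 2 ν := by
      have h2 := e.measurableEmbedding.eLpNorm_map_measure (μ := ν) (p := 2)
        (g := fun x => u i x - f x)
      rwa [hν.map_eq] at h2
    rw [h1]
    refine eLpNorm_congr_ae ?_
    filter_upwards [Lp.coeFn_compMeasurePreserving f hν] with x hx
    rw [hx]
    rfl
  · congr 1
    funext i
    rw [← hν.lintegral_comp_emb e.measurableEmbedding fun x => localLip d (u i) x ^ 2]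
    simp only [localLip_comp_isometry _ e.surjective he]

theorem compMeasurePreserving_symm (e : X ≃ᵐ X) (hν : MeasurePreserving e ν ν)
    (hν' : MeasurePreserving e.symm ν ν) (f : Lp ℝ 2 ν) :
    Lp.compMeasurePreserving e hν (Lp.compMeasurePreserving e.symm hν' f) = f := by
  refine Lp.ext ?_
  filter_upwards [Lp.coeFn_compMeasurePreserving (Lp.compMeasurePreserving e.symm hν' f) hν,
    hν.quasiMeasurePreserving.ae (Lp.coeFn_compMeasurePreserving f hν')] with x h1 h2
  rw [h1, Function.comp_apply, h2, Function.comp_apply, e.symm_apply_apply]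

theorem cheeger_comp (e : X ≃ᵐ X) (hν : MeasurePreserving e ν ν)
    (he : ∀ x y, d (e x) (e y) = d x y) (f : Lp ℝ 2 ν) :
    cheeger d ν (Lp.compMeasurePreserving e hν f) = cheeger d ν f := by
  refine le_antisymm (cheeger_comp_le e hν he f) ?_
  have hν' : MeasurePreserving e.symm ν ν := hν.symm e
  have h := cheeger_comp_le (d := d) e.symm hν' (fun x y => by
    rw [← he, e.apply_symm_apply, e.apply_symm_apply]) (Lp.compMeasurePreserving e hν f)
  rwa [show Lp.compMeasurePreserving e.symm hν' (Lp.compMeasurePreserving e hν f) = f from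
    compMeasurePreserving_symm e.symm hν' hν f] at h

theorem energy_comp (e : X ≃ᵐ X) (hν : MeasurePreserving e ν ν)
    (he : ∀ x y, d (e x) (e y) = d x y) (f φ : Lp ℝ 2 ν) :
    energy d ν (Lp.compMeasurePreserving e hν f) (Lp.compMeasurePreserving e hν φ) =
      energy d ν f φ := by
  rw [energy, ← map_add, ← map_sub, cheeger_comp e hν he, cheeger_comp e hν he, energy]

/-- The resolvent commutes with measure preserving isometries. -/
theorem LipGradient.resolvent_comp {F : Type*} [NormedAddCommGroup F] [InnerProductSpace ℝ F]
    [CompleteSpace F] (D : LipGradient d ν F) (e : X ≃ᵐ X) (hν : MeasurePreserving e ν ν)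
    (he : ∀ x y, d (e x) (e y) = d x y) (f : Lp ℝ 2 ν) :
    D.resolvent (Lp.compMeasurePreserving e hν f) =
      Lp.compMeasurePreserving e hν (D.resolvent f) := by
  have h1 : D.resolvent (D.resolvent f + (f - D.resolvent f)) = D.resolvent f := by
    rw [add_sub_cancel]
  obtain ⟨h2, h3⟩ := (LipGradient.resolvent_iff_energy _ _).1 h1
  have hν' : MeasurePreserving e.symm ν ν := hν.symm e
  have h4 := (LipGradient.resolvent_iff_energy (D := D) (Lp.compMeasurePreserving e hν
    (D.resolvent f)) (Lp.compMeasurePreserving e hν (f - D.resolvent f))).2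
    ⟨(cheeger_comp_le e hν he _).trans_lt h2, fun φ hφ => ?_⟩
  · rwa [← map_add, add_sub_cancel] at h4
  · obtain ⟨ψ, rfl⟩ : ∃ ψ, Lp.compMeasurePreserving e hν ψ = φ :=
      ⟨_, compMeasurePreserving_symm e hν hν' φ⟩
    have hψ : ψ ∈ sobolev d ν := (cheeger_comp e hν he ψ).symm.trans_lt hφ
    rw [energy_comp e hν he, h3 ψ hψ, ← hν.integral_comp e.measurableEmbedding]
    refine integral_congr_ae ?_
    filter_upwards [Lp.coeFn_compMeasurePreserving (f - D.resolvent f) hν,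
      Lp.coeFn_compMeasurePreserving ψ hν] with x h5 h6
    rw [h5, h6]
    rfl

theorem rePart_compMeasurePreserving {e : X → X} (hν : MeasurePreserving e ν ν) (f : Lp ℂ 2 ν) :
    rePart (Lp.compMeasurePreserving e hν f) = Lp.compMeasurePreserving e hν (rePart f) := by
  refine Lp.ext ?_
  filter_upwards [ae_rePart (Lp.compMeasurePreserving e hν f),
    Lp.coeFn_compMeasurePreserving f hν, Lp.coeFn_compMeasurePreserving (rePart f) hν,
    hν.quasiMeasurePreserving.ae (ae_rePart f)] with x h1 h2 h3 h4
  rw [h1, h2, h3, Function.comp_apply, Function.comp_apply, h4]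

theorem imPart_compMeasurePreserving {e : X → X} (hν : MeasurePreserving e ν ν) (f : Lp ℂ 2 ν) :
    imPart (Lp.compMeasurePreserving e hν f) = Lp.compMeasurePreserving e hν (imPart f) := by
  refine Lp.ext ?_
  filter_upwards [ae_imPart (Lp.compMeasurePreserving e hν f),
    Lp.coeFn_compMeasurePreserving f hν, Lp.coeFn_compMeasurePreserving (imPart f) hν,
    hν.quasiMeasurePreserving.ae (ae_imPart f)] with x h1 h2 h3 h4
  rw [h1, h2, h3, Function.comp_apply, Function.comp_apply, h4]

/-- The complexification of a real operator. -/
def complexify (R : Lp ℝ 2 ν →L[ℝ] Lp ℝ 2 ν) : Lp ℂ 2 ν →L[ℂ] Lp ℂ 2 ν where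
  toFun f := complexOf (R (rePart f)) (R (imPart f))
  map_add' f g := by
    refine ext_rePart_imPart ?_ ?_
    · rw [rePart_complexOf, rePart_add, rePart_add, rePart_complexOf, rePart_complexOf, map_add]
    · rw [imPart_complexOf, imPart_add, imPart_add, imPart_complexOf, imPart_complexOf, map_add]
  map_smul' c f := by
    refine ext_rePart_imPart ?_ ?_
    · rw [rePart_complexOf, rePart_smul, RingHom.id_apply, rePart_smul, rePart_complexOf,
        imPart_complexOf, map_sub, map_smul, map_smul]
    · rw [imPart_complexOf, imPart_smul, RingHom.id_apply, imPart_smul, imPart_complexOf,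
        rePart_complexOf, map_add, map_smul, map_smul]
  cont := by
    have h1 : Continuous fun f : Lp ℂ 2 ν => R (rePart f) :=
      R.continuous.comp (Complex.reCLM.compLpL 2 ν).continuous
    have h2 : Continuous fun f : Lp ℂ 2 ν => R (imPart f) :=
      R.continuous.comp (Complex.imCLM.compLpL 2 ν).continuous
    exact ((Complex.ofRealCLM.compLpL 2 ν).continuous.comp h1).add
      (((Complex.ofRealCLM.compLpL 2 ν).continuous.comp h2).const_smul Complex.I)

@[simp]
theorem rePart_complexify (R : Lp ℝ 2 ν →L[ℝ] Lp ℝ 2 ν) (f : Lp ℂ 2 ν) :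
    rePart (complexify R f) = R (rePart f) := rePart_complexOf _ _

@[simp]
theorem imPart_complexify (R : Lp ℝ 2 ν →L[ℝ] Lp ℝ 2 ν) (f : Lp ℂ 2 ν) :
    imPart (complexify R f) = R (imPart f) := imPart_complexOf _ _

end Isometry

/-! ### The resolvent of the isotypic part -/

section RhoResolvent

variable {n : ℕ} {l m : ℕ} {A : Matrix (Fin n) (Fin n) ℝ}

theorem circleAct_neg_circleAct (τ : S1) (p : cone m A × S1) :
    circleAct l m A (-τ) (circleAct l m A τ p) = p := by
  simp [circleAct]

/-- The circle action as a measurable equivalence. -/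
def circleActEquiv (l m : ℕ) (A : Matrix (Fin n) (Fin n) ℝ) (τ : S1) :
    cone m A × S1 ≃ᵐ cone m A × S1 where
  toFun := circleAct l m A τ
  invFun := circleAct l m A (-τ)
  left_inv := circleAct_neg_circleAct τ
  right_inv p := by
    have h := circleAct_neg_circleAct (l := l) (-τ) p
    rwa [neg_neg] at h
  measurable_toFun := (measurePreserving_circleAct l m A τ).measurable
  measurable_invFun := (measurePreserving_circleAct l m A (-τ)).measurable

/-- The circle acts by isometries: curves are moved by a translation of the angle. -/
theorem limitDist_circleAct (τ : S1) (p q : cone m A × S1) :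
    limitDist l m A (circleAct l m A τ p) (circleAct l m A τ q) = limitDist l m A p q := by
  have h1 : ∀ (c : ℝ) (x : ℝ → EuclideanSpace ℝ (Fin n)) (θ : ℝ → ℝ),
      curveLength l x (fun s => θ s + c) = curveLength l x θ := by
    intro c x θ
    simp only [curveLength, deriv_add_const]
  rw [limitDist, limitDist]
  congr 1
  ext L
  constructor
  · rintro ⟨x, θ, hx, hθ, hc, h2, h3, h4, h5, rfl⟩
    refine ⟨x, fun s => θ s + -circleRep (l • τ), hx, hθ.add contDiff_const, hc, h2, ?_, h4, ?_,
      (h1 _ _ _).symm⟩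
    · rw [AddCircle.coe_add, h3, AddCircle.coe_neg, coe_circleRep]
      simp [circleAct]
    · rw [AddCircle.coe_add, h5, AddCircle.coe_neg, coe_circleRep]
      simp [circleAct]
  · rintro ⟨x, θ, hx, hθ, hc, h2, h3, h4, h5, rfl⟩
    refine ⟨x, fun s => θ s + circleRep (l • τ), hx, hθ.add contDiff_const, hc, h2, ?_, h4, ?_,
      (h1 _ _ _).symm⟩
    · rw [AddCircle.coe_add, h3, coe_circleRep]
      rfl
    · rw [AddCircle.coe_add, h5, coe_circleRep]
      rfl

/-- The resolvent commutes with the circle action. -/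
theorem complexify_resolvent_circleAct (hl : 0 < l) (τ : S1) (f : Lp ℂ 2 (limitMeasure m A)) :
    complexify (limitGradient hl m A).resolvent (Lp.compMeasurePreserving (circleAct l m A τ)
        (measurePreserving_circleAct l m A τ) f) =
      Lp.compMeasurePreserving (circleAct l m A τ) (measurePreserving_circleAct l m A τ)
      (complexify (limitGradient hl m A).resolvent f) := by
  have hcomm : ∀ g : Lp ℝ 2 (limitMeasure m A), (limitGradient hl m A).resolvent
      (Lp.compMeasurePreserving (circleAct l m A τ) (measurePreserving_circleAct l m A τ) g) =
      Lp.compMeasurePreserving (circleAct l m A τ) (measurePreserving_circleAct l m A τ)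
        ((limitGradient hl m A).resolvent g) := fun g =>
    (limitGradient hl m A).resolvent_comp (circleActEquiv l m A τ)
      (measurePreserving_circleAct l m A τ) (limitDist_circleAct τ) g
  refine ext_rePart_imPart ?_ ?_
  · rw [rePart_compMeasurePreserving, rePart_complexify, rePart_complexify,
      rePart_compMeasurePreserving, hcomm]
  · rw [imPart_compMeasurePreserving, imPart_complexify, imPart_complexify,
      imPart_compMeasurePreserving, hcomm]

theorem rePart_zero {X : Type*} [MeasurableSpace X] {ν : Measure X} :
    rePart (0 : Lp ℂ 2 ν) = 0 := map_zero (Complex.reCLM.compLpL 2 ν)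

theorem imPart_zero {X : Type*} [MeasurableSpace X] {ν : Measure X} :
    imPart (0 : Lp ℂ 2 ν) = 0 := map_zero (Complex.imCLM.compLpL 2 ν)

theorem complexify_resolvent_injective (hl : 0 < l) (f : Lp ℂ 2 (limitMeasure m A))
    (hf : complexify (limitGradient hl m A).resolvent f = 0) : f = 0 := by
  have h1 := rePart_complexify (limitGradient hl m A).resolvent f
  have h2 := imPart_complexify (limitGradient hl m A).resolvent f
  rw [hf] at h1 h2
  rw [rePart_zero] at h1
  rw [imPart_zero] at h2
  refine ext_rePart_imPart ?_ ?_
  · rw [rePart_zero]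
    exact LipGradient.resolvent_injective (isDense_limit hl) _ h1.symm
  · rw [imPart_zero]
    exact LipGradient.resolvent_injective (isDense_limit hl) _ h2.symm

/-- The resolvent preserves the isotypic part, and so does its inverse, since it commutes with the
action and is injective. -/
theorem complexify_resolvent_mem_rhoPart_iff (hl : 0 < l) {k : ℕ}
    {f : Lp ℂ 2 (limitMeasure m A)} :
    complexify (limitGradient hl m A).resolvent f ∈ rhoPart l m A k ↔ f ∈ rhoPart l m A k := by
  rw [mem_rhoPart_iff, mem_rhoPart_iff]
  refine forall_congr' fun τ => ?_
  rw [← complexify_resolvent_circleAct, ← map_smul]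
  constructor
  · intro h
    rw [← sub_eq_zero, ← map_sub] at h
    exact sub_eq_zero.1 (complexify_resolvent_injective hl _ h)
  · intro h
    rw [h]

/-- The resolvent `(1 + Δ)⁻¹` on the isotypic part. -/
def rhoResolvent (hl : 0 < l) (m : ℕ) (A : Matrix (Fin n) (Fin n) ℝ) (k : ℕ) :
    rhoPart l m A k →L[ℂ] rhoPart l m A k :=
  (complexify (limitGradient hl m A).resolvent ∘L (rhoPart l m A k).subtypeL).codRestrict _
    fun f => (complexify_resolvent_mem_rhoPart_iff hl).2 f.2

theorem rePart_rhoResolvent (hl : 0 < l) {k : ℕ} (f : rhoPart l m A k) :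
    rePart (rhoResolvent hl m A k f : Lp ℂ 2 (limitMeasure m A)) =
      (limitGradient hl m A).resolvent (rePart (f : Lp ℂ 2 (limitMeasure m A))) :=
  rePart_complexify _ _

theorem imPart_rhoResolvent (hl : 0 < l) {k : ℕ} (f : rhoPart l m A k) :
    imPart (rhoResolvent hl m A k f : Lp ℂ 2 (limitMeasure m A)) =
      (limitGradient hl m A).resolvent (imPart (f : Lp ℂ 2 (limitMeasure m A))) :=
  imPart_complexify _ _

theorem rhoResolvent_injective (hl : 0 < l) {k : ℕ} (f : rhoPart l m A k)
    (hf : rhoResolvent hl m A k f = 0) : f = 0 := by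
  exact Subtype.ext (complexify_resolvent_injective hl _ (congrArg Subtype.val hf))

theorem inner_rhoResolvent (hl : 0 < l) {k : ℕ} (f g : rhoPart l m A k) :
    inner ℂ (rhoResolvent hl m A k f) g = inner ℂ f (rhoResolvent hl m A k g) := by
  rw [Submodule.coe_inner, Submodule.coe_inner, inner_complex_eq, inner_complex_eq,
    rePart_rhoResolvent, imPart_rhoResolvent, rePart_rhoResolvent, imPart_rhoResolvent]
  simp only [LipGradient.inner_resolvent]

theorem rhoResolvent_eq_iff (hl : 0 < l) {k : ℕ} (f g : rhoPart l m A k) :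
    rhoResolvent hl m A k f = g ↔
      (limitGradient hl m A).resolvent (rePart (f : Lp ℂ 2 (limitMeasure m A))) =
        rePart (g : Lp ℂ 2 (limitMeasure m A)) ∧
      (limitGradient hl m A).resolvent (imPart (f : Lp ℂ 2 (limitMeasure m A))) =
        imPart (g : Lp ℂ 2 (limitMeasure m A)) := by
  rw [← rePart_rhoResolvent, ← imPart_rhoResolvent]
  constructor
  · rintro rfl
    exact ⟨rfl, rfl⟩
  · rintro ⟨h1, h2⟩
    exact Subtype.ext (ext_rePart_imPart h1 h2)

/-- The operator with resolvent `rhoResolvent` is the isotypic part of the Laplacian. -/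
theorem isRhoPart_ofResolvent (hl : 0 < l) (k : ℕ) :
    IsRhoPart l m A k (ofResolvent (limitGradient hl m A).resolvent)
      (ofResolvent (rhoResolvent hl m A k)) := by
  have hinj := LipGradient.resolvent_injective (isDense_limit (m := m) (A := A) hl)
  constructor
  · intro f
    rw [mem_domain_ofResolvent, mem_domain_ofResolvent, mem_domain_ofResolvent]
    constructor
    · rintro ⟨g, hg⟩
      obtain ⟨h1, h2⟩ := (rhoResolvent_eq_iff hl g f).1 hg
      exact ⟨⟨_, h1⟩, ⟨_, h2⟩⟩
    · rintro ⟨⟨a, ha⟩, ⟨b, hb⟩⟩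
      have hS : complexify (limitGradient hl m A).resolvent (complexOf a b) =
          (f : Lp ℂ 2 (limitMeasure m A)) := by
        refine ext_rePart_imPart ?_ ?_
        · rw [rePart_complexify, rePart_complexOf, ha]
        · rw [imPart_complexify, imPart_complexOf, hb]
      have hmem : complexOf a b ∈ rhoPart l m A k :=
        (complexify_resolvent_mem_rhoPart_iff hl).1 (hS ▸ f.2)
      exact ⟨⟨_, hmem⟩, Subtype.ext hS⟩
  · intro f h hfh
    rw [mem_graph_ofResolvent (rhoResolvent_injective hl)] at hfh
    obtain ⟨h1, h2⟩ := (rhoResolvent_eq_iff hl _ _).1 hfh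
    rw [mem_graph_ofResolvent hinj, mem_graph_ofResolvent hinj]
    dsimp only at h1 h2 ⊢
    rw [Submodule.coe_add] at h1 h2
    rw [← rePart_add, ← imPart_add]
    exact ⟨h1, h2⟩

end RhoResolvent

/-! ### The spectrum of the isotypic part -/

section RhoSpectrum

variable {n : ℕ} {l m : ℕ} {A : Matrix (Fin n) (Fin n) ℝ}

/-- The mode components of a bounded set in the form domain of the limit space form a bounded set
in the form domain of the Gaussian cone, by `modeEnergy_le`, so they are relatively compact. -/
theorem isCompactOperator_adjoint_modeOp_proj (hl : 0 < l) {j k : ℕ} (hj : 0 < j) (hk : k = j * l)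
    (b : Bool) : IsCompactOperator (ContinuousLinearMap.adjoint (modeOp k hj b) ∘L
      (limitGradient hl m A).proj) := by
  have hk0 : 0 < k := hk ▸ Nat.mul_pos hj hl
  obtain ⟨K, hK, hKs⟩ := (isCompactOperator_proj_gauss (m := m) (A := A) hk0).image_subset_compact_of_bounded
    (Metric.isBounded_closedBall (x := (0 : (gaussGradient m A k).closedGraph)) (r := 2))
  refine ⟨K, hK, mem_of_superset (Metric.ball_mem_nhds 0 one_pos) fun p hp => hKs ?_⟩
  have hp1 : ‖p‖ ≤ 1 := (mem_ball_zero_iff.1 hp).le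
  have h1 : modeEnergy k hj b ((limitGradient hl m A).proj p) ≤ 1 := by
    have h2 := modeEnergy_le hl hj hk p.2
    rw [← (limitGradient hl m A).proj_apply, enorm_sq_eq_ofReal] at h2
    have h3 : ‖(p : WithLp 2 (Lp ℝ 2 (limitMeasure m A) ×
        Lp (WithLp 2 (EuclideanSpace ℝ (Fin n) × ℝ)) 2 (limitMeasure m A))).snd‖ ^ 2 ≤ 1 := by
      have h4 := sq_norm_closedGraph (limitGradient hl m A) p
      nlinarith [sq_nonneg ‖(limitGradient hl m A).proj p‖, norm_nonneg p]
    refine le_trans ?_ (h2.trans (ENNReal.ofReal_le_one.2 h3))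
    cases b
    · exact le_self_add
    · exact le_add_self
  have h2 : liftNormSq (gaussGradient m A k).proj
      (ContinuousLinearMap.adjoint (modeOp k hj b) ((limitGradient hl m A).proj p)) < 4 :=
    (le_self_add.trans h1).trans_lt (by norm_num)
  rw [liftNormSq, iInf_lt_iff] at h2
  -- the infimum need not be attained, so the bound `1` is relaxed to `4 = 2 ^ 2`
  obtain ⟨w, hw⟩ := h2
  rw [iInf_lt_iff] at hw
  obtain ⟨hw1, hw2⟩ := hw
  refine ⟨w, mem_closedBall_zero_iff.2 ?_, hw1⟩
  rw [enorm_sq_eq_ofReal, show (4 : ℝ≥0∞) = ENNReal.ofReal 4 by simp,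
    ENNReal.ofReal_lt_ofReal_iff (by norm_num)] at hw2
  nlinarith [norm_nonneg w]

theorem isCompactOperator_modeProj_resolvent (hl : 0 < l) {j k : ℕ} (hj : 0 < j) (hk : k = j * l) :
    IsCompactOperator (modeProj k hj ∘L (limitGradient hl m A).resolvent) := by
  have h : ∀ b : Bool, IsCompactOperator fun f => modeOp k hj b (ContinuousLinearMap.adjoint
      (modeOp k hj b) ((limitGradient hl m A).resolvent f)) := fun b =>
    ((isCompactOperator_adjoint_modeOp_proj (m := m) (A := A) hl hj hk b).comp_clm
      (ContinuousLinearMap.adjoint (limitGradient hl m A).proj)).clm_comp (modeOp k hj b)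
  exact (h false).add (h true)

/-- The real and imaginary parts of the elements of the isotypic part are spanned by the two modes.
-/
theorem modeProj_of_mem_rhoPart (hl : 0 < l) {j k : ℕ} (hj : 0 < j) (hk : k = j * l)
    {f : Lp ℂ 2 (limitMeasure m A)} (hf : f ∈ rhoPart l m A k) :
    modeProj k hj (rePart f) = rePart f ∧ modeProj k hj (imPart f) = imPart f := by
  obtain ⟨α, β, h1, h2⟩ := exists_modes_of_mem_rhoPart hl hj hk hf
  rw [h1, h2, map_add, map_sub, modeProj_modeOp, modeProj_modeOp, modeProj_modeOp,
    modeProj_modeOp]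
  exact ⟨rfl, rfl⟩

theorem IsCompactOperator.complexify {X : Type*} [MeasurableSpace X] {ν : Measure X}
    {R : Lp ℝ 2 ν →L[ℝ] Lp ℝ 2 ν} (hR : IsCompactOperator R) :
    IsCompactOperator (GaussianCone.complexify R) := by
  have h1 : IsCompactOperator fun f : Lp ℂ 2 ν => Complex.ofRealCLM.compLpL 2 ν (R (rePart f)) :=
    (hR.comp_clm (Complex.reCLM.compLpL 2 ν)).clm_comp (Complex.ofRealCLM.compLpL 2 ν)
  have h2 : IsCompactOperator fun f : Lp ℂ 2 ν => Complex.ofRealCLM.compLpL 2 ν (R (imPart f)) :=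
    (hR.comp_clm (Complex.imCLM.compLpL 2 ν)).clm_comp (Complex.ofRealCLM.compLpL 2 ν)
  exact h1.add (h2.smul Complex.I)

/-- On the isotypic part the resolvent agrees with its composition with `modeProj`. -/
theorem isCompactOperator_rhoResolvent (hl : 0 < l) {j k : ℕ} (hj : 0 < j) (hk : k = j * l) :
    IsCompactOperator (rhoResolvent hl m A k) := by
  have h1 : IsCompactOperator fun f : rhoPart l m A k =>
      complexify (modeProj k hj ∘L (limitGradient hl m A).resolvent)
        (f : Lp ℂ 2 (limitMeasure m A)) :=
    (IsCompactOperator.complexify (isCompactOperator_modeProj_resolvent hl hj hk)).comp_clm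
      (rhoPart l m A k).subtypeL
  have h2 : ∀ f : rhoPart l m A k, complexify (modeProj k hj ∘L (limitGradient hl m A).resolvent)
      (f : Lp ℂ 2 (limitMeasure m A)) = rhoResolvent hl m A k f := by
    intro f
    obtain ⟨h3, h4⟩ := modeProj_of_mem_rhoPart hl hj hk (rhoResolvent hl m A k f).2
    refine ext_rePart_imPart ?_ ?_
    · rw [rePart_complexify, ← h3, rePart_rhoResolvent]
      rfl
    · rw [imPart_complexify, ← h4, imPart_rhoResolvent]
      rfl
  simp only [h2] at h1
  exact h1.codRestrict (fun f => (rhoResolvent hl m A k f).2) (isClosed_rhoPart l m A k)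

/-- The energy of an eigenfunction. -/
theorem exists_lift_of_resolvent_eq (hl : 0 < l) {μ : ℝ} {g : Lp ℝ 2 (limitMeasure m A)}
    (hg : (limitGradient hl m A).resolvent (g + μ • g) = g) :
    ∃ p ∈ (limitGradient hl m A).closedGraph, p.fst = g ∧ ‖p.snd‖ ^ 2 = μ * ‖g‖ ^ 2 := by
  set p := ContinuousLinearMap.adjoint (limitGradient hl m A).proj (g + μ • g) with hp
  have h1 : (limitGradient hl m A).proj p = g := hg
  have h2 : ‖p‖ ^ 2 = ‖g‖ ^ 2 + μ * ‖g‖ ^ 2 := by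
    rw [← real_inner_self_eq_norm_sq, hp, ContinuousLinearMap.adjoint_inner_left, ← hp, h1,
      inner_add_left, real_inner_smul_left, real_inner_self_eq_norm_sq]
  have h3 := sq_norm_closedGraph (limitGradient hl m A) p
  rw [h1] at h3
  refine ⟨p, p.2, ?_, by linarith⟩
  rw [← (limitGradient hl m A).proj_apply, h1]

theorem sq_norm_of_modeProj_eq {j k : ℕ} (hj : 0 < j) {g : Lp ℝ 2 (limitMeasure m A)}
    (hg : modeProj k hj g = g) : ‖g‖ ^ 2 =
      ‖ContinuousLinearMap.adjoint (modeOp k hj false) g‖ ^ 2 +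
        ‖ContinuousLinearMap.adjoint (modeOp k hj true) g‖ ^ 2 := by
  have h := inner_modeProj k hj g g
  rwa [hg, real_inner_self_eq_norm_sq, real_inner_self_eq_norm_sq, real_inner_self_eq_norm_sq] at h

/-- An eigenvalue with an eigenfunction spanned by the two modes is at least `k ^ 2 + k n`. -/
theorem le_of_resolvent_eq (hl : 0 < l) {j k : ℕ} (hj : 0 < j) (hk : k = j * l) {μ : ℝ}
    {g : Lp ℝ 2 (limitMeasure m A)} (hg : (limitGradient hl m A).resolvent (g + μ • g) = g)
    (hg' : modeProj k hj g = g) (h0 : g ≠ 0) : (k : ℝ) ^ 2 + k * n ≤ μ := by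
  obtain ⟨p, hp, hp1, hp2⟩ := exists_lift_of_resolvent_eq hl hg
  have h1 := mul_sq_modes_le hl hj hk hp
  rw [hp1, ← sq_norm_of_modeProj_eq hj hg', hp2] at h1
  exact le_of_mul_le_mul_right h1 (by positivity)

/-- A function on the Gaussian cone without energy is constant. -/
theorem exists_eq_smul_gaussOne (hA : A.PosDef) {k : ℕ} (hk : 0 < k)
    [IsFiniteMeasure (gaussianMeasure m A k)] {f : Lp ℝ 2 (gaussianMeasure m A k)}
    (hf : liftNormSq (gaussGradient m A k).proj f ≤ ‖f‖ₑ ^ 2) : ∃ c : ℝ, f = c • gaussOne m A k := by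
  obtain ⟨w, hw⟩ : ∃ w, (gaussGradient m A k).proj w = f := by
    by_contra! hcon
    have h2 : liftNormSq (gaussGradient m A k).proj f = ⊤ := by simp [liftNormSq, hcon]
    rw [h2, top_le_iff, enorm_sq_eq_ofReal] at hf
    exact ENNReal.ofReal_ne_top hf
  obtain ⟨p, hp, hpw⟩ := exists_orthogonal_lift (gaussGradient m A k).proj w
  rw [hw] at hpw
  have h2 := liftNormSq_of_mem_orthogonal (gaussGradient m A k).proj hp
  rw [hpw] at h2
  rw [h2, enorm_sq_eq_ofReal, enorm_sq_eq_ofReal, ENNReal.ofReal_le_ofReal_iff (by positivity),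
    sq_norm_closedGraph, hpw] at hf
  have h3 : (p : WithLp 2 (Lp ℝ 2 (gaussianMeasure m A k) ×
      Lp (EuclideanSpace ℝ (Fin n)) 2 (gaussianMeasure m A k))).snd = 0 := by
    rw [← norm_eq_zero, ← pow_eq_zero_iff two_ne_zero]
    exact le_antisymm (by linarith) (by positivity)
  obtain ⟨c, hc⟩ := exists_const_of_snd_eq_zero hA hk p.2 h3
  rw [(gaussGradient m A k).proj_apply] at hpw
  rw [hpw] at hc
  refine ⟨c, Lp.ext ?_⟩
  filter_upwards [hc, Lp.coeFn_smul c (gaussOne m A k), ae_gaussOne (m := m) (A := A) k]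
    with ξ h4 h5 h6
  rw [h4, h5, Pi.smul_apply, h6, smul_eq_mul, mul_one]

/-- The terms with the factor `c` cancel, which leaves `x + y ≤ a + b`. -/
theorem ENNReal_le_of_add_le {x y a b c : ℝ≥0∞} (ha : a ≠ ⊤) (hb : b ≠ ⊤) (hc : c ≠ ⊤)
    (hy : b ≤ y) (h : (x + c * a) + (y + c * b) ≤ (1 + c) * (a + b)) : x ≤ a := by
  have htop : c * a + b + c * b ≠ ⊤ :=
    ENNReal.add_ne_top.2 ⟨ENNReal.add_ne_top.2 ⟨ENNReal.mul_ne_top hc ha, hb⟩,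
      ENNReal.mul_ne_top hc hb⟩
  refine (ENNReal.add_le_add_iff_right htop).1 ?_
  calc x + (c * a + b + c * b) ≤ x + (c * a + y + c * b) := by gcongr
    _ = (x + c * a) + (y + c * b) := by ring
    _ ≤ (1 + c) * (a + b) := h
    _ = a + (c * a + b + c * b) := by ring

set_option maxHeartbeats 1000000 in
/-- The oscillator bound, evaluated at a function for which the resolvent attains it. -/
theorem modeEnergy_le_of_resolvent_eq (hl : 0 < l) {j k : ℕ} (hj : 0 < j) (hk : k = j * l)
    {g : Lp ℝ 2 (limitMeasure m A)}
    (hg : (limitGradient hl m A).resolvent (g + ((k : ℝ) ^ 2 + k * n) • g) = g)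
    (hg' : modeProj k hj g = g) :
    modeEnergy k hj false g + modeEnergy k hj true g ≤
      (1 + ENNReal.ofReal ((k : ℝ) ^ 2 + k * n - 1)) *
        (‖ContinuousLinearMap.adjoint (modeOp k hj false) g‖ₑ ^ 2 +
          ‖ContinuousLinearMap.adjoint (modeOp k hj true) g‖ₑ ^ 2) := by
  have hk0 : 0 < k := hk ▸ Nat.mul_pos hj hl
  obtain ⟨p, hp, hp1, hp2⟩ := exists_lift_of_resolvent_eq hl hg
  have hk1 : (1 : ℝ) ≤ k := by exact_mod_cast hk0
  have hk2 : (0 : ℝ) ≤ (k : ℝ) ^ 2 + k * n - 1 := by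
    have : (0 : ℝ) ≤ k * n := by positivity
    nlinarith
  have h1 := modeEnergy_le hl hj hk hp
  rw [hp1, enorm_sq_eq_ofReal, hp2, sq_norm_of_modeProj_eq hj hg'] at h1
  refine h1.trans (le_of_eq ?_)
  rw [← ENNReal.ofReal_one, ← ENNReal.ofReal_add zero_le_one hk2, add_sub_cancel,
    enorm_sq_eq_ofReal, enorm_sq_eq_ofReal, ← ENNReal.ofReal_add (by positivity) (by positivity),
    ← ENNReal.ofReal_mul (by positivity)]

/-- The components of a lowest eigenfunction along the modes are constant. -/
theorem adjoint_modeOp_of_resolvent_eq (hA : A.PosDef) (hl : 0 < l) {j k : ℕ} (hj : 0 < j)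
    (hk : k = j * l) [IsFiniteMeasure (gaussianMeasure m A k)] {g : Lp ℝ 2 (limitMeasure m A)}
    (hg : (limitGradient hl m A).resolvent (g + ((k : ℝ) ^ 2 + k * n) • g) = g)
    (hg' : modeProj k hj g = g) (b : Bool) :
    ∃ c : ℝ, ContinuousLinearMap.adjoint (modeOp k hj b) g = c • gaussOne m A k := by
  have hk0 : 0 < k := hk ▸ Nat.mul_pos hj hl
  refine exists_eq_smul_gaussOne hA hk0 ?_
  have h1 := modeEnergy_le_of_resolvent_eq hl hj hk hg hg'
  have hle : ∀ f : Lp ℝ 2 (gaussianMeasure m A k), ‖f‖ₑ ^ 2 ≤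
      liftNormSq (gaussGradient m A k).proj f := by
    intro f
    rw [← (gaussGradient m A k).isRelaxation]
    exact le_add_self
  have htop : ∀ f : Lp ℝ 2 (gaussianMeasure m A k), ‖f‖ₑ ^ 2 ≠ ⊤ := fun f => by
    rw [enorm_sq_eq_ofReal]
    exact ENNReal.ofReal_ne_top
  cases b
  · exact ENNReal_le_of_add_le (htop _) (htop _) ENNReal.ofReal_ne_top (hle _) h1
  · rw [add_comm, add_comm (‖_‖ₑ ^ 2)] at h1
    exact ENNReal_le_of_add_le (htop _) (htop _) ENNReal.ofReal_ne_top (hle _) h1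

theorem rePart_ofReal_smul {X : Type*} [MeasurableSpace X] {ν : Measure X} (c : ℝ)
    (f : Lp ℂ 2 ν) : rePart ((c : ℂ) • f) = c • rePart f := by
  rw [rePart_smul, Complex.ofReal_re, Complex.ofReal_im, zero_smul, sub_zero]

theorem imPart_ofReal_smul {X : Type*} [MeasurableSpace X] {ν : Measure X} (c : ℝ)
    (f : Lp ℂ 2 ν) : imPart ((c : ℂ) • f) = c • imPart f := by
  rw [imPart_smul, Complex.ofReal_re, Complex.ofReal_im, zero_smul, add_zero]

/-- Eigenfunctions are characterised by their real and imaginary parts, as `μ` is real. -/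
theorem mem_eigenspace_rho_iff (hl : 0 < l) {k : ℕ} {μ : ℝ} {f : rhoPart l m A k} :
    f ∈ eigenspace (ofResolvent (rhoResolvent hl m A k)) (μ : ℂ) ↔
      (limitGradient hl m A).resolvent (rePart (f : Lp ℂ 2 (limitMeasure m A)) +
          μ • rePart (f : Lp ℂ 2 (limitMeasure m A))) =
        rePart (f : Lp ℂ 2 (limitMeasure m A)) ∧
      (limitGradient hl m A).resolvent (imPart (f : Lp ℂ 2 (limitMeasure m A)) +
          μ • imPart (f : Lp ℂ 2 (limitMeasure m A))) =
        imPart (f : Lp ℂ 2 (limitMeasure m A)) := by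
  rw [mem_eigenspace_ofResolvent (rhoResolvent_injective hl), rhoResolvent_eq_iff,
    Submodule.coe_add, Submodule.coe_smul, rePart_add, imPart_add, rePart_ofReal_smul,
    imPart_ofReal_smul]

theorem le_of_eigenspace_ne_bot (hl : 0 < l) {j k : ℕ} (hj : 0 < j) (hk : k = j * l) {μ : ℝ}
    (hμ : eigenspace (ofResolvent (rhoResolvent hl m A k)) (μ : ℂ) ≠ ⊥) :
    (k : ℝ) ^ 2 + k * n ≤ μ := by
  obtain ⟨f, hf, hf0⟩ := Submodule.exists_mem_ne_zero_of_ne_bot hμ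
  obtain ⟨h1, h2⟩ := (mem_eigenspace_rho_iff hl).1 hf
  obtain ⟨h3, h4⟩ := modeProj_of_mem_rhoPart hl hj hk f.2
  -- one of the real and imaginary parts is nonzero
  by_cases h : rePart (f : Lp ℂ 2 (limitMeasure m A)) = 0
  · refine le_of_resolvent_eq hl hj hk h2 h4 fun h' => hf0 ?_
    refine Subtype.ext (ext_rePart_imPart ?_ ?_)
    · rw [h, Submodule.coe_zero, rePart_zero]
    · rw [h', Submodule.coe_zero, imPart_zero]
  · exact le_of_resolvent_eq hl hj hk h1 h3 h

theorem rePart_groundState {j k : ℕ} (hj : 0 < j) [IsFiniteMeasure (gaussianMeasure m A k)] :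
    rePart (groundState (m := m) (A := A) k hj) =
      √Real.pi • modeOp k hj false (gaussOne m A k) := rePart_complexOf _ _

theorem imPart_groundState {j k : ℕ} (hj : 0 < j) [IsFiniteMeasure (gaussianMeasure m A k)] :
    imPart (groundState (m := m) (A := A) k hj) =
      -(√Real.pi • modeOp k hj true (gaussOne m A k)) := imPart_complexOf _ _

theorem groundState_ne_zero (hA : A.PosDef) {j k : ℕ} (hj : 0 < j)
    [IsFiniteMeasure (gaussianMeasure m A k)] : groundState (m := m) (A := A) k hj ≠ 0 := by
  intro h
  have h1 := rePart_groundState (m := m) (A := A) (k := k) hj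
  rw [h, rePart_zero] at h1
  have h2 : ‖√Real.pi • modeOp k hj false (gaussOne m A k)‖ = 0 := by rw [← h1, norm_zero]
  rw [norm_smul, norm_modeOp] at h2
  rcases mul_eq_zero.1 h2 with h3 | h3
  · rw [norm_eq_zero] at h3
    exact (Real.sqrt_pos.2 Real.pi_pos).ne' h3
  · exact gaussOne_ne_zero hA k (norm_eq_zero.1 h3)

theorem groundState_mem_eigenspace (hl : 0 < l) {j k : ℕ} (hj : 0 < j) (hk : k = j * l)
    [IsFiniteMeasure (gaussianMeasure m A k)] :
    (⟨groundState k hj, groundState_mem_rhoPart hj hk⟩ : rhoPart l m A k) ∈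
      eigenspace (ofResolvent (rhoResolvent hl m A k)) (((k : ℝ) ^ 2 + k * n : ℝ) : ℂ) := by
  have h : ∀ (b : Bool) (c : ℝ), (limitGradient hl m A).resolvent
      (c • modeOp k hj b (gaussOne m A k) +
        ((k : ℝ) ^ 2 + k * n) • c • modeOp k hj b (gaussOne m A k)) =
      c • modeOp k hj b (gaussOne m A k) := by
    intro b c
    have h1 := resolvent_ground (m := m) (A := A) hl hj hk b
    rw [add_smul, one_smul] at h1
    rw [smul_comm _ c, ← smul_add, map_smul, h1]
  rw [mem_eigenspace_rho_iff]
  dsimp only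
  rw [rePart_groundState, imPart_groundState, ← neg_smul]
  exact ⟨h false _, h true _⟩

/-- The mode components of an eigenfunction are constants `c` and `d` by equality in the oscillator
bound, and they determine the function, since the imaginary part has the components `d` and `-c`.
-/
theorem eigenspace_rho_eq_span (hA : A.PosDef) (hl : 0 < l) {j k : ℕ} (hj : 0 < j) (hk : k = j * l)
    [IsFiniteMeasure (gaussianMeasure m A k)] :
    eigenspace (ofResolvent (rhoResolvent hl m A k)) (((k : ℝ) ^ 2 + k * n : ℝ) : ℂ) =
      Submodule.span ℂ {(⟨groundState k hj, groundState_mem_rhoPart hj hk⟩ : rhoPart l m A k)} := by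
  refine le_antisymm (fun f hf => ?_) ?_
  · obtain ⟨h1, -⟩ := (mem_eigenspace_rho_iff hl).1 hf
    obtain ⟨h3, -⟩ := modeProj_of_mem_rhoPart hl hj hk f.2
    obtain ⟨c, hc⟩ := adjoint_modeOp_of_resolvent_eq hA hl hj hk h1 h3 false
    obtain ⟨d, hd⟩ := adjoint_modeOp_of_resolvent_eq hA hl hj hk h1 h3 true
    obtain ⟨α, β, hre, him⟩ := exists_modes_of_mem_rhoPart hl hj hk f.2
    rw [hre, map_add, adjoint_modeOp_modeOp, adjoint_modeOp_modeOp, if_pos rfl,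
      if_neg Bool.false_ne_true, add_zero] at hc
    rw [hre, map_add, adjoint_modeOp_modeOp, adjoint_modeOp_modeOp, if_pos rfl,
      if_neg Bool.false_ne_true.symm, zero_add] at hd
    have hpi : √Real.pi ≠ 0 := (Real.sqrt_pos.2 Real.pi_pos).ne'
    have hE : ((⟨groundState k hj, groundState_mem_rhoPart hj hk⟩ : rhoPart l m A k) :
        Lp ℂ 2 (limitMeasure m A)) = groundState k hj := rfl
    -- the ground state is `√π` times the difference of the cosine mode and `i` times the sine
    -- mode, so the coefficient is `(c + i d) / √π`
    refine Submodule.mem_span_singleton.2 ⟨(((√Real.pi)⁻¹ * c : ℝ) : ℂ) +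
      (((√Real.pi)⁻¹ * d : ℝ) : ℂ) * Complex.I, Subtype.ext (ext_rePart_imPart ?_ ?_)⟩
    · rw [hre, hc, hd, Submodule.coe_smul, hE, rePart_smul, rePart_groundState,
        imPart_groundState, map_smul, map_smul]
      simp only [Complex.add_re, Complex.add_im, Complex.ofReal_re, Complex.ofReal_im,
        Complex.mul_re, Complex.mul_im, Complex.I_re, Complex.I_im, mul_zero, mul_one, zero_add,
        sub_zero, add_zero, smul_neg, sub_neg_eq_add, smul_smul]
      rw [mul_right_comm, inv_mul_cancel₀ hpi, one_mul, mul_right_comm, inv_mul_cancel₀ hpi,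
        one_mul]
    · rw [him, hc, hd, Submodule.coe_smul, hE, imPart_smul, rePart_groundState,
        imPart_groundState, map_smul, map_smul]
      simp only [Complex.add_re, Complex.add_im, Complex.ofReal_re, Complex.ofReal_im,
        Complex.mul_re, Complex.mul_im, Complex.I_re, Complex.I_im, mul_zero, mul_one, zero_add,
        sub_zero, add_zero, smul_neg, smul_smul]
      rw [mul_right_comm, inv_mul_cancel₀ hpi, one_mul, mul_right_comm, inv_mul_cancel₀ hpi,
        one_mul]
      abel
  · rw [Submodule.span_singleton_le_iff_mem]
    exact groundState_mem_eigenspace hl hj hk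

end RhoSpectrum

end GaussianCone

end

theorem mainTheorem9 (n m : ℕ) (hm : m ≤ n) (A : Matrix (Fin n) (Fin n) ℝ) (hA : A.PosDef)
    (k : ℕ) (hk : 0 < k) :
    (GaussianCone.InfinitesimallyHilbertian
        (dist : GaussianCone.cone m A → GaussianCone.cone m A → ℝ)
        (GaussianCone.gaussianMeasure m A k) ∧
      ∃ Δ : Lp ℝ 2 (GaussianCone.gaussianMeasure m A k) →ₗ.[ℝ]
          Lp ℝ 2 (GaussianCone.gaussianMeasure m A k),
        GaussianCone.IsLaplacian dist (GaussianCone.gaussianMeasure m A k) Δ ∧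
        IsSelfAdjoint Δ ∧
        GaussianCone.HasCompactResolvent Δ ∧
        ∃ e : Lp ℝ 2 (GaussianCone.gaussianMeasure m A k),
          (∀ᵐ ξ ∂(GaussianCone.gaussianMeasure m A k), e ξ = 1) ∧
          GaussianCone.eigenspace Δ 0 = Submodule.span ℝ {e} ∧
          Module.finrank ℝ (GaussianCone.eigenspace Δ 0) = 1) ∧
    ∀ j l : ℕ, 0 < l → k = j * l →
      GaussianCone.InfinitesimallyHilbertian (GaussianCone.limitDist l m A)
        (GaussianCone.limitMeasure m A) ∧
      ∃ (Δ : Lp ℝ 2 (GaussianCone.limitMeasure m A) →ₗ.[ℝ] Lp ℝ 2 (GaussianCone.limitMeasure m A))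
        (T : GaussianCone.rhoPart l m A k →ₗ.[ℂ] GaussianCone.rhoPart l m A k),
        GaussianCone.IsLaplacian (GaussianCone.limitDist l m A)
          (GaussianCone.limitMeasure m A) Δ ∧
        IsSelfAdjoint Δ ∧
        GaussianCone.IsRhoPart l m A k Δ T ∧
        IsSelfAdjoint T ∧
        GaussianCone.HasCompactResolvent T ∧
        IsLeast {μ : ℝ | GaussianCone.eigenspace T (μ : ℂ) ≠ ⊥} ((k : ℝ) ^ 2 + k * n) ∧
        ∃ e : GaussianCone.rhoPart l m A k,
          (∀ᵐ p ∂(GaussianCone.limitMeasure m A),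
            (e : Lp ℂ 2 (GaussianCone.limitMeasure m A)) p =
              (Real.exp (-((k : ℝ) * ‖(p.1 : EuclideanSpace ℝ (Fin n))‖ ^ 2 / 2)) : ℂ) *
                fourier (-(j : ℤ)) p.2) ∧
          GaussianCone.eigenspace T (((k : ℝ) ^ 2 + k * n : ℝ) : ℂ) = Submodule.span ℂ {e} ∧
          Module.finrank ℂ
            (GaussianCone.eigenspace T (((k : ℝ) ^ 2 + k * n : ℝ) : ℂ)) = 1 := by
  have := GaussianCone.isFiniteMeasure_gaussianMeasure (m := m) (A := A) hk
  have hD := GaussianCone.isDense_gauss (m := m) (A := A) hk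
  refine ⟨⟨(GaussianCone.gaussGradient m A k).isRelaxation.parallelogram,
    GaussianCone.ofResolvent (GaussianCone.gaussGradient m A k).resolvent,
    GaussianCone.LipGradient.isLaplacian hD, GaussianCone.LipGradient.isSelfAdjoint hD,
    GaussianCone.hasCompactResolvent_ofResolvent
      (GaussianCone.LipGradient.resolvent_injective hD)
      (GaussianCone.isCompactOperator_resolvent_gauss hk),
    GaussianCone.gaussOne m A k, GaussianCone.ae_gaussOne k,
    GaussianCone.eigenspace_zero_gauss hA hk, ?_⟩, fun j l hl hjl => ?_⟩
  · rw [GaussianCone.eigenspace_zero_gauss hA hk]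
    exact finrank_span_singleton (GaussianCone.gaussOne_ne_zero hA k)
  have hj : 0 < j := Nat.pos_of_mul_pos_right (hjl ▸ hk)
  have hDl := GaussianCone.isDense_limit (m := m) (A := A) hl
  have hinj := GaussianCone.rhoResolvent_injective (m := m) (A := A) (k := k) hl
  let e : GaussianCone.rhoPart l m A k :=
    ⟨GaussianCone.groundState k hj, GaussianCone.groundState_mem_rhoPart hj hjl⟩
  have he : e ≠ 0 := fun h => GaussianCone.groundState_ne_zero (m := m) (k := k) hA hj
    (congrArg Subtype.val h)
  have hspan := GaussianCone.eigenspace_rho_eq_span (m := m) hA hl hj hjl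
  refine ⟨(GaussianCone.limitGradient hl m A).isRelaxation.parallelogram,
    GaussianCone.ofResolvent (GaussianCone.limitGradient hl m A).resolvent,
    GaussianCone.ofResolvent (GaussianCone.rhoResolvent hl m A k),
    GaussianCone.LipGradient.isLaplacian hDl, GaussianCone.LipGradient.isSelfAdjoint hDl,
    GaussianCone.isRhoPart_ofResolvent hl k,
    GaussianCone.isSelfAdjoint_ofResolvent hinj (GaussianCone.inner_rhoResolvent hl),
    GaussianCone.hasCompactResolvent_ofResolvent hinj
      (GaussianCone.isCompactOperator_rhoResolvent hl hj hjl),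
    ⟨?_, fun μ hμ => GaussianCone.le_of_eigenspace_ne_bot hl hj hjl hμ⟩,
    e, GaussianCone.ae_groundState hj, hspan, ?_⟩
  · exact (Submodule.ne_bot_iff _).2
      ⟨e, GaussianCone.groundState_mem_eigenspace hl hj hjl, he⟩
  · rw [hspan]
    exact finrank_span_singleton he
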